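/- Let $p>2$ be a prime, let $B$ be a quaternion algebra over $\mathbb Q$ (central simple of dimension $4$) ramified exactly at $p$ and $\infty$, with reduced norm $\mathcal N$, let $\mathscr O\subset B$ be a maximal order, and let $\tilde{\mathscr O}\subset\mathscr O$ be the order of index $p$. For a prime $\ell$, the subscript $\ell$ denotes $-\otimes\mathbb Z_\ell$ (respectively $-\otimes\mathbb Q_\ell$), and $\widehat B^\times$ is the restricted product of the groups $B_\ell^\times$. A left $\tilde{\mathscr O}$-ideal is a lattice $\mathfrak a\subset B$ such that for every prime $\ell$ there is $x_\ell\in B_\ell^\times$ with $\mathfrak a_\ell=\tilde{\mathscr O}_\ell x_\ell$; its right order is $O_r(\mathfrak a)=\{x\in B:\mathfrak a x\subseteq\mathfrak a\}$, and $\mathfrak a^{-1}=\{x\in B:\mathfrak a x\mathfrak a\subseteq\mathfrak a\}$. It is bilateral if $O_r(\mathfrak a)=\tilde{\mathscr O}$. The norm $\mathcal N\mathfrak a>0$ is the positive generator of the subgroup of $\mathbb Q$ generated by $\{\mathcal N x:x\in\mathfrak a\}$, and $\chi(\mathfrak a)=\left(\frac{\mathcal N x/\mathcal N\mathfrak a}{p}\right)$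 for any $x\in\mathfrak a$ with $p\nmid \mathcal N x/\mathcal N\mathfrak a$. Let $\mathcal P$ be the set of bilateral $\tilde{\mathscr O}$-ideals of norm $p$. Let $d$ be a positive integer with $p\nmid d$ such that $D=-pd$ is a fundamental discriminant, let $K$ be the imaginary quadratic field of discriminant $D$, with ring of integers $\mathcal O_K$ and class number $h_D$, let $\mathfrak p_K$ be the ideal of $\mathcal O_K$ of norm $p$, and let $i:K\hookrightarrow B$ be an embedding. Let $\omega_D\in\mathcal O_K$ be an element with $(\operatorname{Tr}\omega_D)^2-4\,\mathrm N\omega_D=D$ and $p\mid\operatorname{Tr}\omega_D$. The set $\mathcal S$ of left $\tilde{\mathscr O}$-ideals $\mathfrak a$ for which $(\mathfrak a,i)$ is a special point, i.e. $O_r(\mathfrak a)\cap i(K)=i(\mathcal O_K)$, is stable under right multiplication by $i(K^\times)$; the elements of $\mathcal S/K^\times$ are called the $\mathcal O_K$-points for $\tilde{\mathscr O}$. For $\mathfrak p\in\mathcal P$ put $$\mathcal C_{\mathfrak p}=\{\mathfrak a\in\mathcal S:\ i(\omega_D)\in\mathfrak a^{-1}\mathfrak p\,\mathfrak a\}.$$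 Then the following hold. 1. There is a unique bilateral $\tilde{\mathscr O}$-ideal $\mathfrak m$ of norm $1$ that has order two in the group of bilateral $\tilde{\mathscr O}$-ideals modulo $\mathbb Q^\times$; write $\widetilde W\mathfrak b=\mathfrak m\mathfrak b$. There is an order $R\subset B$, locally conjugate to $\tilde{\mathscr O}$ at every prime, with $i(\mathcal O_K)\subseteq R$. 2. Suppose that $\mathfrak p\in\mathcal P$ and $\chi(\mathfrak p)=\left(\frac dp\right)$. For every $R$ as in (1) there is $\hat\alpha\in\widehat B^\times$ with $$\hat\alpha^{-1}\tilde{\mathscr O}\hat\alpha=R,\qquad \hat\alpha^{-1}\mathfrak p\hat\alpha=R\,i(\mathfrak p_K),$$ and for every such $\hat\alpha$, $$\mathcal C_{\mathfrak p}/K^\times=\mathcal C_{D,\mathfrak p}:=\{\hat\alpha R\,i(\mathfrak a)\}\cup\{\widetilde W\hat\alpha R\,i(\mathfrak a)\}\quad\text{in }\mathcal S/K^\times,$$ where $\mathfrak a$ runs through the nonzero fractional ideals of $\mathcal O_K$ (equivalently, through representatives of the ideal classes). Moreover $\#(\mathcal C_{\mathfrak p}/K^\times)=2h_D$. 3. There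 are exactly $(p+1)h_D$ $\mathcal O_K$-points for $\tilde{\mathscr O}$, and the set of these is the disjoint union of the sets $\mathcal C_{\mathfrak p}/K^\times$, $\mathfrak p\in\mathcal P$. 4. The set $\mathcal P$ has $p+1$ elements. For $\mathfrak p\in\mathcal P$ one has $\mathcal C_{\mathfrak p}=\emptyset$ if and only if $\chi(\mathfrak p)\ne\left(\frac dp\right)$. Exactly $(p+1)/2$ of the sets $\mathcal C_{\mathfrak p}$, $\mathfrak p\in\mathcal P$, are empty, and the other $(p+1)/2$ are non-empty, each of their quotients $\mathcal C_{\mathfrak p}/K^\times$ having $2h_D$ elements. -/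

import Mathlib

open scoped TensorProduct nonZeroDivisors NumberField RestrictedProduct

/-! ### Quaternion algebras over `ℚ` -/

section Quaternion

variable (B : Type*) [Ring B] [Algebra ℚ B]

/-- The completion `B ⊗ ℚ_ℓ` at a finite prime. -/
abbrev Bloc (ℓ : ℕ) [Fact ℓ.Prime] : Type _ := ℚ_[ℓ] ⊗[ℚ] B

/-- `B` is a quaternion algebra over `ℚ`: central simple of dimension `4`. -/
def IsQuaternionAlg : Prop :=
  Algebra.IsCentral ℚ B ∧ IsSimpleRing B ∧ Module.finrank ℚ B = 4

/-- `B` is ramified at the prime `ℓ`: the completion is a division algebra. -/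
def RamifiedAt (ℓ : ℕ) [Fact ℓ.Prime] : Prop :=
  Nontrivial (Bloc B ℓ) ∧ ∀ x : Bloc B ℓ, x ≠ 0 → IsUnit x

/-- `B` is ramified at `∞`. -/
def RamifiedAtInfty : Prop :=
  Nontrivial (ℝ ⊗[ℚ] B) ∧ ∀ x : ℝ ⊗[ℚ] B, x ≠ 0 → IsUnit x

/-- `B` is split at the prime `ℓ`: the completion is a matrix algebra. -/
def SplitAt (ℓ : ℕ) [Fact ℓ.Prime] : Prop :=
  Nonempty (Bloc B ℓ ≃ₐ[ℚ_[ℓ]] Matrix (Fin 2) (Fin 2) ℚ_[ℓ])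

/-- `B` is a quaternion algebra ramified exactly at `p` and `∞`. -/
def IsQuaternionRamifiedExactly (p : ℕ) [Fact p.Prime] : Prop :=
  IsQuaternionAlg B ∧ RamifiedAt B p ∧ RamifiedAtInfty B ∧
    ∀ (ℓ : ℕ) [Fact ℓ.Prime], ℓ ≠ p → SplitAt B ℓ

variable {B}

/-- The reduced trace; the trace of left multiplication by `x` is twice the reduced trace. -/
noncomputable def trd (x : B) : ℚ := LinearMap.trace ℚ B (LinearMap.mulLeft ℚ x) / 2

/-- Conjugation `x ↦ x̄ = trd x - x`. -/
noncomputable def qconj (x : B) : B := algebraMap ℚ B (trd x) - x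

/-- The reduced norm, i.e. the rational number `x * x̄`; the trace of left multiplication by a
rational number `c` on the `4`-dimensional algebra `B` is `4 * c`. -/
noncomputable def nrd (x : B) : ℚ := LinearMap.trace ℚ B (LinearMap.mulLeft ℚ (x * qconj x)) / 4

/-! ### Lattices, orders and ideals -/

/-- A lattice in `B`: a finitely generated `ℤ`-submodule spanning `B` over `ℚ`. -/
def IsLatticeIn (L : Submodule ℤ B) : Prop :=
  L.FG ∧ Submodule.span ℚ (L : Set B) = ⊤

/-- The underlying `ℤ`-module of a subring, as an element of the lattice semiring. -/
abbrev ordLat (O : Subalgebra ℤ B) : Submodule ℤ B := Subalgebra.toSubmodule O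

/-- An order in `B`. -/
def IsOrderIn (O : Subalgebra ℤ B) : Prop := IsLatticeIn (ordLat O)

/-- A maximal order in `B`. -/
def IsMaximalOrderIn (O : Subalgebra ℤ B) : Prop :=
  IsOrderIn O ∧ ∀ O' : Subalgebra ℤ B, IsOrderIn O' → O ≤ O' → O' = O

/-- `O'` is an order of index `n` in `O`. -/
def IsSuborderOfIndex (O' O : Subalgebra ℤ B) (n : ℕ) : Prop :=
  IsOrderIn O' ∧ O' ≤ O ∧ (ordLat O').toAddSubgroup.relIndex (ordLat O).toAddSubgroup = n

/-- `L b`. -/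
def rmul (L : Submodule ℤ B) (b : B) : Submodule ℤ B := L.map (LinearMap.mulRight ℤ b)

/-- The right order `{x | L x ⊆ L}`, as a set. -/
def rightOrder (L : Submodule ℤ B) : Set B := {x | ∀ a ∈ L, a * x ∈ L}

/-- The inverse `{x | L x L ⊆ L}` of a lattice. -/
def latInv (L : Submodule ℤ B) : Submodule ℤ B where
  carrier := {x | ∀ a ∈ L, ∀ b ∈ L, a * x * b ∈ L}
  add_mem' := by
    intro x y hx hy a ha b hb
    rw [mul_add, add_mul]
    exact L.add_mem (hx a ha b hb) (hy a ha b hb)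
  zero_mem' := by
    intro a _ b _
    simp
  smul_mem' := by
    intro c x hx a ha b hb
    rw [mul_smul_comm, smul_mul_assoc]
    exact L.smul_mem c (hx a ha b hb)

/-- The norm of a lattice: the positive generator of the subgroup of `ℚ` generated by the reduced
norms of its elements (and `0` if there is none). -/
noncomputable def latNorm (L : Submodule ℤ B) : ℚ :=
  open Classical in
  if h : ∃ q : ℚ, 0 < q ∧ Submodule.span ℤ (nrd '' (L : Set B)) = Submodule.span ℤ {q}
  then h.choose else 0

/-- The localization `L ⊗ ℤ_ℓ` inside `B ⊗ ℚ_ℓ`. -/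
noncomputable def locLat (ℓ : ℕ) [Fact ℓ.Prime] (L : Submodule ℤ B) :
    Submodule ℤ_[ℓ] (Bloc B ℓ) :=
  Submodule.span ℤ_[ℓ] ((fun b : B => (1 : ℚ_[ℓ]) ⊗ₜ[ℚ] b) '' (L : Set B))

/-- `x M`, locally. -/
noncomputable def locLmul {ℓ : ℕ} [Fact ℓ.Prime] (x : Bloc B ℓ)
    (M : Submodule ℤ_[ℓ] (Bloc B ℓ)) : Submodule ℤ_[ℓ] (Bloc B ℓ) :=
  M.map (LinearMap.mulLeft ℤ_[ℓ] x)

/-- `M x`, locally. -/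
noncomputable def locRmul {ℓ : ℕ} [Fact ℓ.Prime] (M : Submodule ℤ_[ℓ] (Bloc B ℓ))
    (x : Bloc B ℓ) : Submodule ℤ_[ℓ] (Bloc B ℓ) :=
  M.map (LinearMap.mulRight ℤ_[ℓ] x)

/-- Left `O`-ideals: lattices `L` with `L_ℓ = O_ℓ x_ℓ`, `x_ℓ ∈ B_ℓˣ`, for every prime `ℓ`. -/
def IsLeftIdeal (O : Subalgebra ℤ B) (L : Submodule ℤ B) : Prop :=
  IsLatticeIn L ∧ ∀ (ℓ : ℕ) [Fact ℓ.Prime], ∃ x : (Bloc B ℓ)ˣ,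
    locLat ℓ L = locRmul (locLat ℓ (ordLat O)) (x : Bloc B ℓ)

/-- Bilateral `O`-ideals: left `O`-ideals with right order `O`. -/
def IsBilateral (O : Subalgebra ℤ B) (L : Submodule ℤ B) : Prop :=
  IsLeftIdeal O L ∧ rightOrder L = (O : Set B)

/-- The set of bilateral `O`-ideals of norm `n`. -/
def bilateralOfNorm (O : Subalgebra ℤ B) (n : ℕ) : Set (Submodule ℤ B) :=
  {P | IsBilateral O P ∧ latNorm P = n}

/-- `ℚˣ`-equivalence of lattices. -/
def QEquiv (L M : Submodule ℤ B) : Prop :=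
  ∃ c : ℚ, c ≠ 0 ∧ L = rmul M (algebraMap ℚ B c)

/-- `M` is a bilateral `O`-ideal of norm `1` having order exactly two in the group of bilateral
`O`-ideals modulo `ℚˣ`-equivalence. -/
def IsInvolutiveNormOne (O : Subalgebra ℤ B) (M : Submodule ℤ B) : Prop :=
  M ∈ bilateralOfNorm O 1 ∧ ¬ QEquiv M (ordLat O) ∧ QEquiv (M * M) (ordLat O)

/-- The quadratic character: `(nrd x / N(L) | p)` for an `x ∈ L` such that the integer
`nrd x / N(L)` is prime to `p`. -/
noncomputable def chi (p : ℕ) [Fact p.Prime] (L : Submodule ℤ B) : ℤ :=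
  open Classical in
  if h : ∃ n : ℤ, ¬ (p : ℤ) ∣ n ∧ ∃ x ∈ L, nrd x = n * latNorm L
  then legendreSym p h.choose else 0

/-- Two orders are in the same genus: locally conjugate at every prime. -/
def SameGenus (O R : Subalgebra ℤ B) : Prop :=
  ∀ (ℓ : ℕ) [Fact ℓ.Prime], ∃ x : (Bloc B ℓ)ˣ,
    locLat ℓ (ordLat R) =
      locLmul (↑x⁻¹ : Bloc B ℓ) (locRmul (locLat ℓ (ordLat O)) (x : Bloc B ℓ))

/-! ### Finite ideles of `B` -/

instance factPrimes (ℓ : Nat.Primes) : Fact (ℓ : ℕ).Prime := ⟨ℓ.2⟩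

/-- The group of finite ideles `B̂ˣ`, the restricted product of the groups `B_ℓˣ` with respect to
the unit groups `O_ℓˣ` of the completions of an order `O`. -/
abbrev BIdeles (O : Subalgebra ℤ B) : Type _ :=
  Πʳ ℓ : Nat.Primes, [(Bloc B (ℓ : ℕ))ˣ,
    {x : (Bloc B (ℓ : ℕ))ˣ | (x : Bloc B (ℓ : ℕ)) ∈ locLat (ℓ : ℕ) (ordLat O) ∧
      (↑x⁻¹ : Bloc B (ℓ : ℕ)) ∈ locLat (ℓ : ℕ) (ordLat O)}]

/-- The global lattice with prescribed completions. -/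
noncomputable def globalLat
    (M : ∀ ℓ : Nat.Primes, Submodule ℤ_[(ℓ : ℕ)] (Bloc B (ℓ : ℕ))) : Submodule ℤ B where
  carrier := {b | ∀ ℓ : Nat.Primes, (1 : ℚ_[(ℓ : ℕ)]) ⊗ₜ[ℚ] b ∈ M ℓ}
  add_mem' := by
    intro x y hx hy ℓ
    rw [TensorProduct.tmul_add]
    exact (M ℓ).add_mem (hx ℓ) (hy ℓ)
  zero_mem' := by
    intro ℓ
    simp
  smul_mem' := by
    intro c x hx ℓ
    rw [TensorProduct.tmul_smul]
    exact zsmul_mem (hx ℓ) c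

/-- The lattice `α̂ L`. -/
noncomputable def ideleMul {O : Subalgebra ℤ B} (α : BIdeles O) (L : Submodule ℤ B) :
    Submodule ℤ B :=
  globalLat fun ℓ => locLmul (α ℓ : Bloc B (ℓ : ℕ)) (locLat (ℓ : ℕ) L)

/-- The lattice `α̂⁻¹ L α̂`. -/
noncomputable def ideleConj {O : Subalgebra ℤ B} (α : BIdeles O) (L : Submodule ℤ B) :
    Submodule ℤ B :=
  globalLat fun ℓ => locLmul (↑(α ℓ)⁻¹ : Bloc B (ℓ : ℕ))
    (locRmul (locLat (ℓ : ℕ) L) (α ℓ : Bloc B (ℓ : ℕ)))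

end Quaternion

/-! ### Special points -/

section SpecialPoints

variable {B : Type*} [Ring B] [Algebra ℚ B] {K : Type*} [Field K] [NumberField K]

/-- `(L, ψ)` is a special point for the maximal order `𝓞 K`: `L` is a left `O`-ideal and
`O_r(L) ∩ ψ(K) = ψ(𝓞 K)`. -/
def IsSpecialPoint (O : Subalgebra ℤ B) (L : Submodule ℤ B) (ψ : K →ₐ[ℚ] B) : Prop :=
  IsLeftIdeal O L ∧
    rightOrder L ∩ Set.range ψ = Set.range (fun z : 𝓞 K => ψ (z : K))

/-- Two lattices are identified when they differ by right multiplication by `i(Kˣ)`. -/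
def kSetoid (i : K →ₐ[ℚ] B) : Setoid (Submodule ℤ B) where
  r L M := ∃ k : K, k ≠ 0 ∧ M = rmul L (i k)
  iseqv :=
    { refl := fun L => ⟨1, one_ne_zero, by
        ext x
        simp [rmul]⟩
      symm := by
        rintro L M ⟨k, hk, rfl⟩
        refine ⟨k⁻¹, inv_ne_zero hk, ?_⟩
        ext x
        simp [rmul, mul_assoc, ← map_mul, hk]
      trans := by
        rintro L M N ⟨k, hk, rfl⟩ ⟨l, hl, rfl⟩
        refine ⟨k * l, mul_ne_zero hk hl, ?_⟩
        ext x
        simp [rmul, mul_assoc] }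

/-- The image `S / Kˣ` of a set of lattices in the quotient by `i(Kˣ)`. -/
def modK (i : K →ₐ[ℚ] B) (S : Set (Submodule ℤ B)) : Set (Quotient (kSetoid i)) :=
  Quotient.mk (kSetoid i) '' S

/-- The set of `𝓞 K`-points for `O`. -/
def OKPoints (O : Subalgebra ℤ B) (i : K →ₐ[ℚ] B) : Set (Quotient (kSetoid i)) :=
  modK i {L | IsSpecialPoint O L i}

/-- The set `𝒞_𝔭` of left `O`-ideals `L` such that `(L, i)` is a special point and
`i(ω) ∈ L⁻¹ P L`. -/
def CSet (O : Subalgebra ℤ B) (i : K →ₐ[ℚ] B) (ω : 𝓞 K) (P : Submodule ℤ B) :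
    Set (Submodule ℤ B) :=
  {L | IsSpecialPoint O L i ∧ i (ω : K) ∈ latInv L * P * L}

/-- The lattice `i(J) ⊆ i(K)` of a fractional ideal `J` of `K`. -/
noncomputable def embIdeal (i : K →ₐ[ℚ] B) (J : FractionalIdeal (𝓞 K)⁰ K) : Submodule ℤ B :=
  ((J : Submodule (𝓞 K) K).restrictScalars ℤ).map (i : K →+* B).toIntAlgHom.toLinearMap

/-- The two conditions `α̂⁻¹ O α̂ = R` and `α̂⁻¹ P α̂ = R i(𝔭_K)`. -/
def IsTransporter (O R : Subalgebra ℤ B) (i : K →ₐ[ℚ] B) (P : Submodule ℤ B)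
    (pK : Ideal (𝓞 K)) (α : BIdeles O) : Prop :=
  ideleConj α (ordLat O) = ordLat R ∧
    ideleConj α P = ordLat R * embIdeal i (pK : FractionalIdeal (𝓞 K)⁰ K)

/-- The set `𝒞_{D,𝔭} = {α̂ R i(𝔞)} ∪ {W̃ α̂ R i(𝔞)}`, where `W` is the bilateral ideal acting
as `W̃`. -/
def CDSet (O R : Subalgebra ℤ B) (i : K →ₐ[ℚ] B) (W : Submodule ℤ B) (α : BIdeles O) :
    Set (Quotient (kSetoid i)) :=
  modK i
    (Set.range (fun J : (FractionalIdeal (𝓞 K)⁰ K)ˣ =>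
        ideleMul α (ordLat R * embIdeal i (J : FractionalIdeal (𝓞 K)⁰ K))) ∪
      Set.range (fun J : (FractionalIdeal (𝓞 K)⁰ K)ˣ =>
        W * ideleMul α (ordLat R * embIdeal i (J : FractionalIdeal (𝓞 K)⁰ K))))

end SpecialPoints

/-! The problem is local, and only the prime p matters. A left ideal is `idl Ot x` for a family x of
local units, almost all of them units of the local order, and x is determined up to left
multiplication by the local unit groups. Since ω generates the ring of integers, the ideal is a
special point exactly when x_ℓ ω x_ℓ⁻¹ lies in the local order for every ℓ
(`isSpecialPoint_idl_iff`).

Away from p the local order is a copy of the integral 2×2 matrices. There ω is never a scalar modulo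
ℓ, so all its integral conjugates are integrally conjugate to one companion matrix. Hence any two
special families differ at ℓ by a local unit on the left and an element of K on the right
(`exists_factor`, `exists_loc_of_ne`).

At p the completion is a division algebra. Its valuation ring has a residue field κ with p²
elements, and the local order is the preimage of the prime field F_p
(`IsSuborderOfIndex.mem_locLat_iff`). Congruence to a rational integer modulo the maximal ideal
survives every conjugation, so the whole group B_pˣ normalizes the local order. The norm of ω is
divisible by p exactly once, so ω is a uniformizer and reduces to 0. It therefore lies in the local
order, and x_p is subject to no condition. Conjugation by a uniformizer induces Frobenius on κ
(`res_uniformizer_conj`), so elements of K of unit norm, which commute with ω, reduce into F_p.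

Consequently the special points form one free orbit under pairs (bilateral ideal of norm 1,
fractional ideal of K): see `exists_eq_bil_mul` and `bil_mul_idl_mul_embIdeal_injective`. Bilateral
ideals of norm 1 correspond to κˣ/F_pˣ, which is cyclic of order p + 1. Dividing by Kˣ leaves (p +
1) h points, and the single element of order two in the cyclic group is the ideal 𝔪.

A special point determines the bilateral ideal of norm p generated at p by the uniformizer ϖ = x_p ω
x_p⁻¹, and this is the only 𝔭 whose set contains the point (`idl_mem_CSet_iff`). Moving the point by
a unit u with residue z replaces ϖ by u ϖ u⁻¹. The commutator with ϖ reduces to z^(1-p), which lies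
in F_p if and only if z^p = ±z. So the ideal is unchanged precisely for the trivial class and the
class of 𝔪 (`CSet_eq`). Each non-empty piece thus has 2h classes, and counting leaves (p + 1)/2 such
pieces.

The character decides which pieces are non-empty. The norm of ω divided by p is d/4 modulo p, so
ideals coming from points have character (d/p). Conversely, if the ideal of c ω has this character,
then the residue of c is a square in κ, and c ω is a conjugate of ω up to a unit of the local order
(`exists_conj_of_isSquare`). -/

set_option linter.unusedSectionVars false

universe u

/-! ### Algebras of dimension four with a conjugation and a reduced norm. -/

section QuatLike

/-- The reduced trace over a general base field. -/
noncomputable def trdF (F : Type*) {A : Type*} [Field F] [Ring A] [Algebra F A] (x : A) : F :=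
  LinearMap.trace F A (LinearMap.mulLeft F x) / 2

/-- Conjugation over a general base field. -/
noncomputable def conjF (F : Type*) {A : Type*} [Field F] [Ring A] [Algebra F A] (x : A) : A :=
  algebraMap F A (trdF F x) - x

/-- The reduced norm over a general base field. -/
noncomputable def nrdF (F : Type*) {A : Type*} [Field F] [Ring A] [Algebra F A] (x : A) : F :=
  LinearMap.trace F A (LinearMap.mulLeft F (x * conjF F x)) / 4

/-- The algebra has dimension four, `conjF` is an anti-involution and `x * conjF x` is the
scalar `nrdF x`. -/
structure QuatLike (F A : Type*) [Field F] [Ring A] [Algebra F A] : Prop where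
  finrank : Module.finrank F A = 4
  conj_mul : ∀ x y : A, conjF F (x * y) = conjF F y * conjF F x
  mul_conj : ∀ x : A, x * conjF F x = algebraMap F A (nrdF F x)

variable {F A A' : Type*} [Field F] [Ring A] [Algebra F A] [Ring A'] [Algebra F A']

theorem trdF_add (x y : A) : trdF F (x + y) = trdF F x + trdF F y := by
  have : LinearMap.mulLeft F (x + y) = LinearMap.mulLeft F x + LinearMap.mulLeft F y := by
    ext; simp [add_mul]
  simp only [trdF, this, map_add, add_div]

theorem trdF_smul (c : F) (x : A) : trdF F (c • x) = c * trdF F x := by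
  have : LinearMap.mulLeft F (c • x) = c • LinearMap.mulLeft F x := by
    ext; simp
  simp only [trdF, this, map_smul, smul_eq_mul, mul_div_assoc]

/-- `trdF` as a linear map. -/
noncomputable def trdL (F A : Type*) [Field F] [Ring A] [Algebra F A] : A →ₗ[F] F where
  toFun := trdF F
  map_add' := trdF_add
  map_smul' := trdF_smul

/-- `conjF` as a linear map. -/
noncomputable def conjL (F A : Type*) [Field F] [Ring A] [Algebra F A] : A →ₗ[F] A :=
  (Algebra.linearMap F A).comp (trdL F A) - LinearMap.id

theorem conjL_apply (x : A) : conjL F A x = conjF F x := rfl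

theorem trdL_apply (x : A) : trdL F A x = trdF F x := rfl

theorem conjF_add (x y : A) : conjF F (x + y) = conjF F x + conjF F y := map_add (conjL F A) x y

theorem conjF_sub (x y : A) : conjF F (x - y) = conjF F x - conjF F y := map_sub (conjL F A) x y

theorem conjF_smul (c : F) (x : A) : conjF F (c • x) = c • conjF F x := map_smul (conjL F A) c x

theorem add_conjF (x : A) : x + conjF F x = algebraMap F A (trdF F x) := by
  rw [conjF]; abel

theorem trdF_equiv (e : A ≃ₐ[F] A') (x : A) : trdF F (e x) = trdF F x := by
  have : LinearMap.mulLeft F (e x) = e.toLinearEquiv.conj (LinearMap.mulLeft F x) := by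
    ext y; simp [LinearEquiv.conj_apply]
  simp only [trdF, this, LinearMap.trace_conj']

theorem conjF_equiv (e : A ≃ₐ[F] A') (x : A) : conjF F (e x) = e (conjF F x) := by
  simp [conjF, trdF_equiv]

theorem nrdF_equiv (e : A ≃ₐ[F] A') (x : A) : nrdF F (e x) = nrdF F x := by
  have h := trdF_equiv e (x * conjF F x)
  simp only [trdF, map_mul, ← conjF_equiv] at h
  simp only [nrdF]
  -- If 2 = 0 then 4 = 0 as well, and division by zero makes both norms 0.
  by_cases h2 : (2 : F) = 0
  · have : (4 : F) = 0 := by linear_combination 2 * h2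
    simp [this]
  · rw [div_left_inj' h2] at h
    rw [h]

theorem finrank_matrix_two : Module.finrank F (Matrix (Fin 2) (Fin 2) F) = 4 := by
  simp [Module.finrank_matrix]

theorem QuatLike.of_equiv (h : QuatLike F A) (e : A ≃ₐ[F] A') : QuatLike F A' where
  finrank := by rw [← h.finrank, e.toLinearEquiv.finrank_eq]
  conj_mul x y := by
    obtain ⟨x, rfl⟩ := e.surjective x
    obtain ⟨y, rfl⟩ := e.surjective y
    rw [← map_mul, conjF_equiv, conjF_equiv, conjF_equiv, h.conj_mul, map_mul]
  mul_conj x := by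
    obtain ⟨x, rfl⟩ := e.surjective x
    rw [conjF_equiv, nrdF_equiv, ← map_mul, h.mul_conj, e.commutes]

variable [CharZero F]

theorem trace_mulLeft_algebraMap (h4 : Module.finrank F A = 4) (c : F) :
    LinearMap.trace F A (LinearMap.mulLeft F (algebraMap F A c)) = 4 * c := by
  have : Module.Finite F A := Module.finite_of_finrank_pos (by omega)
  have : LinearMap.mulLeft F (algebraMap F A c) = c • LinearMap.id := by
    ext; simp [Algebra.smul_def]
  rw [this, map_smul, LinearMap.trace_id, h4]; simp [mul_comm]

theorem nrdF_eq_of_mul_conj (h4 : Module.finrank F A = 4) {x : A} {c : F}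
    (h : x * conjF F x = algebraMap F A c) : nrdF F x = c := by
  rw [nrdF, h, trace_mulLeft_algebraMap h4]; field_simp

theorem trdF_algebraMap (h4 : Module.finrank F A = 4) (c : F) :
    trdF F (algebraMap F A c) = 2 * c := by
  rw [trdF, trace_mulLeft_algebraMap h4]; ring

/-- Left multiplication by X acts on each of the two columns separately, so its trace is twice the
matrix trace. -/
theorem trdF_matrix (X : Matrix (Fin 2) (Fin 2) F) : trdF F X = X.trace := by
  have : LinearMap.trace F _ (LinearMap.mulLeft F X) = 2 * X.trace := by
    rw [LinearMap.trace_eq_matrix_trace F (Matrix.stdBasis F (Fin 2) (Fin 2))]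
    simp only [Matrix.trace, Matrix.diag, LinearMap.toMatrix_apply, LinearMap.mulLeft_apply,
      Fintype.sum_prod_type, Fin.sum_univ_two, Matrix.stdBasis_eq_single]
    have h (i j : Fin 2) : ((Matrix.stdBasis F (Fin 2) (Fin 2)).repr
      (X * Matrix.single i j 1)) (i, j) = X i i := by
      have (Y : Matrix (Fin 2) (Fin 2) F) (i j) :
        ((Matrix.stdBasis F (Fin 2) (Fin 2)).repr Y) (i, j) = Y i j := by
        simp [Matrix.stdBasis]
      rw [this]; simp
    simp only [h]; ring
  rw [trdF, this]; field_simp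

theorem conjF_matrix (X : Matrix (Fin 2) (Fin 2) F) : conjF F X = X.adjugate := by
  rw [conjF, trdF_matrix]
  ext i j
  fin_cases i <;> fin_cases j <;>
    simp [Matrix.adjugate_fin_two, Matrix.trace, Matrix.algebraMap_matrix_apply]

theorem mul_conjF_matrix (X : Matrix (Fin 2) (Fin 2) F) :
    X * conjF F X = algebraMap F _ X.det := by
  rw [conjF_matrix, Matrix.mul_adjugate, Algebra.algebraMap_eq_smul_one]

theorem nrdF_matrix (X : Matrix (Fin 2) (Fin 2) F) : nrdF F X = X.det :=
  nrdF_eq_of_mul_conj finrank_matrix_two (mul_conjF_matrix X)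

theorem quatLike_matrix : QuatLike F (Matrix (Fin 2) (Fin 2) F) where
  finrank := finrank_matrix_two
  conj_mul x y := by simp only [conjF_matrix, Matrix.adjugate_mul_distrib]
  mul_conj x := by rw [mul_conjF_matrix, nrdF_matrix]

section BaseChange

variable {E : Type*} [Field E] [Algebra F E]

theorem trdF_one_tmul (h4 : Module.finrank F A = 4) (x : A) :
    trdF E ((1 : E) ⊗ₜ[F] x) = algebraMap F E (trdF F x) := by
  have : Module.Finite F A := Module.finite_of_finrank_pos (by omega)
  have : LinearMap.mulLeft E ((1 : E) ⊗ₜ[F] x) =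
      (LinearMap.mulLeft F x).baseChange E := by
    ext y; simp
  rw [trdF, this, LinearMap.trace_baseChange, trdF, map_div₀, map_ofNat]

theorem conjF_tmul (h4 : Module.finrank F A = 4) (a : E) (x : A) :
    conjF E (a ⊗ₜ[F] x) = a ⊗ₜ[F] conjF F x := by
  have : a ⊗ₜ[F] x = a • ((1 : E) ⊗ₜ[F] x) := by simp [TensorProduct.smul_tmul']
  rw [this, conjF_smul, conjF, trdF_one_tmul h4, ← IsScalarTower.algebraMap_apply,
    Algebra.TensorProduct.algebraMap_apply', smul_sub, conjF, TensorProduct.tmul_sub]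
  simp [TensorProduct.smul_tmul']

theorem nrdF_one_tmul (h4 : Module.finrank F A = 4) (x : A) :
    nrdF E ((1 : E) ⊗ₜ[F] x) = algebraMap F E (nrdF F x) := by
  have : Module.Finite F A := Module.finite_of_finrank_pos (by omega)
  have : LinearMap.mulLeft E ((1 : E) ⊗ₜ[F] (x * conjF F x)) =
      (LinearMap.mulLeft F (x * conjF F x)).baseChange E := by
    ext y; simp [mul_assoc]
  rw [nrdF, conjF_tmul h4, Algebra.TensorProduct.tmul_mul_tmul, one_mul, this,
    LinearMap.trace_baseChange, nrdF, map_div₀, map_ofNat]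

/-- The anti-involution law is bilinear and is checked on pure tensors. That x times its conjugate
is a scalar is quadratic in x, so sums need polarization. -/
theorem QuatLike.baseChange [CharZero E] (h : QuatLike F A) : QuatLike E (E ⊗[F] A) := by
  have h4 : Module.finrank E (E ⊗[F] A) = 4 := by rw [Module.finrank_baseChange, h.finrank]
  have hc (x y : E ⊗[F] A) : conjF E (x * y) = conjF E y * conjF E x := by
    induction x using TensorProduct.induction_on with
    | zero => simp [← conjL_apply]
    | add x x' hx hx' => rw [add_mul, conjF_add, hx, hx', conjF_add, mul_add]
    | tmul a x =>
      induction y using TensorProduct.induction_on with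
      | zero => simp [← conjL_apply]
      | add y y' hx hx' => rw [mul_add, conjF_add, hx, hx', conjF_add, add_mul]
      | tmul b y =>
        simp only [Algebra.TensorProduct.tmul_mul_tmul, conjF_tmul h.finrank, h.conj_mul,
          mul_comm]
  have hcc (x : E ⊗[F] A) : conjF E (conjF E x) = x := by
    simp only [conjF, ← trdL_apply, map_sub]
    simp only [trdL_apply, trdF_algebraMap h4]
    rw [two_mul, map_add]; abel
  refine ⟨h4, hc, fun x => ?_⟩
  have : ∃ c : E, x * conjF E x = algebraMap E _ c := by
    induction x using TensorProduct.induction_on with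
    | zero => exact ⟨0, by simp⟩
    | add x y hx hy =>
      obtain ⟨c, hc1⟩ := hx
      obtain ⟨d, hd1⟩ := hy
      -- The cross terms are an element plus its own conjugate, hence its trace.
      refine ⟨c + d + trdF E (x * conjF E y), ?_⟩
      have : algebraMap E (E ⊗[F] A) (trdF E (x * conjF E y)) = x * conjF E y + y * conjF E x := by
        have h1 := hc x (conjF E y)
        rw [hcc] at h1
        rw [← h1, add_conjF]
      rw [map_add, map_add, this, ← hc1, ← hd1, conjF_add, add_mul, mul_add, mul_add]; abel
    | tmul a x =>
      refine ⟨a * a * algebraMap F E (nrdF F x), ?_⟩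
      rw [conjF_tmul h.finrank, Algebra.TensorProduct.tmul_mul_tmul, h.mul_conj,
        Algebra.algebraMap_eq_smul_one, Algebra.algebraMap_eq_smul_one,
        ← TensorProduct.smul_tmul, Algebra.TensorProduct.one_def, TensorProduct.smul_tmul',
        Algebra.smul_def, smul_eq_mul, mul_one, mul_comm]
  obtain ⟨c, hc1⟩ := this
  rw [nrdF_eq_of_mul_conj h4 hc1, hc1]

theorem QuatLike.of_baseChange (h4 : Module.finrank F A = 4) (h : QuatLike E (E ⊗[F] A)) :
    QuatLike F A := by
  have hi : Function.Injective (fun x : A => (1 : E) ⊗ₜ[F] x) :=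
    Algebra.TensorProduct.includeRight_injective (algebraMap F E).injective
  refine ⟨h4, fun x y => hi ?_, fun x => hi ?_⟩
  · have := h.conj_mul (1 ⊗ₜ[F] x) (1 ⊗ₜ[F] y)
    simpa [conjF_tmul h4] using this
  · have := h.mul_conj (1 ⊗ₜ[F] x)
    rw [conjF_tmul h4, nrdF_one_tmul h4, ← IsScalarTower.algebraMap_apply,
      Algebra.TensorProduct.algebraMap_apply'] at this
    simpa using this

end BaseChange

namespace QuatLike

theorem nontrivial (h : QuatLike F A) : Nontrivial A :=
  Module.nontrivial_of_finrank_pos (R := F) (by rw [h.finrank]; norm_num)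

theorem algebraMap_inj (h : QuatLike F A) {a b : F} (hab : algebraMap F A a = algebraMap F A b) :
    a = b :=
  have := h.nontrivial
  (algebraMap F A).injective hab

theorem conj_conj (h : QuatLike F A) (x : A) : conjF F (conjF F x) = x := by
  simp only [conjF, ← trdL_apply, map_sub]
  simp only [trdL_apply, trdF_algebraMap h.finrank]
  rw [two_mul, map_add]; abel

theorem conj_algebraMap (h : QuatLike F A) (c : F) :
    conjF F (algebraMap F A c) = algebraMap F A c := by
  rw [conjF, trdF_algebraMap h.finrank, two_mul, map_add]; abel

theorem nrd_algebraMap (h : QuatLike F A) (c : F) : nrdF F (algebraMap F A c) = c ^ 2 :=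
  nrdF_eq_of_mul_conj h.finrank (by rw [h.conj_algebraMap, map_pow, sq])

theorem nrd_one (h : QuatLike F A) : nrdF F (1 : A) = 1 := by
  simpa using h.nrd_algebraMap 1

theorem nrd_zero (h : QuatLike F A) : nrdF F (0 : A) = 0 := by
  simpa using h.nrd_algebraMap 0

theorem nrd_mul (h : QuatLike F A) (x y : A) : nrdF F (x * y) = nrdF F x * nrdF F y := by
  apply nrdF_eq_of_mul_conj h.finrank
  rw [h.conj_mul, mul_assoc, ← mul_assoc y, h.mul_conj, Algebra.commutes, ← mul_assoc, h.mul_conj,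
    map_mul]

theorem nrd_smul (h : QuatLike F A) (c : F) (x : A) : nrdF F (c • x) = c ^ 2 * nrdF F x := by
  rw [Algebra.smul_def, h.nrd_mul, h.nrd_algebraMap]

theorem nrd_neg (h : QuatLike F A) (x : A) : nrdF F (-x) = nrdF F x := by
  have := h.nrd_smul (-1) x
  simpa using this

theorem conj_mul_self (h : QuatLike F A) (x : A) : conjF F x * x = algebraMap F A (nrdF F x) := by
  rw [← h.mul_conj, conjF, sub_mul, mul_sub, Algebra.commutes]

theorem nrd_conj (h : QuatLike F A) (x : A) : nrdF F (conjF F x) = nrdF F x :=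
  nrdF_eq_of_mul_conj h.finrank (by rw [h.conj_conj, h.conj_mul_self])

theorem mul_self (h : QuatLike F A) (x : A) : x * x = trdF F x • x - algebraMap F A (nrdF F x) := by
  rw [← h.conj_mul_self, conjF, sub_mul, Algebra.smul_def]; abel

theorem nrd_add (h : QuatLike F A) (x y : A) :
    nrdF F (x + y) = nrdF F x + nrdF F y + trdF F (x * conjF F y) := by
  apply nrdF_eq_of_mul_conj h.finrank
  have : algebraMap F A (trdF F (x * conjF F y)) = x * conjF F y + y * conjF F x := by
    have h1 := h.conj_mul x (conjF F y)
    rw [h.conj_conj] at h1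
    rw [← h1, add_conjF]
  rw [map_add, map_add, this, ← h.mul_conj, ← h.mul_conj, conjF_add, add_mul, mul_add, mul_add]
  abel

theorem conj_one (h : QuatLike F A) : conjF F (1 : A) = 1 := by
  simpa using h.conj_algebraMap 1

theorem nrd_one_add (h : QuatLike F A) (x : A) : nrdF F (1 + x) = 1 + trdF F x + nrdF F x := by
  rw [add_comm 1 x, h.nrd_add, h.nrd_one, h.conj_one, mul_one]; ring

theorem nrd_ne_zero_of_isUnit (h : QuatLike F A) {x : A} (hx : IsUnit x) : nrdF F x ≠ 0 := by
  obtain ⟨u, rfl⟩ := hx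
  intro h0
  have := h.nrd_mul u ↑u⁻¹
  rw [Units.mul_inv, h.nrd_one, h0, zero_mul] at this
  exact one_ne_zero this

theorem nrd_inv (h : QuatLike F A) (u : Aˣ) : nrdF F (↑u⁻¹ : A) = (nrdF F (u : A))⁻¹ := by
  have := h.nrd_mul u ↑u⁻¹
  rw [Units.mul_inv, h.nrd_one] at this
  exact eq_inv_of_mul_eq_one_right this.symm

theorem inv_eq (h : QuatLike F A) (u : Aˣ) : (↑u⁻¹ : A) = (nrdF F (u : A))⁻¹ • conjF F (u : A) := by
  have h0 := h.nrd_ne_zero_of_isUnit u.isUnit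
  rw [Units.inv_eq_of_mul_eq_one_right]
  rw [mul_smul_comm, h.mul_conj, Algebra.algebraMap_eq_smul_one, smul_smul, inv_mul_cancel₀ h0,
    one_smul]

theorem isUnit_of_nrd_ne_zero (h : QuatLike F A) {x : A} (hx : nrdF F x ≠ 0) : IsUnit x := by
  refine ⟨⟨x, (nrdF F x)⁻¹ • conjF F x, ?_, ?_⟩, rfl⟩
  · rw [mul_smul_comm, h.mul_conj, Algebra.algebraMap_eq_smul_one, smul_smul, inv_mul_cancel₀ hx,
      one_smul]
  · rw [smul_mul_assoc, h.conj_mul_self, Algebra.algebraMap_eq_smul_one, smul_smul,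
      inv_mul_cancel₀ hx, one_smul]

end QuatLike

end QuatLike

/-! ### Lattices in B and their completions. -/

section LocalGlobal

variable {B : Type*} [Ring B] [Algebra ℚ B]

/-- The canonical map to the completion. -/
noncomputable def toLoc (ℓ : ℕ) [Fact ℓ.Prime] : B →ₐ[ℚ] Bloc B ℓ :=
  Algebra.TensorProduct.includeRight

theorem toLoc_apply (ℓ : ℕ) [Fact ℓ.Prime] (b : B) : toLoc ℓ b = (1 : ℚ_[ℓ]) ⊗ₜ[ℚ] b := rfl

section
variable {ℓ : ℕ} [Fact ℓ.Prime]

theorem toLoc_mem_locLat {L : Submodule ℤ B} {b : B} (hb : b ∈ L) : toLoc ℓ b ∈ locLat ℓ L :=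
  Submodule.subset_span ⟨b, hb, rfl⟩

theorem locLat_le_iff {L : Submodule ℤ B} {M : Submodule ℤ_[ℓ] (Bloc B ℓ)} :
    locLat ℓ L ≤ M ↔ ∀ b ∈ L, toLoc ℓ b ∈ M := by
  rw [locLat, Submodule.span_le]
  exact ⟨fun h b hb => h ⟨b, hb, rfl⟩, by rintro h _ ⟨b, hb, rfl⟩; exact h b hb⟩

theorem locLat_mono {L M : Submodule ℤ B} (h : L ≤ M) : locLat ℓ L ≤ locLat ℓ M :=
  locLat_le_iff.2 fun _ hb => toLoc_mem_locLat (h hb)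

theorem locLat_span (S : Set B) :
    locLat ℓ (Submodule.span ℤ S) = Submodule.span ℤ_[ℓ] (toLoc ℓ '' S) := by
  apply le_antisymm
  · rw [locLat_le_iff]
    intro b hb
    induction hb using Submodule.span_induction with
    | mem x hx => exact Submodule.subset_span ⟨x, hx, rfl⟩
    | zero => simp
    | add x y _ _ hx hy => rw [map_add]; exact add_mem hx hy
    | smul n x _ hx => rw [map_zsmul]; exact zsmul_mem hx n
  · rw [Submodule.span_le]
    rintro _ ⟨b, hb, rfl⟩
    exact toLoc_mem_locLat (Submodule.subset_span hb)

theorem isUnit_padicInt_of_coprime {N : ℕ} (hN : N.Coprime ℓ) : IsUnit (N : ℤ_[ℓ]) := by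
  rw [PadicInt.isUnit_iff]
  have h : ¬ ((ℓ : ℤ) ∣ (N : ℤ)) := by
    intro h
    have := (Nat.Prime.coprime_iff_not_dvd (Fact.out : ℓ.Prime)).1 hN.symm
    exact this (by exact_mod_cast h)
  have h1 := PadicInt.norm_int_lt_one_iff_dvd (p := ℓ) (N : ℤ)
  have h2 := PadicInt.norm_le_one (N : ℤ_[ℓ])
  rcases h2.lt_or_eq with h3 | h3
  · exact absurd (h1.1 (by simpa using h3)) h
  · exact h3

theorem mem_of_nsmul_mem {M : Submodule ℤ_[ℓ] (Bloc B ℓ)} {N : ℕ} (hN : N.Coprime ℓ)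
    {x : Bloc B ℓ} (hx : N • x ∈ M) : x ∈ M := by
  obtain ⟨u, hu⟩ := isUnit_padicInt_of_coprime hN
  have := M.smul_mem (↑u⁻¹ : ℤ_[ℓ]) hx
  rwa [← Nat.cast_smul_eq_nsmul ℤ_[ℓ], ← hu, smul_smul, Units.inv_mul, one_smul] at this

theorem exists_pow_nsmul_mem {M : Submodule ℤ_[ℓ] (Bloc B ℓ)}
    (hM : Submodule.span ℚ_[ℓ] (M : Set (Bloc B ℓ)) = ⊤) (x : Bloc B ℓ) :
    ∃ k : ℕ, (ℓ ^ k) • x ∈ M := by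
  have hx : x ∈ Submodule.span ℚ_[ℓ] (M : Set (Bloc B ℓ)) := by rw [hM]; trivial
  induction hx using Submodule.span_induction with
  | mem x hx => exact ⟨0, by simpa using hx⟩
  | zero => exact ⟨0, by simp⟩
  | add x y _ _ hx hy =>
    obtain ⟨k, hk⟩ := hx
    obtain ⟨l, hl⟩ := hy
    refine ⟨k + l, ?_⟩
    rw [nsmul_add]
    refine add_mem ?_ ?_
    · rw [pow_add, mul_comm, mul_smul]; exact nsmul_mem hk _
    · rw [pow_add, mul_smul]; exact nsmul_mem hl _
  | smul a x _ hx =>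
    obtain ⟨k, hk⟩ := hx
    have : ∃ l : ℕ, ∃ c : ℤ_[ℓ], (ℓ : ℚ_[ℓ]) ^ l * a = c := by
      obtain ⟨l, hl⟩ := PadicInt.exists_pow_neg_lt ℓ (ε := (‖a‖ + 1)⁻¹) (by positivity)
      refine ⟨l, ⟨(ℓ : ℚ_[ℓ]) ^ l * a, ?_⟩, rfl⟩
      rw [norm_mul, Padic.norm_p_pow]
      have h1 : (ℓ : ℝ) ^ (-(l : ℤ)) * ‖a‖ ≤ (‖a‖ + 1)⁻¹ * (‖a‖ + 1) := by
        gcongr; linarith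
      rwa [inv_mul_cancel₀ (by positivity)] at h1
    obtain ⟨l, c, hc⟩ := this
    refine ⟨l + k, ?_⟩
    have : (ℓ ^ (l + k)) • a • x = c • ((ℓ ^ k) • x) := by
      rw [← Nat.cast_smul_eq_nsmul ℚ_[ℓ], ← Nat.cast_smul_eq_nsmul ℚ_[ℓ],
        ← algebraMap_smul ℚ_[ℓ] c, PadicInt.algebraMap_apply, ← hc, smul_smul, smul_smul]
      push_cast
      congr 1; ring
    rw [this]
    exact M.smul_mem _ hk

theorem exists_pow_nsmul_le {M M' : Submodule ℤ_[ℓ] (Bloc B ℓ)} (hM : M.FG)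
    (hM' : Submodule.span ℚ_[ℓ] (M' : Set (Bloc B ℓ)) = ⊤) :
    ∃ k : ℕ, ∀ x ∈ M, (ℓ ^ k) • x ∈ M' := by
  obtain ⟨S, rfl⟩ := hM
  choose k hk using fun x : Bloc B ℓ => exists_pow_nsmul_mem hM' x
  refine ⟨S.sup k, fun x hx => ?_⟩
  induction hx using Submodule.span_induction with
  | mem x hx =>
    have : k x ≤ S.sup k := Finset.le_sup hx
    rw [← Nat.sub_add_cancel this, pow_add, mul_smul]
    exact nsmul_mem (hk x) _
  | zero => simp
  | add x y _ _ hx hy => rw [nsmul_add]; exact add_mem hx hy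
  | smul a x _ hx => rw [smul_comm]; exact M'.smul_mem _ hx

/-- Each ℓ-adic coefficient is truncated modulo ℓ^k to a natural number, which shows that L is dense
in its completion. -/
theorem exists_approx {L : Submodule ℤ B} (k : ℕ) {x : Bloc B ℓ} (hx : x ∈ locLat ℓ L) :
    ∃ b ∈ L, ∃ y ∈ locLat ℓ L, x = toLoc ℓ b + (ℓ ^ k) • y := by
  rw [locLat] at hx
  induction hx using Submodule.span_induction with
  | mem x hx =>
    obtain ⟨b, hb, rfl⟩ := hx
    exact ⟨b, hb, 0, zero_mem _, by simp [toLoc_apply]⟩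
  | zero => exact ⟨0, zero_mem _, 0, zero_mem _, by simp⟩
  | add x x' _ _ hx hx' =>
    obtain ⟨b, hb, y, hy, rfl⟩ := hx
    obtain ⟨b', hb', y', hy', rfl⟩ := hx'
    exact ⟨b + b', add_mem hb hb', y + y', add_mem hy hy', by rw [map_add, nsmul_add]; abel⟩
  | smul a x _ hx =>
    obtain ⟨b, hb, y, hy, rfl⟩ := hx
    obtain ⟨c, hc⟩ := Ideal.mem_span_singleton.1 (PadicInt.appr_spec k a)
    refine ⟨(a.appr k) • b, nsmul_mem hb _, c • toLoc ℓ b + a • y,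
      add_mem (Submodule.smul_mem _ _ (toLoc_mem_locLat hb)) (Submodule.smul_mem _ _ hy), ?_⟩
    have h1 : a = (a.appr k : ℤ_[ℓ]) + ((ℓ ^ k : ℕ) : ℤ_[ℓ]) * c := by
      push_cast; rw [← hc]; ring
    conv_lhs => rw [smul_add]; enter [1]; rw [h1]
    rw [add_smul, mul_smul, Nat.cast_smul_eq_nsmul, Nat.cast_smul_eq_nsmul, map_nsmul, nsmul_add,
      smul_comm a (ℓ ^ k)]
    abel

end

theorem rat_eq_int_of_padic_norm {q : ℚ} (h : ∀ (ℓ : ℕ) [Fact ℓ.Prime], ‖(q : ℚ_[ℓ])‖ ≤ 1) :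
    ∃ n : ℤ, (n : ℚ) = q := by
  refine ⟨q.num, Rat.coe_int_num_of_den_eq_one ?_⟩
  by_contra hd
  obtain ⟨ℓ, hℓ, hdvd⟩ := Nat.exists_prime_and_dvd hd
  have : Fact ℓ.Prime := ⟨hℓ⟩
  have h1 := h ℓ
  have hq0 : (q.den : ℚ_[ℓ]) ≠ 0 := by exact_mod_cast q.den_ne_zero
  have h2 : (q : ℚ_[ℓ]) * (q.den : ℚ_[ℓ]) = (q.num : ℚ_[ℓ]) := by
    exact_mod_cast congrArg (fun x : ℚ => (x : ℚ_[ℓ])) (Rat.mul_den_eq_num q)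
  have h3 : ‖(q.den : ℚ_[ℓ])‖ < 1 := by
    simpa using (Padic.norm_intCast_lt_one_iff (p := ℓ) (k := (q.den : ℤ))).2
        (by exact_mod_cast hdvd)
  have h4 : ‖(q.num : ℚ_[ℓ])‖ < 1 := by
    rw [← h2, norm_mul]
    nlinarith [norm_nonneg (q : ℚ_[ℓ]), norm_nonneg (q.den : ℚ_[ℓ])]
  have h5 := (Padic.norm_intCast_lt_one_iff (p := ℓ) (k := q.num)).1 h4
  have h6 := Nat.dvd_gcd (Int.natCast_dvd.1 h5) hdvd
  rw [Nat.Coprime.gcd_eq_one q.reduced] at h6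
  exact hℓ.one_lt.ne' (Nat.dvd_one.1 h6)

namespace IsLatticeIn

variable {L L' : Submodule ℤ B}

theorem isLattice (hL : IsLatticeIn L) : Submodule.IsLattice ℚ L := ⟨hL.1, hL.2⟩

theorem exists_basis (hL : IsLatticeIn L) :
    ∃ (n : ℕ) (e : Module.Basis (Fin n) ℚ B), L = Submodule.span ℤ (Set.range e) := by
  have := hL.isLattice
  let b := Module.finBasis ℤ L
  refine ⟨_, b.extendOfIsLattice ℚ, ?_⟩
  have : Set.range (b.extendOfIsLattice ℚ) = L.subtype '' Set.range b := by
    rw [← Set.range_comp]; congr 1; ext i; simp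
  rw [this, ← Submodule.map_span, b.span_eq, Submodule.map_top, Submodule.range_subtype]

theorem mem_of_forall_loc (hL : IsLatticeIn L) {b : B}
    (h : ∀ (ℓ : ℕ) [Fact ℓ.Prime], toLoc ℓ b ∈ locLat ℓ L) : b ∈ L := by
  obtain ⟨n, e, rfl⟩ := hL.exists_basis
  rw [Module.Basis.mem_span_iff_repr_mem]
  intro i
  obtain ⟨m, hm⟩ := rat_eq_int_of_padic_norm (q := e.repr b i) fun ℓ _ => by
    have h1 := h ℓ
    have h2 : toLoc ℓ '' Set.range e = Set.range (e.baseChange ℚ_[ℓ]) := by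
      rw [← Set.range_comp]; congr 1; ext i; simp [toLoc_apply]
    rw [locLat_span, h2, Module.Basis.mem_span_iff_repr_mem] at h1
    obtain ⟨c, hc⟩ := h1 i
    rw [toLoc_apply, Module.Basis.baseChange_repr_tmul] at hc
    have : ((e.repr b i : ℚ) : ℚ_[ℓ]) = (c : ℚ_[ℓ]) := by
      rw [← PadicInt.algebraMap_apply, hc, Algebra.smul_def, mul_one]; rfl
    rw [this]; exact c.2
  exact ⟨m, by simpa using hm⟩

theorem exists_nsmul_mem (hL : IsLatticeIn L) (x : B) : ∃ k : ℕ, 0 < k ∧ k • x ∈ L := by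
  have hx : x ∈ Submodule.span ℚ (L : Set B) := by rw [hL.2]; trivial
  induction hx using Submodule.span_induction with
  | mem x hx => exact ⟨1, one_pos, by simpa using hx⟩
  | zero => exact ⟨1, one_pos, by simp⟩
  | add x y _ _ hx hy =>
    obtain ⟨k, hk0, hk⟩ := hx
    obtain ⟨l, hl0, hl⟩ := hy
    refine ⟨k * l, by positivity, ?_⟩
    rw [nsmul_add]
    refine add_mem ?_ ?_
    · rw [mul_comm, mul_smul]; exact nsmul_mem hk _
    · rw [mul_smul]; exact nsmul_mem hl _
  | smul a x _ hx =>
    obtain ⟨k, hk0, hk⟩ := hx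
    refine ⟨a.den * k, Nat.mul_pos a.den_pos hk0, ?_⟩
    have : (a.den * k) • a • x = a.num • (k • x) := by
      rw [← Nat.cast_smul_eq_nsmul ℚ, ← Nat.cast_smul_eq_nsmul ℚ, ← Int.cast_smul_eq_zsmul ℚ,
        smul_smul, smul_smul, ← Rat.mul_den_eq_num a]
      push_cast
      congr 1; ring
    rw [this]
    exact zsmul_mem hk _

theorem exists_nsmul_le (hL : L.FG) (hL' : IsLatticeIn L') :
    ∃ k : ℕ, 0 < k ∧ ∀ x ∈ L, k • x ∈ L' := by
  obtain ⟨S, rfl⟩ := hL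
  choose k hk0 hk using fun x : B => hL'.exists_nsmul_mem x
  refine ⟨S.prod k, Finset.prod_pos fun x _ => hk0 x, fun x hx => ?_⟩
  induction hx using Submodule.span_induction with
  | mem x hx =>
    obtain ⟨c, hc⟩ := Finset.dvd_prod_of_mem k hx
    rw [hc, mul_comm, mul_smul]
    exact nsmul_mem (hk x) _
  | zero => simp
  | add x y _ _ hx hy => rw [nsmul_add]; exact add_mem hx hy
  | smul a x _ hx => rw [smul_comm]; exact L'.smul_mem _ hx

theorem of_nsmul_le {L₀ : Submodule ℤ B} (hL₀ : IsLatticeIn L₀) {k m : ℕ} (hk : 0 < k)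
    (hm : 0 < m) (h1 : ∀ x ∈ L, k • x ∈ L₀) (h2 : ∀ x ∈ L₀, m • x ∈ L) : IsLatticeIn L := by
  constructor
  · have : IsNoetherian ℤ L₀ := by
      have : Module.Finite ℤ L₀ := Module.Finite.iff_fg.2 hL₀.1
      infer_instance
    let f : L →ₗ[ℤ] L₀ :=
      { toFun := fun x => ⟨k • (x : B), h1 x x.2⟩
        map_add' := by intro x y; ext; simp
        map_smul' := by
          intro c x; ext
          simp only [Submodule.coe_smul, RingHom.id_apply]
          exact smul_comm _ _ _ }
    have hf : Function.Injective f := by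
      intro x y hxy
      have h : k • (x : B) = k • (y : B) := congrArg Subtype.val hxy
      rw [← Nat.cast_smul_eq_nsmul ℚ, ← Nat.cast_smul_eq_nsmul ℚ] at h
      have hk' : (k : ℚ) ≠ 0 := by positivity
      exact Subtype.ext (smul_right_injective B hk' h)
    have : IsNoetherian ℤ L := isNoetherian_of_injective f hf
    exact Module.Finite.iff_fg.1 inferInstance
  · rw [eq_top_iff, ← hL₀.2, Submodule.span_le]
    intro x hx
    have hm' : (m : ℚ) ≠ 0 := by positivity
    have : x = (m : ℚ)⁻¹ • (m • x) := by
      rw [← Nat.cast_smul_eq_nsmul ℚ, smul_smul, inv_mul_cancel₀ hm', one_smul]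
    rw [this]
    exact Submodule.smul_mem _ _ (Submodule.subset_span (h2 x hx))

theorem isLattice_locLat (hL : IsLatticeIn L) (ℓ : ℕ) [Fact ℓ.Prime] :
    Submodule.IsLattice ℚ_[ℓ] (locLat ℓ L) := by
  constructor
  · obtain ⟨⟨S, rfl⟩, -⟩ := hL
    rw [locLat_span]
    exact Submodule.fg_span (S.finite_toSet.image _)
  · rw [eq_top_iff]
    intro x _
    induction x using TensorProduct.induction_on with
    | zero => exact zero_mem _
    | add x y hx hy => exact add_mem (hx trivial) (hy trivial)
    | tmul a b =>
      obtain ⟨k, hk0, hk⟩ := hL.exists_nsmul_mem b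
      have hk' : (k : ℚ_[ℓ]) ≠ 0 := by exact_mod_cast hk0.ne'
      have : a ⊗ₜ[ℚ] b = (a * (k : ℚ_[ℓ])⁻¹) • toLoc ℓ (k • b) := by
        rw [map_nsmul, ← Nat.cast_smul_eq_nsmul ℚ_[ℓ], smul_smul, mul_assoc,
          inv_mul_cancel₀ hk', toLoc_apply, TensorProduct.smul_tmul']
        simp
      rw [this]
      exact Submodule.smul_mem _ _ (Submodule.subset_span (toLoc_mem_locLat hk))

theorem le_of_forall_loc (hL' : IsLatticeIn L')
    (h : ∀ (ℓ : ℕ) [Fact ℓ.Prime], locLat ℓ L ≤ locLat ℓ L') : L ≤ L' :=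
  fun _ hb => hL'.mem_of_forall_loc fun ℓ _ => h ℓ (toLoc_mem_locLat hb)

theorem finite_locLat_ne (hL : IsLatticeIn L) (hL' : IsLatticeIn L') :
    {ℓ : Nat.Primes | locLat (ℓ : ℕ) L ≠ locLat (ℓ : ℕ) L'}.Finite := by
  have key : ∀ {L L' : Submodule ℤ B}, IsLatticeIn L → IsLatticeIn L' →
      {ℓ : Nat.Primes | ¬ locLat (ℓ : ℕ) L ≤ locLat (ℓ : ℕ) L'}.Finite := by
    intro L L' hL hL'
    obtain ⟨k, hk0, hk⟩ := exists_nsmul_le hL.1 hL'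
    refine Set.Finite.subset (s := {ℓ : Nat.Primes | (ℓ : ℕ) ∣ k}) ?_ ?_
    · exact Set.Finite.of_finite_image (f := ((↑) : Nat.Primes → ℕ))
        ((Set.finite_Iic k).subset (by
          rintro _ ⟨ℓ, hℓ, rfl⟩; exact Nat.le_of_dvd hk0 hℓ)) Nat.Primes.coe_nat_injective.injOn
    · intro ℓ hℓ
      by_contra hdvd
      refine hℓ (locLat_le_iff.2 fun b hb => ?_)
      refine mem_of_nsmul_mem (N := k)
        ((Nat.Prime.coprime_iff_not_dvd ℓ.2).2 hdvd).symm ?_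
      rw [← map_nsmul]
      exact toLoc_mem_locLat (hk b hb)
  refine ((key hL hL').union (key hL' hL)).subset fun ℓ hℓ => ?_
  by_contra hcon
  simp only [Set.mem_union, Set.mem_ofPred_eq, not_or, not_not] at hcon
  exact hℓ (le_antisymm hcon.1 hcon.2)

end IsLatticeIn

section Dictionary

variable {L₀ : Submodule ℤ B} {M M' : ∀ ℓ : Nat.Primes, Submodule ℤ_[(ℓ : ℕ)] (Bloc B (ℓ : ℕ))}

/-- N is a product of prime powers over the finitely many primes outside T at which the two families
differ. -/
theorem exists_coprime_nsmul_le (hM : ∀ ℓ : Nat.Primes, Submodule.IsLattice ℚ_[(ℓ : ℕ)] (M ℓ))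
    (hM' : ∀ ℓ : Nat.Primes, Submodule.IsLattice ℚ_[(ℓ : ℕ)] (M' ℓ))
    (hfin : {ℓ : Nat.Primes | M ℓ ≠ M' ℓ}.Finite)
    (T : Finset Nat.Primes) :
    ∃ N : ℕ, 0 < N ∧ (∀ ℓ ∈ T, N.Coprime (ℓ : ℕ)) ∧
      ∀ ℓ ∉ T, ∀ x ∈ M ℓ, N • x ∈ M' ℓ := by
  classical
  have hk : ∀ ℓ : Nat.Primes, ∃ k : ℕ, ∀ x ∈ M ℓ, ((ℓ : ℕ) ^ k) • x ∈ M' ℓ := fun ℓ =>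
    exists_pow_nsmul_le (hM ℓ).fg (hM' ℓ).span_eq_top
  choose k hk using hk
  let S := hfin.toFinset \ T
  refine ⟨∏ ℓ ∈ S, (ℓ : ℕ) ^ k ℓ, Finset.prod_pos fun ℓ _ => pow_pos ℓ.2.pos _, ?_, ?_⟩
  · intro ℓ hℓ
    refine Nat.Coprime.prod_left fun ℓ' hℓ' => Nat.Coprime.pow_left _ ?_
    rw [Nat.coprime_primes ℓ'.2 ℓ.2]
    intro h
    have : ℓ' = ℓ := Subtype.ext h
    subst this
    simp [S] at hℓ'
    exact hℓ'.2 hℓ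
  · intro ℓ hℓ x hx
    by_cases h : M ℓ = M' ℓ
    · rw [← h]; exact nsmul_mem hx _
    · have hS : ℓ ∈ S := by simp [S, h, hℓ]
      rw [← Finset.prod_erase_mul _ _ hS, mul_smul]
      exact nsmul_mem (hk ℓ x hx) _

theorem isLatticeIn_globalLat (hL₀ : IsLatticeIn L₀)
    (hM : ∀ ℓ : Nat.Primes, Submodule.IsLattice ℚ_[(ℓ : ℕ)] (M ℓ))
    (hfin : {ℓ : Nat.Primes | M ℓ ≠ locLat (ℓ : ℕ) L₀}.Finite) : IsLatticeIn (globalLat M) := by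
  have h0 := fun ℓ : Nat.Primes => hL₀.isLattice_locLat (ℓ : ℕ)
  obtain ⟨k, hk0, -, hk⟩ := exists_coprime_nsmul_le hM h0 hfin ∅
  obtain ⟨m, hm0, -, hm⟩ := exists_coprime_nsmul_le h0 hM (by simpa only [ne_comm] using hfin) ∅
  refine hL₀.of_nsmul_le hk0 hm0 (fun x hx => hL₀.mem_of_forall_loc fun ℓ _ => ?_)
    fun x hx ℓ => ?_
  · rw [map_nsmul]
    exact hk ⟨ℓ, Fact.out⟩ (Finset.notMem_empty _) _ (hx ⟨ℓ, Fact.out⟩)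
  · have := hm ℓ (by simp) _ (toLoc_mem_locLat hx)
    rwa [← map_nsmul] at this

/-- Approximation: an element of M_ℓ is close to some b in B that is integral for L₀ away from ℓ. A
multiplier N prime to ℓ carries L₀ into M at all other primes, so N b is global, and N is invertible
at ℓ. -/
theorem locLat_globalLat (hL₀ : IsLatticeIn L₀)
    (hM : ∀ ℓ : Nat.Primes, Submodule.IsLattice ℚ_[(ℓ : ℕ)] (M ℓ))
    (hfin : {ℓ : Nat.Primes | M ℓ ≠ locLat (ℓ : ℕ) L₀}.Finite) (ℓ : Nat.Primes) :
    locLat (ℓ : ℕ) (globalLat M) = M ℓ := by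
  have h0 := fun ℓ : Nat.Primes => hL₀.isLattice_locLat (ℓ : ℕ)
  refine le_antisymm (locLat_le_iff.2 fun b (hb : b ∈ globalLat M) => hb ℓ) ?_
  intro x hx
  obtain ⟨N, hN0, hNc, hN⟩ := exists_coprime_nsmul_le h0 hM (by simpa only [ne_comm] using hfin) {ℓ}
  obtain ⟨a, ha⟩ := exists_pow_nsmul_le (hM ℓ).fg (h0 ℓ).span_eq_top
  obtain ⟨c, hc⟩ := exists_pow_nsmul_le (h0 ℓ).fg (hM ℓ).span_eq_top
  have hNℓ : N.Coprime (ℓ : ℕ) := hNc ℓ (by simp)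
  have hℓ0 : ((ℓ : ℕ) : ℚ) ≠ 0 := by exact_mod_cast ℓ.2.ne_zero
  have hN0' : (N : ℚ) ≠ 0 := by exact_mod_cast hN0.ne'
  have hglob : ∀ b : B, (∃ n : ℕ, ((ℓ : ℕ) ^ n) • b ∈ L₀) → toLoc (ℓ : ℕ) (N • b) ∈ M ℓ →
      N • b ∈ globalLat M := by
    intro b ⟨n, hn⟩ h1 ℓ'
    by_cases h : ℓ' = ℓ
    · subst h; exact h1
    · have hb : toLoc (ℓ' : ℕ) b ∈ locLat (ℓ' : ℕ) L₀ := by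
        refine mem_of_nsmul_mem (N := (ℓ : ℕ) ^ n) (Nat.Coprime.pow_left _ ?_) ?_
        · rw [Nat.coprime_primes ℓ.2 ℓ'.2]
          exact fun h' => h (Subtype.ext h'.symm)
        · rw [← map_nsmul]; exact toLoc_mem_locLat hn
      have := hN ℓ' (by simpa using h) _ hb
      rwa [← map_nsmul] at this
  have hsub : ∀ y ∈ locLat (ℓ : ℕ) L₀, ((ℓ : ℕ) ^ c) • y ∈ locLat (ℓ : ℕ) (globalLat M) := by
    intro y hy
    have hle : locLat (ℓ : ℕ) L₀ ≤
        (locLat (ℓ : ℕ) (globalLat M)).comap (LinearMap.lsmul ℤ_[(ℓ : ℕ)] _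
          (((ℓ : ℕ) ^ c : ℕ) : ℤ_[(ℓ : ℕ)])) := by
      rw [locLat_le_iff]
      intro b hb
      rw [Submodule.mem_comap, LinearMap.lsmul_apply, Nat.cast_smul_eq_nsmul]
      refine mem_of_nsmul_mem hNℓ ?_
      rw [← map_nsmul, ← map_nsmul]
      refine toLoc_mem_locLat (hglob _ ⟨0, by rw [pow_zero, one_smul]; exact nsmul_mem hb _⟩ ?_)
      rw [map_nsmul, map_nsmul]
      exact nsmul_mem (hc _ (toLoc_mem_locLat hb)) _
    have := hle hy
    rwa [Submodule.mem_comap, LinearMap.lsmul_apply, Nat.cast_smul_eq_nsmul] at this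
  refine mem_of_nsmul_mem hNℓ ?_
  obtain ⟨b, hb, y, hy, hxy⟩ := exists_approx (a + c) (ha x hx)
  have hx' : x = toLoc (ℓ : ℕ) ((((ℓ : ℕ) : ℚ) ^ a)⁻¹ • b) + ((ℓ : ℕ) ^ c) • y := by
    have hinj : Function.Injective (fun z : Bloc B (ℓ : ℕ) => ((ℓ : ℕ) ^ a) • z) := by
      intro z z' hz
      have h : (((ℓ : ℕ) ^ a : ℕ) : ℚ_[(ℓ : ℕ)]) • z = (((ℓ : ℕ) ^ a : ℕ) : ℚ_[(ℓ : ℕ)]) • z' := by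
        simpa only [Nat.cast_smul_eq_nsmul] using hz
      refine smul_right_injective _ ?_ h
      exact_mod_cast pow_ne_zero _ ℓ.2.ne_zero
    apply hinj
    simp only [nsmul_add]
    rw [hxy, ← map_nsmul, ← Nat.cast_smul_eq_nsmul ℚ (_ ^ a), smul_smul, pow_add, mul_smul]
    push_cast
    rw [mul_inv_cancel₀ (pow_ne_zero _ hℓ0), one_smul]
  have hy' := hsub y hy
  rw [hx', nsmul_add]
  refine add_mem ?_ (nsmul_mem hy' _)
  rw [← map_nsmul]
  refine toLoc_mem_locLat (hglob _ ⟨a, ?_⟩ ?_)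
  · rw [← Nat.cast_smul_eq_nsmul ℚ, smul_smul]
    push_cast
    rwa [mul_inv_cancel₀ (pow_ne_zero _ hℓ0), one_smul]
  · rw [map_nsmul]
    refine nsmul_mem ?_ _
    have : toLoc (ℓ : ℕ) ((((ℓ : ℕ) : ℚ) ^ a)⁻¹ • b) = x - ((ℓ : ℕ) ^ c) • y := by
      rw [hx']; abel
    rw [this]
    exact sub_mem hx (hc y hy)

theorem globalLat_locLat {L : Submodule ℤ B} (hL : IsLatticeIn L) :
    globalLat (fun ℓ => locLat (ℓ : ℕ) L) = L := by
  apply le_antisymm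
  · intro b hb
    exact hL.mem_of_forall_loc fun ℓ _ => hb ⟨ℓ, Fact.out⟩
  · intro b hb ℓ
    exact toLoc_mem_locLat hb

end Dictionary

section Products

variable {ℓ : ℕ} [Fact ℓ.Prime]

theorem locLat_mul (L M : Submodule ℤ B) : locLat ℓ (L * M) = locLat ℓ L * locLat ℓ M := by
  apply le_antisymm
  · rw [locLat_le_iff]
    intro b hb
    induction hb using Submodule.mul_induction_on' with
    | mem_mul_mem x hx y hy =>
      rw [map_mul]; exact Submodule.mul_mem_mul (toLoc_mem_locLat hx) (toLoc_mem_locLat hy)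
    | add x _ y _ hx hy => rw [map_add]; exact add_mem hx hy
  · rw [locLat, locLat, Submodule.span_mul_span, Submodule.span_le]
    rintro _ ⟨_, ⟨x, hx, rfl⟩, _, ⟨y, hy, rfl⟩, rfl⟩
    have := toLoc_mem_locLat (ℓ := ℓ) (Submodule.mul_mem_mul hx hy)
    rwa [map_mul] at this

theorem IsLatticeIn.mul {L M : Submodule ℤ B} (hL : IsLatticeIn L) (hM : IsLatticeIn M) :
    IsLatticeIn (L * M) := by
  refine ⟨hL.1.mul hM.1, ?_⟩
  obtain ⟨k, hk0, hk⟩ := hM.exists_nsmul_mem 1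
  rw [eq_top_iff, ← hL.2, Submodule.span_le]
  intro x hx
  have hm' : (k : ℚ) ≠ 0 := by positivity
  have : x = (k : ℚ)⁻¹ • (x * k • (1 : B)) := by
    rw [mul_smul_comm, mul_one, ← Nat.cast_smul_eq_nsmul ℚ, smul_smul, inv_mul_cancel₀ hm',
        one_smul]
  rw [this]
  exact Submodule.smul_mem _ _ (Submodule.subset_span (Submodule.mul_mem_mul hx hk))

end Products

end LocalGlobal

/-! ### Quaternion division algebras over ℚ_p: valuation ring and residue field. -/

section LocalDivision

/-- A quaternion division algebra over `ℚ_p`. -/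
structure QuatDiv (p : ℕ) [Fact p.Prime] (D : Type*) [Ring D] [Algebra ℚ_[p] D] : Prop where
  quat : QuatLike ℚ_[p] D
  isUnit : ∀ x : D, x ≠ 0 → IsUnit x

variable {p : ℕ} [Fact p.Prime]

theorem Padic.norm_le_inv_of_lt_one {c : ℚ_[p]} (h : ‖c‖ < 1) : ‖c‖ ≤ (p : ℝ)⁻¹ := by
  have := (Padic.norm_le_pow_iff_norm_lt_pow_add_one c (-1)).2 (by simpa using h)
  simpa using this

/-- A `p`-adic number of norm at most one, as a `p`-adic integer. -/
def Padic.toInt (c : ℚ_[p]) (h : ‖c‖ ≤ 1) : ℤ_[p] := ⟨c, h⟩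

theorem Padic.coe_toInt (c : ℚ_[p]) (h : ‖c‖ ≤ 1) : (Padic.toInt c h : ℚ_[p]) = c := rfl

theorem Padic.toZMod_toInt_eq_zero_iff (c : ℚ_[p]) (h : ‖c‖ ≤ 1) :
    PadicInt.toZMod (Padic.toInt c h) = 0 ↔ ‖c‖ < 1 := by
  rw [← RingHom.mem_ker, PadicInt.ker_toZMod, IsLocalRing.mem_maximalIdeal,
    PadicInt.mem_nonunits, PadicInt.norm_def, Padic.coe_toInt]

theorem Padic.exists_natCast_near {c : ℚ_[p]} (h : ‖c‖ ≤ 1) : ∃ n : ℕ, ‖c - n‖ < 1 := by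
  obtain ⟨d, hd⟩ := Ideal.mem_span_singleton.1 (PadicInt.appr_spec 1 (Padic.toInt c h))
  refine ⟨(Padic.toInt c h).appr 1, ?_⟩
  have h1 := congrArg (fun z : ℤ_[p] => (z : ℚ_[p])) hd
  simp only [pow_one] at h1
  push_cast at h1
  rw [Padic.coe_toInt] at h1
  rw [h1, norm_mul]
  calc _ ≤ ‖(p : ℚ_[p])‖ * 1 := by gcongr; exact d.2
    _ < 1 := by rw [mul_one]; exact Padic.norm_p_lt_one

/-- Modulo p the polynomial is X(X - 1), and the simple root 1 lifts by Hensel's lemma. -/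
theorem exists_root_of_norm_lt_one {c : ℚ_[p]} (hc : ‖c‖ < 1) : ∃ r : ℚ_[p], r ^ 2 - r + c = 0 := by
  let c' : ℤ_[p] := Padic.toInt c hc.le
  let F : Polynomial ℤ_[p] := Polynomial.X ^ 2 - Polynomial.X + Polynomial.C c'
  have h1 : (Polynomial.aeval (1 : ℤ_[p])) F = c' := by simp [F]
  have h2 : (Polynomial.aeval (1 : ℤ_[p])) (Polynomial.derivative F) = 1 := by
    simp [F]
    try norm_num
  obtain ⟨z, hz, -⟩ := hensels_lemma (F := F) (a := (1 : ℤ_[p])) (by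
    rw [h1, h2, PadicInt.norm_def, Padic.coe_toInt]; simpa using hc)
  refine ⟨z, ?_⟩
  have h3 : z ^ 2 - z + c' = 0 := by simpa [F] using hz
  exact_mod_cast congrArg (fun z : ℤ_[p] => (z : ℚ_[p])) h3

variable {D : Type*} [Ring D] [Algebra ℚ_[p] D]

namespace QuatDiv

theorem mul_eq_zero (h : QuatDiv p D) {x y : D} (hxy : x * y = 0) : x = 0 ∨ y = 0 := by
  by_cases hx : x = 0
  · exact Or.inl hx
  · exact Or.inr (((h.isUnit x hx).mul_right_eq_zero).1 hxy)

theorem nrd_ne_zero (h : QuatDiv p D) {x : D} (hx : x ≠ 0) : nrdF ℚ_[p] x ≠ 0 :=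
  h.quat.nrd_ne_zero_of_isUnit (h.isUnit x hx)

/-- If the trace t were not integral, x/t would satisfy X² - X + n/t² with small constant term. This
polynomial splits by Hensel, so the absence of zero divisors makes x a scalar. A scalar of integral
norm has integral trace. -/
theorem norm_trd_le_one (h : QuatDiv p D) {x : D} (hx : ‖nrdF ℚ_[p] x‖ ≤ 1) :
    ‖trdF ℚ_[p] x‖ ≤ 1 := by
  by_contra! ht
  set t := trdF ℚ_[p] x with ht_def
  set n := nrdF ℚ_[p] x with hn_def
  have ht0 : t ≠ 0 := by rintro h0; rw [h0, norm_zero] at ht; linarith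
  have hc : ‖n / t ^ 2‖ < 1 := by
    rw [norm_div, norm_pow, div_lt_one (by positivity)]
    nlinarith
  obtain ⟨r, hr⟩ := exists_root_of_norm_lt_one hc
  have hr' : (r * t) * ((1 - r) * t) = n := by
    field_simp at hr
    linear_combination -hr
  have hprod : (x - algebraMap ℚ_[p] D (r * t)) * (x - algebraMap ℚ_[p] D ((1 - r) * t)) = 0 := by
    have h1 := h.quat.mul_self x
    rw [← ht_def, ← hn_def, ← hr', Algebra.smul_def] at h1
    have h2 : t = r * t + (1 - r) * t := by ring
    rw [sub_mul, mul_sub, mul_sub, h1, ← map_mul]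
    conv_lhs => enter [1, 1, 1, 1, 2]; rw [h2]
    rw [map_add, add_mul, ← Algebra.commutes (_ * t) x, ]
    abel
  have key : ∀ s : ℚ_[p], x - algebraMap ℚ_[p] D s = 0 → False := by
    intro s hs
    rw [sub_eq_zero] at hs
    have hn : n = s ^ 2 := by rw [hn_def, hs, h.quat.nrd_algebraMap]
    have ht' : t = 2 * s := by rw [ht_def, hs, trdF_algebraMap h.quat.finrank]
    rw [hn, norm_pow] at hx
    have hs1 : ‖s‖ ≤ 1 := by
      by_contra! h'
      nlinarith
    have h2 : ‖(2 : ℚ_[p])‖ ≤ 1 := by exact_mod_cast Padic.norm_int_le_one (p := p) 2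
    rw [ht', norm_mul] at ht
    nlinarith [norm_nonneg s, norm_nonneg (2 : ℚ_[p])]
  rcases h.mul_eq_zero hprod with h0 | h0
  · exact key _ h0
  · exact key _ h0

/-- After division by the summand of larger norm this becomes a bound for N(1 + z) = 1 + tr z + N z,
where the trace is already controlled. -/
theorem norm_nrd_add_le (h : QuatDiv p D) (x y : D) :
    ‖nrdF ℚ_[p] (x + y)‖ ≤ max ‖nrdF ℚ_[p] x‖ ‖nrdF ℚ_[p] y‖ := by
  have key : ∀ x y : D, ‖nrdF ℚ_[p] x‖ ≤ ‖nrdF ℚ_[p] y‖ →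
      ‖nrdF ℚ_[p] (x + y)‖ ≤ ‖nrdF ℚ_[p] y‖ := by
    intro x y hxy
    by_cases hy : y = 0
    · subst hy
      rw [h.quat.nrd_zero, norm_zero] at hxy ⊢
      simpa using hxy
    · obtain ⟨u, rfl⟩ := h.isUnit y hy
      have hu := h.nrd_ne_zero hy
      have h1 : x + u = (1 + x * ↑u⁻¹) * u := by simp [add_mul, add_comm]
      have h2 : ‖nrdF ℚ_[p] (x * (↑u⁻¹ : D))‖ ≤ 1 := by
        rw [h.quat.nrd_mul, h.quat.nrd_inv, norm_mul, norm_inv]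
        rw [← div_eq_mul_inv, div_le_one (by positivity)]
        exact hxy
      rw [h1, h.quat.nrd_mul, norm_mul, h.quat.nrd_one_add]
      have h3 : ‖1 + trdF ℚ_[p] (x * (↑u⁻¹ : D)) + nrdF ℚ_[p] (x * (↑u⁻¹ : D))‖ ≤ 1 := by
        refine (Padic.nonarchimedean _ _).trans (max_le ?_ h2)
        refine (Padic.nonarchimedean _ _).trans (max_le (by simp) (h.norm_trd_le_one h2))
      exact mul_le_of_le_one_left (norm_nonneg _) h3
  rcases le_total ‖nrdF ℚ_[p] x‖ ‖nrdF ℚ_[p] y‖ with hle | hle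
  · exact (key x y hle).trans (le_max_right _ _)
  · rw [add_comm]; exact (key y x hle).trans (le_max_left _ _)

theorem norm_nrd_sub_le (h : QuatDiv p D) (x y : D) :
    ‖nrdF ℚ_[p] (x - y)‖ ≤ max ‖nrdF ℚ_[p] x‖ ‖nrdF ℚ_[p] y‖ := by
  have := h.norm_nrd_add_le x (-y)
  rwa [h.quat.nrd_neg, ← sub_eq_add_neg] at this

/-- With a trace t of norm 1, the identity t x = x² + N(x) and the ultrametric inequality give |N x|
≤ |N x|², which forces x = 0. -/
theorem norm_trd_lt_one (h : QuatDiv p D) {x : D} (hx : ‖nrdF ℚ_[p] x‖ < 1) :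
    ‖trdF ℚ_[p] x‖ < 1 := by
  refine lt_of_le_of_ne (h.norm_trd_le_one hx.le) fun h1 => ?_
  have h2 : trdF ℚ_[p] x • x = x * x + algebraMap ℚ_[p] D (nrdF ℚ_[p] x) := by
    rw [h.quat.mul_self]; abel
  have h3 := h.norm_nrd_add_le (x * x) (algebraMap ℚ_[p] D (nrdF ℚ_[p] x))
  rw [← h2, h.quat.nrd_smul, h.quat.nrd_mul, h.quat.nrd_algebraMap, norm_mul, norm_pow, h1,
    norm_mul, norm_pow, ← sq, max_self, one_pow, one_mul] at h3
  have h4 : ‖nrdF ℚ_[p] x‖ = 0 := by nlinarith [norm_nonneg (nrdF ℚ_[p] x)]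
  have h5 : x = 0 := by
    by_contra h0
    exact h.nrd_ne_zero h0 (by simpa using h4)
  rw [h5, ← trdL_apply, map_zero, norm_zero] at h1
  exact zero_ne_one h1

/-- The valuation ring. -/
def valRing (h : QuatDiv p D) : Subring D where
  carrier := {x | ‖nrdF ℚ_[p] x‖ ≤ 1}
  mul_mem' := by
    intro x y (hx : ‖nrdF ℚ_[p] x‖ ≤ 1) (hy : ‖nrdF ℚ_[p] y‖ ≤ 1)
    change ‖nrdF ℚ_[p] (x * y)‖ ≤ 1
    rw [h.quat.nrd_mul, norm_mul]
    exact mul_le_one₀ hx (norm_nonneg _) hy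
  one_mem' := by change ‖nrdF ℚ_[p] (1 : D)‖ ≤ 1; rw [h.quat.nrd_one, norm_one]
  add_mem' := by
    intro x y (hx : ‖nrdF ℚ_[p] x‖ ≤ 1) (hy : ‖nrdF ℚ_[p] y‖ ≤ 1)
    exact (h.norm_nrd_add_le x y).trans (max_le hx hy)
  zero_mem' := by
    change ‖nrdF ℚ_[p] (0 : D)‖ ≤ 1
    rw [h.quat.nrd_zero, norm_zero]
    exact zero_le_one
  neg_mem' := by
    intro x (hx : ‖nrdF ℚ_[p] x‖ ≤ 1)
    change ‖nrdF ℚ_[p] (-x)‖ ≤ 1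
    rwa [h.quat.nrd_neg]

theorem mem_valRing (h : QuatDiv p D) {x : D} : x ∈ h.valRing ↔ ‖nrdF ℚ_[p] x‖ ≤ 1 := Iff.rfl

/-- The maximal ideal of the valuation ring. -/
def maxIdeal (h : QuatDiv p D) : Ideal h.valRing where
  carrier := {x | ‖nrdF ℚ_[p] (x : D)‖ < 1}
  add_mem' := by
    intro x y (hx : ‖nrdF ℚ_[p] (x : D)‖ < 1) (hy : ‖nrdF ℚ_[p] (y : D)‖ < 1)
    exact (h.norm_nrd_add_le x y).trans_lt (max_lt hx hy)
  zero_mem' := by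
    change ‖nrdF ℚ_[p] (0 : D)‖ < 1
    rw [h.quat.nrd_zero, norm_zero]; exact zero_lt_one
  smul_mem' := by
    intro c x (hx : ‖nrdF ℚ_[p] (x : D)‖ < 1)
    change ‖nrdF ℚ_[p] ((c : D) * (x : D))‖ < 1
    rw [h.quat.nrd_mul, norm_mul]
    exact mul_lt_one_of_nonneg_of_lt_one_right c.2 (norm_nonneg _) hx

instance isTwoSided_maxIdeal (h : QuatDiv p D) : h.maxIdeal.IsTwoSided where
  mul_mem_of_left := by
    intro a b (ha : ‖nrdF ℚ_[p] (a : D)‖ < 1)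
    change ‖nrdF ℚ_[p] ((a : D) * (b : D))‖ < 1
    rw [h.quat.nrd_mul, norm_mul]
    exact mul_lt_one_of_nonneg_of_lt_one_left (norm_nonneg _) ha b.2

/-- Multiplication by ϖ carries the valuation ring onto its maximal ideal, and the maximal ideal
onto p times the ring. The latter has index p⁴ by the integral basis, so the index in question has
square p⁴. -/
theorem index_maxIdeal (h : QuatDiv p D) {ϖ : D} (hϖ : ‖nrdF ℚ_[p] ϖ‖ = (p : ℝ)⁻¹)
    (e : Module.Basis (Fin 4) ℚ_[p] D)
    (he : ∀ x, ‖nrdF ℚ_[p] x‖ ≤ 1 ↔ ∀ i, ‖e.repr x i‖ ≤ 1) :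
    h.maxIdeal.toAddSubgroup.index = p ^ 2 := by
  have hp0 : (0 : ℝ) < p := by exact_mod_cast (Fact.out : p.Prime).pos
  have hp1 : (1 : ℝ) < p := by exact_mod_cast (Fact.out : p.Prime).one_lt
  have hϖ0 : ϖ ≠ 0 := by
    rintro rfl
    rw [h.quat.nrd_zero, norm_zero] at hϖ
    exact (inv_pos.2 hp0).ne hϖ
  obtain ⟨u, hu⟩ := h.isUnit ϖ hϖ0
  have hϖ1 : ϖ ∈ h.valRing := by
    rw [mem_valRing, hϖ]; exact inv_le_one_of_one_le₀ hp1.le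
  let f : h.valRing →+ h.valRing := AddMonoidHom.mulLeft (⟨ϖ, hϖ1⟩ : h.valRing)
  have hf : ∀ x, ((f x : h.valRing) : D) = ϖ * x := fun x => rfl
  have hfN : ∀ x, ‖nrdF ℚ_[p] ((f x : h.valRing) : D)‖ = (p : ℝ)⁻¹ * ‖nrdF ℚ_[p] (x : D)‖ := by
    intro x; rw [hf, h.quat.nrd_mul, norm_mul, hϖ]
  have hker : f.ker = ⊥ := by
    rw [AddMonoidHom.ker_eq_bot_iff]
    intro x y hxy
    have := congrArg (fun z : h.valRing => (z : D)) hxy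
    simp only [hf, ← hu] at this
    exact Subtype.ext (u.isUnit.mul_left_cancel this)
  have hdiv : ∀ y : h.valRing, ‖nrdF ℚ_[p] (y : D)‖ ≤ (p : ℝ)⁻¹ →
      ∃ x : h.valRing, f x = y ∧ ‖nrdF ℚ_[p] (x : D)‖ = p * ‖nrdF ℚ_[p] (y : D)‖ := by
    intro y hy
    have hN : ‖nrdF ℚ_[p] ((↑u⁻¹ : D) * (y : D))‖ = p * ‖nrdF ℚ_[p] (y : D)‖ := by
      rw [h.quat.nrd_mul, h.quat.nrd_inv, hu, norm_mul, norm_inv, hϖ, inv_inv]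
    refine ⟨⟨(↑u⁻¹ : D) * (y : D), ?_⟩, ?_, hN⟩
    · rw [mem_valRing, hN]
      calc (p : ℝ) * _ ≤ p * (p : ℝ)⁻¹ := by gcongr
        _ = 1 := mul_inv_cancel₀ hp0.ne'
    · ext; rw [hf, ← hu]; simp
  have hrange : f.range = h.maxIdeal.toAddSubgroup := by
    ext y
    constructor
    · rintro ⟨x, rfl⟩
      change ‖nrdF ℚ_[p] ((f x : h.valRing) : D)‖ < 1
      rw [hfN]
      calc (p : ℝ)⁻¹ * _ ≤ (p : ℝ)⁻¹ * 1 := by gcongr; exact x.2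
        _ < 1 := by rw [mul_one]; exact inv_lt_one_of_one_lt₀ hp1
    · intro (hy : ‖nrdF ℚ_[p] (y : D)‖ < 1)
      obtain ⟨x, hx, -⟩ := hdiv y (Padic.norm_le_inv_of_lt_one hy)
      exact ⟨x, hx⟩
  have hz : ∀ x : h.valRing, ∀ i, ‖e.repr (x : D) i‖ ≤ 1 := fun x => (he x).1 x.2
  let g : h.valRing →+ (Fin 4 → ZMod p) :=
    AddMonoidHom.mk' (fun x i => PadicInt.toZMod (Padic.toInt _ (hz x i))) (by
      intro x y; ext i
      rw [Pi.add_apply, ← RingHom.map_add]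
      refine congrArg _ (Subtype.ext ?_)
      change e.repr ((x : D) + (y : D)) i = e.repr (x : D) i + e.repr (y : D) i
      simp)
  have hg : ∀ x i, g x i = PadicInt.toZMod (Padic.toInt _ (hz x i)) := fun _ _ => rfl
  have hpN : ∀ x : D, ‖nrdF ℚ_[p] ((p : ℚ_[p])⁻¹ • x)‖ = (p : ℝ) ^ 2 * ‖nrdF ℚ_[p] x‖ := by
    intro x
    rw [h.quat.nrd_smul, norm_mul, norm_pow, norm_inv, Padic.norm_p, inv_inv]
  -- The kernel of reduction of coordinates is p times the valuation ring, expressed through the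
  -- norm.
  have hgker : ∀ x : h.valRing, x ∈ g.ker ↔ ‖nrdF ℚ_[p] (x : D)‖ ≤ ((p : ℝ)⁻¹) ^ 2 := by
    intro x
    have h1 : x ∈ g.ker ↔ ∀ i, ‖e.repr (x : D) i‖ < 1 := by
      rw [AddMonoidHom.mem_ker, funext_iff]
      refine forall_congr' fun i => ?_
      rw [hg]
      exact Padic.toZMod_toInt_eq_zero_iff _ _
    rw [h1]
    have h2 : ‖nrdF ℚ_[p] (x : D)‖ ≤ ((p : ℝ)⁻¹) ^ 2 ↔
        ‖nrdF ℚ_[p] ((p : ℚ_[p])⁻¹ • (x : D))‖ ≤ 1 := by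
      rw [hpN, inv_pow, ← one_div, le_div_iff₀ (by positivity), mul_comm]
    rw [h2, he]
    refine forall_congr' fun i => ?_
    rw [map_smul, Finsupp.smul_apply, smul_eq_mul, norm_mul, norm_inv, Padic.norm_p, inv_inv]
    constructor
    · intro h3
      calc _ ≤ (p : ℝ) * (p : ℝ)⁻¹ := by gcongr; exact Padic.norm_le_inv_of_lt_one h3
        _ = 1 := mul_inv_cancel₀ hp0.ne'
    · intro h3
      by_contra! h4
      nlinarith
  have hgsurj : Function.Surjective g := by
    intro v
    choose w hw using fun i => ZMod.ringHom_surjective (PadicInt.toZMod (p := p)) (v i)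
    let x : D := e.equivFun.symm fun i => (w i : ℚ_[p])
    have hx : ∀ i, e.repr x i = w i := by
      intro i
      exact congrFun (e.equivFun.apply_symm_apply fun i => (w i : ℚ_[p])) i
    refine ⟨⟨x, (he x).2 fun i => by rw [hx]; exact (w i).2⟩, ?_⟩
    ext i
    rw [← hw, hg]
    exact congrArg _ (Subtype.ext (hx i))
  have hmap : h.maxIdeal.toAddSubgroup.map f = g.ker := by
    ext y
    rw [hgker]
    constructor
    · rintro ⟨x, hx, rfl⟩
      rw [hfN, sq]
      gcongr
      exact Padic.norm_le_inv_of_lt_one hx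
    · intro hy
      have hlt : ((p : ℝ)⁻¹) ^ 2 < (p : ℝ)⁻¹ := by
        rw [sq]
        exact mul_lt_of_lt_one_left (inv_pos.2 hp0) (inv_lt_one_of_one_lt₀ hp1)
      obtain ⟨x, hx, hxN⟩ := hdiv y (hy.trans hlt.le)
      refine ⟨x, ?_, hx⟩
      change ‖_‖ < _
      rw [hxN]
      calc (p : ℝ) * _ ≤ p * ((p : ℝ)⁻¹) ^ 2 := by gcongr
        _ = (p : ℝ)⁻¹ := by field_simp
        _ < 1 := inv_lt_one_of_one_lt₀ hp1
  have hidx := AddSubgroup.index_map h.maxIdeal.toAddSubgroup f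
  rw [hker, sup_bot_eq, hrange, hmap, AddSubgroup.index_ker, AddMonoidHom.range_eq_top.2 hgsurj]
    at hidx
  have hcard : Nat.card (⊤ : AddSubgroup (Fin 4 → ZMod p)) = p ^ 4 := by
    rw [AddSubgroup.card_top, Nat.card_fun]; simp
  rw [hcard] at hidx
  have : (p ^ 2) ^ 2 = h.maxIdeal.toAddSubgroup.index ^ 2 := by
    rw [sq h.maxIdeal.toAddSubgroup.index, ← hidx]; ring
  exact (Nat.pow_left_injective (n := 2) (by norm_num) this).symm

end QuatDiv

/-- A reduction map from the valuation ring of `D` onto a field, extended by junk to `D`. -/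
structure ResidueMap (p : ℕ) [Fact p.Prime] (D : Type*) [Ring D] [Algebra ℚ_[p] D]
    (κ : Type*) [Field κ] where
  res : D → κ
  map_add : ∀ x y, ‖nrdF ℚ_[p] x‖ ≤ 1 → ‖nrdF ℚ_[p] y‖ ≤ 1 → res (x + y) = res x + res y
  map_mul : ∀ x y, ‖nrdF ℚ_[p] x‖ ≤ 1 → ‖nrdF ℚ_[p] y‖ ≤ 1 → res (x * y) = res x * res y
  map_one : res 1 = 1
  surj : ∀ z, ∃ x, ‖nrdF ℚ_[p] x‖ ≤ 1 ∧ res x = z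
  eq_zero_iff : ∀ x, ‖nrdF ℚ_[p] x‖ ≤ 1 → (res x = 0 ↔ ‖nrdF ℚ_[p] x‖ < 1)

theorem QuatDiv.exists_residueMap {D : Type u} [Ring D] [Algebra ℚ_[p] D] (h : QuatDiv p D) {ϖ : D}
    (hϖ : ‖nrdF ℚ_[p] ϖ‖ = (p : ℝ)⁻¹) (e : Module.Basis (Fin 4) ℚ_[p] D)
    (he : ∀ x, ‖nrdF ℚ_[p] x‖ ≤ 1 ↔ ∀ i, ‖e.repr x i‖ ≤ 1) :
    ∃ (κ : Type u) (_ : Field κ) (_ : Fintype κ),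
      Fintype.card κ = p ^ 2 ∧ Nonempty (ResidueMap p D κ) := by
  classical
  have hcard : Nat.card (h.valRing ⧸ h.maxIdeal) = p ^ 2 := h.index_maxIdeal hϖ e he
  have hfin : Finite (h.valRing ⧸ h.maxIdeal) :=
    Nat.finite_of_card_ne_zero (by rw [hcard]; exact pow_ne_zero _ (Fact.out : p.Prime).ne_zero)
  have hnt : Nontrivial (h.valRing ⧸ h.maxIdeal) := by
    rw [← Finite.one_lt_card_iff_nontrivial, hcard]
    exact Nat.one_lt_pow two_ne_zero (Fact.out : p.Prime).one_lt
  have hzero : ∀ x : h.valRing, Ideal.Quotient.mk h.maxIdeal x = 0 ↔ ‖nrdF ℚ_[p] (x : D)‖ < 1 :=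
    fun x => Ideal.Quotient.eq_zero_iff_mem
  have hnzd : NoZeroDivisors (h.valRing ⧸ h.maxIdeal) := by
    constructor
    intro a b hab
    obtain ⟨x, rfl⟩ := Ideal.Quotient.mk_surjective a
    obtain ⟨y, rfl⟩ := Ideal.Quotient.mk_surjective b
    rw [← RingHom.map_mul, hzero, Subring.coe_mul, h.quat.nrd_mul, norm_mul] at hab
    rw [hzero, hzero]
    by_contra! hcon
    have := one_le_mul_of_one_le_of_one_le hcon.1 hcon.2
    linarith
  have hdom : IsDomain (h.valRing ⧸ h.maxIdeal) := NoZeroDivisors.to_isDomain _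
  -- Wedderburn's theorem: a finite domain is commutative.
  let _ : Field (h.valRing ⧸ h.maxIdeal) := (Finite.isDomain_to_isField _).toField
  let _ : Fintype (h.valRing ⧸ h.maxIdeal) := Fintype.ofFinite _
  refine ⟨h.valRing ⧸ h.maxIdeal, inferInstance, inferInstance, ?_, ⟨?_⟩⟩
  · rw [← Nat.card_eq_fintype_card, hcard]
  · have hres : ∀ (x : D) (hx : ‖nrdF ℚ_[p] x‖ ≤ 1), (if hx : ‖nrdF ℚ_[p] x‖ ≤ 1 then
        Ideal.Quotient.mk h.maxIdeal ⟨x, hx⟩ else 0) = Ideal.Quotient.mk h.maxIdeal ⟨x, hx⟩ :=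
      fun x hx => dif_pos hx
    exact
    { res := fun x => if hx : ‖nrdF ℚ_[p] x‖ ≤ 1 then
        Ideal.Quotient.mk h.maxIdeal ⟨x, hx⟩ else 0
      map_add := fun x y hx hy => by
        rw [hres x hx, hres y hy, hres _ (h.valRing.add_mem hx hy)]
        exact (Ideal.Quotient.mk h.maxIdeal).map_add ⟨x, hx⟩ ⟨y, hy⟩
      map_mul := fun x y hx hy => by
        rw [hres x hx, hres y hy, hres _ (h.valRing.mul_mem hx hy)]
        exact (Ideal.Quotient.mk h.maxIdeal).map_mul ⟨x, hx⟩ ⟨y, hy⟩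
      map_one := by
        rw [hres 1 h.valRing.one_mem]
        exact (Ideal.Quotient.mk h.maxIdeal).map_one
      surj := fun z => by
        obtain ⟨x, rfl⟩ := Ideal.Quotient.mk_surjective z
        exact ⟨x, x.2, hres x x.2⟩
      eq_zero_iff := fun x hx => by
        rw [hres x hx]
        exact hzero ⟨x, hx⟩ }

end LocalDivision

/-! ### The field with p² elements: Frobenius, squares, and the quotient by the prime field. -/

section QuadraticResidueField

variable {p : ℕ} [Fact p.Prime] {κ : Type*} [Field κ] [Fintype κ]

theorem pow_pow_of_card_sq (hκ : Fintype.card κ = p ^ 2) (z : κ) : (z ^ p) ^ p = z := by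
  rw [← pow_mul, ← sq, ← hκ, FiniteField.pow_card]

theorem fixed_iff_natCast (hκ : Fintype.card κ = p ^ 2) {z : κ} : z ^ p = z ↔ ∃ n : ℕ, z = n := by
  have := charP_of_card_eq_prime_pow hκ
  constructor
  · intro hz
    rw [← Subfield.mem_bot_iff_pow_eq_self, ← ZMod.fieldRange_castHom_eq_bot p] at hz
    obtain ⟨a, rfl⟩ := hz
    exact ⟨a.val, by simp⟩
  · rintro ⟨n, rfl⟩
    exact map_natCast (frobenius κ p) n

theorem exists_not_fixed (hκ : Fintype.card κ = p ^ 2) : ∃ z : κ, z ^ p ≠ z := by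
  have := charP_of_card_eq_prime_pow hκ
  by_contra! hcon
  have h1 : Nat.card (⊥ : Subfield κ) = Nat.card κ := by
    rw [show (⊥ : Subfield κ) = ⊤ from
      eq_top_iff.2 fun z _ => (Subfield.mem_bot_iff_pow_eq_self κ p).2 (hcon z)]
    exact Nat.card_congr Subfield.topEquiv.toEquiv
  rw [Subfield.card_bot κ p, Nat.card_eq_fintype_card, hκ] at h1
  have := (Fact.out : p.Prime).one_lt
  nlinarith

theorem exists_neg_fixed (hκ : Fintype.card κ = p ^ 2) : ∃ z : κ, z ≠ 0 ∧ z ^ p = -z := by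
  have := charP_of_card_eq_prime_pow hκ
  obtain ⟨t, ht⟩ := exists_not_fixed hκ
  refine ⟨t - t ^ p, sub_ne_zero.2 ht.symm, ?_⟩
  rw [sub_pow_char, pow_pow_of_card_sq hκ]; ring

theorem ringChar_ne_two_of_card_sq (hp : 2 < p) (hκ : Fintype.card κ = p ^ 2) :
    ringChar κ ≠ 2 := by
  have := charP_of_card_eq_prime_pow hκ
  rw [ringChar.eq κ p]; omega

theorem fixed_or_neg_of_sq_fixed {z : κ} (hz : (z ^ 2) ^ p = z ^ 2) : z ^ p = z ∨ z ^ p = -z := by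
  rw [← sq_eq_sq_iff_eq_or_eq_neg, ← pow_mul, mul_comm, pow_mul, hz]

/-- Since (p² - 1)/2 = (p + 1)(p - 1)/2, Euler's criterion in κ becomes Euler's criterion in F_p for
the norm z^(p+1). -/
theorem isSquare_iff_norm_pow (hp : 2 < p) (hκ : Fintype.card κ = p ^ 2) {z : κ} (hz : z ≠ 0) :
    IsSquare z ↔ (z ^ (p + 1)) ^ (p / 2) = 1 := by
  rw [FiniteField.isSquare_iff (ringChar_ne_two_of_card_sq hp hκ) hz, hκ, ← pow_mul]
  obtain ⟨k, hk⟩ := (Fact.out : p.Prime).odd_of_ne_two (by omega)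
  have h1 : p ^ 2 / 2 = (p + 1) * (p / 2) := by
    have h2 : p / 2 = k := by omega
    have h3 : p ^ 2 = 2 * ((2 * k + 1 + 1) * k) + 1 := by rw [hk]; ring
    rw [h2, h3, hk]; omega
  rw [h1]

/-- This kernel is F_pˣ inside a cyclic group of order (p - 1)(p + 1). -/
theorem index_fixed_units (hκ : Fintype.card κ = p ^ 2) :
    (powMonoidHom (p - 1) : κˣ →* κˣ).ker.index = p + 1 := by
  have hp := (Fact.out : p.Prime).two_le
  have h1 := IsCyclic.card_powMonoidHom_ker (G := κˣ) (p - 1)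
  have h2 : Nat.card κˣ = (p - 1) * (p + 1) := by
    rw [Nat.card_units, Nat.card_eq_fintype_card, hκ]
    obtain ⟨k, rfl⟩ : ∃ k, p = k + 1 := ⟨p - 1, by omega⟩
    simp only [Nat.add_sub_cancel]
    have : (k + 1) ^ 2 = k * (k + 1 + 1) + 1 := by ring
    omega
  have h3 := (powMonoidHom (p - 1) : κˣ →* κˣ).ker.card_mul_index
  rw [h1, h2, Nat.gcd_mul_right_left] at h3
  exact Nat.eq_of_mul_eq_mul_left (by omega) h3

theorem mem_ker_powMonoidHom_iff_fixed {z : κˣ} :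
    z ∈ (powMonoidHom (p - 1) : κˣ →* κˣ).ker ↔ (z : κ) ^ p = z := by
  rw [MonoidHom.mem_ker, powMonoidHom_apply, Units.ext_iff, Units.val_pow_eq_pow_val,
    Units.val_one]
  have hp := (Fact.out : p.Prime).one_lt
  have : (z : κ) ^ p = (z : κ) ^ (p - 1) * z := by
    rw [← pow_succ]; congr 1; omega
  rw [this, mul_eq_right₀ z.ne_zero]

end QuadraticResidueField

/-! ### Reduction to the residue field: conjugation, norm and commutators. -/

namespace ResidueMap

variable {p : ℕ} [Fact p.Prime] {D : Type*} [Ring D] [Algebra ℚ_[p] D]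
  {κ : Type*} [Field κ] (R : ResidueMap p D κ)

theorem map_zero (h : QuatDiv p D) : R.res 0 = 0 := by
  rw [R.eq_zero_iff 0 (by rw [h.quat.nrd_zero]; simp), h.quat.nrd_zero]; simp

theorem map_sub (h : QuatDiv p D) {x y : D} (hx : ‖nrdF ℚ_[p] x‖ ≤ 1) (hy : ‖nrdF ℚ_[p] y‖ ≤ 1) :
    R.res (x - y) = R.res x - R.res y := by
  rw [eq_sub_iff_add_eq, ← R.map_add _ _ ((h.norm_nrd_sub_le x y).trans (max_le hx hy)) hy,
    sub_add_cancel]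

theorem norm_nrd_natCast_le (h : QuatDiv p D) (n : ℕ) : ‖nrdF ℚ_[p] (n : D)‖ ≤ 1 := by
  have : (n : D) = algebraMap ℚ_[p] D n := by simp
  rw [this, h.quat.nrd_algebraMap, norm_pow]
  exact pow_le_one₀ (norm_nonneg _) (by exact_mod_cast Padic.norm_int_le_one (p := p) n)

theorem map_natCast (h : QuatDiv p D) (n : ℕ) : R.res (n : D) = n := by
  induction n with
  | zero => simpa using R.map_zero h
  | succ n ih =>
    rw [Nat.cast_succ, R.map_add _ _ (norm_nrd_natCast_le h n) (by rw [h.quat.nrd_one]; simp), ih,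
      R.map_one, Nat.cast_succ]

theorem res_eq_iff (h : QuatDiv p D) {x y : D} (hx : ‖nrdF ℚ_[p] x‖ ≤ 1)
    (hy : ‖nrdF ℚ_[p] y‖ ≤ 1) : R.res x = R.res y ↔ ‖nrdF ℚ_[p] (x - y)‖ < 1 := by
  rw [← R.eq_zero_iff _ ((h.norm_nrd_sub_le x y).trans (max_le hx hy)), R.map_sub h hx hy,
    sub_eq_zero]

theorem ne_zero_iff {x : D} (hx : ‖nrdF ℚ_[p] x‖ ≤ 1) :
    R.res x ≠ 0 ↔ ‖nrdF ℚ_[p] x‖ = 1 := by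
  rw [Ne, R.eq_zero_iff x hx, not_lt]
  exact ⟨fun h' => le_antisymm hx h', fun h' => h'.ge⟩

theorem map_inv (h : QuatDiv p D) {u : Dˣ} (hu : ‖nrdF ℚ_[p] (u : D)‖ = 1) :
    R.res (↑u⁻¹ : D) = (R.res u)⁻¹ := by
  apply eq_inv_of_mul_eq_one_right
  rw [← R.map_mul _ _ hu.le (by rw [h.quat.nrd_inv, norm_inv, hu, inv_one]), Units.mul_inv,
    R.map_one]

theorem norm_nrd_algebraMap_le (h : QuatDiv p D) {c : ℚ_[p]} (hc : ‖c‖ ≤ 1) :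
    ‖nrdF ℚ_[p] (algebraMap ℚ_[p] D c)‖ ≤ 1 := by
  rw [h.quat.nrd_algebraMap, norm_pow]
  exact pow_le_one₀ (norm_nonneg _) hc

theorem res_algebraMap (h : QuatDiv p D) {c : ℚ_[p]} (hc : ‖c‖ ≤ 1) {n : ℕ}
    (hn : ‖c - n‖ < 1) : R.res (algebraMap ℚ_[p] D c) = n := by
  rw [← R.map_natCast h, R.res_eq_iff h (norm_nrd_algebraMap_le h hc) (norm_nrd_natCast_le h n)]
  have : algebraMap ℚ_[p] D c - n = algebraMap ℚ_[p] D (c - n) := by simp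
  rw [this, h.quat.nrd_algebraMap, norm_pow]
  exact pow_lt_one₀ (norm_nonneg _) hn two_ne_zero

variable [Fintype κ] (hκ : Fintype.card κ = p ^ 2)

theorem fixed_iff (h : QuatDiv p D) (hκ : Fintype.card κ = p ^ 2) {u : D}
    (hu : ‖nrdF ℚ_[p] u‖ ≤ 1) :
    R.res u ^ p = R.res u ↔ ∃ n : ℕ, ‖nrdF ℚ_[p] (u - n)‖ < 1 := by
  rw [fixed_iff_natCast hκ]
  refine exists_congr fun n => ?_
  rw [← R.map_natCast h, R.res_eq_iff h hu (norm_nrd_natCast_le h n)]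

theorem res_algebraMap_fixed (h : QuatDiv p D) (hκ : Fintype.card κ = p ^ 2) {c : ℚ_[p]}
    (hc : ‖c‖ ≤ 1) :
    R.res (algebraMap ℚ_[p] D c) ^ p = R.res (algebraMap ℚ_[p] D c) := by
  obtain ⟨n, hn⟩ := Padic.exists_natCast_near hc
  rw [fixed_iff_natCast hκ]
  exact ⟨n, R.res_algebraMap h hc hn⟩

/-- The residues of u and of its conjugate are the roots of a quadratic over F_p, so Frobenius sends
the first to itself or to the second. In the former case u is congruent to an integer, and so is its
conjugate. -/
theorem res_conj (h : QuatDiv p D) (hκ : Fintype.card κ = p ^ 2) {u : D}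
    (hu : ‖nrdF ℚ_[p] u‖ ≤ 1) : R.res (conjF ℚ_[p] u) = R.res u ^ p := by
  have := charP_of_card_eq_prime_pow hκ
  have hcu : ‖nrdF ℚ_[p] (conjF ℚ_[p] u)‖ ≤ 1 := by rwa [h.quat.nrd_conj]
  have hT := R.res_algebraMap_fixed h hκ (h.norm_trd_le_one hu)
  have hN := R.res_algebraMap_fixed h hκ hu
  rw [← add_conjF, R.map_add _ _ hu hcu] at hT
  rw [← h.quat.mul_conj, R.map_mul _ _ hu hcu] at hN
  set z := R.res u
  set z' := R.res (conjF ℚ_[p] u)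
  have hprod : (z ^ p - z) * (z ^ p - z') = 0 := by
    -- Frobenius is applied to the quadratic equation of z, whose coefficients it fixes.
    have h1 : (z * z - (z + z') * z + z * z') ^ p = 0 := by
      rw [show z * z - (z + z') * z + z * z' = 0 by ring]
      exact zero_pow (Fact.out : p.Prime).ne_zero
    rw [add_pow_char, sub_pow_char, mul_pow (z + z') z, hT, hN, mul_pow] at h1
    linear_combination h1
  rcases mul_eq_zero.1 hprod with h0 | h0
  · rw [sub_eq_zero] at h0
    rw [h0]
    obtain ⟨n, hn⟩ := (R.fixed_iff h hκ hu).1 h0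
    have h1 : conjF ℚ_[p] u - n = conjF ℚ_[p] (u - n) := by
      rw [conjF_sub]
      congr 1
      have := h.quat.conj_algebraMap (n : ℚ_[p])
      simpa using this.symm
    have h2 : z = n := by
      rw [← R.map_natCast h]
      exact (R.res_eq_iff h hu (norm_nrd_natCast_le h n)).2 hn
    have h3 : z' = n := by
      rw [← R.map_natCast h]
      refine (R.res_eq_iff h hcu (norm_nrd_natCast_le h n)).2 ?_
      rwa [h1, h.quat.nrd_conj]
    rw [h2, h3]
  · exact (sub_eq_zero.1 h0).symm

theorem res_nrd (h : QuatDiv p D) (hκ : Fintype.card κ = p ^ 2) {u : D}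
    (hu : ‖nrdF ℚ_[p] u‖ ≤ 1) :
    R.res (algebraMap ℚ_[p] D (nrdF ℚ_[p] u)) = R.res u ^ (p + 1) := by
  have hcu : ‖nrdF ℚ_[p] (conjF ℚ_[p] u)‖ ≤ 1 := by rwa [h.quat.nrd_conj]
  rw [← h.quat.mul_conj, R.map_mul _ _ hu hcu, R.res_conj h hκ hu]; ring

/-- A residue in F_p means that u - n has small norm for some integer n. This condition is invariant
under all conjugations, not only those by units of the valuation ring. -/
theorem fixed_conj_units (h : QuatDiv p D) (hκ : Fintype.card κ = p ^ 2) {u : D} (x : Dˣ)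
    (hu : ‖nrdF ℚ_[p] u‖ ≤ 1) (hf : R.res u ^ p = R.res u) :
    ‖nrdF ℚ_[p] ((x : D) * u * (↑x⁻¹ : D))‖ ≤ 1 ∧
      R.res ((x : D) * u * (↑x⁻¹ : D)) ^ p = R.res ((x : D) * u * (↑x⁻¹ : D)) := by
  have hN : ∀ y : D, nrdF ℚ_[p] ((x : D) * y * (↑x⁻¹ : D)) = nrdF ℚ_[p] y := by
    intro y
    have hx := h.quat.nrd_ne_zero_of_isUnit x.isUnit
    rw [h.quat.nrd_mul, h.quat.nrd_mul, h.quat.nrd_inv]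
    field_simp
  refine ⟨by rwa [hN], ?_⟩
  rw [R.fixed_iff h hκ (by rwa [hN])]
  obtain ⟨n, hn⟩ := (R.fixed_iff h hκ hu).1 hf
  refine ⟨n, ?_⟩
  have : (x : D) * u * (↑x⁻¹ : D) - n = (x : D) * (u - n) * (↑x⁻¹ : D) := by
    rw [mul_sub, sub_mul, ← Nat.cast_commute, mul_assoc (n : D), Units.mul_inv, mul_one]
  rwa [this, hN]

/-- Writing t = tr(ϖu) and s = tr ϖ, the trace identity gives ϖu - ūϖ = t - s ū. Both traces are
divisible by p, so the right side stays in the maximal ideal after division by ϖ. -/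
theorem res_uniformizer_conj (h : QuatDiv p D) (hκ : Fintype.card κ = p ^ 2) {ϖ : Dˣ}
    (hϖ : ‖nrdF ℚ_[p] (ϖ : D)‖ = (p : ℝ)⁻¹) {u : D} (hu : ‖nrdF ℚ_[p] u‖ ≤ 1) :
    R.res ((ϖ : D) * u * (↑ϖ⁻¹ : D)) = R.res u ^ p := by
  have hp1 : (1 : ℝ) < p := by exact_mod_cast (Fact.out : p.Prime).one_lt
  have hp0 : (0 : ℝ) < p := by linarith
  have hpi : (p : ℝ)⁻¹ < 1 := inv_lt_one_of_one_lt₀ hp1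
  have hcu : ‖nrdF ℚ_[p] (conjF ℚ_[p] u)‖ ≤ 1 := by rwa [h.quat.nrd_conj]
  have hN : ‖nrdF ℚ_[p] ((ϖ : D) * u * (↑ϖ⁻¹ : D))‖ ≤ 1 := by
    rw [h.quat.nrd_mul, h.quat.nrd_mul, h.quat.nrd_inv, norm_mul, norm_mul, norm_inv, hϖ]
    field_simp
    exact hu
  rw [← R.res_conj h hκ hu, R.res_eq_iff h hN hcu]
  set t := trdF ℚ_[p] ((ϖ : D) * u)
  set s := trdF ℚ_[p] (ϖ : D)
  have ht : ‖t‖ ≤ (p : ℝ)⁻¹ := by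
    refine Padic.norm_le_inv_of_lt_one (h.norm_trd_lt_one ?_)
    rw [h.quat.nrd_mul, norm_mul, hϖ]
    exact mul_lt_one_of_nonneg_of_lt_one_left (by positivity) hpi hu
  have hs : ‖s‖ ≤ (p : ℝ)⁻¹ := by
    refine Padic.norm_le_inv_of_lt_one (h.norm_trd_lt_one ?_)
    rw [hϖ]; exact hpi
  have hsmall : ∀ y : D, ‖nrdF ℚ_[p] y‖ ≤ ((p : ℝ)⁻¹) ^ 2 →
      ‖nrdF ℚ_[p] (y * (↑ϖ⁻¹ : D))‖ < 1 := by
    intro y hy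
    rw [h.quat.nrd_mul, h.quat.nrd_inv, norm_mul, norm_inv, hϖ, inv_inv]
    calc _ ≤ ((p : ℝ)⁻¹) ^ 2 * p := by gcongr
      _ = (p : ℝ)⁻¹ := by field_simp
      _ < 1 := hpi
  have hid : (ϖ : D) * u * (↑ϖ⁻¹ : D) - conjF ℚ_[p] u =
      (algebraMap ℚ_[p] D t - s • conjF ℚ_[p] u) * (↑ϖ⁻¹ : D) := by
    have h1 : algebraMap ℚ_[p] D t = (ϖ : D) * u + conjF ℚ_[p] u * conjF ℚ_[p] (ϖ : D) := by
      rw [← h.quat.conj_mul, add_conjF]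
    have h2 : conjF ℚ_[p] (ϖ : D) = algebraMap ℚ_[p] D s - ϖ := rfl
    rw [h1, h2, mul_sub, ← Algebra.commutes, ← Algebra.smul_def]
    simp only [sub_mul, add_mul]
    rw [mul_assoc (conjF ℚ_[p] u), Units.mul_inv, mul_one]; abel
  rw [hid]
  apply hsmall
  refine (h.norm_nrd_sub_le _ _).trans (max_le ?_ ?_)
  · rw [h.quat.nrd_algebraMap, norm_pow]; gcongr
  · rw [h.quat.nrd_smul, norm_mul, norm_pow]
    calc _ ≤ ((p : ℝ)⁻¹) ^ 2 * 1 := by gcongr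
      _ = _ := mul_one _

theorem fixed_of_commute (h : QuatDiv p D) (hκ : Fintype.card κ = p ^ 2) {ϖ : Dˣ}
    (hϖ : ‖nrdF ℚ_[p] (ϖ : D)‖ = (p : ℝ)⁻¹) {u : D} (hu : ‖nrdF ℚ_[p] u‖ ≤ 1)
    (hc : (ϖ : D) * u = u * ϖ) : R.res u ^ p = R.res u := by
  rw [← R.res_uniformizer_conj h hκ hϖ hu, hc, mul_assoc, Units.mul_inv, mul_one]

theorem res_commutator (h : QuatDiv p D) (hκ : Fintype.card κ = p ^ 2) {ϖ : Dˣ}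
    (hϖ : ‖nrdF ℚ_[p] (ϖ : D)‖ = (p : ℝ)⁻¹) {u : Dˣ} (hu : ‖nrdF ℚ_[p] (u : D)‖ = 1) :
    R.res (↑(u * ϖ * u⁻¹ * ϖ⁻¹) : D) = R.res u * ((R.res u)⁻¹) ^ p := by
  have hu' : ‖nrdF ℚ_[p] (↑u⁻¹ : D)‖ ≤ 1 := by rw [h.quat.nrd_inv, norm_inv, hu, inv_one]
  have h1 : (↑(u * ϖ * u⁻¹ * ϖ⁻¹) : D) = u * ((ϖ : D) * (↑u⁻¹ : D) * (↑ϖ⁻¹ : D)) := by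
    push_cast; simp only [mul_assoc]
  have hp0 : (p : ℝ) ≠ 0 := by exact_mod_cast (Fact.out : p.Prime).ne_zero
  rw [h1, R.map_mul _ _ hu.le, R.res_uniformizer_conj h hκ hϖ hu', R.map_inv h hu]
  rw [h.quat.nrd_mul, h.quat.nrd_mul, h.quat.nrd_inv, h.quat.nrd_inv, norm_mul, norm_mul,
    norm_inv, norm_inv, hϖ, hu]
  field_simp
  exact le_refl _

/-- The commutator reduces to z/z^p. Frobenius inverts this element, so it is fixed if and only if
it equals its inverse. -/
theorem commutator_fixed_iff (h : QuatDiv p D) (hκ : Fintype.card κ = p ^ 2) {ϖ : Dˣ}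
    (hϖ : ‖nrdF ℚ_[p] (ϖ : D)‖ = (p : ℝ)⁻¹) {u : Dˣ} (hu : ‖nrdF ℚ_[p] (u : D)‖ = 1) :
    R.res (↑(u * ϖ * u⁻¹ * ϖ⁻¹) : D) ^ p = R.res (↑(u * ϖ * u⁻¹ * ϖ⁻¹) : D) ↔
      (R.res u ^ 2) ^ p = R.res u ^ 2 := by
  have hz : R.res u ≠ 0 := (R.ne_zero_iff hu.le).2 hu
  rw [R.res_commutator h hκ hϖ hu]
  set z := R.res u
  rw [mul_pow, inv_pow, inv_pow, pow_pow_of_card_sq hκ]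
  have hzp : z ^ p ≠ 0 := pow_ne_zero _ hz
  rw [← div_eq_mul_inv, ← div_eq_mul_inv, div_eq_div_iff hz hzp, ← pow_mul, mul_comm 2 p, pow_mul,
    sq, sq]

/-- If the residue of c is s² and u lifts s, then v reduces to s^(1-p) s^(-2), the inverse of the
norm s^(p+1), hence to an element of F_p. -/
theorem exists_conj_of_isSquare (h : QuatDiv p D) (hκ : Fintype.card κ = p ^ 2) {ϖ : Dˣ}
    (hϖ : ‖nrdF ℚ_[p] (ϖ : D)‖ = (p : ℝ)⁻¹) {c : Dˣ} (hc : ‖nrdF ℚ_[p] (c : D)‖ = 1)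
    (hsq : IsSquare (R.res c)) :
    ∃ u v : Dˣ, ‖nrdF ℚ_[p] (u : D)‖ = 1 ∧ ‖nrdF ℚ_[p] (v : D)‖ = 1 ∧
      R.res v ^ p = R.res v ∧ u * ϖ * u⁻¹ = v * (c * ϖ) := by
  obtain ⟨s, hs⟩ := hsq
  have hcz : R.res c ≠ 0 := (R.ne_zero_iff hc.le).2 hc
  obtain ⟨x, hx, hxs⟩ := R.surj s
  have hs0 : s ≠ 0 := by rintro rfl; exact hcz (by rw [hs, zero_mul])
  have hx1 : ‖nrdF ℚ_[p] x‖ = 1 := (R.ne_zero_iff hx).1 (by rwa [hxs])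
  have hx0 : x ≠ 0 := by
    rintro rfl
    rw [h.quat.nrd_zero, norm_zero] at hx1
    exact zero_ne_one hx1
  obtain ⟨u, rfl⟩ := h.isUnit x hx0
  have hci : ‖nrdF ℚ_[p] (↑c⁻¹ : D)‖ = 1 := by rw [h.quat.nrd_inv, norm_inv, hc, inv_one]
  have hp0 : (p : ℝ) ≠ 0 := by exact_mod_cast (Fact.out : p.Prime).ne_zero
  have hcom : ‖nrdF ℚ_[p] (↑(u * ϖ * u⁻¹ * ϖ⁻¹) : D)‖ = 1 := by
    push_cast
    rw [h.quat.nrd_mul, h.quat.nrd_mul, h.quat.nrd_mul, h.quat.nrd_inv, h.quat.nrd_inv]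
    simp only [norm_mul, norm_inv, hϖ, hx1]
    field_simp
  have hv : (↑(u * ϖ * u⁻¹ * ϖ⁻¹ * c⁻¹) : D) = (↑(u * ϖ * u⁻¹ * ϖ⁻¹) : D) * (↑c⁻¹ : D) :=
    Units.val_mul _ _
  refine ⟨u, u * ϖ * u⁻¹ * ϖ⁻¹ * c⁻¹, hx1, ?_, ?_, by group⟩
  · rw [hv, h.quat.nrd_mul, norm_mul, hcom, hci, one_mul]
  · rw [hv, R.map_mul _ _ hcom.le hci.le, R.res_commutator h hκ hϖ hx1, R.map_inv h hc, hs, hxs]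
    have : s * s⁻¹ ^ p * (s * s)⁻¹ = (s ^ (p + 1))⁻¹ := by
      rw [pow_succ, inv_pow]; field_simp
    rw [this, ← hxs, ← R.res_nrd h hκ hx, inv_pow, R.res_algebraMap_fixed h hκ hx]

end ResidueMap

/-! ### Two by two matrices: companion forms, centralizers, integrality. -/

section MatrixTwo

/-- The companion matrix of `X ^ 2 - t X + n`. -/
def companionTwo {F : Type*} [CommRing F] (t n : F) : Matrix (Fin 2) (Fin 2) F := !![0, -n; 1, t]

/-- The columns of the second matrix are v = (a, b) and A v. In the basis v, A v, the matrix A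
becomes its companion matrix by Cayley–Hamilton. -/
theorem mul_cyclic {F : Type*} [CommRing F] (A : Matrix (Fin 2) (Fin 2) F) (a b : F) :
    A * !![a, A 0 0 * a + A 0 1 * b; b, A 1 0 * a + A 1 1 * b] =
      !![a, A 0 0 * a + A 0 1 * b; b, A 1 0 * a + A 1 1 * b] * companionTwo A.trace A.det := by
  ext i j
  fin_cases i <;> fin_cases j <;>
    simp [companionTwo, Matrix.mul_apply, Matrix.trace, Matrix.det_fin_two] <;> ring

theorem det_cyclic {F : Type*} [CommRing F] (A : Matrix (Fin 2) (Fin 2) F) (a b : F) :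
    (!![a, A 0 0 * a + A 0 1 * b; b, A 1 0 * a + A 1 1 * b]).det =
      A 1 0 * a ^ 2 + (A 1 1 - A 0 0) * (a * b) - A 0 1 * b ^ 2 := by
  rw [Matrix.det_fin_two]; simp; ring

/-- The determinant of (v, A v) is a quadratic form in v. If it vanishes at (1,0), (0,1) and (1,1),
then A is scalar. -/
theorem exists_conj_companion {F : Type*} [Field F] (A : Matrix (Fin 2) (Fin 2) F)
    (hA : ∀ c : F, A ≠ algebraMap F _ c) :
    ∃ g : (Matrix (Fin 2) (Fin 2) F)ˣ, A * g = g * companionTwo A.trace A.det := by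
  have key : ∀ a b : F, A 1 0 * a ^ 2 + (A 1 1 - A 0 0) * (a * b) - A 0 1 * b ^ 2 ≠ 0 →
      ∃ g : (Matrix (Fin 2) (Fin 2) F)ˣ, A * g = g * companionTwo A.trace A.det := by
    intro a b hab
    rw [← det_cyclic] at hab
    obtain ⟨g, hg⟩ := (Matrix.isUnit_iff_isUnit_det _).2 hab.isUnit
    exact ⟨g, by rw [hg]; exact mul_cyclic A a b⟩
  by_contra hcon
  have h1 : A 1 0 = 0 := by
    by_contra h; exact hcon (key 1 0 (by simpa using h))
  have h2 : A 0 1 = 0 := by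
    by_contra h; exact hcon (key 0 1 (by simpa using h))
  have h3 : A 1 1 - A 0 0 = 0 := by
    by_contra h; exact hcon (key 1 1 (by simpa [h1, h2] using h))
  refine hA (A 0 0) ?_
  ext i j
  fin_cases i <;> fin_cases j <;> simp [Matrix.algebraMap_matrix_apply, h1, h2, sub_eq_zero.1 h3]

/-- The first basis vector is cyclic for the companion matrix, so a commuting matrix is determined
by its first column. -/
theorem commute_companion {F : Type*} [CommRing F] {t n : F} {Z : Matrix (Fin 2) (Fin 2) F}
    (h : Z * companionTwo t n = companionTwo t n * Z) :
    Z = algebraMap F _ (Z 0 0) + Z 1 0 • companionTwo t n := by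
  have h00 := congrFun (congrFun h 0) 0
  have h10 := congrFun (congrFun h 1) 0
  simp [companionTwo, Matrix.mul_apply] at h00 h10
  ext i j
  fin_cases i <;> fin_cases j <;> simp [companionTwo, Matrix.algebraMap_matrix_apply]
  · rw [h00]; ring
  · rw [h10]; ring

theorem exists_of_commute {F : Type*} [Field F] {A Z : Matrix (Fin 2) (Fin 2) F}
    (hA : ∀ c : F, A ≠ algebraMap F _ c) (h : Z * A = A * Z) :
    ∃ a b : F, Z = algebraMap F _ a + b • A := by
  obtain ⟨g, hg⟩ := exists_conj_companion A hA
  set C := companionTwo A.trace A.det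
  have hC : C = (↑g⁻¹ : Matrix (Fin 2) (Fin 2) F) * A * g := by
    rw [mul_assoc, hg, ← mul_assoc, Units.inv_mul, one_mul]
  have hcomm : ((↑g⁻¹ : Matrix (Fin 2) (Fin 2) F) * Z * g) * C =
      C * ((↑g⁻¹ : Matrix (Fin 2) (Fin 2) F) * Z * g) := by
    have e1 : ∀ X Y : Matrix (Fin 2) (Fin 2) F, ((↑g⁻¹ : Matrix (Fin 2) (Fin 2) F) * X * g) *
      ((↑g⁻¹ : Matrix (Fin 2) (Fin 2) F) * Y * g) =
        (↑g⁻¹ : Matrix (Fin 2) (Fin 2) F) * (X * Y) * g := by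
      intro X Y
      simp only [mul_assoc, Units.mul_inv_cancel_left]
    rw [hC, e1, e1, h]
  have h1 := commute_companion hcomm
  have h2 : Z = g * ((↑g⁻¹ : Matrix (Fin 2) (Fin 2) F) * Z * g) *
      (↑g⁻¹ : Matrix (Fin 2) (Fin 2) F) := by
    simp only [mul_assoc, Units.mul_inv_cancel_left, Units.mul_inv, mul_one]
  rw [h1, mul_add, add_mul, ← Algebra.commutes, Units.mul_inv_cancel_right,
    mul_smul_comm, smul_mul_assoc, ← hg, Units.mul_inv_cancel_right] at h2
  exact ⟨_, _, h2⟩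

variable {ℓ : ℕ} [Fact ℓ.Prime]

/-- Matrices with integral entries. -/
def IsIntMat (X : Matrix (Fin 2) (Fin 2) ℚ_[ℓ]) : Prop := ∀ i j, ‖X i j‖ ≤ 1

theorem IsIntMat.mul {X Y : Matrix (Fin 2) (Fin 2) ℚ_[ℓ]} (hX : IsIntMat X) (hY : IsIntMat Y) :
    IsIntMat (X * Y) := by
  intro i j
  rw [Matrix.mul_apply, Fin.sum_univ_two]
  refine (Padic.nonarchimedean _ _).trans (max_le ?_ ?_) <;> rw [norm_mul] <;>
    exact mul_le_one₀ (hX _ _) (norm_nonneg _) (hY _ _)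

theorem IsIntMat.add {X Y : Matrix (Fin 2) (Fin 2) ℚ_[ℓ]} (hX : IsIntMat X) (hY : IsIntMat Y) :
    IsIntMat (X + Y) := fun i j =>
  (Padic.nonarchimedean _ _).trans (max_le (hX i j) (hY i j))

theorem IsIntMat.norm_trace_le {X : Matrix (Fin 2) (Fin 2) ℚ_[ℓ]} (hX : IsIntMat X) :
    ‖X.trace‖ ≤ 1 := by
  rw [Matrix.trace_fin_two]
  exact (Padic.nonarchimedean _ _).trans (max_le (hX 0 0) (hX 1 1))

theorem IsIntMat.norm_det_le {X : Matrix (Fin 2) (Fin 2) ℚ_[ℓ]} (hX : IsIntMat X) :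
    ‖X.det‖ ≤ 1 := by
  rw [Matrix.det_fin_two, sub_eq_add_neg]
  refine (Padic.nonarchimedean _ _).trans (max_le ?_ ?_)
  · rw [norm_mul]; exact mul_le_one₀ (hX _ _) (norm_nonneg _) (hX _ _)
  · rw [norm_neg, norm_mul]; exact mul_le_one₀ (hX _ _) (norm_nonneg _) (hX _ _)

theorem IsIntMat.inv {g : (Matrix (Fin 2) (Fin 2) ℚ_[ℓ])ˣ}
    (hg : IsIntMat (g : Matrix (Fin 2) (Fin 2) ℚ_[ℓ]))
    (hd : ‖(g : Matrix (Fin 2) (Fin 2) ℚ_[ℓ]).det‖ = 1) :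
    IsIntMat (↑g⁻¹ : Matrix (Fin 2) (Fin 2) ℚ_[ℓ]) := by
  have hdu : IsUnit (g : Matrix (Fin 2) (Fin 2) ℚ_[ℓ]).det := by
    rw [isUnit_iff_ne_zero]; rintro h0; rw [h0, norm_zero] at hd; exact zero_ne_one hd
  intro i j
  rw [Matrix.coe_units_inv, Matrix.inv_def, Matrix.smul_apply, smul_eq_mul, norm_mul,
    Ring.inverse_eq_inv', norm_inv, hd, inv_one, one_mul, Matrix.adjugate_fin_two]
  fin_cases i <;> fin_cases j <;> simp <;> exact hg _ _

theorem norm_intMat_single (i j : Fin 2) : IsIntMat (Matrix.single i j (1 : ℚ_[ℓ])) := by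
  intro i' j'
  rw [Matrix.single_apply]
  split_ifs <;> simp

/-- Elementary matrices isolate the entry X i j: the sum of the integral matrices E_ki (X E_jk X⁻¹),
multiplied by X, is the scalar X i j. Taking determinants bounds the square of this entry. -/
theorem isIntMat_of_normalizes {x : (Matrix (Fin 2) (Fin 2) ℚ_[ℓ])ˣ}
    (hx : ∀ y, IsIntMat y → IsIntMat ((x : Matrix (Fin 2) (Fin 2) ℚ_[ℓ]) * y *
      (↑x⁻¹ : Matrix (Fin 2) (Fin 2) ℚ_[ℓ])))
    (hd : ‖(x : Matrix (Fin 2) (Fin 2) ℚ_[ℓ]).det‖ = 1) :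
    IsIntMat (x : Matrix (Fin 2) (Fin 2) ℚ_[ℓ]) := by
  intro i j
  set X := (x : Matrix (Fin 2) (Fin 2) ℚ_[ℓ])
  let Y : Fin 2 → Matrix (Fin 2) (Fin 2) ℚ_[ℓ] := fun k =>
    Matrix.single k i 1 * (X * Matrix.single j k 1 * (↑x⁻¹ : Matrix (Fin 2) (Fin 2) ℚ_[ℓ]))
  have hY : ∀ k, IsIntMat (Y k) :=
      fun k => (norm_intMat_single k i).mul (hx _ (norm_intMat_single j k))
  have h1 : (Y 0 + Y 1) * X = algebraMap ℚ_[ℓ] _ (X i j) := by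
    have : ∀ k, Y k * X = Matrix.single k k (X i j) := by
      intro k
      simp only [Y, X, mul_assoc, Units.inv_mul, mul_one]
      rw [← mul_assoc, Matrix.single_mul_mul_single]; simp
    rw [add_mul, this, this]
    ext a b
    fin_cases a <;> fin_cases b <;> simp [Matrix.algebraMap_matrix_apply]
  have h2 := congrArg Matrix.det h1
  rw [Matrix.det_mul, Algebra.algebraMap_eq_smul_one, Matrix.det_smul, Matrix.det_one] at h2
  have h3 := congrArg norm h2
  rw [norm_mul, hd, mul_one, Fintype.card_fin, mul_one, norm_pow] at h3
  have h4 := ((hY 0).add (hY 1)).norm_det_le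
  rw [h3] at h4
  exact (sq_le_one_iff₀ (norm_nonneg _)).1 h4

/-- The integral form of the cyclic vector argument: unless A is scalar modulo ℓ, the quadratic form
takes a unit value at one of the vectors (1,0), (0,1), (1,1), and the base change then has unit
determinant. -/
theorem exists_int_conj_companion {A : Matrix (Fin 2) (Fin 2) ℚ_[ℓ]} (hA : IsIntMat A)
    (hns : ∀ n : ℕ, ¬ ∀ i j, ‖(A - (n : Matrix (Fin 2) (Fin 2) ℚ_[ℓ])) i j‖ < 1) :
    ∃ g : (Matrix (Fin 2) (Fin 2) ℚ_[ℓ])ˣ, IsIntMat (g : Matrix (Fin 2) (Fin 2) ℚ_[ℓ]) ∧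
      IsIntMat (↑g⁻¹ : Matrix (Fin 2) (Fin 2) ℚ_[ℓ]) ∧ A * g = g * companionTwo A.trace A.det := by
  have key : ∀ a b : ℚ_[ℓ], ‖a‖ ≤ 1 → ‖b‖ ≤ 1 →
      ‖A 1 0 * a ^ 2 + (A 1 1 - A 0 0) * (a * b) - A 0 1 * b ^ 2‖ = 1 →
      ∃ g : (Matrix (Fin 2) (Fin 2) ℚ_[ℓ])ˣ, IsIntMat (g : Matrix (Fin 2) (Fin 2) ℚ_[ℓ]) ∧
      IsIntMat (↑g⁻¹ : Matrix (Fin 2) (Fin 2) ℚ_[ℓ]) ∧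
        A * g = g * companionTwo A.trace A.det := by
    intro a b ha hb hab
    rw [← det_cyclic] at hab
    have hne : (!![a, A 0 0 * a + A 0 1 * b; b, A 1 0 * a + A 1 1 * b]).det ≠ 0 := by
      intro h0; rw [h0, norm_zero] at hab; exact zero_ne_one hab
    obtain ⟨g, hg⟩ := (Matrix.isUnit_iff_isUnit_det _).2 hne.isUnit
    have hlin : ∀ i, ‖A i 0 * a + A i 1 * b‖ ≤ 1 := by
      intro i
      refine (Padic.nonarchimedean _ _).trans (max_le ?_ ?_) <;> rw [norm_mul]
      · exact mul_le_one₀ (hA _ _) (norm_nonneg _) ha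
      · exact mul_le_one₀ (hA _ _) (norm_nonneg _) hb
    have hgi : IsIntMat (g : Matrix (Fin 2) (Fin 2) ℚ_[ℓ]) := by
      rw [hg]
      intro i j
      fin_cases i <;> fin_cases j
      · exact ha
      · exact hlin 0
      · exact hb
      · exact hlin 1
    exact ⟨g, hgi, hgi.inv (by rw [hg]; exact hab), by rw [hg]; exact mul_cyclic A a b⟩
  by_contra hcon
  have h1 : ‖A 1 0‖ < 1 := by
    refine lt_of_le_of_ne (hA _ _) fun h => hcon (key 1 0 (by simp) (by simp) (by simpa using h))
  have h2 : ‖A 0 1‖ < 1 := by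
    refine lt_of_le_of_ne (hA _ _) fun h => hcon (key 0 1 (by simp) (by simp) (by simpa using h))
  have h3' : ‖A 1 1 - A 0 0‖ ≤ 1 := by
    rw [sub_eq_add_neg]
    exact (Padic.nonarchimedean _ _).trans (max_le (hA _ _) (by rw [norm_neg]; exact hA _ _))
  have h3 : ‖A 1 1 - A 0 0‖ < 1 := by
    refine lt_of_le_of_ne h3' fun h => hcon (key 1 1 (by simp) (by simp) ?_)
    have h4 : ‖A 1 0 - A 0 1‖ < 1 := by
      rw [sub_eq_add_neg]
      exact (Padic.nonarchimedean _ _).trans_lt (max_lt h1 (by rwa [norm_neg]))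
    have h5 : A 1 0 * 1 ^ 2 + (A 1 1 - A 0 0) * (1 * 1) - A 0 1 * 1 ^ 2 =
      (A 1 1 - A 0 0) + (A 1 0 - A 0 1) := by ring
    rw [h5, Padic.add_eq_max_of_ne (by rw [h]; exact h4.ne'), h, max_eq_left h4.le]
  obtain ⟨n, hn⟩ := Padic.exists_natCast_near (hA 0 0)
  refine hns n fun i j => ?_
  have h5 : ‖A 1 1 - n‖ < 1 := by
    have : A 1 1 - n = (A 1 1 - A 0 0) + (A 0 0 - n) := by ring
    rw [this]
    exact (Padic.nonarchimedean _ _).trans_lt (max_lt h3 hn)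
  fin_cases i <;> fin_cases j <;> simp [Matrix.natCast_apply] <;> assumption

end MatrixTwo

/-! ### Orders isomorphic to integral matrices. -/

section SplitOrder

variable {ℓ : ℕ} [Fact ℓ.Prime] {A : Type*} [Ring A] [Algebra ℚ_[ℓ] A]

/-- A subset of `A` that corresponds to the integral matrices under some isomorphism of `A`
with a matrix algebra. -/
def IsSplitOrder (M : Set A) : Prop :=
  ∃ φ : A ≃ₐ[ℚ_[ℓ]] Matrix (Fin 2) (Fin 2) ℚ_[ℓ], ∀ x, x ∈ M ↔ IsIntMat (φ x)

namespace IsSplitOrder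

variable {M : Set A} (hM : IsSplitOrder (ℓ := ℓ) M)

theorem norm_trd_le (hM : IsSplitOrder (ℓ := ℓ) M) {x : A} (hx : x ∈ M) : ‖trdF ℚ_[ℓ] x‖ ≤ 1 := by
  obtain ⟨φ, hφ⟩ := hM
  rw [← trdF_equiv φ, trdF_matrix]
  exact ((hφ x).1 hx).norm_trace_le

theorem norm_nrd_le (hM : IsSplitOrder (ℓ := ℓ) M) {x : A} (hx : x ∈ M) : ‖nrdF ℚ_[ℓ] x‖ ≤ 1 := by
  obtain ⟨φ, hφ⟩ := hM
  rw [← nrdF_equiv φ, nrdF_matrix]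
  exact ((hφ x).1 hx).norm_det_le

theorem mem_of_normalizes (hM : IsSplitOrder (ℓ := ℓ) M) {x : Aˣ}
    (hx : ∀ y ∈ M, (x : A) * y * (↑x⁻¹ : A) ∈ M) (hd : ‖nrdF ℚ_[ℓ] (x : A)‖ = 1) :
    (x : A) ∈ M := by
  obtain ⟨φ, hφ⟩ := hM
  rw [hφ]
  have hX : φ (x : A) = (Units.map (φ : A →* Matrix (Fin 2) (Fin 2) ℚ_[ℓ]) x :) := rfl
  have hX' : φ (↑x⁻¹ : A) = (↑(Units.map (φ : A →* Matrix (Fin 2) (Fin 2) ℚ_[ℓ]) x)⁻¹ :) := rfl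
  rw [hX]
  apply isIntMat_of_normalizes
  · intro y hy
    have := hx (φ.symm y) ((hφ _).2 (by simpa using hy))
    rw [hφ, map_mul, map_mul, φ.apply_symm_apply, hX, hX'] at this
    exact this
  · rw [← hX, ← nrdF_matrix, nrdF_equiv]; exact hd

/-- The companion matrix of w has entries 0, 1, the trace and minus the norm, so it is integral. -/
theorem exists_conj_mem (hM : IsSplitOrder (ℓ := ℓ) M) {w : A}
    (hw : ∀ c, w ≠ algebraMap ℚ_[ℓ] A c) (ht : ‖trdF ℚ_[ℓ] w‖ ≤ 1) (hn : ‖nrdF ℚ_[ℓ] w‖ ≤ 1) :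
    ∃ x : Aˣ, (x : A) * w * (↑x⁻¹ : A) ∈ M := by
  obtain ⟨φ, hφ⟩ := hM
  rw [← trdF_equiv φ, trdF_matrix] at ht
  rw [← nrdF_equiv φ, nrdF_matrix] at hn
  obtain ⟨g, hg⟩ := exists_conj_companion (φ w) (fun c hc => hw c (φ.injective (by simpa using hc)))
  refine ⟨Units.map (φ.symm : Matrix (Fin 2) (Fin 2) ℚ_[ℓ] →* A) g⁻¹, ?_⟩
  rw [hφ]
  have : φ ((Units.map (φ.symm : Matrix (Fin 2) (Fin 2) ℚ_[ℓ] →* A) g⁻¹ : Aˣ) * w *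
      (↑(Units.map (φ.symm : Matrix (Fin 2) (Fin 2) ℚ_[ℓ] →* A) g⁻¹)⁻¹ : A)) =
      companionTwo (φ w).trace (φ w).det := by
    rw [← map_inv, inv_inv, map_mul, map_mul]
    simp only [Units.coe_map, MonoidHom.coe_coe, AlgEquiv.apply_symm_apply]
    rw [mul_assoc, hg, ← mul_assoc, Units.inv_mul, one_mul]
  rw [this]
  intro i j
  fin_cases i <;> fin_cases j
  · simp [companionTwo]
  · simpa [companionTwo] using hn
  · simp [companionTwo]
  · simpa [companionTwo] using ht

/-- Neither conjugate of w is scalar modulo ℓ, so both are integrally conjugate to the same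
companion matrix. The product of the two conjugators is u. The element x⁻¹ u⁻¹ x' then centralizes
w, and so is a linear polynomial in w. -/
theorem exists_factor (hM : IsSplitOrder (ℓ := ℓ) M) {w : A} {x x' : Aˣ}
    (hx : (x : A) * w * (↑x⁻¹ : A) ∈ M) (hx' : (x' : A) * w * (↑x'⁻¹ : A) ∈ M)
    (hns : ∀ n : ℕ, ∀ y ∈ M, (x : A) * w * (↑x⁻¹ : A) - n ≠ (ℓ : ℚ_[ℓ]) • y)
    (hns' : ∀ n : ℕ, ∀ y ∈ M, (x' : A) * w * (↑x'⁻¹ : A) - n ≠ (ℓ : ℚ_[ℓ]) • y)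
    (hw : ∀ c, w ≠ algebraMap ℚ_[ℓ] A c) :
    ∃ u z : Aˣ, (u : A) ∈ M ∧ (↑u⁻¹ : A) ∈ M ∧ x' = u * x * z ∧
      ∃ a b : ℚ_[ℓ], (z : A) = algebraMap ℚ_[ℓ] A a + b • w := by
  obtain ⟨φ, hφ⟩ := hM
  have hℓ0 : (ℓ : ℚ_[ℓ]) ≠ 0 := by exact_mod_cast (Fact.out : ℓ.Prime).ne_zero
  have hℓ1 : (0 : ℝ) < ℓ := by exact_mod_cast (Fact.out : ℓ.Prime).pos
  have hcomp : ∀ x : Aˣ, (x : A) * w * (↑x⁻¹ : A) ∈ M →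
      (∀ n : ℕ, ∀ y ∈ M, (x : A) * w * (↑x⁻¹ : A) - n ≠ (ℓ : ℚ_[ℓ]) • y) →
      ∃ g : (Matrix (Fin 2) (Fin 2) ℚ_[ℓ])ˣ, IsIntMat (g : Matrix (Fin 2) (Fin 2) ℚ_[ℓ]) ∧
      IsIntMat (↑g⁻¹ : Matrix (Fin 2) (Fin 2) ℚ_[ℓ]) ∧ φ ((x : A) * w * (↑x⁻¹ : A)) * g =
        g * companionTwo (φ w).trace (φ w).det := by
    intro x hx hns
    obtain ⟨g, hg1, hg2, hg3⟩ := exists_int_conj_companion ((hφ _).1 hx) (fun n hn => by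
      refine hns n (φ.symm ((ℓ : ℚ_[ℓ])⁻¹ • (φ ((x : A) * w * (↑x⁻¹ : A)) - n))) ?_ ?_
      · rw [hφ, φ.apply_symm_apply]
        intro i j
        rw [Matrix.smul_apply, smul_eq_mul, norm_mul, norm_inv, Padic.norm_p, inv_inv]
        calc (ℓ : ℝ) * _ ≤ ℓ * (ℓ : ℝ)⁻¹ := by
              gcongr; exact Padic.norm_le_inv_of_lt_one (hn i j)
          _ = 1 := mul_inv_cancel₀ hℓ1.ne'
      · rw [← map_smul, smul_smul, mul_inv_cancel₀ hℓ0, one_smul]; simp [mul_assoc])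
    refine ⟨g, hg1, hg2, ?_⟩
    have htr : (φ ((x : A) * w * (↑x⁻¹ : A))).trace = (φ w).trace := by
      rw [map_mul, Matrix.trace_mul_comm, ← map_mul, ← mul_assoc, Units.inv_mul, one_mul]
    have hdet : (φ ((x : A) * w * (↑x⁻¹ : A))).det = (φ w).det := by
      rw [map_mul, Matrix.det_mul, mul_comm, ← Matrix.det_mul, ← map_mul, ← mul_assoc,
        Units.inv_mul, one_mul]
    rw [htr, hdet] at hg3
    exact hg3
  obtain ⟨g, hg1, hg2, hg3⟩ := hcomp x hx hns
  obtain ⟨g', hg1', hg2', hg3'⟩ := hcomp x' hx' hns'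
  let e : Aˣ ≃* (Matrix (Fin 2) (Fin 2) ℚ_[ℓ])ˣ := Units.mapEquiv (φ : A ≃* _)
  have he : ∀ y : Aˣ, ((e y : (Matrix (Fin 2) (Fin 2) ℚ_[ℓ])ˣ) : Matrix (Fin 2) (Fin 2) ℚ_[ℓ]) =
    φ y := fun y => rfl
  let u : Aˣ := e.symm (g' * g⁻¹)
  have hu : φ (u : A) = g' * (↑g⁻¹ : Matrix (Fin 2) (Fin 2) ℚ_[ℓ]) := by
    rw [← he, e.apply_symm_apply]; rfl
  have hui : φ (↑u⁻¹ : A) = g * (↑g'⁻¹ : Matrix (Fin 2) (Fin 2) ℚ_[ℓ]) := by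
    rw [← he, map_inv, e.apply_symm_apply, mul_inv_rev, inv_inv]; rfl
  have hconj : (u : A) * ((x : A) * w * (↑x⁻¹ : A)) = (x' : A) * w * (↑x'⁻¹ : A) * u := by
    apply φ.injective
    rw [map_mul, map_mul φ _ (u : A), hu]
    set C := companionTwo (φ w).trace (φ w).det
    rw [← mul_assoc, hg3']
    have h1 : φ ((x : A) * w * (↑x⁻¹ : A)) = g * C * (↑g⁻¹ : Matrix (Fin 2) (Fin 2) ℚ_[ℓ]) := by
      rw [← hg3, Units.mul_inv_cancel_right]
    rw [h1]
    simp only [mul_assoc, Units.inv_mul_cancel_left]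
  refine ⟨u, x⁻¹ * u⁻¹ * x', ?_, ?_, by group, ?_⟩
  · rw [hφ, hu]; exact hg1'.mul hg2
  · rw [hφ, hui]; exact hg1.mul hg2'
  · have hz : (↑(x⁻¹ * u⁻¹ * x') : A) * w = w * (↑(x⁻¹ * u⁻¹ * x') : A) := by
      push_cast
      have h1 : (x' : A) * w = (u : A) * ((x : A) * w * (↑x⁻¹ : A)) * (↑u⁻¹ : A) * x' := by
        rw [hconj]
        simp only [mul_assoc, Units.mul_inv_cancel_left, Units.inv_mul, mul_one]
      calc (↑x⁻¹ : A) * (↑u⁻¹ : A) * (x' : A) * w = (↑x⁻¹ : A) * (↑u⁻¹ : A) * ((x' : A) * w) := by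
            rw [mul_assoc]
        _ = _ := by
            rw [h1]
            simp only [mul_assoc, Units.inv_mul_cancel_left]
    have hA : ∀ c, φ w ≠ algebraMap ℚ_[ℓ] _ c :=
      fun c hc => hw c (φ.injective (by simpa using hc))
    obtain ⟨a, b, hab⟩ := exists_of_commute hA (Z := φ (↑(x⁻¹ * u⁻¹ * x') : A))
      (by rw [← map_mul, hz, map_mul])
    refine ⟨a, b, φ.injective ?_⟩
    rw [hab, map_add, map_smul, AlgEquiv.commutes]

end IsSplitOrder

end SplitOrder

/-! ### Completions of a maximal order. -/

section LocalOrders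

variable {B : Type*} [Ring B] [Algebra ℚ B]

theorem quatLike_of_splitAt {ℓ : ℕ} [Fact ℓ.Prime] (h4 : Module.finrank ℚ B = 4)
    (h : SplitAt B ℓ) : QuatLike ℚ B := by
  obtain ⟨e⟩ := h
  exact QuatLike.of_baseChange h4 (quatLike_matrix.of_equiv e.symm)

/-- The prime 2 differs from p, so B splits there, and the identities descend from 2×2 matrices. -/
theorem IsQuaternionRamifiedExactly.quatLike {p : ℕ} [Fact p.Prime]
    (hB : IsQuaternionRamifiedExactly B p) (hp : 2 < p) : QuatLike ℚ B :=
  have : Fact (Nat.Prime 2) := ⟨Nat.prime_two⟩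
  quatLike_of_splitAt hB.1.2.2 (hB.2.2.2 2 (by omega))

theorem IsQuaternionRamifiedExactly.quatDiv {p : ℕ} [Fact p.Prime]
    (hB : IsQuaternionRamifiedExactly B p) (hp : 2 < p) : QuatDiv p (Bloc B p) :=
  ⟨(hB.quatLike hp).baseChange, hB.2.1.2⟩

section
variable {ℓ : ℕ} [Fact ℓ.Prime] {O : Subalgebra ℤ B}

theorem one_mem_locLat : (1 : Bloc B ℓ) ∈ locLat ℓ (ordLat O) := by
  have := toLoc_mem_locLat (ℓ := ℓ) (L := ordLat O) O.one_mem
  rwa [map_one] at this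

theorem mul_mem_locLat {x y : Bloc B ℓ} (hx : x ∈ locLat ℓ (ordLat O))
    (hy : y ∈ locLat ℓ (ordLat O)) : x * y ∈ locLat ℓ (ordLat O) := by
  have := Submodule.mul_mem_mul hx hy
  rw [← locLat_mul] at this
  exact locLat_mono (Submodule.mul_le.2 fun _ ha _ hb => O.mul_mem ha hb) this

end

/-- Gluing Λ at ℓ with the completions of O at all other primes produces a global order containing
O. -/
theorem locLat_eq_of_maximal {O : Subalgebra ℤ B} (hO : IsMaximalOrderIn O) (ℓ : Nat.Primes)
    (Λ : Submodule ℤ_[(ℓ : ℕ)] (Bloc B (ℓ : ℕ))) (hΛ : Submodule.IsLattice ℚ_[(ℓ : ℕ)] Λ)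
    (hmul : ∀ x ∈ Λ, ∀ y ∈ Λ, x * y ∈ Λ) (hle : locLat (ℓ : ℕ) (ordLat O) ≤ Λ) :
    locLat (ℓ : ℕ) (ordLat O) = Λ := by
  classical
  let M : ∀ ℓ : Nat.Primes, Submodule ℤ_[(ℓ : ℕ)] (Bloc B (ℓ : ℕ)) :=
    Function.update (fun ℓ => locLat (ℓ : ℕ) (ordLat O)) ℓ Λ
  have hM0 : M ℓ = Λ := Function.update_self _ _ _
  have hM1 : ∀ ℓ' ≠ ℓ, M ℓ' = locLat (ℓ' : ℕ) (ordLat O) := fun ℓ' h => Function.update_of_ne h _ _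
  have hMlat : ∀ ℓ : Nat.Primes, Submodule.IsLattice ℚ_[(ℓ : ℕ)] (M ℓ) := by
    intro ℓ'
    by_cases h : ℓ' = ℓ
    · subst h; rw [hM0]; exact hΛ
    · rw [hM1 _ h]; exact hO.1.isLattice_locLat _
  have hfin : {ℓ : Nat.Primes | M ℓ ≠ locLat (ℓ : ℕ) (ordLat O)}.Finite :=
    (Set.finite_singleton ℓ).subset fun ℓ' h => by
      by_contra h'; exact h (hM1 ℓ' h')
  have hMle : ∀ ℓ' : Nat.Primes, locLat (ℓ' : ℕ) (ordLat O) ≤ M ℓ' := by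
    intro ℓ'
    by_cases h : ℓ' = ℓ
    · subst h; rw [hM0]; exact hle
    · rw [hM1 _ h]
  have hMmul : ∀ ℓ' : Nat.Primes, ∀ x ∈ M ℓ', ∀ y ∈ M ℓ', x * y ∈ M ℓ' := by
    intro ℓ'
    by_cases h : ℓ' = ℓ
    · subst h; rw [hM0]; exact hmul
    · rw [hM1 _ h]; exact fun x hx y hy => mul_mem_locLat hx hy
  have hOM : ordLat O ≤ globalLat M := fun b hb ℓ' => hMle ℓ' (toLoc_mem_locLat hb)
  let O' : Subalgebra ℤ B := Submodule.toSubalgebra (globalLat M) (hOM O.one_mem) (by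
    intro x y hx hy ℓ'
    have := hMmul ℓ' _ (hx ℓ') _ (hy ℓ')
    rwa [Algebra.TensorProduct.tmul_mul_tmul, one_mul] at this)
  have hO'l : ordLat O' = globalLat M := by
    ext x; rfl
  have hO' : IsOrderIn O' := by
    change IsLatticeIn (ordLat O')
    rw [hO'l]; exact isLatticeIn_globalLat hO.1 hMlat hfin
  have heq := hO.2 O' hO' hOM
  rw [← hM0, ← locLat_globalLat hO.1 hMlat hfin ℓ, ← hO'l, heq]

section Division

variable {p : ℕ} [Fact p.Prime] {D : Type*} [Ring D] [Algebra ℚ_[p] D]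
  [Module ℤ_[p] D] [IsScalarTower ℤ_[p] ℚ_[p] D]

/-- The valuation ring as a lattice. -/
def QuatDiv.valLat (h : QuatDiv p D) : Submodule ℤ_[p] D where
  carrier := h.valRing
  add_mem' := h.valRing.add_mem
  zero_mem' := h.valRing.zero_mem
  smul_mem' := by
    intro c x (hx : ‖nrdF ℚ_[p] x‖ ≤ 1)
    change ‖nrdF ℚ_[p] (c • x)‖ ≤ 1
    rw [← algebraMap_smul ℚ_[p] c x, h.quat.nrd_smul, norm_mul, norm_pow]
    exact mul_le_one₀ (pow_le_one₀ (norm_nonneg _) c.2) (norm_nonneg _) hx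

theorem QuatDiv.mem_valLat (h : QuatDiv p D) {x : D} :
    x ∈ h.valLat ↔ ‖nrdF ℚ_[p] x‖ ≤ 1 := Iff.rfl

/-- The trace pairing with the basis e is non-degenerate, because tr(x x̄) = 2 N(x), and it is
integral on the valuation ring. So this ring lies in the lattice dual to e, which is Noetherian. -/
theorem QuatDiv.fg_valLat (h : QuatDiv p D) {n : ℕ} (e : Module.Basis (Fin n) ℚ_[p] D)
    (he : ∀ i, ‖nrdF ℚ_[p] (e i)‖ ≤ 1) : h.valLat.FG := by
  let T : D →ₗ[ℚ_[p]] (Fin n → ℚ_[p]) :=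
    LinearMap.pi fun i => (trdL ℚ_[p] D).comp (LinearMap.mulRight ℚ_[p] (e i))
  have hT : ∀ x i, T x i = trdF ℚ_[p] (x * e i) := fun x i => rfl
  have hTinj : Function.Injective T := by
    rw [← LinearMap.ker_eq_bot, LinearMap.ker_eq_bot']
    intro x hx
    have h1 : (trdL ℚ_[p] D).comp (LinearMap.mulLeft ℚ_[p] x) = 0 :=
      e.ext fun i => by
        have := congrFun hx i
        simpa [hT, trdL_apply] using this
    have h2 := LinearMap.congr_fun h1 (conjF ℚ_[p] x)
    rw [LinearMap.comp_apply, LinearMap.mulLeft_apply, h.quat.mul_conj, trdL_apply,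
      trdF_algebraMap h.quat.finrank] at h2
    by_contra hx0
    exact h.nrd_ne_zero hx0 (by simpa using h2)
  have hfd : Module.Finite ℚ_[p] D := Module.Finite.of_basis e
  let T' : D ≃ₗ[ℚ_[p]] (Fin n → ℚ_[p]) := LinearEquiv.ofInjectiveOfFinrankEq T hTinj (by
    rw [Module.finrank_eq_card_basis e]; simp)
  have hT' : ∀ x, T' x = T x := fun x => rfl
  have hle : h.valLat ≤ Submodule.span ℤ_[p] (Set.range fun i => T'.symm (Pi.single i 1)) := by
    intro x hx
    have hx' : x = ∑ i, trdF ℚ_[p] (x * e i) • T'.symm (Pi.single i 1) := by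
      apply T'.injective
      ext j
      simp only [map_sum, map_smul, LinearEquiv.apply_symm_apply, Finset.sum_apply, Pi.smul_apply,
        smul_eq_mul]
      rw [hT', hT, Finset.sum_eq_single j]
      · simp
      · intro b _ hb; simp [hb.symm]
      · simp
    rw [hx']
    refine Submodule.sum_mem _ fun i _ => ?_
    have h1 : ‖trdF ℚ_[p] (x * e i)‖ ≤ 1 :=
      h.norm_trd_le_one (h.valRing.mul_mem hx (he i))
    have h2 : trdF ℚ_[p] (x * e i) • T'.symm (Pi.single i 1) =
        Padic.toInt _ h1 • T'.symm (Pi.single i 1) := by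
      rw [← algebraMap_smul ℚ_[p] (Padic.toInt _ h1)]; rfl
    rw [h2]
    exact Submodule.smul_mem _ _ (Submodule.subset_span ⟨i, rfl⟩)
  have : IsNoetherian ℤ_[p] (Submodule.span ℤ_[p] (Set.range fun i => T'.symm (Pi.single i 1))) :=
    isNoetherian_span_of_finite _ (Set.finite_range _)
  exact Submodule.FG.of_le (Submodule.fg_span (Set.finite_range _)) hle

/-- If |N u| > 1, dividing a monic integral equation of degree k by u^k leaves 1 equal to a sum of
terms of norm less than 1. -/
theorem QuatDiv.norm_nrd_le_one_of_isIntegral (h : QuatDiv p D) {x : D}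
    (hx : (Int.castRingHom D).IsIntegralElem x) :
    ‖nrdF ℚ_[p] x‖ ≤ 1 := by
  by_contra! hlt
  have hx0 : x ≠ 0 := by
    rintro rfl; rw [h.quat.nrd_zero, norm_zero] at hlt; linarith
  obtain ⟨u, rfl⟩ := h.isUnit x hx0
  obtain ⟨f, hf, hfu⟩ := hx
  have hinv : ‖nrdF ℚ_[p] (↑u⁻¹ : D)‖ < 1 := by
    rw [h.quat.nrd_inv, norm_inv]; exact inv_lt_one_of_one_lt₀ hlt
  have hint : ∀ c : ℤ, (c : D) ∈ h.valRing := fun c => intCast_mem _ c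
  have key : ∀ k : ℕ, ∀ i < k, ∀ c : ℤ,
      ‖nrdF ℚ_[p] (((c : D) * (u : D) ^ i) * (↑u⁻¹ : D) ^ k)‖ < 1 := by
    intro k i hik c
    obtain ⟨m, rfl⟩ : ∃ m, k = i + (m + 1) := ⟨k - i - 1, by omega⟩
    have h1 : ((c : D) * (u : D) ^ i) * (↑u⁻¹ : D) ^ (i + (m + 1)) =
        (c : D) * (↑u⁻¹ : D) ^ m * (↑u⁻¹ : D) := by
      rw [pow_add, pow_succ, ← mul_assoc, mul_assoc (c : D) ((u : D) ^ i),
          ← Units.val_pow_eq_pow_val,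
        ← Units.val_pow_eq_pow_val, inv_pow, Units.mul_inv, mul_one, ← mul_assoc]
    rw [h1, h.quat.nrd_mul, norm_mul]
    exact mul_lt_one_of_nonneg_of_lt_one_right
      (h.valRing.mul_mem (hint c) (pow_mem (show (↑u⁻¹ : D) ∈ h.valRing from hinv.le) m))
      (norm_nonneg _) hinv
  rw [Polynomial.eval₂_eq_sum_range, Finset.sum_range_succ, hf.coeff_natDegree, map_one,
    one_mul] at hfu
  set k := f.natDegree
  have h1 : ‖nrdF ℚ_[p] ((∑ i ∈ Finset.range k, Int.castRingHom D (f.coeff i) * (u : D) ^ i) *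
      (↑u⁻¹ : D) ^ k)‖ < 1 := by
    rw [Finset.sum_mul]
    have : ∀ s : Finset ℕ, (∀ i ∈ s, i < k) →
        ‖nrdF ℚ_[p] (∑ i ∈ s, Int.castRingHom D (f.coeff i) * (u : D) ^ i * (↑u⁻¹ : D) ^ k)‖
          < 1 := by
      intro s
      induction s using Finset.induction_on with
      | empty => intro _; simp [h.quat.nrd_zero]
      | insert a s ha ih =>
        intro hs
        rw [Finset.sum_insert ha]
        refine (h.norm_nrd_add_le _ _).trans_lt (max_lt ?_ (ih fun i hi => hs i (by simp [hi])))
        exact key k a (hs a (by simp)) _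
    exact this _ fun i hi => Finset.mem_range.1 hi
  rw [eq_neg_of_add_eq_zero_left hfu, neg_mul, h.quat.nrd_neg, ← Units.val_pow_eq_pow_val,
    ← Units.val_pow_eq_pow_val, inv_pow, Units.mul_inv, h.quat.nrd_one, norm_one] at h1
  exact lt_irrefl _ h1

end Division

theorem IsOrderIn.isIntegral {O : Subalgebra ℤ B} (hO : IsOrderIn O) {b : B} (hb : b ∈ O) :
    IsIntegral ℤ b := IsIntegral.of_mem_of_fg O hO.1 b hb

theorem locLat_le_valLat {p : ℕ} [Fact p.Prime] (h : QuatDiv p (Bloc B p)) {O : Subalgebra ℤ B}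
    (hO : IsOrderIn O) : locLat p (ordLat O) ≤ h.valLat := by
  rw [locLat_le_iff]
  intro b hb
  refine h.norm_nrd_le_one_of_isIntegral ?_
  obtain ⟨f, hf, hfb⟩ := hO.isIntegral hb
  refine ⟨f, hf, ?_⟩
  have := congrArg (toLoc p : B → Bloc B p) hfb
  rw [map_zero] at this
  rw [← this]
  exact (Polynomial.hom_eval₂ f _ (toLoc p : B →ₐ[ℚ] Bloc B p).toRingHom b).symm ▸
    congrArg (fun g => Polynomial.eval₂ g (toLoc p b) f) (RingHom.ext_int _ _)

theorem locLat_maximal_ramified {p : ℕ} [Fact p.Prime] (h : QuatDiv p (Bloc B p))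
    {O : Subalgebra ℤ B} (hO : IsMaximalOrderIn O) : locLat p (ordLat O) = h.valLat := by
  obtain ⟨n, e, he⟩ := IsLatticeIn.exists_basis hO.1
  have hle := locLat_le_valLat h hO.1
  refine locLat_eq_of_maximal hO ⟨p, Fact.out⟩ h.valLat ⟨?_, ?_⟩ ?_ hle
  · refine h.fg_valLat (e.baseChange ℚ_[p]) fun i => hle ?_
    rw [Module.Basis.baseChange_apply, ← toLoc_apply]
    refine toLoc_mem_locLat ?_
    rw [he]; exact Submodule.subset_span ⟨i, rfl⟩
  · rw [eq_top_iff, ← (IsLatticeIn.isLattice_locLat hO.1 p).span_eq_top]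
    exact Submodule.span_mono hle
  · exact fun x hx y hy => h.valRing.mul_mem hx hy

/-- The first columns of the elements of O_ℓ form a lattice in ℚ_ℓ² that is stable under O_ℓ. In a
basis of this lattice O_ℓ acts by integral matrices, and maximality gives equality. -/
theorem isSplitOrder_maximal {ℓ : ℕ} [Fact ℓ.Prime] (h : SplitAt B ℓ) {O : Subalgebra ℤ B}
    (hO : IsMaximalOrderIn O) :
    IsSplitOrder (ℓ := ℓ) (locLat ℓ (ordLat O) : Set (Bloc B ℓ)) := by
  obtain ⟨φ₀⟩ := h
  have hlat := IsLatticeIn.isLattice_locLat hO.1 ℓ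
  let col : Bloc B ℓ →ₗ[ℚ_[ℓ]] (Fin 2 → ℚ_[ℓ]) :=
    (LinearMap.pi fun i => LinearMap.proj (R := ℚ_[ℓ]) (φ := fun _ : Fin 2 => ℚ_[ℓ]) 0 ∘ₗ
      LinearMap.proj (R := ℚ_[ℓ]) (φ := fun _ : Fin 2 => Fin 2 → ℚ_[ℓ]) i) ∘ₗ
      φ₀.toLinearEquiv.toLinearMap
  have hcol : ∀ x i, col x i = φ₀ x i 0 := fun x i => rfl
  have hcolmul : ∀ x y, col (x * y) = (φ₀ x).mulVec (col y) := by
    intro x y; ext i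
    rw [hcol, map_mul, Matrix.mul_apply]; rfl
  have hcolsurj : Function.Surjective col := by
    intro v
    refine ⟨φ₀.symm (Matrix.of fun i _ => v i), ?_⟩
    ext i; rw [hcol, φ₀.apply_symm_apply]; rfl
  let Λ₀ : Submodule ℤ_[ℓ] (Fin 2 → ℚ_[ℓ]) :=
    (locLat ℓ (ordLat O)).map (col.restrictScalars ℤ_[ℓ])
  have hΛ₀ : Submodule.IsLattice ℚ_[ℓ] Λ₀ := by
    refine ⟨hlat.fg.map _, ?_⟩
    have h1 : (Λ₀ : Set (Fin 2 → ℚ_[ℓ])) = col '' (locLat ℓ (ordLat O)) := rfl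
    rw [h1, ← Submodule.map_span, hlat.span_eq_top, Submodule.map_top,
      LinearMap.range_eq_top.2 hcolsurj]
  let b₀ := (Module.finBasis ℤ_[ℓ] Λ₀).extendOfIsLattice ℚ_[ℓ]
  have hb₀ : ∀ i, b₀ i = (Module.finBasis ℤ_[ℓ] Λ₀ i : Fin 2 → ℚ_[ℓ]) := fun i =>
    Module.Basis.extendOfIsLattice_apply _ _ _
  have hcard : Module.finrank ℤ_[ℓ] Λ₀ = 2 := by
    have := Module.finrank_eq_card_basis b₀
    simpa using this.symm
  let b := b₀.reindex (finCongr hcard)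
  have hbmem : ∀ i, b i ∈ Λ₀ := by
    intro i
    rw [Module.Basis.reindex_apply, hb₀]
    exact Subtype.mem _
  have hbrepr : ∀ v ∈ Λ₀, ∀ i, ‖b.repr v i‖ ≤ 1 := by
    intro v hv i
    have hspan : v ∈ Submodule.span ℤ_[ℓ] (Set.range b₀) := by
      have h1 : Set.range b₀ = Λ₀.subtype '' Set.range (Module.finBasis ℤ_[ℓ] Λ₀) := by
        rw [← Set.range_comp]; congr 1; ext1 i; exact hb₀ i
      rw [h1, ← Submodule.map_span, Module.Basis.span_eq, Submodule.map_top,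
        Submodule.range_subtype]
      exact hv
    obtain ⟨c, hc⟩ := (Module.Basis.mem_span_iff_repr_mem ℤ_[ℓ] b₀ v).1 hspan
      ((finCongr hcard).symm i)
    rw [Module.Basis.repr_reindex_apply, ← hc]
    exact c.2
  let φ : Bloc B ℓ ≃ₐ[ℚ_[ℓ]] Matrix (Fin 2) (Fin 2) ℚ_[ℓ] :=
    (φ₀.trans Matrix.toLinAlgEquiv').trans (LinearMap.toMatrixAlgEquiv b)
  have hφ : ∀ x i j, φ x i j = b.repr ((φ₀ x).mulVec (b j)) i := by
    intro x i j
    simp only [φ, AlgEquiv.trans_apply, LinearMap.toMatrixAlgEquiv_apply,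
      Matrix.toLinAlgEquiv'_apply]
  have hint : ∀ x ∈ locLat ℓ (ordLat O), IsIntMat (φ x) := by
    intro x hx i j
    rw [hφ]
    apply hbrepr
    obtain ⟨y, hy, hyj⟩ := hbmem j
    refine ⟨x * y, mul_mem_locLat hx hy, ?_⟩
    rw [← hyj]
    exact hcolmul x y
  let Λ : Submodule ℤ_[ℓ] (Bloc B ℓ) :=
    { carrier := {x | IsIntMat (φ x)}
      add_mem' := by
        intro x y (hx : IsIntMat _) (hy : IsIntMat _)
        change IsIntMat _
        rw [map_add]; exact hx.add hy
      zero_mem' := by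
        change IsIntMat _
        rw [map_zero]; intro i j; simp
      smul_mem' := by
        intro c x (hx : IsIntMat _)
        change IsIntMat _
        rw [← algebraMap_smul ℚ_[ℓ] c x, map_smul]
        intro i j
        rw [Matrix.smul_apply, smul_eq_mul, norm_mul]
        exact mul_le_one₀ c.2 (norm_nonneg _) (hx i j) }
  have hle : locLat ℓ (ordLat O) ≤ Λ := hint
  have hfg : Λ.FG := by
    have h1 : Λ = Submodule.span ℤ_[ℓ]
        (Set.range fun ij : Fin 2 × Fin 2 => φ.symm (Matrix.single ij.1 ij.2 1)) := by
      apply le_antisymm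
      · intro x (hx : IsIntMat _)
        have h2 : x = ∑ i, ∑ j, Padic.toInt _ (hx i j) • φ.symm (Matrix.single i j 1) := by
          apply φ.injective
          conv_lhs => rw [Matrix.matrix_eq_sum_single (φ x)]
          rw [map_sum]
          refine Finset.sum_congr rfl fun i _ => ?_
          rw [map_sum]
          refine Finset.sum_congr rfl fun j _ => ?_
          rw [← algebraMap_smul ℚ_[ℓ] (Padic.toInt _ _), map_smul, φ.apply_symm_apply,
            Matrix.smul_single, smul_eq_mul, mul_one]
          rfl
        rw [h2]
        exact Submodule.sum_mem _ fun i _ => Submodule.sum_mem _ fun j _ =>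
          Submodule.smul_mem _ _ (Submodule.subset_span ⟨(i, j), rfl⟩)
      · rw [Submodule.span_le]
        rintro _ ⟨ij, rfl⟩
        change IsIntMat (φ (φ.symm _))
        rw [φ.apply_symm_apply]
        exact norm_intMat_single _ _
    rw [h1]
    exact Submodule.fg_span (Set.finite_range _)
  have heq := locLat_eq_of_maximal hO ⟨ℓ, Fact.out⟩ Λ ⟨hfg, by
    rw [eq_top_iff, ← hlat.span_eq_top]; exact Submodule.span_mono hle⟩ (by
    intro x (hx : IsIntMat _) y (hy : IsIntMat _)
    change IsIntMat _
    rw [map_mul]; exact hx.mul hy) hle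
  refine ⟨φ, fun x => ?_⟩
  have heq' : locLat ℓ (ordLat O) = Λ := heq
  rw [heq']; rfl

end LocalOrders

/-! ### The order of index p, at p and away from p. -/

section IndexP

variable {B : Type*} [Ring B] [Algebra ℚ B]

theorem IsSuborderOfIndex.index_nsmul_mem {Ot O : Subalgebra ℤ B} {n : ℕ}
    (h : IsSuborderOfIndex Ot O n)
    {b : B} (hb : b ∈ O) : n • b ∈ Ot := by
  have h1 := AddSubgroup.nsmul_index_mem
    (((ordLat Ot).toAddSubgroup).addSubgroupOf (ordLat O).toAddSubgroup) ⟨b, hb⟩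
  rw [← h.2.2]
  exact h1

theorem IsSuborderOfIndex.exists_generator {Ot O : Subalgebra ℤ B} {p : ℕ} [Fact p.Prime]
    (h : IsSuborderOfIndex Ot O p) :
    ∃ y ∈ O, y ∉ Ot ∧ ∀ z ∈ O, ∃ n : ℕ, z - n • y ∈ Ot := by
  let G := (ordLat O).toAddSubgroup
  let H : AddSubgroup G := ((ordLat Ot).toAddSubgroup).addSubgroupOf G
  have hcard : Nat.card (G ⧸ H) = p := h.2.2
  have hne : ∃ y : G, y ∉ H := by
    by_contra! hcon
    have htop : H = ⊤ := eq_top_iff.2 fun y _ => hcon y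
    have h1 : H.index = p := hcard
    rw [htop, AddSubgroup.index_top] at h1
    exact (Fact.out : p.Prime).one_lt.ne h1
  obtain ⟨y, hy⟩ := hne
  refine ⟨y, y.2, hy, fun z hz => ?_⟩
  have hy0 : (QuotientAddGroup.mk y : G ⧸ H) ≠ 0 := by
    rwa [Ne, QuotientAddGroup.eq_zero_iff]
  have hmem := mem_zmultiples_of_prime_card hcard (g := (QuotientAddGroup.mk y : G ⧸ H))
    (g' := (QuotientAddGroup.mk ⟨z, hz⟩ : G ⧸ H)) hy0
  have hfin : Finite (G ⧸ H) := Nat.finite_of_card_ne_zero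
    (by rw [hcard]; exact (Fact.out : p.Prime).ne_zero)
  rw [← mem_multiples_iff_mem_zmultiples] at hmem
  obtain ⟨n, hn⟩ := hmem
  refine ⟨n, ?_⟩
  have h2 : (QuotientAddGroup.mk (⟨z, hz⟩ - n • y) : G ⧸ H) = 0 := by
    rw [QuotientAddGroup.mk_sub, QuotientAddGroup.mk_nsmul, sub_eq_zero]
    exact hn.symm
  rw [QuotientAddGroup.eq_zero_iff] at h2
  exact h2

theorem IsSuborderOfIndex.locLat_eq {Ot O : Subalgebra ℤ B} {p : ℕ} [Fact p.Prime]
    (h : IsSuborderOfIndex Ot O p) {ℓ : ℕ} [Fact ℓ.Prime] (hℓ : ℓ ≠ p) :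
    locLat ℓ (ordLat Ot) = locLat ℓ (ordLat O) := by
  apply le_antisymm (locLat_mono h.2.1)
  rw [locLat_le_iff]
  intro b hb
  refine mem_of_nsmul_mem (N := p) ?_ ?_
  · exact (Nat.coprime_primes Fact.out Fact.out).2 hℓ.symm
  · rw [← map_nsmul]; exact toLoc_mem_locLat (h.index_nsmul_mem hb)

/-- Multiplication on the quotient O/Ot, which has p elements, shows that Ot reduces into F_p. As pO
lies in Ot and some residue is outside F_p, nothing in the preimage of F_p is missing. -/
theorem IsSuborderOfIndex.mem_locLat_iff {Ot O : Subalgebra ℤ B} {p : ℕ} [Fact p.Prime]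
    (h : IsSuborderOfIndex Ot O p) (hO : IsMaximalOrderIn O) (hD : QuatDiv p (Bloc B p))
    {κ : Type*} [Field κ] [Fintype κ] (hκ : Fintype.card κ = p ^ 2)
    (R : ResidueMap p (Bloc B p) κ) (x : Bloc B p) :
    x ∈ locLat p (ordLat Ot) ↔ ‖nrdF ℚ_[p] x‖ ≤ 1 ∧ R.res x ^ p = R.res x := by
  have hOp : ∀ x, x ∈ locLat p (ordLat O) ↔ ‖nrdF ℚ_[p] x‖ ≤ 1 := by
    intro x; rw [locLat_maximal_ramified hD hO]; exact hD.mem_valLat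
  have hle := locLat_mono (ℓ := p) (L := ordLat Ot) (M := ordLat O) h.2.1
  have hpmem : ∀ z ∈ locLat p (ordLat O), p • z ∈ locLat p (ordLat Ot) := by
    intro z hz
    have h1 : locLat p (ordLat O) ≤ (locLat p (ordLat Ot)).comap
        (LinearMap.lsmul ℤ_[p] _ (p : ℤ_[p])) := by
      rw [locLat_le_iff]
      intro b hb
      rw [Submodule.mem_comap, LinearMap.lsmul_apply, Nat.cast_smul_eq_nsmul, ← map_nsmul]
      exact toLoc_mem_locLat (h.index_nsmul_mem hb)
    have h2 := h1 hz
    rwa [Submodule.mem_comap, LinearMap.lsmul_apply, Nat.cast_smul_eq_nsmul] at h2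
  obtain ⟨y₀, hy₀, hy₀', hgen⟩ := h.exists_generator
  set y := toLoc p y₀
  have hyO : y ∈ locLat p (ordLat O) := toLoc_mem_locLat hy₀
  have hy : y ∉ locLat p (ordLat Ot) := by
    intro hy
    refine hy₀' (IsLatticeIn.mem_of_forall_loc h.1 fun ℓ _ => ?_)
    by_cases hℓ : ℓ = p
    · subst hℓ; exact hy
    · rw [h.locLat_eq hℓ]; exact toLoc_mem_locLat hy₀
  have hgen' : ∀ z ∈ locLat p (ordLat O), ∃ n : ℕ, z - n • y ∈ locLat p (ordLat Ot) := by
    intro z hz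
    obtain ⟨b, hb, z', hz', rfl⟩ := exists_approx 1 hz
    obtain ⟨n, hn⟩ := hgen b hb
    refine ⟨n, ?_⟩
    have : toLoc p b + p ^ 1 • z' - n • y = toLoc p (b - n • y₀) + p • z' := by
      rw [map_sub, map_nsmul, pow_one]; abel
    rw [this]
    exact add_mem (toLoc_mem_locLat hn) (hpmem z' hz')
  have hnat : ∀ n : ℕ, (n : Bloc B p) ∈ locLat p (ordLat Ot) := by
    intro n
    have := nsmul_mem (one_mem_locLat (ℓ := p) (O := Ot)) n
    rwa [nsmul_one] at this
  have hcp : ∀ n : ℕ, n.Coprime p → n • y ∉ locLat p (ordLat Ot) := fun n hn h' =>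
    hy (mem_of_nsmul_mem hn h')
  -- The product a y equals n y modulo Ot for some integer n. If the residue of a were outside F_p,
  -- then a - n would be a unit whose inverse, a multiple of its conjugate, lies in Ot, and y itself
  -- would lie in Ot.
  have hfix : ∀ a ∈ locLat p (ordLat Ot), R.res a ^ p = R.res a := by
    intro a ha
    by_contra hne
    have haO := (hOp a).1 (hle ha)
    obtain ⟨n, hn⟩ := hgen' _ (mul_mem_locLat (hle ha) hyO)
    have hb : a - n ∈ locLat p (ordLat Ot) := sub_mem ha (hnat n)
    have hbN := (hOp _).1 (hle hb)
    have hbN1 : ‖nrdF ℚ_[p] (a - n)‖ = 1 := by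
      refine le_antisymm hbN (not_lt.1 fun hlt => hne ?_)
      exact (R.fixed_iff hD hκ haO).2 ⟨n, hlt⟩
    have hcm : (nrdF ℚ_[p] (a - n))⁻¹ • conjF ℚ_[p] (a - n) ∈ locLat p (ordLat Ot) := by
      have hinv : ‖(nrdF ℚ_[p] (a - n))⁻¹‖ ≤ 1 := by rw [norm_inv, hbN1, inv_one]
      have hs : ∀ c : ℚ_[p], ‖c‖ ≤ 1 → ∀ z ∈ locLat p (ordLat Ot),
          c • z ∈ locLat p (ordLat Ot) := by
        intro c hc z hz
        have := (locLat p (ordLat Ot)).smul_mem (Padic.toInt c hc) hz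
        rw [← algebraMap_smul ℚ_[p] (Padic.toInt c hc)] at this
        exact this
      refine hs _ hinv _ ?_
      rw [conjF, Algebra.algebraMap_eq_smul_one]
      exact sub_mem (hs _ (hD.norm_trd_le_one hbN) _ one_mem_locLat) hb
    refine hy ?_
    have h3 := mul_mem_locLat hcm (show (a - n) * y ∈ locLat p (ordLat Ot) by
      rw [sub_mul, ← nsmul_eq_mul]; exact hn)
    have h0 : nrdF ℚ_[p] (a - n) ≠ 0 := by
      intro h0; rw [h0, norm_zero] at hbN1; exact zero_ne_one hbN1
    rwa [smul_mul_assoc, ← mul_assoc, hD.quat.conj_mul_self, ← Algebra.smul_def, smul_smul,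
      inv_mul_cancel₀ h0, one_smul] at h3
  have hyN := (hOp y).1 hyO
  have := charP_of_card_eq_prime_pow hκ
  have hnsmul : ∀ n : ℕ, ‖nrdF ℚ_[p] (n • y)‖ ≤ 1 := fun n => (hOp _).1 (nsmul_mem hyO n)
  have hres : ∀ n : ℕ, R.res (n • y) = n * R.res y := by
    intro n
    rw [nsmul_eq_mul, R.map_mul _ _ (ResidueMap.norm_nrd_natCast_le hD n) hyN, R.map_natCast hD]
  have hsubfix : ∀ a b : κ, (a - b) ^ p = a - b → b ^ p = b → a ^ p = a := by
    intro a b h1 h2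
    rw [sub_pow_char, h2] at h1
    exact sub_left_injective h1
  -- Otherwise Ot and y, which together generate the valuation ring, would all reduce into F_p.
  have hynf : R.res y ^ p ≠ R.res y := by
    intro hyf
    obtain ⟨t, ht⟩ := exists_not_fixed hκ
    obtain ⟨z, hz, rfl⟩ := R.surj t
    obtain ⟨n, hn⟩ := hgen' z ((hOp z).2 hz)
    have h1 := hfix _ hn
    rw [R.map_sub hD hz (hnsmul n)] at h1
    refine ht (hsubfix _ _ h1 ?_)
    rw [hres, mul_pow, hyf, (fixed_iff_natCast hκ).2 ⟨n, rfl⟩]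
  refine ⟨fun hx => ⟨(hOp x).1 (hle hx), hfix x hx⟩, fun ⟨hx, hxf⟩ => ?_⟩
  obtain ⟨n, hn⟩ := hgen' x ((hOp x).2 hx)
  have h1 := hfix _ hn
  rw [R.map_sub hD hx (hnsmul n), sub_pow_char, hxf, hres, mul_pow,
    (fixed_iff_natCast hκ (z := (n : κ))).2 ⟨n, rfl⟩] at h1
  have h2 : (n : κ) * (R.res y ^ p - R.res y) = 0 := by linear_combination -h1
  have h3 : (n : κ) = 0 := (mul_eq_zero.1 h2).resolve_right (sub_ne_zero.2 hynf)
  rw [CharP.cast_eq_zero_iff κ p] at h3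
  obtain ⟨m, rfl⟩ := h3
  have h4 : x = (x - (p * m) • y) + p • (m • y) := by rw [mul_smul]; abel
  rw [h4]
  exact add_mem hn (hpmem _ (nsmul_mem hyO m))

end IndexP

/-- The local structure of the order `Ot` at all primes: it is a matrix order away from `p`, and
at `p` it is the preimage of the prime field in the valuation ring of a division algebra. -/
structure LocalStructure (p : ℕ) [Fact p.Prime] {B : Type*} [Ring B] [Algebra ℚ B]
    (Ot : Subalgebra ℤ B) (κ : Type*) [Field κ] [Fintype κ] where
  two_lt : 2 < p
  quat : QuatLike ℚ B
  div : QuatDiv p (Bloc B p)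
  lat : IsLatticeIn (ordLat Ot)
  split : ∀ (ℓ : ℕ) [Fact ℓ.Prime], ℓ ≠ p →
    IsSplitOrder (ℓ := ℓ) (locLat ℓ (ordLat Ot) : Set (Bloc B ℓ))
  card : Fintype.card κ = p ^ 2
  R : ResidueMap p (Bloc B p) κ
  mem_iff : ∀ x, x ∈ locLat p (ordLat Ot) ↔ ‖nrdF ℚ_[p] x‖ ≤ 1 ∧ R.res x ^ p = R.res x

theorem exists_localStructure (p : ℕ) [Fact p.Prime] (hp : 2 < p) {B : Type u} [Ring B]
    [Algebra ℚ B] (hB : IsQuaternionRamifiedExactly B p) (O Ot : Subalgebra ℤ B)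
    (hO : IsMaximalOrderIn O) (hOt : IsSuborderOfIndex Ot O p) {ϖ : Bloc B p}
    (hϖ : ‖nrdF ℚ_[p] ϖ‖ = (p : ℝ)⁻¹) :
    ∃ (κ : Type u) (_ : Field κ) (_ : Fintype κ), Nonempty (LocalStructure p Ot κ) := by
  have hD := hB.quatDiv hp
  obtain ⟨n, e, he⟩ := IsLatticeIn.exists_basis hO.1
  have hn : n = 4 := by
    have := Module.finrank_eq_card_basis e
    rw [hB.1.2.2] at this
    simpa using this.symm
  subst hn
  have hOp : ∀ x, ‖nrdF ℚ_[p] x‖ ≤ 1 ↔ ∀ i, ‖(e.baseChange ℚ_[p]).repr x i‖ ≤ 1 := by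
    intro x
    have h2 : toLoc p '' Set.range e = Set.range (e.baseChange ℚ_[p]) := by
      rw [← Set.range_comp]; congr 1; ext i; simp [toLoc_apply]
    rw [← hD.mem_valLat, ← locLat_maximal_ramified hD hO, he, locLat_span, h2,
      Module.Basis.mem_span_iff_repr_mem]
    refine forall_congr' fun i => ⟨?_, fun h => ⟨Padic.toInt _ h, rfl⟩⟩
    rintro ⟨c, hc⟩
    rw [← hc]; exact c.2
  obtain ⟨κ, _, _, hκ, ⟨R⟩⟩ := hD.exists_residueMap hϖ _ hOp
  refine ⟨κ, _, _, ⟨{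
    two_lt := hp
    quat := hB.quatLike hp
    div := hD
    lat := hOt.1
    split := fun ℓ _ hℓ => ?_
    card := hκ
    R := R
    mem_iff := hOt.mem_locLat_iff hO hD hκ R }⟩⟩
  rw [hOt.locLat_eq hℓ]
  exact isSplitOrder_maximal (hB.2.2.2 ℓ hℓ) hO

/-! ### Left ideals as families of local generators. -/

section LeftIdeals

variable {B : Type*} [Ring B] [Algebra ℚ B]

section
variable {ℓ : ℕ} [Fact ℓ.Prime]

theorem mem_locRmul {M : Submodule ℤ_[ℓ] (Bloc B ℓ)} {x : (Bloc B ℓ)ˣ} {z : Bloc B ℓ} :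
    z ∈ locRmul M (x : Bloc B ℓ) ↔ z * (↑x⁻¹ : Bloc B ℓ) ∈ M := by
  constructor
  · rintro ⟨y, hy, rfl⟩; simpa using hy
  · intro h; exact ⟨_, h, by simp⟩

theorem mem_locLmul {M : Submodule ℤ_[ℓ] (Bloc B ℓ)} {x : (Bloc B ℓ)ˣ} {z : Bloc B ℓ} :
    z ∈ locLmul (x : Bloc B ℓ) M ↔ (↑x⁻¹ : Bloc B ℓ) * z ∈ M := by
  constructor
  · rintro ⟨y, hy, rfl⟩; simpa using hy
  · intro h; exact ⟨_, h, by simp⟩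

theorem isLattice_map_equiv {M : Submodule ℤ_[ℓ] (Bloc B ℓ)} (hM : Submodule.IsLattice ℚ_[ℓ] M)
    (f : Bloc B ℓ →ₗ[ℚ_[ℓ]] Bloc B ℓ) (hf : Function.Surjective f) :
    Submodule.IsLattice ℚ_[ℓ] (M.map (f.restrictScalars ℤ_[ℓ])) := by
  refine ⟨hM.fg.map _, ?_⟩
  have h1 : ((M.map (f.restrictScalars ℤ_[ℓ]) : Submodule ℤ_[ℓ] (Bloc B ℓ)) : Set (Bloc B ℓ)) =
    f '' M := rfl
  rw [h1, ← Submodule.map_span, hM.span_eq_top, Submodule.map_top, LinearMap.range_eq_top.2 hf]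

theorem isLattice_locRmul {M : Submodule ℤ_[ℓ] (Bloc B ℓ)} (hM : Submodule.IsLattice ℚ_[ℓ] M)
    (x : (Bloc B ℓ)ˣ) : Submodule.IsLattice ℚ_[ℓ] (locRmul M (x : Bloc B ℓ)) :=
  isLattice_map_equiv hM (LinearMap.mulRight ℚ_[ℓ] (x : Bloc B ℓ)) fun y => ⟨y * ↑x⁻¹, by simp⟩

theorem isLattice_locLmul {M : Submodule ℤ_[ℓ] (Bloc B ℓ)} (hM : Submodule.IsLattice ℚ_[ℓ] M)
    (x : (Bloc B ℓ)ˣ) : Submodule.IsLattice ℚ_[ℓ] (locLmul (x : Bloc B ℓ) M) :=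
  isLattice_map_equiv hM (LinearMap.mulLeft ℚ_[ℓ] (x : Bloc B ℓ)) fun y => ⟨↑x⁻¹ * y, by simp⟩

/-- The unit group of the completion of an order. -/
def locUnits (O : Subalgebra ℤ B) (ℓ : ℕ) [Fact ℓ.Prime] : Subgroup (Bloc B ℓ)ˣ where
  carrier := {u | (u : Bloc B ℓ) ∈ locLat ℓ (ordLat O) ∧
    (↑u⁻¹ : Bloc B ℓ) ∈ locLat ℓ (ordLat O)}
  mul_mem' := by
    rintro x y ⟨hx, hx'⟩ ⟨hy, hy'⟩
    refine ⟨?_, ?_⟩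
    · rw [Units.val_mul]; exact mul_mem_locLat hx hy
    · rw [mul_inv_rev, Units.val_mul]; exact mul_mem_locLat hy' hx'
  one_mem' := ⟨one_mem_locLat, by rw [inv_one]; exact one_mem_locLat⟩
  inv_mem' := by
    rintro x ⟨hx, hx'⟩
    exact ⟨hx', by rwa [inv_inv]⟩

variable {O : Subalgebra ℤ B}

theorem mem_locUnits {u : (Bloc B ℓ)ˣ} : u ∈ locUnits O ℓ ↔
    (u : Bloc B ℓ) ∈ locLat ℓ (ordLat O) ∧ (↑u⁻¹ : Bloc B ℓ) ∈ locLat ℓ (ordLat O) := Iff.rfl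

theorem locRmul_le_iff {x y : (Bloc B ℓ)ˣ} :
    locRmul (locLat ℓ (ordLat O)) (x : Bloc B ℓ) ≤ locRmul (locLat ℓ (ordLat O)) (y : Bloc B ℓ) ↔
      (x : Bloc B ℓ) * (↑y⁻¹ : Bloc B ℓ) ∈ locLat ℓ (ordLat O) := by
  constructor
  · intro h
    exact mem_locRmul.1 (h (mem_locRmul.2 (by rw [Units.mul_inv]; exact one_mem_locLat)))
  · intro h z hz
    rw [mem_locRmul] at hz ⊢
    have := mul_mem_locLat hz h
    rwa [mul_assoc, Units.inv_mul_cancel_left] at this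

theorem locRmul_eq_iff {x y : (Bloc B ℓ)ˣ} :
    locRmul (locLat ℓ (ordLat O)) (x : Bloc B ℓ) = locRmul (locLat ℓ (ordLat O)) (y : Bloc B ℓ) ↔
      x * y⁻¹ ∈ locUnits O ℓ := by
  rw [le_antisymm_iff, locRmul_le_iff, locRmul_le_iff, mem_locUnits, mul_inv_rev, inv_inv,
    Units.val_mul, Units.val_mul]

theorem locRmul_one (M : Submodule ℤ_[ℓ] (Bloc B ℓ)) :
    locRmul M ((1 : (Bloc B ℓ)ˣ) : Bloc B ℓ) = M := by
  ext z; rw [mem_locRmul]; simp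

theorem mul_toLoc_mem {L : Submodule ℤ B} {M : Submodule ℤ_[ℓ] (Bloc B ℓ)} {b : Bloc B ℓ}
    (h : ∀ a ∈ L, toLoc ℓ a * b ∈ M) {z : Bloc B ℓ} (hz : z ∈ locLat ℓ L) : z * b ∈ M := by
  have h1 : locLat ℓ L ≤ M.comap (LinearMap.mulRight ℤ_[ℓ] b) :=
    locLat_le_iff.2 fun a ha => h a ha
  exact h1 hz

theorem toLoc_mul_mem {L : Submodule ℤ B} {M : Submodule ℤ_[ℓ] (Bloc B ℓ)} {b : Bloc B ℓ}
    (h : ∀ a ∈ L, b * toLoc ℓ a ∈ M) {z : Bloc B ℓ} (hz : z ∈ locLat ℓ L) : b * z ∈ M := by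
  have h1 : locLat ℓ L ≤ M.comap (LinearMap.mulLeft ℤ_[ℓ] b) :=
    locLat_le_iff.2 fun a ha => h a ha
  exact h1 hz

/-- The unit `u` of `B_ℓ` with values the image of a global unit. -/
noncomputable def unitLoc (ℓ : ℕ) [Fact ℓ.Prime] : Bˣ →* (Bloc B ℓ)ˣ :=
  Units.map (toLoc ℓ : B →ₐ[ℚ] Bloc B ℓ)

theorem coe_unitLoc (b : Bˣ) : (unitLoc ℓ b : Bloc B ℓ) = toLoc ℓ (b : B) := rfl

end

/-- Families of local units, almost all of them in the unit groups of the completions of `O`. -/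
def AEUnit (O : Subalgebra ℤ B) (x : ∀ ℓ : Nat.Primes, (Bloc B (ℓ : ℕ))ˣ) : Prop :=
  {ℓ : Nat.Primes | x ℓ ∉ locUnits O (ℓ : ℕ)}.Finite

/-- The lattice `O x`. -/
noncomputable def idl (O : Subalgebra ℤ B) (x : ∀ ℓ : Nat.Primes, (Bloc B (ℓ : ℕ))ˣ) :
    Submodule ℤ B :=
  globalLat fun ℓ => locRmul (locLat (ℓ : ℕ) (ordLat O)) (x ℓ : Bloc B (ℓ : ℕ))

variable {O : Subalgebra ℤ B} {x y : ∀ ℓ : Nat.Primes, (Bloc B (ℓ : ℕ))ˣ}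

theorem AEUnit.mul (hx : AEUnit O x) (hy : AEUnit O y) : AEUnit O (x * y) := by
  refine (Set.Finite.union hx hy).subset fun ℓ hℓ => ?_
  by_contra hcon
  rw [Set.mem_union, not_or] at hcon
  exact hℓ (mul_mem (not_not.1 hcon.1) (not_not.1 hcon.2))

theorem aeUnit_one : AEUnit O 1 :=
  Set.finite_empty.subset fun ℓ hℓ => hℓ (one_mem (locUnits O (ℓ : ℕ)))

theorem aeUnit_of_eventually_eq (hx : AEUnit O x) (h : {ℓ | y ℓ ≠ x ℓ}.Finite) : AEUnit O y := by
  refine (Set.Finite.union hx h).subset fun ℓ hℓ => ?_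
  by_contra hcon
  rw [Set.mem_union, not_or] at hcon
  have h1 : y ℓ = x ℓ := not_not.1 hcon.2
  refine hℓ ?_
  rw [h1]; exact not_not.1 hcon.1

section

theorem finite_locRmul_ne (hx : AEUnit O x) :
    {ℓ : Nat.Primes | locRmul (locLat (ℓ : ℕ) (ordLat O)) (x ℓ : Bloc B (ℓ : ℕ)) ≠
      locLat (ℓ : ℕ) (ordLat O)}.Finite := by
  refine Set.Finite.subset hx fun ℓ hℓ h' => hℓ ?_
  conv_rhs => rw [← locRmul_one (locLat (ℓ : ℕ) (ordLat O))]
  rw [locRmul_eq_iff, inv_one, mul_one]; exact h'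

theorem isLatticeIn_idl (hO : IsLatticeIn (ordLat O)) (hx : AEUnit O x) :
    IsLatticeIn (idl O x) :=
  isLatticeIn_globalLat hO (fun ℓ => isLattice_locRmul (hO.isLattice_locLat _) (x ℓ))
    (finite_locRmul_ne hx)

theorem locLat_idl (hO : IsLatticeIn (ordLat O)) (hx : AEUnit O x) (ℓ : Nat.Primes) :
    locLat (ℓ : ℕ) (idl O x) = locRmul (locLat (ℓ : ℕ) (ordLat O)) (x ℓ : Bloc B (ℓ : ℕ)) :=
  locLat_globalLat hO (fun ℓ => isLattice_locRmul (hO.isLattice_locLat _) (x ℓ))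
    (finite_locRmul_ne hx) ℓ

theorem mem_idl {b : B} : b ∈ idl O x ↔ ∀ ℓ : Nat.Primes,
    toLoc (ℓ : ℕ) b * (↑(x ℓ)⁻¹ : Bloc B (ℓ : ℕ)) ∈ locLat (ℓ : ℕ) (ordLat O) :=
  forall_congr' fun _ => mem_locRmul

theorem idl_one (hO : IsLatticeIn (ordLat O)) : idl O 1 = ordLat O := by
  rw [← globalLat_locLat hO, idl]
  congr 1
  ext1 ℓ
  exact locRmul_one _

theorem eq_idl_of_locLat {L : Submodule ℤ B} (hL : IsLatticeIn L)
    (h : ∀ ℓ : Nat.Primes, locLat (ℓ : ℕ) L =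
      locRmul (locLat (ℓ : ℕ) (ordLat O)) (x ℓ : Bloc B (ℓ : ℕ))) : L = idl O x := by
  rw [← globalLat_locLat hL, idl]
  congr 1
  ext1 ℓ
  exact h ℓ

theorem aeUnit_of_locLat (hO : IsLatticeIn (ordLat O)) {L : Submodule ℤ B} (hL : IsLatticeIn L)
    (h : ∀ ℓ : Nat.Primes, locLat (ℓ : ℕ) L =
      locRmul (locLat (ℓ : ℕ) (ordLat O)) (x ℓ : Bloc B (ℓ : ℕ))) : AEUnit O x := by
  refine (hL.finite_locLat_ne hO).subset fun ℓ hℓ h' => hℓ ?_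
  rw [h ℓ] at h'
  conv_rhs at h' => rw [← locRmul_one (locLat (ℓ : ℕ) (ordLat O))]
  rwa [locRmul_eq_iff, inv_one, mul_one] at h'

theorem isLeftIdeal_idl (hO : IsLatticeIn (ordLat O)) (hx : AEUnit O x) :
    IsLeftIdeal O (idl O x) :=
  ⟨isLatticeIn_idl hO hx, fun ℓ _ => ⟨x ⟨ℓ, Fact.out⟩, locLat_idl hO hx ⟨ℓ, Fact.out⟩⟩⟩

theorem isLeftIdeal_iff (hO : IsLatticeIn (ordLat O)) {L : Submodule ℤ B} :
    IsLeftIdeal O L ↔ ∃ x, AEUnit O x ∧ L = idl O x := by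
  constructor
  · rintro ⟨hL, hloc⟩
    choose x hx using fun ℓ : Nat.Primes => hloc (ℓ : ℕ)
    exact ⟨x, aeUnit_of_locLat hO hL hx, eq_idl_of_locLat hL hx⟩
  · rintro ⟨x, hx, rfl⟩
    exact isLeftIdeal_idl hO hx

theorem idl_eq_iff (hO : IsLatticeIn (ordLat O)) (hx : AEUnit O x) (hy : AEUnit O y) :
    idl O x = idl O y ↔ ∀ ℓ : Nat.Primes, x ℓ * (y ℓ)⁻¹ ∈ locUnits O (ℓ : ℕ) := by
  constructor
  · intro h ℓ
    rw [← locRmul_eq_iff, ← locLat_idl hO hx, h, locLat_idl hO hy]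
  · intro h
    refine eq_idl_of_locLat (isLatticeIn_idl hO hx) fun ℓ => ?_
    rw [locLat_idl hO hx, locRmul_eq_iff]; exact h ℓ

theorem mem_rightOrder_idl (hO : IsLatticeIn (ordLat O)) (hx : AEUnit O x) {b : B} :
    b ∈ rightOrder (idl O x) ↔ ∀ ℓ : Nat.Primes,
      (x ℓ : Bloc B (ℓ : ℕ)) * toLoc (ℓ : ℕ) b * (↑(x ℓ)⁻¹ : Bloc B (ℓ : ℕ)) ∈
        locLat (ℓ : ℕ) (ordLat O) := by
  constructor
  · intro h ℓ
    rw [← mem_locRmul, ← locLat_idl hO hx]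
    refine mul_toLoc_mem (L := idl O x) (fun a ha => ?_) ?_
    · rw [← map_mul]; exact toLoc_mem_locLat (h a ha)
    · rw [locLat_idl hO hx, mem_locRmul, Units.mul_inv]; exact one_mem_locLat
  · intro h a ha
    rw [mem_idl] at ha ⊢
    intro ℓ
    have := mul_mem_locLat (ha ℓ) (h ℓ)
    rw [map_mul]
    simpa only [mul_assoc, Units.inv_mul_cancel_left] using this

/-- By density the condition may be tested on the local generator x, which gives x b x ∈ O x, hence
x b ∈ O. -/
theorem mem_latInv_idl (hO : IsLatticeIn (ordLat O)) (hx : AEUnit O x) {b : B} :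
    b ∈ latInv (idl O x) ↔ ∀ ℓ : Nat.Primes,
      (x ℓ : Bloc B (ℓ : ℕ)) * toLoc (ℓ : ℕ) b ∈ locLat (ℓ : ℕ) (ordLat O) := by
  constructor
  · intro h ℓ
    have hxL : (x ℓ : Bloc B (ℓ : ℕ)) ∈ locLat (ℓ : ℕ) (idl O x) := by
      rw [locLat_idl hO hx, mem_locRmul, Units.mul_inv]; exact one_mem_locLat
    have h1 : (x ℓ : Bloc B (ℓ : ℕ)) * (toLoc (ℓ : ℕ) b * (x ℓ : Bloc B (ℓ : ℕ))) ∈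
        locLat (ℓ : ℕ) (idl O x) := by
      refine mul_toLoc_mem (L := idl O x) (fun a ha => ?_) hxL
      rw [← mul_assoc]
      refine toLoc_mul_mem (L := idl O x) (fun a' ha' => ?_) hxL
      rw [← map_mul, ← map_mul]
      exact toLoc_mem_locLat (h a ha a' ha')
    rw [locLat_idl hO hx, mem_locRmul] at h1
    simpa only [mul_assoc, Units.mul_inv, mul_one] using h1
  · intro h a ha a' ha'
    rw [mem_idl] at ha ha' ⊢
    intro ℓ
    have := mul_mem_locLat (mul_mem_locLat (ha ℓ) (h ℓ)) (ha' ℓ)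
    rw [map_mul, map_mul]
    simpa only [mul_assoc, Units.inv_mul_cancel_left] using this

theorem locLat_latInv_idl (hO : IsLatticeIn (ordLat O)) (hx : AEUnit O x) (ℓ : Nat.Primes) :
    locLat (ℓ : ℕ) (latInv (idl O x)) =
      locLmul (↑(x ℓ)⁻¹ : Bloc B (ℓ : ℕ)) (locLat (ℓ : ℕ) (ordLat O)) := by
  have h1 : latInv (idl O x) = globalLat fun ℓ =>
      locLmul (↑(x ℓ)⁻¹ : Bloc B (ℓ : ℕ)) (locLat (ℓ : ℕ) (ordLat O)) := by
    ext b
    rw [mem_latInv_idl hO hx]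
    refine forall_congr' fun ℓ => ?_
    rw [mem_locLmul, inv_inv]; rfl
  rw [h1]
  refine locLat_globalLat hO (M := fun ℓ : Nat.Primes =>
    locLmul (↑(x ℓ)⁻¹ : Bloc B (ℓ : ℕ)) (locLat (ℓ : ℕ) (ordLat O)))
    (fun ℓ => isLattice_locLmul (hO.isLattice_locLat _) (x ℓ)⁻¹) ?_ ℓ
  refine Set.Finite.subset hx fun ℓ hℓ h' => hℓ ?_
  ext z
  rw [mem_locLmul, inv_inv]
  constructor
  · intro h
    have := mul_mem_locLat h'.2 h
    rwa [Units.inv_mul_cancel_left] at this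
  · exact mul_mem_locLat h'.1

/-- The family `x` normalizes the completions of `O`. -/
def Normalizes (O : Subalgebra ℤ B) (x : ∀ ℓ : Nat.Primes, (Bloc B (ℓ : ℕ))ˣ) : Prop :=
  ∀ ℓ : Nat.Primes, ∀ u ∈ locLat (ℓ : ℕ) (ordLat O),
    (x ℓ : Bloc B (ℓ : ℕ)) * u * (↑(x ℓ)⁻¹ : Bloc B (ℓ : ℕ)) ∈ locLat (ℓ : ℕ) (ordLat O)

theorem locRmul_mul_locRmul {ℓ : ℕ} [Fact ℓ.Prime] {m x : (Bloc B ℓ)ˣ}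
    (hm : ∀ u ∈ locLat ℓ (ordLat O), (m : Bloc B ℓ) * u * (↑m⁻¹ : Bloc B ℓ) ∈ locLat ℓ (ordLat O)) :
    locRmul (locLat ℓ (ordLat O)) (m : Bloc B ℓ) * locRmul (locLat ℓ (ordLat O)) (x : Bloc B ℓ) =
      locRmul (locLat ℓ (ordLat O)) ((m * x : (Bloc B ℓ)ˣ) : Bloc B ℓ) := by
  apply le_antisymm
  · rw [Submodule.mul_le]
    rintro _ ⟨a, ha, rfl⟩ _ ⟨b, hb, rfl⟩
    rw [mem_locRmul]
    have := mul_mem_locLat ha (hm b hb)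
    simp only [LinearMap.mulRight_apply, mul_inv_rev, Units.val_mul]
    simpa only [mul_assoc, Units.mul_inv_cancel_left] using this
  · rintro _ ⟨a, ha, rfl⟩
    rw [LinearMap.mulRight_apply, Units.val_mul, ← mul_assoc]
    exact Submodule.mul_mem_mul (mem_locRmul.2 (by simpa using ha))
      (mem_locRmul.2 (by rw [Units.mul_inv]; exact one_mem_locLat))

theorem idl_mul_idl (hO : IsLatticeIn (ordLat O)) (hx : AEUnit O x) (hy : AEUnit O y)
    (hn : Normalizes O x) : idl O x * idl O y = idl O (x * y) := by
  refine eq_idl_of_locLat ((isLatticeIn_idl hO hx).mul (isLatticeIn_idl hO hy)) fun ℓ => ?_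
  rw [locLat_mul, locLat_idl hO hx, locLat_idl hO hy, locRmul_mul_locRmul (hn ℓ)]; rfl

theorem rmul_idl (b : Bˣ) :
    rmul (idl O x) (b : B) = idl O (x * fun ℓ : Nat.Primes => unitLoc (ℓ : ℕ) b) := by
  have hl : rmul (idl O x) (b : B) = idl O (x * fun ℓ : Nat.Primes => unitLoc (ℓ : ℕ) b) := by
    ext z
    constructor
    · rintro ⟨a, ha, rfl⟩
      rw [SetLike.mem_coe, mem_idl] at ha
      rw [mem_idl]
      intro ℓ
      rw [LinearMap.mulRight_apply, map_mul, ← coe_unitLoc, Pi.mul_apply, mul_inv_rev,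
        Units.val_mul, mul_assoc, Units.mul_inv_cancel_left]
      exact ha ℓ
    · intro hz
      rw [mem_idl] at hz
      refine ⟨z * ↑b⁻¹, ?_, by simp⟩
      rw [SetLike.mem_coe, mem_idl]
      intro ℓ
      have := hz ℓ
      rw [Pi.mul_apply, mul_inv_rev, Units.val_mul, ← mul_assoc] at this
      rwa [map_mul, ← coe_unitLoc, map_inv]
  exact hl

theorem finite_toLoc_notMem (hO : IsLatticeIn (ordLat O)) (b : B) :
    {ℓ : Nat.Primes | toLoc (ℓ : ℕ) b ∉ locLat (ℓ : ℕ) (ordLat O)}.Finite := by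
  obtain ⟨k, hk0, hk⟩ := hO.exists_nsmul_mem b
  have hfin : {ℓ : Nat.Primes | (ℓ : ℕ) ∣ k}.Finite :=
    Set.Finite.of_finite_image (f := ((↑) : Nat.Primes → ℕ))
      ((Set.finite_Iic k).subset (by rintro _ ⟨ℓ, hℓ, rfl⟩; exact Nat.le_of_dvd hk0 hℓ))
      Nat.Primes.coe_nat_injective.injOn
  refine hfin.subset fun ℓ hℓ => ?_
  by_contra hcon
  refine hℓ (mem_of_nsmul_mem (N := k) ((Nat.Prime.coprime_iff_not_dvd ℓ.2).2 hcon).symm ?_)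
  rw [← map_nsmul]; exact toLoc_mem_locLat hk

theorem aeUnit_unitLoc (hO : IsLatticeIn (ordLat O)) (b : Bˣ) :
    AEUnit O fun ℓ => unitLoc (ℓ : ℕ) b := by
  refine ((finite_toLoc_notMem hO (b : B)).union (finite_toLoc_notMem hO (↑b⁻¹ : B))).subset
    fun ℓ hℓ => ?_
  by_contra hcon
  rw [Set.mem_union, not_or] at hcon
  refine hℓ ⟨not_not.1 hcon.1, ?_⟩
  rw [← map_inv]; exact not_not.1 hcon.2

/-- Locally the product is x⁻¹ O y x. This translates membership in 𝔞⁻¹𝔭𝔞 into a condition on x b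
x⁻¹ at each prime. -/
theorem mem_latInv_mul_mul (hO : IsLatticeIn (ordLat O)) (hx : AEUnit O x) (hy : AEUnit O y)
    (hn : Normalizes O y) {b : B} :
    b ∈ latInv (idl O x) * idl O y * idl O x ↔ ∀ ℓ : Nat.Primes,
      (x ℓ : Bloc B (ℓ : ℕ)) * toLoc (ℓ : ℕ) b * (↑(x ℓ)⁻¹ : Bloc B (ℓ : ℕ)) ∈
        locRmul (locLat (ℓ : ℕ) (ordLat O)) (y ℓ : Bloc B (ℓ : ℕ)) := by
  have hone : ∀ (ℓ : Nat.Primes) (z : (Bloc B (ℓ : ℕ))ˣ),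
      (z : Bloc B (ℓ : ℕ)) ∈ locRmul (locLat (ℓ : ℕ) (ordLat O)) (z : Bloc B (ℓ : ℕ)) :=
    fun ℓ z => mem_locRmul.2 (by rw [Units.mul_inv]; exact one_mem_locLat)
  have hloc : ∀ ℓ : Nat.Primes, locLat (ℓ : ℕ) (latInv (idl O x) * idl O y * idl O x) =
      locLmul (↑(x ℓ)⁻¹ : Bloc B (ℓ : ℕ)) (locLat (ℓ : ℕ) (ordLat O)) *
        locRmul (locLat (ℓ : ℕ) (ordLat O)) ((y ℓ * x ℓ : (Bloc B (ℓ : ℕ))ˣ) : Bloc B (ℓ : ℕ)) := by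
    intro ℓ
    rw [mul_assoc, locLat_mul, locLat_mul, locLat_latInv_idl hO hx, locLat_idl hO hy,
      locLat_idl hO hx, locRmul_mul_locRmul (hn ℓ)]
  have hmem : ∀ ℓ : Nat.Primes, toLoc (ℓ : ℕ) b ∈
      locLat (ℓ : ℕ) (latInv (idl O x) * idl O y * idl O x) ↔
      (x ℓ : Bloc B (ℓ : ℕ)) * toLoc (ℓ : ℕ) b * (↑(x ℓ)⁻¹ : Bloc B (ℓ : ℕ)) ∈
        locRmul (locLat (ℓ : ℕ) (ordLat O)) (y ℓ : Bloc B (ℓ : ℕ)) := by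
    intro ℓ
    rw [hloc]
    constructor
    · intro h
      have hle : locLmul (↑(x ℓ)⁻¹ : Bloc B (ℓ : ℕ)) (locLat (ℓ : ℕ) (ordLat O)) *
        locRmul (locLat (ℓ : ℕ) (ordLat O)) ((y ℓ * x ℓ : (Bloc B (ℓ : ℕ))ˣ) : Bloc B (ℓ : ℕ)) ≤
          locLmul (↑(x ℓ)⁻¹ : Bloc B (ℓ : ℕ))
            (locRmul (locRmul (locLat (ℓ : ℕ) (ordLat O)) (y ℓ : Bloc B (ℓ : ℕ)))
              (x ℓ : Bloc B (ℓ : ℕ))) := by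
        rw [Submodule.mul_le]
        rintro _ ⟨a, ha, rfl⟩ c hc
        rw [mem_locRmul, mul_inv_rev, Units.val_mul, ← mul_assoc] at hc
        rw [mem_locLmul, mem_locRmul, mem_locRmul, inv_inv, LinearMap.mulLeft_apply]
        have := mul_mem_locLat ha hc
        simpa only [mul_assoc, Units.mul_inv_cancel_left] using this
      have := hle h
      rwa [mem_locLmul, mem_locRmul, inv_inv] at this
    · intro h
      rw [mem_locRmul] at h
      have h1 : toLoc (ℓ : ℕ) b = ((↑(x ℓ)⁻¹ : Bloc B (ℓ : ℕ)) *
          ((x ℓ : Bloc B (ℓ : ℕ)) * toLoc (ℓ : ℕ) b * (↑(x ℓ)⁻¹ : Bloc B (ℓ : ℕ)) *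
            (↑(y ℓ)⁻¹ : Bloc B (ℓ : ℕ)))) * ((y ℓ * x ℓ : (Bloc B (ℓ : ℕ))ˣ) : Bloc B (ℓ : ℕ)) := by
        simp only [Units.val_mul, mul_assoc, Units.inv_mul_cancel_left, Units.inv_mul, mul_one]
      rw [h1]
      exact Submodule.mul_mem_mul ⟨_, h, rfl⟩ (hone ℓ _)
  have hlat : ∀ ℓ : Nat.Primes, Submodule.IsLattice ℚ_[(ℓ : ℕ)]
      (locLmul (↑(x ℓ)⁻¹ : Bloc B (ℓ : ℕ)) (locLat (ℓ : ℕ) (ordLat O))) := fun ℓ =>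
    isLattice_locLmul (hO.isLattice_locLat _) (x ℓ)⁻¹
  have hinvlat : IsLatticeIn (latInv (idl O x)) := by
    have h1 : latInv (idl O x) = globalLat fun ℓ =>
        locLmul (↑(x ℓ)⁻¹ : Bloc B (ℓ : ℕ)) (locLat (ℓ : ℕ) (ordLat O)) := by
      ext b
      rw [mem_latInv_idl hO hx]
      refine forall_congr' fun ℓ => ?_
      rw [mem_locLmul, inv_inv]; rfl
    rw [h1]
    refine isLatticeIn_globalLat hO hlat ?_
    refine Set.Finite.subset hx fun ℓ hℓ h' => hℓ ?_
    ext z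
    rw [mem_locLmul, inv_inv]
    constructor
    · intro h
      have := mul_mem_locLat h'.2 h
      rwa [Units.inv_mul_cancel_left] at this
    · exact mul_mem_locLat h'.1
  constructor
  · intro h ℓ
    exact (hmem ℓ).1 (toLoc_mem_locLat h)
  · intro h
    refine ((hinvlat.mul (isLatticeIn_idl hO hy)).mul (isLatticeIn_idl hO hx)).mem_of_forall_loc
      fun ℓ _ => ?_
    exact (hmem ⟨ℓ, Fact.out⟩).2 (h ⟨ℓ, Fact.out⟩)

end

end LeftIdeals

/-! ### Norms of ideals, and ideals concentrated at p. -/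

section BilateralIdeals

variable {p : ℕ} [Fact p.Prime] {B : Type*} [Ring B] [Algebra ℚ B] {Ot : Subalgebra ℤ B}

theorem nrdF_toLoc (h : QuatLike ℚ B) (ℓ : ℕ) [Fact ℓ.Prime] (b : B) :
    nrdF ℚ_[ℓ] (toLoc ℓ b) = (nrd b : ℚ_[ℓ]) := by
  rw [toLoc_apply, nrdF_one_tmul h.finrank, eq_ratCast]; rfl

theorem trdF_toLoc (h : QuatLike ℚ B) (ℓ : ℕ) [Fact ℓ.Prime] (b : B) :
    trdF ℚ_[ℓ] (toLoc ℓ b) = (trd b : ℚ_[ℓ]) := by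
  rw [toLoc_apply, trdF_one_tmul h.finrank, eq_ratCast]; rfl

theorem norm_natCast_eq_one_of_ne {ℓ : ℕ} [Fact ℓ.Prime] (h : ℓ ≠ p) : ‖(p : ℚ_[ℓ])‖ = 1 := by
  rw [Padic.norm_natCast_eq_one_iff]
  exact (Nat.coprime_primes Fact.out Fact.out).2 h

theorem algebraMap_mem_locLat {ℓ : ℕ} [Fact ℓ.Prime] {c : ℚ_[ℓ]} (hc : ‖c‖ ≤ 1) :
    algebraMap ℚ_[ℓ] (Bloc B ℓ) c ∈ locLat ℓ (ordLat Ot) := by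
  rw [Algebra.algebraMap_eq_smul_one]
  exact (locLat ℓ (ordLat Ot)).smul_mem (Padic.toInt c hc) one_mem_locLat

namespace LocalStructure

variable {κ : Type*} [Field κ] [Fintype κ] (S : LocalStructure p Ot κ)

theorem quatLoc (S : LocalStructure p Ot κ) (ℓ : ℕ) [Fact ℓ.Prime] :
    QuatLike ℚ_[ℓ] (Bloc B ℓ) := S.quat.baseChange

theorem norm_nrd_le (S : LocalStructure p Ot κ) {ℓ : ℕ} [Fact ℓ.Prime] {x : Bloc B ℓ}
    (hx : x ∈ locLat ℓ (ordLat Ot)) : ‖nrdF ℚ_[ℓ] x‖ ≤ 1 := by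
  rcases eq_or_ne ℓ p with rfl | h
  · exact ((S.mem_iff x).1 hx).1
  · exact (S.split ℓ h).norm_nrd_le hx

theorem norm_trd_le (S : LocalStructure p Ot κ) {ℓ : ℕ} [Fact ℓ.Prime] {x : Bloc B ℓ}
    (hx : x ∈ locLat ℓ (ordLat Ot)) : ‖trdF ℚ_[ℓ] x‖ ≤ 1 := by
  rcases eq_or_ne ℓ p with rfl | h
  · exact S.div.norm_trd_le_one ((S.mem_iff x).1 hx).1
  · exact (S.split ℓ h).norm_trd_le hx

/-- The inverse is the conjugate divided by the norm, and conjugation preserves the local order. -/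
theorem mem_locUnits_iff (S : LocalStructure p Ot κ) {ℓ : ℕ} [Fact ℓ.Prime]
    {u : (Bloc B ℓ)ˣ} : u ∈ locUnits Ot ℓ ↔
      (u : Bloc B ℓ) ∈ locLat ℓ (ordLat Ot) ∧ ‖nrdF ℚ_[ℓ] (u : Bloc B ℓ)‖ = 1 := by
  have hq := S.quatLoc ℓ
  rw [mem_locUnits]
  refine and_congr_right fun h => ⟨fun h' => ?_, fun h' => ?_⟩
  · have h1 := S.norm_nrd_le h
    have h2 := S.norm_nrd_le h'
    rw [hq.nrd_inv, norm_inv] at h2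
    have h0 : 0 < ‖nrdF ℚ_[ℓ] (u : Bloc B ℓ)‖ :=
      norm_pos_iff.2 (hq.nrd_ne_zero_of_isUnit u.isUnit)
    exact le_antisymm h1 ((inv_le_one₀ h0).1 h2)
  · rw [hq.inv_eq]
    have h2 : conjF ℚ_[ℓ] (u : Bloc B ℓ) ∈ locLat ℓ (ordLat Ot) :=
      sub_mem (algebraMap_mem_locLat (S.norm_trd_le h)) h
    exact (locLat ℓ (ordLat Ot)).smul_mem (Padic.toInt _ (by rw [norm_inv, h', inv_one])) h2

theorem mem_locUnits_self_iff (S : LocalStructure p Ot κ) {u : (Bloc B p)ˣ} :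
    u ∈ locUnits Ot p ↔ ‖nrdF ℚ_[p] (u : Bloc B p)‖ = 1 ∧ S.R.res u ^ p = S.R.res u := by
  rw [S.mem_locUnits_iff, S.mem_iff]
  constructor
  · rintro ⟨⟨-, h⟩, h'⟩; exact ⟨h', h⟩
  · rintro ⟨h, h'⟩; exact ⟨⟨h.le, h'⟩, h⟩

theorem norm_nrd_one_add (S : LocalStructure p Ot κ) {ℓ : ℕ} [Fact ℓ.Prime] {c : Bloc B ℓ}
    (hc : c ∈ locLat ℓ (ordLat Ot)) : ‖nrdF ℚ_[ℓ] (1 + ℓ • c)‖ = 1 := by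
  have hℓ : ‖(ℓ : ℚ_[ℓ])‖ < 1 := Padic.norm_p_lt_one
  rw [← Nat.cast_smul_eq_nsmul ℚ_[ℓ], (S.quatLoc ℓ).nrd_one_add, trdF_smul, (S.quatLoc ℓ).nrd_smul,
    add_assoc]
  have h1 : ‖(ℓ : ℚ_[ℓ]) * trdF ℚ_[ℓ] c + (ℓ : ℚ_[ℓ]) ^ 2 * nrdF ℚ_[ℓ] c‖ < 1 := by
    refine (Padic.nonarchimedean _ _).trans_lt (max_lt ?_ ?_)
    · rw [norm_mul]
      exact mul_lt_one_of_nonneg_of_lt_one_left (norm_nonneg _) hℓ (S.norm_trd_le hc)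
    · rw [norm_mul]
      refine mul_lt_one_of_nonneg_of_lt_one_left (norm_nonneg _) ?_ (S.norm_nrd_le hc)
      rw [norm_pow]; exact pow_lt_one₀ (norm_nonneg _) hℓ two_ne_zero
  rw [Padic.add_eq_max_of_ne (by rw [norm_one]; exact h1.ne'), norm_one, max_eq_left h1.le]

variable {x y : ∀ ℓ : Nat.Primes, (Bloc B (ℓ : ℕ))ˣ}

/-- Approximating x_ℓ modulo ℓ gives an element of the ideal whose norm has the same ℓ-adic size as
that of the local generator. -/
theorem exists_mem_idl_near (hO : IsLatticeIn (ordLat Ot)) (hx : AEUnit Ot x) (ℓ : Nat.Primes) :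
    ∃ b ∈ idl Ot x, ∃ c ∈ locLat (ℓ : ℕ) (ordLat Ot),
      toLoc (ℓ : ℕ) b = (1 + (ℓ : ℕ) • c) * (x ℓ : Bloc B (ℓ : ℕ)) := by
  have hxL : (x ℓ : Bloc B (ℓ : ℕ)) ∈ locLat (ℓ : ℕ) (idl Ot x) := by
    rw [locLat_idl hO hx, mem_locRmul, Units.mul_inv]; exact one_mem_locLat
  obtain ⟨b, hb, z, hz, h⟩ := exists_approx 1 hxL
  rw [locLat_idl hO hx, mem_locRmul] at hz
  refine ⟨b, hb, -(z * (↑(x ℓ)⁻¹ : Bloc B (ℓ : ℕ))), neg_mem hz, ?_⟩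
  rw [pow_one] at h
  rw [add_mul, one_mul, smul_neg, neg_mul, smul_mul_assoc, mul_assoc, Units.inv_mul, mul_one,
    ← sub_eq_add_neg]
  exact eq_sub_of_add_eq h.symm

theorem norm_nrd_le_of_mem_idl (S : LocalStructure p Ot κ) {b : B} (hb : b ∈ idl Ot x)
    (ℓ : Nat.Primes) :
    ‖(nrd b : ℚ_[(ℓ : ℕ)])‖ ≤ ‖nrdF ℚ_[(ℓ : ℕ)] (x ℓ : Bloc B (ℓ : ℕ))‖ := by
  have h1 := S.norm_nrd_le (mem_idl.1 hb ℓ)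
  have h0 : 0 < ‖nrdF ℚ_[(ℓ : ℕ)] (x ℓ : Bloc B (ℓ : ℕ))‖ :=
    norm_pos_iff.2 ((S.quatLoc _).nrd_ne_zero_of_isUnit (x ℓ).isUnit)
  rw [(S.quatLoc _).nrd_mul, (S.quatLoc _).nrd_inv, norm_mul, norm_inv, nrdF_toLoc S.quat,
    ← div_eq_mul_inv, div_le_one h0] at h1
  exact h1

theorem exists_mem_idl_norm_eq (S : LocalStructure p Ot κ) (hx : AEUnit Ot x) (ℓ : Nat.Primes) :
    ∃ b ∈ idl Ot x,
      ‖(nrd b : ℚ_[(ℓ : ℕ)])‖ = ‖nrdF ℚ_[(ℓ : ℕ)] (x ℓ : Bloc B (ℓ : ℕ))‖ := by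
  obtain ⟨b, hb, c, hc, h⟩ := exists_mem_idl_near S.lat hx ℓ
  refine ⟨b, hb, ?_⟩
  rw [← nrdF_toLoc S.quat, h, (S.quatLoc _).nrd_mul, norm_mul, S.norm_nrd_one_add hc, one_mul]

theorem norm_le_of_mem_span (S : LocalStructure p Ot κ) {q : ℚ}
    (hq : q ∈ Submodule.span ℤ (nrd '' (idl Ot x : Set B))) (ℓ : Nat.Primes) :
    ‖(q : ℚ_[(ℓ : ℕ)])‖ ≤ ‖nrdF ℚ_[(ℓ : ℕ)] (x ℓ : Bloc B (ℓ : ℕ))‖ := by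
  induction hq using Submodule.span_induction with
  | mem q hq =>
    obtain ⟨b, hb, rfl⟩ := hq
    exact S.norm_nrd_le_of_mem_idl hb ℓ
  | zero => simp
  | add a b _ _ ha hb =>
    rw [Rat.cast_add]
    exact (Padic.nonarchimedean _ _).trans (max_le ha hb)
  | smul n a _ ha =>
    rw [zsmul_eq_mul, Rat.cast_mul, Rat.cast_intCast, norm_mul]
    exact mul_le_of_le_one_left (norm_nonneg _) (Padic.norm_int_le_one n) |>.trans ha

theorem span_nrd_idl (S : LocalStructure p Ot κ) (hx : AEUnit Ot x) {n : ℕ} (hn : 0 < n)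
    (h : ∀ ℓ : Nat.Primes,
      ‖nrdF ℚ_[(ℓ : ℕ)] (x ℓ : Bloc B (ℓ : ℕ))‖ = ‖(n : ℚ_[(ℓ : ℕ)])‖) :
    Submodule.span ℤ (nrd '' (idl Ot x : Set B)) = Submodule.span ℤ {(n : ℚ)} := by
  have hn0 : (n : ℚ) ≠ 0 := by exact_mod_cast hn.ne'
  have hloc : ∀ ℓ : ℕ, [Fact ℓ.Prime] → ‖(n : ℚ_[ℓ])‖ ≠ 0 := fun ℓ _ =>
    norm_ne_zero_iff.2 (by exact_mod_cast hn.ne')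
  have hint : ∀ q ∈ Submodule.span ℤ (nrd '' (idl Ot x : Set B)), ∃ m : ℤ, q = m * n := by
    intro q hq
    obtain ⟨m, hm⟩ := rat_eq_int_of_padic_norm (q := q / n) fun ℓ _ => by
      have := (S.norm_le_of_mem_span hq ⟨ℓ, Fact.out⟩).trans_eq (h _)
      rw [Rat.cast_div, norm_div, Rat.cast_natCast]
      exact div_le_one_of_le₀ this (norm_nonneg _)
    exact ⟨m, by rw [hm, div_mul_cancel₀ _ hn0]⟩
  apply le_antisymm
  · intro q hq
    obtain ⟨m, rfl⟩ := hint q hq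
    exact Submodule.mem_span_singleton.2 ⟨m, by rw [zsmul_eq_mul]⟩
  · rw [Submodule.span_singleton_le_iff_mem]
    let f : ℤ →ₗ[ℤ] ℚ := LinearMap.toSpanSingleton ℤ ℚ (n : ℚ)
    -- The multiples of n in the span form an ideal of ℤ. No prime ℓ divides its generator, since
    -- some element of the lattice has norm of exactly the ℓ-adic size of n.
    let I : Ideal ℤ := (Submodule.span ℤ (nrd '' (idl Ot x : Set B))).comap f
    obtain ⟨k, hk⟩ : ∃ k, I = Ideal.span {k} := (IsPrincipalIdealRing.principal I).principal
    have hunit : k.natAbs = 1 := by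
      rw [Nat.eq_one_iff_not_exists_prime_dvd]
      intro ℓ hℓ hdvd
      have : Fact ℓ.Prime := ⟨hℓ⟩
      obtain ⟨b, hb, hb'⟩ := S.exists_mem_idl_norm_eq hx ⟨ℓ, hℓ⟩
      have hbG : nrd b ∈ Submodule.span ℤ (nrd '' (idl Ot x : Set B)) :=
        Submodule.subset_span (Set.mem_image_of_mem nrd hb)
      obtain ⟨m, hm⟩ := hint _ hbG
      replace hb' : ‖(nrd b : ℚ_[ℓ])‖ = ‖(n : ℚ_[ℓ])‖ := hb'.trans (h _)
      rw [hm, Rat.cast_mul, norm_mul, Rat.cast_intCast, Rat.cast_natCast] at hb'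
      have hm1 : ‖(m : ℚ_[ℓ])‖ = 1 := mul_right_cancel₀ (hloc ℓ) (by rw [hb', one_mul])
      have hmI : m ∈ I := by
        change m • (n : ℚ) ∈ Submodule.span ℤ (nrd '' (idl Ot x : Set B))
        rw [zsmul_eq_mul, ← hm]; exact hbG
      rw [hk, Ideal.mem_span_singleton] at hmI
      have h3 : (ℓ : ℤ) ∣ m := (Int.natCast_dvd.2 hdvd).trans hmI
      have h4 := (Padic.norm_intCast_lt_one_iff (p := ℓ)).2 h3
      exact absurd hm1 h4.ne
    have h1 : (1 : ℤ) ∈ I := by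
      rw [hk, Ideal.mem_span_singleton]
      exact (Int.isUnit_iff_natAbs_eq.2 hunit).dvd
    have h2 : (1 : ℤ) • (n : ℚ) ∈ Submodule.span ℤ (nrd '' (idl Ot x : Set B)) := h1
    rwa [one_smul] at h2

theorem latNorm_idl_eq_iff (S : LocalStructure p Ot κ) (hx : AEUnit Ot x) {n : ℕ} (hn : 0 < n) :
    latNorm (idl Ot x) = n ↔ ∀ ℓ : Nat.Primes,
      ‖nrdF ℚ_[(ℓ : ℕ)] (x ℓ : Bloc B (ℓ : ℕ))‖ = ‖(n : ℚ_[(ℓ : ℕ)])‖ := by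
  have hn0 : (0 : ℚ) < n := by exact_mod_cast hn
  constructor
  · intro h ℓ
    rw [latNorm] at h
    split_ifs at h with hex
    · obtain ⟨-, h2⟩ := hex.choose_spec
      rw [h] at h2
      apply le_antisymm
      · obtain ⟨b, hb, hb'⟩ := S.exists_mem_idl_norm_eq hx ℓ
        have hbG := Submodule.subset_span (R := ℤ) (Set.mem_image_of_mem nrd hb)
        rw [h2] at hbG
        obtain ⟨m, hm⟩ := Submodule.mem_span_singleton.1 hbG
        rw [← hb', ← hm, zsmul_eq_mul, Rat.cast_mul, norm_mul, Rat.cast_intCast, Rat.cast_natCast]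
        exact mul_le_of_le_one_left (norm_nonneg _) (Padic.norm_int_le_one m)
      · have := S.norm_le_of_mem_span (x := x) (q := n)
          (by rw [h2]; exact Submodule.mem_span_singleton_self _) ℓ
        rwa [Rat.cast_natCast] at this
    · exact absurd h hn0.ne
  · intro h
    have hex : ∃ q : ℚ, 0 < q ∧
        Submodule.span ℤ (nrd '' (idl Ot x : Set B)) = Submodule.span ℤ {q} :=
      ⟨n, hn0, S.span_nrd_idl hx hn h⟩
    rw [latNorm, dif_pos hex]
    obtain ⟨h1, h2⟩ := hex.choose_spec
    obtain ⟨z, hz⟩ := Submodule.span_singleton_eq_span_singleton.1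
      ((S.span_nrd_idl hx hn h).symm.trans h2)
    rw [← hz]
    rcases Int.units_eq_one_or z with rfl | rfl
    · rw [one_smul]
    · rw [← hz, Units.smul_def] at h1
      simp at h1
      linarith

end LocalStructure

/-- The family of local units that is `y` at `p` and `1` elsewhere. -/
noncomputable def atP (y : (Bloc B p)ˣ) : ∀ ℓ : Nat.Primes, (Bloc B (ℓ : ℕ))ˣ :=
  Pi.mulSingle (⟨p, Fact.out⟩ : Nat.Primes) y

theorem atP_self (y : (Bloc B p)ˣ) : atP y ⟨p, Fact.out⟩ = y := Pi.mulSingle_eq_same _ _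

theorem atP_of_ne (y : (Bloc B p)ˣ) {ℓ : Nat.Primes} (h : (ℓ : ℕ) ≠ p) : atP y ℓ = 1 :=
  Pi.mulSingle_eq_of_ne (fun hℓ => h (congrArg Subtype.val hℓ)) _

theorem atP_mul (y z : (Bloc B p)ˣ) : atP (y * z) = atP y * atP z := Pi.mulSingle_mul _ _ _

theorem forall_primes_iff {P : Nat.Primes → Prop} (p : ℕ) [Fact p.Prime] :
    (∀ ℓ, P ℓ) ↔ P ⟨p, Fact.out⟩ ∧ ∀ ℓ : Nat.Primes, (ℓ : ℕ) ≠ p → P ℓ := by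
  refine ⟨fun h => ⟨h _, fun ℓ _ => h ℓ⟩, fun h ℓ => ?_⟩
  by_cases hℓ : (ℓ : ℕ) = p
  · have : ℓ = ⟨p, Fact.out⟩ := Subtype.ext hℓ
    rw [this]; exact h.1
  · exact h.2 ℓ hℓ

theorem aeUnit_atP (y : (Bloc B p)ˣ) : AEUnit Ot (atP y) := by
  refine aeUnit_of_eventually_eq aeUnit_one ((Set.finite_singleton ⟨p, Fact.out⟩).subset ?_)
  intro ℓ hℓ
  by_contra hcon
  exact hℓ (atP_of_ne y fun h => hcon (Subtype.ext h))

/-- The ideal which is `Ot_p y` at `p` and `Ot_ℓ` at `ℓ ≠ p`. -/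
noncomputable def bil (Ot : Subalgebra ℤ B) (y : (Bloc B p)ˣ) : Submodule ℤ B := idl Ot (atP y)

theorem bil_eq_iff (hO : IsLatticeIn (ordLat Ot)) {y z : (Bloc B p)ˣ} :
    bil Ot y = bil Ot z ↔ y * z⁻¹ ∈ locUnits Ot p := by
  rw [bil, bil, idl_eq_iff hO (aeUnit_atP y) (aeUnit_atP z), forall_primes_iff p, atP_self,
    atP_self]
  refine and_iff_left fun ℓ hℓ => ?_
  rw [atP_of_ne y hℓ, atP_of_ne z hℓ, inv_one, mul_one]
  exact one_mem _

theorem bil_one (hO : IsLatticeIn (ordLat Ot)) : bil Ot (1 : (Bloc B p)ˣ) = ordLat Ot := by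
  have h : atP (1 : (Bloc B p)ˣ) = 1 := Pi.mulSingle_one _
  rw [bil, h, idl_one hO]

end BilateralIdeals

/-! ### Bilateral ideals of norm 1 and p, and the involution. -/

section BilateralCount

variable {p : ℕ} [Fact p.Prime] {B : Type*} [Ring B] [Algebra ℚ B] {Ot : Subalgebra ℤ B}
  {κ : Type*} [Field κ] [Fintype κ]

namespace LocalStructure

theorem mem_conj (S : LocalStructure p Ot κ) (y : (Bloc B p)ˣ) {u : Bloc B p}
    (hu : u ∈ locLat p (ordLat Ot)) :
    (y : Bloc B p) * u * (↑y⁻¹ : Bloc B p) ∈ locLat p (ordLat Ot) := by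
  rw [S.mem_iff] at hu ⊢
  exact S.R.fixed_conj_units S.div S.card y hu.1 hu.2

theorem normalizes_atP (S : LocalStructure p Ot κ) (y : (Bloc B p)ˣ) :
    Normalizes Ot (atP y) := by
  refine (forall_primes_iff p).2 ⟨fun u hu => ?_, fun ℓ hℓ u hu => ?_⟩
  · rw [atP_self]; exact S.mem_conj y hu
  · rw [atP_of_ne y hℓ, inv_one, Units.val_one, one_mul, mul_one]; exact hu

theorem bil_mul_idl (S : LocalStructure p Ot κ) (y : (Bloc B p)ˣ)
    {x : ∀ ℓ : Nat.Primes, (Bloc B (ℓ : ℕ))ˣ} (hx : AEUnit Ot x) :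
    bil Ot y * idl Ot x = idl Ot (atP y * x) :=
  idl_mul_idl S.lat (aeUnit_atP y) hx (S.normalizes_atP y)

theorem bil_mul_bil (S : LocalStructure p Ot κ) (y z : (Bloc B p)ˣ) :
    bil Ot y * bil Ot z = bil Ot (y * z) := by
  rw [bil, bil, bil, atP_mul]
  exact S.bil_mul_idl y (aeUnit_atP z)

theorem rightOrder_bil (S : LocalStructure p Ot κ) (y : (Bloc B p)ˣ) :
    rightOrder (bil Ot y) = (Ot : Set B) := by
  ext b
  rw [bil, mem_rightOrder_idl S.lat (aeUnit_atP y), forall_primes_iff p, atP_self, SetLike.mem_coe]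
  constructor
  · rintro ⟨h1, h2⟩
    suffices h : ∀ ℓ : Nat.Primes, toLoc (ℓ : ℕ) b ∈ locLat (ℓ : ℕ) (ordLat Ot) from
      S.lat.mem_of_forall_loc fun ℓ _ => h ⟨ℓ, Fact.out⟩
    refine (forall_primes_iff p).2 ⟨?_, fun ℓ hℓ => ?_⟩
    · have := S.mem_conj y⁻¹ h1
      rwa [inv_inv, ← mul_assoc, ← mul_assoc, Units.inv_mul, one_mul, mul_assoc, Units.inv_mul,
        mul_one] at this
    · have := h2 ℓ hℓ
      rwa [atP_of_ne y hℓ, inv_one, Units.val_one, one_mul, mul_one] at this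
  · intro hb
    refine ⟨S.mem_conj y (toLoc_mem_locLat hb), fun ℓ hℓ => ?_⟩
    rw [atP_of_ne y hℓ, inv_one, Units.val_one, one_mul, mul_one]
    exact toLoc_mem_locLat hb

theorem latNorm_bil_eq_iff (S : LocalStructure p Ot κ) (y : (Bloc B p)ˣ) {n : ℕ} (hn : 0 < n)
    (hn' : ∀ (ℓ : ℕ) [Fact ℓ.Prime], ℓ ≠ p → ‖(n : ℚ_[ℓ])‖ = 1) :
    latNorm (bil Ot y) = n ↔ ‖nrdF ℚ_[p] (y : Bloc B p)‖ = ‖(n : ℚ_[p])‖ := by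
  rw [bil, S.latNorm_idl_eq_iff (aeUnit_atP y) hn, forall_primes_iff p, atP_self]
  refine and_iff_left fun ℓ hℓ => ?_
  rw [atP_of_ne y hℓ, Units.val_one, (S.quatLoc _).nrd_one, norm_one, hn' _ hℓ]

theorem isLeftIdeal_bil (S : LocalStructure p Ot κ) (y : (Bloc B p)ˣ) :
    IsLeftIdeal Ot (bil Ot y) := (isLeftIdeal_iff S.lat).2 ⟨_, aeUnit_atP y, rfl⟩

/-- Away from p the generator normalizes the integral matrices and has unit norm, so it is a unit
and may be replaced by 1. At p every generator is allowed, as the local order is normalized by B_pˣ.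
-/
theorem mem_bilateralOfNorm_iff (S : LocalStructure p Ot κ) {n : ℕ} (hn : 0 < n)
    (hn' : ∀ (ℓ : ℕ) [Fact ℓ.Prime], ℓ ≠ p → ‖(n : ℚ_[ℓ])‖ = 1) {P : Submodule ℤ B} :
    P ∈ bilateralOfNorm Ot n ↔
      ∃ y : (Bloc B p)ˣ, ‖nrdF ℚ_[p] (y : Bloc B p)‖ = ‖(n : ℚ_[p])‖ ∧ P = bil Ot y := by
  constructor
  · rintro ⟨⟨hP, hr⟩, hN⟩
    obtain ⟨x, hx, rfl⟩ := (isLeftIdeal_iff S.lat).1 hP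
    rw [S.latNorm_idl_eq_iff hx hn] at hN
    obtain ⟨y, hy⟩ : ∃ y : (Bloc B p)ˣ, x ⟨p, Fact.out⟩ = y := ⟨_, rfl⟩
    have hNy := hN ⟨p, Fact.out⟩
    rw [hy] at hNy
    refine ⟨y, hNy, ?_⟩
    rw [bil, idl_eq_iff S.lat hx (aeUnit_atP _), forall_primes_iff p, atP_self, hy,
      mul_inv_cancel]
    refine ⟨one_mem (locUnits Ot p), fun ℓ hℓ => ?_⟩
    rw [atP_of_ne _ hℓ, inv_one, mul_one]
    have hx1 : ‖nrdF ℚ_[(ℓ : ℕ)] (x ℓ : Bloc B (ℓ : ℕ))‖ = 1 := by rw [hN, hn' _ hℓ]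
    refine S.mem_locUnits_iff.2 ⟨?_, hx1⟩
    refine (S.split _ hℓ).mem_of_normalizes (fun u hu => ?_) hx1
    have h1 : locLat (ℓ : ℕ) (ordLat Ot) ≤ (locLat (ℓ : ℕ) (ordLat Ot)).comap
        ((LinearMap.mulRight ℤ_[(ℓ : ℕ)] (↑(x ℓ)⁻¹ : Bloc B (ℓ : ℕ))).comp
          (LinearMap.mulLeft ℤ_[(ℓ : ℕ)] (x ℓ : Bloc B (ℓ : ℕ)))) := by
      refine locLat_le_iff.2 fun b hb => ?_
      have hb' : b ∈ rightOrder (idl Ot x) := by rw [hr]; exact hb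
      exact (mem_rightOrder_idl S.lat hx).1 hb' ℓ
    exact h1 hu
  · rintro ⟨y, hy, rfl⟩
    exact ⟨⟨S.isLeftIdeal_bil y, S.rightOrder_bil y⟩, (S.latNorm_bil_eq_iff y hn hn').2 hy⟩

theorem mem_bilateralOfNorm_one_iff (S : LocalStructure p Ot κ) {P : Submodule ℤ B} :
    P ∈ bilateralOfNorm Ot 1 ↔
      ∃ y : (Bloc B p)ˣ, ‖nrdF ℚ_[p] (y : Bloc B p)‖ = 1 ∧ P = bil Ot y := by
  rw [S.mem_bilateralOfNorm_iff one_pos (fun ℓ _ _ => by simp)]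
  simp

theorem mem_bilateralOfNorm_prime_iff (S : LocalStructure p Ot κ) {P : Submodule ℤ B} :
    P ∈ bilateralOfNorm Ot p ↔
      ∃ y : (Bloc B p)ˣ, ‖nrdF ℚ_[p] (y : Bloc B p)‖ = (p : ℝ)⁻¹ ∧ P = bil Ot y := by
  rw [S.mem_bilateralOfNorm_iff (Fact.out : p.Prime).pos
    (fun ℓ _ hℓ => norm_natCast_eq_one_of_ne hℓ), Padic.norm_p]

theorem exists_lift (S : LocalStructure p Ot κ) {z : κ} (hz : z ≠ 0) :
    ∃ u : (Bloc B p)ˣ, ‖nrdF ℚ_[p] (u : Bloc B p)‖ = 1 ∧ S.R.res u = z := by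
  obtain ⟨x, hx, rfl⟩ := S.R.surj z
  have h1 := (S.R.ne_zero_iff hx).1 hz
  have hx0 : IsUnit x := S.div.quat.isUnit_of_nrd_ne_zero fun h => by simp [h] at h1
  exact ⟨hx0.unit, h1, rfl⟩

theorem norm_nrd_mul (S : LocalStructure p Ot κ) (u v : (Bloc B p)ˣ) :
    ‖nrdF ℚ_[p] ((u * v : (Bloc B p)ˣ) : Bloc B p)‖ =
      ‖nrdF ℚ_[p] (u : Bloc B p)‖ * ‖nrdF ℚ_[p] (v : Bloc B p)‖ := by
  rw [Units.val_mul, S.div.quat.nrd_mul, norm_mul]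

theorem norm_nrd_inv (S : LocalStructure p Ot κ) (u : (Bloc B p)ˣ) :
    ‖nrdF ℚ_[p] ((u⁻¹ : (Bloc B p)ˣ) : Bloc B p)‖ = ‖nrdF ℚ_[p] (u : Bloc B p)‖⁻¹ := by
  rw [S.div.quat.nrd_inv, norm_inv]

theorem norm_nrd_pos (S : LocalStructure p Ot κ) (u : (Bloc B p)ˣ) :
    0 < ‖nrdF ℚ_[p] (u : Bloc B p)‖ :=
  norm_pos_iff.2 (S.div.quat.nrd_ne_zero_of_isUnit u.isUnit)

/-- For `u`, `v` of norm one, `u v⁻¹` is a unit of the local order iff the ratio of the residues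
lies in the prime field. -/
theorem mul_inv_mem_locUnits_iff (S : LocalStructure p Ot κ) {u v : (Bloc B p)ˣ}
    (hu : ‖nrdF ℚ_[p] (u : Bloc B p)‖ = 1) (hv : ‖nrdF ℚ_[p] (v : Bloc B p)‖ = 1) :
    u * v⁻¹ ∈ locUnits Ot p ↔
      (S.R.res u * (S.R.res v)⁻¹) ^ p = S.R.res u * (S.R.res v)⁻¹ := by
  rw [S.mem_locUnits_self_iff, S.norm_nrd_mul, S.norm_nrd_inv, hu, hv, Units.val_mul,
    S.R.map_mul _ _ hu.le (by rw [S.norm_nrd_inv, hv, inv_one]), S.R.map_inv S.div hv]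
  simp

theorem res_ne_zero (S : LocalStructure p Ot κ) {u : (Bloc B p)ˣ}
    (hu : ‖nrdF ℚ_[p] (u : Bloc B p)‖ = 1) : S.R.res u ≠ 0 := (S.R.ne_zero_iff hu.le).2 hu

/-- An ideal of the given norm has a generator u ϖ with u of norm 1, and it depends only on the
class of the residue of u in κˣ/F_pˣ. -/
theorem ncard_bil (S : LocalStructure p Ot κ) (ϖ : (Bloc B p)ˣ) :
    {P | ∃ y : (Bloc B p)ˣ, ‖nrdF ℚ_[p] (y : Bloc B p)‖ = ‖nrdF ℚ_[p] (ϖ : Bloc B p)‖ ∧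
      P = bil Ot y}.ncard = p + 1 := by
  choose lift hlift hres using fun z : κˣ => S.exists_lift z.ne_zero
  set H := (powMonoidHom (p - 1) : κˣ →* κˣ).ker
  have hiff : ∀ z z' : κˣ, bil Ot (lift z * ϖ) = bil Ot (lift z' * ϖ) ↔ z⁻¹ * z' ∈ H := by
    intro z z'
    rw [eq_comm, bil_eq_iff S.lat, mul_inv_rev, mul_assoc, mul_inv_cancel_left,
      S.mul_inv_mem_locUnits_iff (hlift _) (hlift _), hres, hres, mem_ker_powMonoidHom_iff_fixed,
      mul_comm z⁻¹, Units.val_mul, Units.val_inv_eq_inv_val]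
  let g : κˣ ⧸ H → Submodule ℤ B := Quotient.lift (fun z => bil Ot (lift z * ϖ)) fun z z' h =>
    (hiff z z').2 (QuotientGroup.leftRel_apply.1 h)
  have hg : Function.Injective g := by
    intro a b
    induction a using Quotient.inductionOn
    induction b using Quotient.inductionOn
    intro h
    exact Quotient.sound (QuotientGroup.leftRel_apply.2 ((hiff _ _).1 h))
  have hrange : {P | ∃ y : (Bloc B p)ˣ,
      ‖nrdF ℚ_[p] (y : Bloc B p)‖ = ‖nrdF ℚ_[p] (ϖ : Bloc B p)‖ ∧ P = bil Ot y} =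
      Set.range g := by
    ext P
    constructor
    · rintro ⟨y, hy, rfl⟩
      have h1 : ‖nrdF ℚ_[p] ((y * ϖ⁻¹ : (Bloc B p)ˣ) : Bloc B p)‖ = 1 := by
        rw [S.norm_nrd_mul, S.norm_nrd_inv, hy, mul_inv_cancel₀ (S.norm_nrd_pos ϖ).ne']
      refine ⟨Quotient.mk _ (Units.mk0 _ (S.res_ne_zero h1)), ?_⟩
      change bil Ot (lift _ * ϖ) = bil Ot y
      rw [eq_comm, bil_eq_iff S.lat, mul_inv_rev, ← mul_assoc,
        S.mul_inv_mem_locUnits_iff h1 (hlift _), hres, Units.val_mk0,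
        mul_inv_cancel₀ (S.res_ne_zero h1), one_pow]
    · rintro ⟨a, rfl⟩
      induction a using Quotient.inductionOn with
      | h z => exact ⟨lift z * ϖ, by rw [S.norm_nrd_mul, hlift, one_mul], rfl⟩
  rw [hrange, ← Nat.card_coe_set_eq, Nat.card_range_of_injective hg]
  exact index_fixed_units S.card

theorem ncard_bilateralOfNorm_one (S : LocalStructure p Ot κ) :
    (bilateralOfNorm Ot 1).ncard = p + 1 := by
  rw [← S.ncard_bil 1]
  congr 1
  ext P
  rw [S.mem_bilateralOfNorm_one_iff, Set.mem_ofPred_eq, Units.val_one, S.div.quat.nrd_one, norm_one]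

theorem ncard_bilateralOfNorm_prime (S : LocalStructure p Ot κ) {ϖ : (Bloc B p)ˣ}
    (hϖ : ‖nrdF ℚ_[p] (ϖ : Bloc B p)‖ = (p : ℝ)⁻¹) : (bilateralOfNorm Ot p).ncard = p + 1 := by
  rw [← S.ncard_bil ϖ]
  congr 1
  ext P
  rw [S.mem_bilateralOfNorm_prime_iff, Set.mem_ofPred_eq, hϖ]

/-- A rational scalar relating the two lattices must have unit norm at p, so it is already a unit of
the local order. -/
theorem qEquiv_bil_iff (S : LocalStructure p Ot κ) {y : (Bloc B p)ˣ}
    (hy : ‖nrdF ℚ_[p] (y : Bloc B p)‖ = 1) :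
    QEquiv (bil Ot y) (ordLat Ot) ↔ y ∈ locUnits Ot p := by
  constructor
  · rintro ⟨c, hc, h⟩
    have hu : IsUnit (algebraMap ℚ B c) := (IsUnit.mk0 c hc).map (algebraMap ℚ B)
    rw [← idl_one S.lat, ← hu.unit_spec, rmul_idl, bil, idl_eq_iff S.lat (aeUnit_atP y)
      (aeUnit_one.mul (aeUnit_unitLoc S.lat _)), forall_primes_iff p, atP_self] at h
    set v : (Bloc B p)ˣ := unitLoc p hu.unit with hv
    have hvc : (v : Bloc B p) = algebraMap ℚ_[p] (Bloc B p) (c : ℚ_[p]) := by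
      rw [hv, coe_unitLoc, hu.unit_spec, AlgHom.commutes,
        IsScalarTower.algebraMap_apply ℚ ℚ_[p] (Bloc B p), eq_ratCast]
    have h1 : y * v⁻¹ ∈ locUnits Ot p := by simpa using h.1
    have h2 := (S.mem_locUnits_iff.1 h1).2
    have hvn : ‖nrdF ℚ_[p] (v : Bloc B p)‖ = ‖(c : ℚ_[p])‖ ^ 2 := by
      rw [hvc, S.div.quat.nrd_algebraMap, norm_pow]
    rw [S.norm_nrd_mul, S.norm_nrd_inv, hy, one_mul, inv_eq_one, hvn,
      pow_eq_one_iff_of_nonneg (norm_nonneg _) two_ne_zero] at h2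
    have h3 : v ∈ locUnits Ot p :=
      S.mem_locUnits_iff.2 ⟨by rw [hvc]; exact algebraMap_mem_locLat h2.le, by
        rw [hvn, h2, one_pow]⟩
    have := mul_mem h1 h3
    rwa [inv_mul_cancel_right] at this
  · intro h
    refine ⟨1, one_ne_zero, ?_⟩
    have h1 : bil Ot y = ordLat Ot := by
      rw [← bil_one (p := p) S.lat, bil_eq_iff S.lat, inv_one, mul_one]; exact h
    rw [h1]
    ext z
    simp [rmul]

theorem isInvolutiveNormOne_iff (S : LocalStructure p Ot κ) {M : Submodule ℤ B} :
    IsInvolutiveNormOne Ot M ↔ ∃ u : (Bloc B p)ˣ, ‖nrdF ℚ_[p] (u : Bloc B p)‖ = 1 ∧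
      S.R.res u ^ p = -S.R.res u ∧ M = bil Ot u := by
  have hsq : ∀ u : (Bloc B p)ˣ, ‖nrdF ℚ_[p] (u : Bloc B p)‖ = 1 →
      (QEquiv (bil Ot u * bil Ot u) (ordLat Ot) ↔ (S.R.res u ^ 2) ^ p = S.R.res u ^ 2) := by
    intro u hu
    have huu : ‖nrdF ℚ_[p] ((u * u : (Bloc B p)ˣ) : Bloc B p)‖ = 1 := by
      rw [S.norm_nrd_mul, hu, one_mul]
    rw [S.bil_mul_bil, S.qEquiv_bil_iff huu, S.mem_locUnits_self_iff, Units.val_mul,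
      S.R.map_mul _ _ hu.le hu.le, ← sq (S.R.res _), ← Units.val_mul]
    exact and_iff_right huu
  constructor
  · rintro ⟨h1, h2, h3⟩
    obtain ⟨u, hu, rfl⟩ := S.mem_bilateralOfNorm_one_iff.1 h1
    refine ⟨u, hu, ?_, rfl⟩
    rw [S.qEquiv_bil_iff hu, S.mem_locUnits_self_iff] at h2
    exact (fixed_or_neg_of_sq_fixed ((hsq u hu).1 h3)).resolve_left fun h => h2 ⟨hu, h⟩
  · rintro ⟨u, hu, hneg, rfl⟩
    refine ⟨S.mem_bilateralOfNorm_one_iff.2 ⟨u, hu, rfl⟩, ?_, ?_⟩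
    · rw [S.qEquiv_bil_iff hu, S.mem_locUnits_self_iff]
      rintro ⟨-, h⟩
      rw [hneg, neg_eq_iff_add_eq_zero, ← two_mul, mul_eq_zero] at h
      exact h.elim (Ring.two_ne_zero (ringChar_ne_two_of_card_sq S.two_lt S.card))
        (S.res_ne_zero hu)
    · rw [hsq u hu, ← pow_mul, mul_comm, pow_mul, hneg, neg_sq]

/-- The nonzero z with z^p = -z form a single coset of F_pˣ. -/
theorem existsUnique_isInvolutiveNormOne (S : LocalStructure p Ot κ) :
    ∃! W : Submodule ℤ B, IsInvolutiveNormOne Ot W := by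
  obtain ⟨z, hz, hneg⟩ := exists_neg_fixed S.card
  obtain ⟨u, hu, rfl⟩ := S.exists_lift hz
  refine ⟨bil Ot u, S.isInvolutiveNormOne_iff.2 ⟨u, hu, hneg, rfl⟩, fun M hM => ?_⟩
  obtain ⟨v, hv, hv', rfl⟩ := S.isInvolutiveNormOne_iff.1 hM
  rw [bil_eq_iff S.lat, S.mul_inv_mem_locUnits_iff hv hu, mul_pow, inv_pow, hv', hneg, inv_neg,
    neg_mul_neg]

end LocalStructure

end BilateralCount

/-! ### The quadratic character of bilateral ideals of norm p. -/

section QuadraticCharacter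

variable {p : ℕ} [Fact p.Prime] {B : Type*} [Ring B] [Algebra ℚ B] {Ot : Subalgebra ℤ B}
  {κ : Type*} [Field κ] [Fintype κ]

theorem intCast_legendreSym (hκ : Fintype.card κ = p ^ 2) (n : ℤ) :
    ((legendreSym p n : ℤ) : κ) = (n : κ) ^ (p / 2) := by
  have := charP_of_card_eq_prime_pow hκ
  have h := congrArg (ZMod.castHom (dvd_refl p) κ) (legendreSym.eq_pow p n)
  simpa only [map_intCast, map_pow] using h

theorem legendreSym_eq_iff (hp : 2 < p) (hκ : Fintype.card κ = p ^ 2) {m n : ℤ}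
    (hm : ¬ (p : ℤ) ∣ m) (hn : ¬ (p : ℤ) ∣ n) :
    legendreSym p m = legendreSym p n ↔ (m : κ) ^ (p / 2) = (n : κ) ^ (p / 2) := by
  rw [← intCast_legendreSym hκ, ← intCast_legendreSym hκ]
  refine ⟨fun h => by rw [h], fun h => ?_⟩
  have h2 : (-1 : κ) ≠ 1 := Ring.neg_one_ne_one_of_char_ne_two (ringChar_ne_two_of_card_sq hp hκ)
  have hd : ∀ k : ℤ, ¬ (p : ℤ) ∣ k → legendreSym p k = 1 ∨ legendreSym p k = -1 := fun k hk =>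
    legendreSym.eq_one_or_neg_one p fun h0 => hk ((ZMod.intCast_zmod_eq_zero_iff_dvd k p).1 h0)
  rcases hd m hm with h1 | h1 <;> rcases hd n hn with h3 | h3 <;> rw [h1, h3] at h ⊢ <;>
    simp at h
  · exact absurd h.symm h2
  · exact absurd h h2

namespace LocalStructure

theorem res_intCast (S : LocalStructure p Ot κ) (n : ℤ) :
    S.R.res (algebraMap ℚ_[p] (Bloc B p) (n : ℚ_[p])) = (n : κ) := by
  have := charP_of_card_eq_prime_pow S.card
  have hp0 : (p : ℤ) ≠ 0 := by exact_mod_cast (Fact.out : p.Prime).ne_zero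
  have hm : ((n % p).toNat : ℤ) = n % p := Int.toNat_of_nonneg (Int.emod_nonneg n hp0)
  have hdvd : (p : ℤ) ∣ n - (n % p).toNat := by rw [hm]; exact Int.dvd_self_sub_emod
  rw [S.R.res_algebraMap S.div (Padic.norm_int_le_one n) (n := (n % p).toNat) ?_]
  · have h := (CharP.intCast_eq_zero_iff κ p _).2 hdvd
    rw [Int.cast_sub, Int.cast_natCast, sub_eq_zero] at h
    exact h.symm
  · have := (Padic.norm_intCast_lt_one_iff (p := p)).2 hdvd
    rwa [Int.cast_sub, Int.cast_natCast] at this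

theorem res_algebraMap_mul (S : LocalStructure p Ot κ) {a b : ℚ_[p]} (ha : ‖a‖ ≤ 1)
    (hb : ‖b‖ ≤ 1) : S.R.res (algebraMap ℚ_[p] (Bloc B p) (a * b)) =
      S.R.res (algebraMap ℚ_[p] (Bloc B p) a) * S.R.res (algebraMap ℚ_[p] (Bloc B p) b) := by
  rw [_root_.map_mul, S.R.map_mul _ _ (ResidueMap.norm_nrd_algebraMap_le S.div ha)
    (ResidueMap.norm_nrd_algebraMap_le S.div hb)]

/-- The reduced norms of units of the local order become squares in the prime field. -/
theorem res_nrd_pow_half (S : LocalStructure p Ot κ) {c : Bloc B p}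
    (hc : c ∈ locLat p (ordLat Ot)) (hn : ‖nrdF ℚ_[p] c‖ = 1) :
    S.R.res (algebraMap ℚ_[p] (Bloc B p) (nrdF ℚ_[p] c)) ^ (p / 2) = 1 := by
  have hp2 := S.two_lt
  obtain ⟨k, hk⟩ := (Fact.out : p.Prime).odd_of_ne_two (by omega)
  obtain ⟨h1, h2⟩ := (S.mem_iff c).1 hc
  have h0 : S.R.res c ≠ 0 := (S.R.ne_zero_iff h1).2 hn
  rw [S.R.res_nrd S.div S.card h1, ← pow_mul]
  generalize S.R.res c = z at h0 h2
  rw [show (p + 1) * (p / 2) = 2 * k * (k + 1) by rw [show p / 2 = k by omega, hk]; ring, pow_mul]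
  rw [hk, pow_succ] at h2
  rw [mul_right_cancel₀ h0 (h2.trans (one_mul z).symm), one_pow]

/-- `chi` evaluates one chosen element of the ideal. At p this element is c y with c in the local
order and of unit norm; the norm of c reduces to a square in F_p, so only y matters. -/
theorem chi_bil (S : LocalStructure p Ot κ) {y : (Bloc B p)ˣ}
    (hy : ‖nrdF ℚ_[p] (y : Bloc B p)‖ = (p : ℝ)⁻¹) :
    ∃ n : ℤ, ¬ (p : ℤ) ∣ n ∧ chi p (bil Ot y) = legendreSym p n ∧
      (n : κ) ^ (p / 2) =
        S.R.res (algebraMap ℚ_[p] (Bloc B p) (nrdF ℚ_[p] (y : Bloc B p) / p)) ^ (p / 2) := by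
  have hp0 : (p : ℚ_[p]) ≠ 0 := by exact_mod_cast (Fact.out : p.Prime).ne_zero
  have hpQ : (p : ℚ) ≠ 0 := by exact_mod_cast (Fact.out : p.Prime).ne_zero
  have hpR : (p : ℝ) ≠ 0 := by exact_mod_cast (Fact.out : p.Prime).ne_zero
  have hN : latNorm (bil Ot y) = p :=
    (S.latNorm_bil_eq_iff y (Fact.out : p.Prime).pos
      fun ℓ _ hℓ => norm_natCast_eq_one_of_ne hℓ).2 (by rw [hy, Padic.norm_p])
  have hyp : ‖nrdF ℚ_[p] (y : Bloc B p) / p‖ = 1 := by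
    rw [norm_div, hy, Padic.norm_p, div_self (inv_ne_zero hpR)]
  have hex : ∃ n : ℤ, ¬ (p : ℤ) ∣ n ∧ ∃ x ∈ bil Ot y, nrd x = n * latNorm (bil Ot y) := by
    obtain ⟨b, hb, hbn⟩ := S.exists_mem_idl_norm_eq (aeUnit_atP y) ⟨p, Fact.out⟩
    rw [atP_self] at hbn
    replace hbn : ‖(nrd b : ℚ_[p])‖ = (p : ℝ)⁻¹ := hbn.trans hy
    obtain ⟨n, hn⟩ := rat_eq_int_of_padic_norm (q := nrd b / p) fun ℓ _ => by
      rw [Rat.cast_div, norm_div, Rat.cast_natCast]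
      rcases eq_or_ne ℓ p with rfl | hℓ
      · rw [hbn, Padic.norm_p, div_self (inv_ne_zero hpR)]
      · rw [norm_natCast_eq_one_of_ne hℓ, div_one]
        have hℓ' : ((⟨ℓ, Fact.out⟩ : Nat.Primes) : ℕ) ≠ p := hℓ
        have := S.norm_nrd_le_of_mem_idl hb ⟨ℓ, Fact.out⟩
        rwa [atP_of_ne y hℓ', Units.val_one, (S.quatLoc _).nrd_one, norm_one] at this
    refine ⟨n, fun hdvd => ?_, b, hb, by rw [hN, hn, div_mul_cancel₀ _ hpQ]⟩
    have h1 := (Padic.norm_intCast_lt_one_iff (p := p)).2 hdvd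
    have h2 : (n : ℚ_[p]) = (nrd b : ℚ_[p]) / p := by
      have := congrArg (Rat.cast : ℚ → ℚ_[p]) hn
      rwa [Rat.cast_intCast, Rat.cast_div, Rat.cast_natCast] at this
    rw [h2, norm_div, hbn, Padic.norm_p, div_self (inv_ne_zero hpR)] at h1
    exact lt_irrefl _ h1
  refine ⟨hex.choose, hex.choose_spec.1, by rw [chi, dif_pos hex], ?_⟩
  obtain ⟨hn, x, hx, hxn⟩ := hex.choose_spec
  set n := hex.choose
  rw [hN] at hxn
  have hc := mem_idl.1 hx ⟨p, Fact.out⟩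
  rw [atP_self] at hc
  set c : Bloc B p := toLoc p x * (↑y⁻¹ : Bloc B p) with hcdef
  have hcy : (nrd x : ℚ_[p]) = nrdF ℚ_[p] c * nrdF ℚ_[p] (y : Bloc B p) := by
    rw [← nrdF_toLoc S.quat, ← S.div.quat.nrd_mul, hcdef, mul_assoc, Units.inv_mul, mul_one]
  have hncy : (n : ℚ_[p]) = nrdF ℚ_[p] c * (nrdF ℚ_[p] (y : Bloc B p) / p) := by
    rw [← mul_div_assoc, ← hcy, hxn, Rat.cast_mul, Rat.cast_intCast, Rat.cast_natCast,
      mul_div_cancel_right₀ _ hp0]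
  have hcn : ‖nrdF ℚ_[p] c‖ = 1 := by
    have h1 : ‖(n : ℚ_[p])‖ = 1 := le_antisymm (Padic.norm_int_le_one n)
      (not_lt.1 fun h => hn ((Padic.norm_intCast_lt_one_iff (p := p)).1 h))
    rwa [hncy, norm_mul, hyp, mul_one] at h1
  rw [← S.res_intCast, hncy, S.res_algebraMap_mul hcn.le hyp.le, mul_pow,
    S.res_nrd_pow_half hc hcn, one_mul]

/-- The norm of c ϖ divided by p is N(c) m, and m is d up to the square 4. So the character is (d/p)
exactly when N(c) is a square modulo p, which is the criterion for the residue of c to be a square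
in κ. -/
theorem chi_bil_eq_iff_isSquare (S : LocalStructure p Ot κ) {ϖ c : (Bloc B p)ˣ} {d m : ℤ}
    (hϖ : nrdF ℚ_[p] (ϖ : Bloc B p) = p * m) (hd : ¬ (p : ℤ) ∣ d) (hm : (p : ℤ) ∣ 4 * m - d)
    (hc : ‖nrdF ℚ_[p] (c : Bloc B p)‖ = 1) :
    chi p (bil Ot (c * ϖ)) = legendreSym p d ↔ IsSquare (S.R.res c) := by
  have := charP_of_card_eq_prime_pow S.card
  have hp2 := S.two_lt
  have hp0 : (p : ℚ_[p]) ≠ 0 := by exact_mod_cast (Fact.out : p.Prime).ne_zero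
  have hm' : ¬ (p : ℤ) ∣ m := fun h => hd (by
    have := dvd_sub (h.mul_left 4) hm
    rwa [sub_sub_cancel] at this)
  have hmn : ‖(m : ℚ_[p])‖ = 1 := le_antisymm (Padic.norm_int_le_one m)
    (not_lt.1 fun h => hm' ((Padic.norm_intCast_lt_one_iff (p := p)).1 h))
  have hcϖ : ‖nrdF ℚ_[p] ((c * ϖ : (Bloc B p)ˣ) : Bloc B p)‖ = (p : ℝ)⁻¹ := by
    rw [S.norm_nrd_mul, hc, hϖ, norm_mul, hmn, Padic.norm_p, one_mul, mul_one]
  obtain ⟨n, hn, hchi, hpow⟩ := S.chi_bil hcϖ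
  have hdiv : nrdF ℚ_[p] ((c * ϖ : (Bloc B p)ˣ) : Bloc B p) / p =
      nrdF ℚ_[p] (c : Bloc B p) * m := by
    rw [Units.val_mul, S.div.quat.nrd_mul, hϖ]; field_simp
  rw [hdiv, S.res_algebraMap_mul hc.le hmn.le, S.R.res_nrd S.div S.card hc.le, S.res_intCast,
    mul_pow] at hpow
  have h2 : (2 : κ) ≠ 0 := Ring.two_ne_zero (ringChar_ne_two_of_card_sq S.two_lt S.card)
  have h4 : (4 : κ) ^ (p / 2) = 1 := by
    obtain ⟨k, hk⟩ := (Fact.out : p.Prime).odd_of_ne_two (by omega)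
    have h2p : (2 : κ) ^ p = 2 := map_ofNat (frobenius κ p) 2
    rw [show p / 2 = k by omega, show (4 : κ) = 2 ^ 2 by norm_num, ← pow_mul]
    rw [hk, pow_succ] at h2p
    exact mul_right_cancel₀ h2 (by rw [h2p, one_mul])
  have hdm : (d : κ) = 4 * m := by
    have h := (CharP.intCast_eq_zero_iff κ p _).2 hm
    rw [Int.cast_sub, Int.cast_mul, sub_eq_zero] at h
    rw [← h]; norm_num
  have hm0 : (m : κ) ^ (p / 2) ≠ 0 :=
    pow_ne_zero _ fun h => hm' ((CharP.intCast_eq_zero_iff κ p _).1 h)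
  rw [hchi, legendreSym_eq_iff S.two_lt S.card hn hd, hpow, hdm, mul_pow, h4, one_mul,
    isSquare_iff_norm_pow S.two_lt S.card (S.res_ne_zero hc)]
  exact mul_eq_right₀ hm0

end LocalStructure

end QuadraticCharacter

/-! ### Arithmetic of the ring of integers. -/

section QuadraticField

/-- Cayley–Hamilton for the matrix of multiplication by ω. -/
theorem mul_self_eq_trace_sub_norm {R : Type*} [CommRing R] (e : Module.Basis (Fin 2) ℤ R)
    (ω : R) : ω * ω = (Algebra.trace ℤ R ω : R) * ω - (Algebra.norm ℤ ω : R) := by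
  apply Algebra.leftMulMatrix_injective e
  rw [map_sub, map_mul, map_mul, Algebra.trace_eq_matrix_trace e, Algebra.norm_eq_matrix_det e,
    map_intCast, map_intCast]
  set M := Algebra.leftMulMatrix e ω
  rw [Matrix.trace_fin_two, Matrix.det_fin_two]
  ext i j
  fin_cases i <;> fin_cases j <;>
    simp [Matrix.mul_apply, Fin.sum_univ_two, Matrix.intCast_apply] <;> ring

variable {K : Type*} [Field K] [NumberField K]

theorem exists_basis_ringOfIntegers (hK : Module.finrank ℚ K = 2) :
    Nonempty (Module.Basis (Fin 2) ℤ (𝓞 K)) :=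
  ⟨(Module.finBasis ℤ (𝓞 K)).reindex (finCongr (by rw [NumberField.RingOfIntegers.rank, hK]))⟩

theorem mul_self_ringOfIntegers (hK : Module.finrank ℚ K = 2) (ω : 𝓞 K) :
    ω * ω = (Algebra.trace ℤ (𝓞 K) ω : 𝓞 K) * ω - (Algebra.norm ℤ ω : 𝓞 K) :=
  mul_self_eq_trace_sub_norm (exists_basis_ringOfIntegers hK).some ω

/-- An element whose discriminant is the discriminant of the quadratic field generates the ring of
integers. -/
theorem exists_eq_add_mul (hK : Module.finrank ℚ K = 2) {ω : 𝓞 K}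
    (hω : (Algebra.trace ℤ (𝓞 K) ω) ^ 2 - 4 * Algebra.norm ℤ ω = NumberField.discr K)
    (z : 𝓞 K) : ∃ a b : ℤ, z = a + b * ω := by
  obtain ⟨e⟩ := exists_basis_ringOfIntegers hK
  have hsq : Algebra.trace ℤ (𝓞 K) (ω * ω) =
      Algebra.trace ℤ (𝓞 K) ω ^ 2 - 2 * Algebra.norm ℤ ω := by
    have h1 : ω * ω = Algebra.trace ℤ (𝓞 K) ω • ω - algebraMap ℤ (𝓞 K) (Algebra.norm ℤ ω) := by
      rw [mul_self_ringOfIntegers hK ω, zsmul_eq_mul, eq_intCast]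
    have h2 : Algebra.trace ℤ (𝓞 K) (algebraMap ℤ (𝓞 K) (Algebra.norm ℤ ω)) =
        2 * Algebra.norm ℤ ω := by
      rw [Algebra.trace_algebraMap, NumberField.RingOfIntegers.rank, hK]; simp
    rw [h1, map_sub, map_smul, h2]; simp; ring
  have h1 : Algebra.trace ℤ (𝓞 K) (1 : 𝓞 K) = 2 := by
    have := Algebra.trace_algebraMap (S := 𝓞 K) (1 : ℤ)
    rwa [map_one, NumberField.RingOfIntegers.rank, hK, nsmul_eq_mul, mul_one] at this
  have hdisc : Algebra.discr ℤ ![(1 : 𝓞 K), ω] = NumberField.discr K := by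
    rw [← hω, Algebra.discr_def, Matrix.det_fin_two]
    simp [Algebra.traceMatrix_apply, Algebra.traceForm_apply, hsq, h1]
    ring
  have hmat : (![(1 : 𝓞 K), ω] : Fin 2 → 𝓞 K) =
      Matrix.vecMul (e : Fin 2 → 𝓞 K) ((e.toMatrix ![(1 : 𝓞 K), ω]).map (algebraMap ℤ (𝓞 K))) := by
    ext1 j
    rw [Matrix.vecMul, dotProduct]
    have := e.sum_repr (![(1 : 𝓞 K), ω] j)
    rw [← this]
    refine Finset.sum_congr rfl fun k _ => ?_
    rw [Matrix.map_apply, Module.Basis.toMatrix_apply, zsmul_eq_mul, mul_comm, eq_intCast]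
  -- The discriminant of (1, ω) is that of an integral basis times the squared determinant of the
  -- base change. The two discriminants agree, so the determinant is ±1.
  have hdet : IsUnit (e.det ![(1 : 𝓞 K), ω]) := by
    have h2 := Algebra.discr_of_matrix_vecMul (A := ℤ) (e : Fin 2 → 𝓞 K)
      (e.toMatrix ![(1 : 𝓞 K), ω])
    rw [← hmat, hdisc, NumberField.discr_eq_discr] at h2
    have h3 : (e.toMatrix ![(1 : 𝓞 K), ω]).det ^ 2 = 1 :=
      mul_right_cancel₀ (NumberField.discr_ne_zero K) (by rw [← h2, one_mul])
    rw [Module.Basis.det_apply]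
    exact IsUnit.of_mul_eq_one _ (by rw [← sq]; exact h3)
  have hspan := ((Module.Basis.is_basis_iff_det e).2 hdet).2
  have hz : z ∈ Submodule.span ℤ (Set.range ![(1 : 𝓞 K), ω]) := by rw [hspan]; trivial
  rw [Matrix.range_cons, Matrix.range_cons, Matrix.range_empty, Set.union_empty,
    Set.singleton_union, Submodule.mem_span_pair] at hz
  obtain ⟨a, b, h⟩ := hz
  exact ⟨a, b, by rw [← h, zsmul_eq_mul, zsmul_eq_mul, mul_one]⟩

theorem isIntegral_of_quadratic {R : Type*} [CommRing R] {k : R} {T N : ℤ}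
    (h : k * k = T * k - N) : IsIntegral ℤ k := by
  refine ⟨Polynomial.X ^ 2 + (Polynomial.C (-T) * Polynomial.X + Polynomial.C N), ?_, ?_⟩
  · exact Polynomial.monic_X_pow_add (by
      refine (Polynomial.degree_linear_le).trans_lt ?_
      norm_num)
  · rw [Polynomial.eval₂_add, Polynomial.eval₂_add, Polynomial.eval₂_mul, Polynomial.eval₂_pow,
      Polynomial.eval₂_X, Polynomial.eval₂_C, Polynomial.eval₂_C, eq_intCast, eq_intCast, sq, h,
      Int.cast_neg]
    ring

/-- For `J` a nonzero ideal, `J` is locally at `ℓ` generated by one of its elements. -/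
theorem exists_local_generator (ℓ : ℕ) [Fact ℓ.Prime] {J : Ideal (𝓞 K)} (hJ : J ≠ ⊥) :
    ∃ a ∈ J, a ≠ 0 ∧ ∃ s : ℕ, s.Coprime ℓ ∧ ∀ k ∈ J, ∃ z : 𝓞 K, (s : 𝓞 K) * k = a * z := by
  have hℓ0 : (ℓ : 𝓞 K) ≠ 0 := by exact_mod_cast (Fact.out : ℓ.Prime).ne_zero
  have hI : Ideal.span {(ℓ : 𝓞 K)} * J ≠ 0 := by
    refine mul_ne_zero ?_ hJ
    rw [Ne, Ideal.zero_eq_bot, Ideal.span_singleton_eq_bot]; exact hℓ0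
  -- An element a is taken with J = ℓJ + (a).
  obtain ⟨a, ha⟩ := IsDedekindDomain.exists_sup_span_eq (I := Ideal.span {(ℓ : 𝓞 K)} * J) (J := J)
    Ideal.mul_le_right hI
  have haJ : a ∈ J := by
    rw [← ha]; exact Ideal.mem_sup_right (Ideal.mem_span_singleton_self a)
  let f : 𝓞 K →ₗ[ℤ] (𝓞 K ⧸ Ideal.span {a}) :=
      (Ideal.Quotient.mk (Ideal.span {a})).toAddMonoidHom.toIntLinearMap
  have hf : ∀ x, f x = Ideal.Quotient.mk (Ideal.span {a}) x := fun _ => rfl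
  let N : Submodule ℤ (𝓞 K ⧸ Ideal.span {a}) := (J.restrictScalars ℤ).map f
  have hN : N.FG := Submodule.FG.map _ (IsNoetherian.noetherian _)
  -- The image N of J modulo (a) satisfies N = ℓN, so by Nakayama an integer r ≡ 1 modulo ℓ
  -- annihilates it.
  have hle : N ≤ (Ideal.span {(ℓ : ℤ)}) • N := by
    rintro _ ⟨x, hx, rfl⟩
    have hx' : x ∈ Ideal.span {(ℓ : 𝓞 K)} * J ⊔ Ideal.span {a} := by rw [ha]; exact hx
    obtain ⟨y, hy, z, hz, rfl⟩ := Submodule.mem_sup.1 hx'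
    obtain ⟨y', hy', rfl⟩ := Ideal.mem_span_singleton_mul.1 hy
    have h1 : f ((ℓ : 𝓞 K) * y' + z) = (ℓ : ℤ) • f y' := by
      rw [map_add, hf z, (Ideal.Quotient.eq_zero_iff_mem).2 hz, add_zero, ← map_zsmul]
      congr 1; simp
    rw [h1]
    exact Submodule.smul_mem_smul (Ideal.mem_span_singleton_self _) ⟨y', hy', rfl⟩
  obtain ⟨r, hr, hr'⟩ := Submodule.exists_sub_one_mem_and_smul_eq_zero_of_fg_of_le_smul _ N hN hle
  have hrJ : ∀ k ∈ J, ∃ z : 𝓞 K, (r : 𝓞 K) * k = a * z := by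
    intro k hk
    have := hr' (f k) ⟨k, hk, rfl⟩
    rw [← map_zsmul, hf, Ideal.Quotient.eq_zero_iff_mem, Ideal.mem_span_singleton,
      zsmul_eq_mul] at this
    exact this
  rw [Ideal.mem_span_singleton] at hr
  have hcop : r.natAbs.Coprime ℓ := by
    refine Nat.Coprime.symm ((Nat.Prime.coprime_iff_not_dvd Fact.out).2 fun h => ?_)
    have h1 := dvd_sub (Int.natCast_dvd.2 h) hr
    rw [sub_sub_cancel] at h1
    have h2 := Int.natCast_dvd.1 h1
    exact (Fact.out : ℓ.Prime).one_lt.ne' (Nat.dvd_one.1 h2)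
  refine ⟨a, haJ, ?_, r.natAbs, hcop, fun k hk => ?_⟩
  · rintro rfl
    obtain ⟨k, hk, hk0⟩ := Submodule.exists_mem_ne_zero_of_ne_bot hJ
    obtain ⟨z, hz⟩ := hrJ k hk
    rw [zero_mul, mul_eq_zero] at hz
    have hr0 : r = 0 := by exact_mod_cast hz.resolve_right hk0
    rw [hr0, Int.natAbs_zero, Nat.coprime_zero_left] at hcop
    exact (Fact.out : ℓ.Prime).one_lt.ne' hcop
  · obtain ⟨z, hz⟩ := hrJ k hk
    rcases Int.natAbs_eq r with h | h
    · refine ⟨z, ?_⟩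
      rw [← hz]; congr 1
      conv_rhs => rw [h]
      simp
    · refine ⟨-z, ?_⟩
      rw [mul_neg, ← hz, ← neg_mul]; congr 1
      conv_rhs => rw [h]
      simp

theorem exists_local_generator_fractional (ℓ : ℕ) [Fact ℓ.Prime]
    {J : FractionalIdeal (𝓞 K)⁰ K} (hJ : J ≠ 0) :
    ∃ j ∈ J, j ≠ 0 ∧ ∃ s : ℕ, s.Coprime ℓ ∧ ∀ k ∈ J, ∃ z : 𝓞 K, (s : K) * k = j * z := by
  obtain ⟨c, I, hc, rfl⟩ := FractionalIdeal.exists_eq_spanSingleton_mul J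
  have hc' : (algebraMap (𝓞 K) K c) ≠ 0 := by
    rwa [Ne, FaithfulSMul.algebraMap_eq_zero_iff]
  have hI : I ≠ ⊥ := by
    rintro rfl
    exact hJ (by simp)
  obtain ⟨a, ha, ha0, s, hs, h⟩ := exists_local_generator ℓ hI
  refine ⟨(algebraMap (𝓞 K) K c)⁻¹ * algebraMap (𝓞 K) K a, ?_, ?_, s, hs, fun k hk => ?_⟩
  · exact FractionalIdeal.mem_singleton_mul.2
      ⟨_, (FractionalIdeal.mem_coeIdeal _).2 ⟨a, ha, rfl⟩, rfl⟩
  · refine mul_ne_zero (inv_ne_zero hc') ?_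
    rwa [Ne, FaithfulSMul.algebraMap_eq_zero_iff]
  · obtain ⟨y, hy, rfl⟩ := FractionalIdeal.mem_singleton_mul.1 hk
    obtain ⟨k, hkI, rfl⟩ := (FractionalIdeal.mem_coeIdeal _).1 hy
    obtain ⟨z, hz⟩ := h k hkI
    refine ⟨z, ?_⟩
    have := congrArg (algebraMap (𝓞 K) K) hz
    rw [map_mul, map_mul, map_natCast] at this
    rw [mul_left_comm, this, mul_assoc]

end QuadraticField

/-- A quadratic field embedded in a quaternion algebra, with a generator `ω` of its ring of
integers whose trace is divisible by `p`. -/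
structure EmbeddedField (p : ℕ) [Fact p.Prime] {B : Type*} [Ring B] [Algebra ℚ B]
    (Ot : Subalgebra ℤ B) (κ : Type*) [Field κ] [Fintype κ] (K : Type*) [Field K]
    [NumberField K] where
  S : LocalStructure p Ot κ
  i : K →ₐ[ℚ] B
  ω : 𝓞 K
  d : ℕ
  finrank : Module.finrank ℚ K = 2
  not_dvd : ¬ p ∣ d
  discr : NumberField.discr K = -((p : ℤ) * d)
  disc : (Algebra.trace ℤ (𝓞 K) ω) ^ 2 - 4 * Algebra.norm ℤ ω = NumberField.discr K
  dvd_trace : (p : ℤ) ∣ Algebra.trace ℤ (𝓞 K) ω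

/-! ### The embedded generator, globally and locally. -/

namespace EmbeddedField

variable {p : ℕ} [Fact p.Prime] {B : Type*} [Ring B] [Algebra ℚ B] {Ot : Subalgebra ℤ B}
  {κ : Type*} [Field κ] [Fintype κ] {K : Type*} [Field K] [NumberField K]
  (E : EmbeddedField p Ot κ K)

/-- The trace of the generator. -/
noncomputable def t : ℤ := Algebra.trace ℤ (𝓞 K) E.ω

/-- The norm of the generator. -/
noncomputable def n : ℤ := Algebra.norm ℤ E.ω

/-- The image of the generator in the quaternion algebra. -/
def w : B := E.i (E.ω : K)

theorem disc_eq : E.t ^ 2 - 4 * E.n = -((p : ℤ) * E.d) := E.disc.trans E.discr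

theorem disc_neg : E.t ^ 2 - 4 * E.n < 0 := by
  rw [E.disc_eq, neg_neg_iff_pos]
  have h1 : 0 < p := (Fact.out : p.Prime).pos
  have h2 : 0 < E.d := Nat.pos_of_ne_zero fun h => E.not_dvd (h ▸ dvd_zero p)
  positivity

theorem ω_mul_self : (E.ω : K) * (E.ω : K) = (E.t : K) * (E.ω : K) - (E.n : K) := by
  have := congrArg (algebraMap (𝓞 K) K) (mul_self_ringOfIntegers E.finrank E.ω)
  rwa [map_mul, map_sub, map_mul, map_intCast, map_intCast] at this

theorem exists_eq (z : 𝓞 K) : ∃ a b : ℤ, (z : K) = a + b * (E.ω : K) := by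
  obtain ⟨a, b, h⟩ := exists_eq_add_mul E.finrank E.disc z
  refine ⟨a, b, ?_⟩
  have := congrArg (algebraMap (𝓞 K) K) h
  rwa [map_add, map_mul, map_intCast, map_intCast] at this

theorem ω_ne_ratCast (c : ℚ) : (E.ω : K) ≠ c := by
  intro h
  have h1 := E.ω_mul_self
  rw [h] at h1
  have h2 : c * c = E.t * c - E.n := by exact_mod_cast h1
  have h3 : ((E.t ^ 2 - 4 * E.n : ℤ) : ℚ) < 0 := by exact_mod_cast E.disc_neg
  push_cast at h3
  nlinarith [sq_nonneg (2 * c - E.t)]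

theorem w_mul_self : E.w * E.w = (E.t : ℚ) • E.w - algebraMap ℚ B (E.n : ℚ) := by
  have := congrArg E.i E.ω_mul_self
  rw [map_mul, map_sub, map_mul, map_intCast, map_intCast] at this
  rw [w, this, map_intCast, Algebra.smul_def, map_intCast]

theorem w_ne_algebraMap (c : ℚ) : E.w ≠ algebraMap ℚ B c := by
  have := E.S.quat.nontrivial
  intro h
  refine E.ω_ne_ratCast c (E.i.toRingHom.injective ?_)
  change E.w = E.i (c : K)
  rw [h, ← eq_ratCast (algebraMap ℚ K), AlgHom.commutes]

/-- The element w satisfies two monic quadratic equations, one from K and one from B. If they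
differed, w would be rational. -/
theorem trd_nrd_w : trd E.w = E.t ∧ nrd E.w = E.n := by
  have h1 : E.w * E.w = trd E.w • E.w - algebraMap ℚ B (nrd E.w) := E.S.quat.mul_self E.w
  rw [E.w_mul_self] at h1
  have h2 : ((E.t : ℚ) - trd E.w) • E.w = algebraMap ℚ B (E.n - nrd E.w) := by
    rw [sub_smul, map_sub, sub_eq_sub_iff_add_eq_add, add_comm]
    exact (sub_eq_iff_eq_add.1 (sub_eq_iff_eq_add.1 h1 ▸ by abel))
  by_cases h : (E.t : ℚ) - trd E.w = 0
  · rw [h, zero_smul, ← map_zero (algebraMap ℚ B)] at h2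
    have := E.S.quat.algebraMap_inj h2
    exact ⟨(sub_eq_zero.1 h).symm, (sub_eq_zero.1 this.symm).symm⟩
  · refine absurd ?_ (E.w_ne_algebraMap (((E.t : ℚ) - trd E.w)⁻¹ * (E.n - nrd E.w)))
    rw [map_mul, ← h2, ← Algebra.smul_def, smul_smul, inv_mul_cancel₀ h, one_smul]

section
variable (ℓ : ℕ) [Fact ℓ.Prime]

theorem trd_toLoc_w : trdF ℚ_[ℓ] (toLoc ℓ E.w) = (E.t : ℚ_[ℓ]) := by
  rw [trdF_toLoc E.S.quat, E.trd_nrd_w.1, Rat.cast_intCast]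

theorem nrd_toLoc_w : nrdF ℚ_[ℓ] (toLoc ℓ E.w) = (E.n : ℚ_[ℓ]) := by
  rw [nrdF_toLoc E.S.quat, E.trd_nrd_w.2, Rat.cast_intCast]

theorem toLoc_w_ne (c : ℚ_[ℓ]) : toLoc ℓ E.w ≠ algebraMap ℚ_[ℓ] (Bloc B ℓ) c := by
  intro h
  have h1 := E.trd_toLoc_w ℓ
  have h2 := E.nrd_toLoc_w ℓ
  rw [h, trdF_algebraMap (E.S.quatLoc ℓ).finrank] at h1
  rw [h, (E.S.quatLoc ℓ).nrd_algebraMap] at h2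
  have h3 : ((E.t ^ 2 - 4 * E.n : ℤ) : ℚ_[ℓ]) = 0 := by
    push_cast
    rw [← h1, ← h2]; ring
  exact E.disc_neg.ne (by exact_mod_cast h3)

end

/-- The norm of the generator is exactly divisible by `p`, with quotient `d / 4` modulo `p`. -/
theorem exists_n_eq : ∃ m : ℤ, E.n = p * m ∧ (p : ℤ) ∣ 4 * m - E.d := by
  obtain ⟨s, hs⟩ : (p : ℤ) ∣ E.t := E.dvd_trace
  have h1 : 4 * E.n = p * (E.d + p * s ^ 2) := by
    have := E.disc_eq
    rw [hs] at this
    linarith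
  have hp4 : IsCoprime (p : ℤ) 4 := by
    rw [Int.isCoprime_iff_gcd_eq_one]
    have := E.S.two_lt
    have h2 : Nat.Coprime p 2 := (Nat.coprime_primes Fact.out Nat.prime_two).2 (by omega)
    exact Nat.Coprime.pow_right 2 h2
  obtain ⟨m, hm⟩ : (p : ℤ) ∣ E.n := hp4.dvd_of_dvd_mul_left ⟨_, h1⟩
  -- With t = p s the discriminant equation reads 4n = p (d + p s²), so 4m - d = p s².
  refine ⟨m, hm, ⟨s ^ 2, ?_⟩⟩
  have hp0 : (p : ℤ) ≠ 0 := by exact_mod_cast (Fact.out : p.Prime).ne_zero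
  apply mul_left_cancel₀ hp0
  rw [hm] at h1
  linarith

theorem not_dvd_int : ¬ (p : ℤ) ∣ E.d := fun h => E.not_dvd (by exact_mod_cast h)

theorem norm_n : ‖(E.n : ℚ_[p])‖ = (p : ℝ)⁻¹ := by
  obtain ⟨m, hm, hd⟩ := E.exists_n_eq
  have hm' : ¬ (p : ℤ) ∣ m := fun h => E.not_dvd_int (by
    have := dvd_sub (h.mul_left 4) hd
    rwa [sub_sub_cancel] at this)
  have hmn : ‖(m : ℚ_[p])‖ = 1 := le_antisymm (Padic.norm_int_le_one m)
    (not_lt.1 fun h => hm' ((Padic.norm_intCast_lt_one_iff (p := p)).1 h))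
  rw [hm, Int.cast_mul, norm_mul, hmn, mul_one, Int.cast_natCast, Padic.norm_p]

theorem ω_ne_zero : (E.ω : K) ≠ 0 := by
  have := E.ω_ne_ratCast 0
  rwa [Rat.cast_zero] at this

/-- The units of the completions coming from the quadratic field. -/
noncomputable def loc (ℓ : ℕ) [Fact ℓ.Prime] : Kˣ →* (Bloc B ℓ)ˣ :=
  (unitLoc ℓ).comp (Units.map (E.i : K →* B))

theorem coe_loc (ℓ : ℕ) [Fact ℓ.Prime] (k : Kˣ) :
    (E.loc ℓ k : Bloc B ℓ) = toLoc ℓ (E.i (k : K)) := rfl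

/-- The generator, as a unit. -/
noncomputable def ωu : Kˣ := Units.mk0 (E.ω : K) E.ω_ne_zero

theorem coe_loc_ωu (ℓ : ℕ) [Fact ℓ.Prime] : (E.loc ℓ E.ωu : Bloc B ℓ) = toLoc ℓ E.w := rfl

theorem norm_nrd_ωu : ‖nrdF ℚ_[p] (E.loc p E.ωu : Bloc B p)‖ = (p : ℝ)⁻¹ := by
  rw [coe_loc_ωu, nrd_toLoc_w, norm_n]

theorem nrd_ωu : nrdF ℚ_[p] (E.loc p E.ωu : Bloc B p) = (E.n : ℚ_[p]) := by
  rw [coe_loc_ωu, nrd_toLoc_w]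

theorem loc_comm (ℓ : ℕ) [Fact ℓ.Prime] (k l : Kˣ) :
    E.loc ℓ k * E.loc ℓ l = E.loc ℓ l * E.loc ℓ k := by
  rw [← map_mul, mul_comm, map_mul]

/-- The norm of w is divisible by p, so w reduces to 0, which lies in the prime field. -/
theorem toLoc_w_mem : toLoc p E.w ∈ locLat p (ordLat Ot) := by
  have hp1 : (1 : ℝ) < p := by exact_mod_cast (Fact.out : p.Prime).one_lt
  have h : ‖nrdF ℚ_[p] (toLoc p E.w)‖ < 1 := by
    rw [nrd_toLoc_w, norm_n]; exact inv_lt_one_of_one_lt₀ hp1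
  rw [E.S.mem_iff]
  refine ⟨h.le, ?_⟩
  rw [(E.S.R.eq_zero_iff _ h.le).2 h, zero_pow (Fact.out : p.Prime).ne_zero]

/-- Optimality: `w` is not congruent to a scalar modulo `ℓ`, for any conjugate of the order. -/
theorem conj_w_sub_ne {ℓ : ℕ} [Fact ℓ.Prime] (x : (Bloc B ℓ)ˣ) (m : ℕ) {y : Bloc B ℓ}
    (hy : y ∈ locLat ℓ (ordLat Ot)) :
    (x : Bloc B ℓ) * toLoc ℓ E.w * (↑x⁻¹ : Bloc B ℓ) - m ≠ (ℓ : ℚ_[ℓ]) • y := by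
  intro h
  have hq := E.S.quatLoc ℓ
  have hℓ0 : (ℓ : ℚ_[ℓ]) ≠ 0 := by exact_mod_cast (Fact.out : ℓ.Prime).ne_zero
  have hℓK : (ℓ : K) ≠ 0 := by exact_mod_cast (Fact.out : ℓ.Prime).ne_zero
  set v : Bloc B ℓ := (x : Bloc B ℓ) * toLoc ℓ E.w * (↑x⁻¹ : Bloc B ℓ)
  have hvn : nrdF ℚ_[ℓ] v = E.n := by
    have hx := hq.nrd_ne_zero_of_isUnit x.isUnit
    rw [hq.nrd_mul, hq.nrd_mul, hq.nrd_inv, nrd_toLoc_w]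
    field_simp
  have hvv : v * v = (E.t : ℚ_[ℓ]) • v - algebraMap ℚ_[ℓ] _ (E.n : ℚ_[ℓ]) := by
    have h1 := hq.mul_self (toLoc ℓ E.w)
    rw [trd_toLoc_w, nrd_toLoc_w] at h1
    have h2 : v * v = (x : Bloc B ℓ) * (toLoc ℓ E.w * toLoc ℓ E.w) * (↑x⁻¹ : Bloc B ℓ) := by
      simp only [v, mul_assoc, Units.inv_mul_cancel_left]
    rw [h2, h1, mul_sub, sub_mul, mul_smul_comm, smul_mul_assoc, ← Algebra.commutes,
      mul_assoc (algebraMap _ _ _), Units.mul_inv, mul_one]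
  have hvt : trdF ℚ_[ℓ] v = E.t := by
    have h1 := hq.mul_self v
    rw [hvv, hvn, sub_left_inj] at h1
    by_contra hne
    have h0 : ((E.t : ℚ_[ℓ]) - trdF ℚ_[ℓ] v) • v = 0 := by rw [sub_smul, h1, sub_self]
    rcases smul_eq_zero.1 h0 with h0 | h0
    · exact hne (sub_eq_zero.1 h0).symm
    · refine E.toLoc_w_ne ℓ 0 ?_
      have : toLoc ℓ E.w = (↑x⁻¹ : Bloc B ℓ) * v * x := by
        simp only [v, mul_assoc, Units.inv_mul_cancel_left, Units.inv_mul, mul_one]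
      rw [this, h0, mul_zero, zero_mul, map_zero]
  have hv : v = (m : ℚ_[ℓ]) • 1 + (ℓ : ℚ_[ℓ]) • y := by
    rw [← h, ← Algebra.algebraMap_eq_smul_one, map_natCast, add_sub_cancel]
  have hone : trdF ℚ_[ℓ] (1 : Bloc B ℓ) = 2 := by
    have := trdF_algebraMap hq.finrank (1 : ℚ_[ℓ])
    rwa [map_one, mul_one] at this
  have ht : (E.t : ℚ_[ℓ]) - 2 * m = ℓ * trdF ℚ_[ℓ] y := by
    rw [← hvt, hv, trdF_add, trdF_smul, trdF_smul, hone]; ring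
  have hn : (E.n : ℚ_[ℓ]) - m * E.t + m ^ 2 = ℓ ^ 2 * nrdF ℚ_[ℓ] y := by
    rw [← hq.nrd_smul, ← h, sub_eq_add_neg v, hq.nrd_add, hvn, hq.nrd_neg,
      ← map_natCast (algebraMap ℚ_[ℓ] (Bloc B ℓ)), hq.nrd_algebraMap, ← map_neg,
      hq.conj_algebraMap, ← Algebra.commutes, ← Algebra.smul_def,
      trdF_smul, hvt]
    ring
  have htd : (ℓ : ℤ) ∣ E.t - 2 * m := by
    have := Padic.norm_intCast_lt_one_iff (p := ℓ) (k := E.t - 2 * m)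
    rw [← this]
    push_cast
    rw [ht, norm_mul]
    exact mul_lt_one_of_nonneg_of_lt_one_left (norm_nonneg _) Padic.norm_p_lt_one
      (E.S.norm_trd_le hy)
  have hnd : ((ℓ ^ 2 : ℕ) : ℤ) ∣ E.n - m * E.t + m ^ 2 := by
    push_cast
    rw [← Padic.norm_int_le_pow_iff_dvd]
    push_cast
    rw [hn, norm_mul, norm_pow, Padic.norm_p]
    refine (mul_le_of_le_one_right (by positivity) (E.S.norm_nrd_le hy)).trans ?_
    rw [zpow_neg, inv_pow]; norm_cast
  obtain ⟨a, ha⟩ := htd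
  obtain ⟨b, hb⟩ := hnd
  -- The congruence would make the trace and norm of (ω - m)/ℓ integral. But every integer of K is
  -- in ℤ + ℤω, and this element is not.
  have hz : IsIntegral ℤ (((E.ω : K) - m) / ℓ) := by
    refine isIntegral_of_quadratic (T := a) (N := b) ?_
    have haK : (E.t : K) - 2 * m = ℓ * a := by exact_mod_cast congrArg (Int.cast : ℤ → K) ha
    have hbK : (E.n : K) - m * E.t + m ^ 2 = ℓ ^ 2 * b := by
      exact_mod_cast congrArg (Int.cast : ℤ → K) hb
    have := E.ω_mul_self
    field_simp
    linear_combination this + ((E.ω : K) - m) * haK - hbK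
  obtain ⟨a', b', hab⟩ := E.exists_eq ⟨_, hz⟩
  change ((E.ω : K) - m) / ℓ = a' + b' * E.ω at hab
  rw [div_eq_iff hℓK] at hab
  have hne : (1 - ℓ * b' : ℚ) ≠ 0 := by
    intro h0
    have h1 : (ℓ : ℤ) ∣ 1 := ⟨b', by
      have : (1 : ℚ) = ℓ * b' := sub_eq_zero.1 h0
      exact_mod_cast this⟩
    have h2 := Int.natCast_dvd_natCast.1 (by exact_mod_cast h1 : (ℓ : ℤ) ∣ ((1 : ℕ) : ℤ))
    exact (Fact.out : ℓ.Prime).one_lt.ne' (Nat.dvd_one.1 h2)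
  refine E.ω_ne_ratCast ((m + ℓ * a') / (1 - ℓ * b')) ?_
  have hneK : (1 - ℓ * b' : K) ≠ 0 := by exact_mod_cast (Rat.cast_ne_zero (α := K)).2 hne
  push_cast
  rw [eq_div_iff hneK]
  linear_combination hab

end EmbeddedField

theorem trdF_mul_comm {F A : Type*} [Field F] [Ring A] [Algebra F A] (x y : A) :
    trdF F (x * y) = trdF F (y * x) := by
  rw [trdF, trdF]
  congr 1
  rw [LinearMap.mulLeft_mul, LinearMap.mulLeft_mul]
  exact LinearMap.trace_mul_comm F _ _

theorem trdF_conj_units {F A : Type*} [Field F] [Ring A] [Algebra F A] (x : Aˣ) (y : A) :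
    trdF F ((x : A) * y * (↑x⁻¹ : A)) = trdF F y := by
  rw [trdF_mul_comm, ← mul_assoc, Units.inv_mul, one_mul]

theorem QuatLike.nrd_conj_units {F A : Type*} [Field F] [Ring A] [Algebra F A] [CharZero F]
    (h : QuatLike F A) (x : Aˣ) (y : A) : nrdF F ((x : A) * y * (↑x⁻¹ : A)) = nrdF F y := by
  have hx := h.nrd_ne_zero_of_isUnit x.isUnit
  rw [h.nrd_mul, h.nrd_mul, h.nrd_inv]
  field_simp

/-! ### Fractional ideals of K inside B. -/

section EmbIdeal

variable {B : Type*} [Ring B] [Algebra ℚ B] {K : Type*} [Field K] [NumberField K]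
  (i : K →ₐ[ℚ] B)

theorem mem_embIdeal {J : FractionalIdeal (𝓞 K)⁰ K} {b : B} :
    b ∈ embIdeal i J ↔ ∃ k ∈ J, i k = b := Iff.rfl

theorem embIdeal_mul (J J' : FractionalIdeal (𝓞 K)⁰ K) :
    embIdeal i (J * J') = embIdeal i J * embIdeal i J' := by
  apply le_antisymm
  · rintro _ ⟨k, hk, rfl⟩
    refine FractionalIdeal.mul_induction_on (I := J) (J := J')
      (C := fun k => i k ∈ embIdeal i J * embIdeal i J') hk (fun a ha b hb => ?_)
      fun a b ha hb => ?_
    · rw [map_mul]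
      exact Submodule.mul_mem_mul ⟨a, ha, rfl⟩ ⟨b, hb, rfl⟩
    · rw [map_add]; exact add_mem ha hb
  · rw [Submodule.mul_le]
    rintro _ ⟨a, ha, rfl⟩ _ ⟨b, hb, rfl⟩
    exact ⟨a * b, FractionalIdeal.mul_mem_mul ha hb, map_mul i a b⟩

theorem fg_embIdeal (J : FractionalIdeal (𝓞 K)⁰ K) : (embIdeal i J).FG := by
  have h1 : (J : Submodule (𝓞 K) K).FG := by
    have := FractionalIdeal.isNoetherian J
    exact Module.Finite.iff_fg.1 inferInstance
  exact Submodule.FG.map _ h1.restrictScalars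

theorem isLatticeIn_mul_embIdeal {L : Submodule ℤ B} (hL : IsLatticeIn L)
    {J : FractionalIdeal (𝓞 K)⁰ K} (hJ : J ≠ 0) : IsLatticeIn (L * embIdeal i J) := by
  refine ⟨hL.1.mul (fg_embIdeal i J), eq_top_iff.2 fun b _ => ?_⟩
  obtain ⟨j, hj, hj0⟩ : ∃ j ∈ J, j ≠ 0 := by
    by_contra! hcon
    exact hJ (FractionalIdeal.eq_zero_iff.2 hcon)
  have h1 : Submodule.span ℚ (L : Set B) ≤
      (Submodule.span ℚ ((L * embIdeal i J : Submodule ℤ B) : Set B)).comap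
        (LinearMap.mulRight ℚ (i j)) :=
    Submodule.span_le.2 fun l hl => Submodule.subset_span (Submodule.mul_mem_mul hl ⟨j, hj, rfl⟩)
  have h2 : b * i j⁻¹ ∈ Submodule.span ℚ (L : Set B) := by rw [hL.2]; trivial
  have h3 : b * i j⁻¹ * i j ∈ Submodule.span ℚ ((L * embIdeal i J : Submodule ℤ B) : Set B) :=
    h1 h2
  rwa [mul_assoc, ← map_mul, inv_mul_cancel₀ hj0, map_one, mul_one] at h3

theorem rmul_mul_embIdeal (L : Submodule ℤ B) (J : FractionalIdeal (𝓞 K)⁰ K) (k : K) :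
    rmul (L * embIdeal i J) (i k) =
      L * embIdeal i (J * FractionalIdeal.spanSingleton (𝓞 K)⁰ k) := by
  have h1 : embIdeal i (J * FractionalIdeal.spanSingleton (𝓞 K)⁰ k) =
      rmul (embIdeal i J) (i k) := by
    ext b
    rw [mem_embIdeal, mul_comm]
    constructor
    · rintro ⟨z, hz, rfl⟩
      obtain ⟨y, hy, rfl⟩ := FractionalIdeal.mem_singleton_mul.1 hz
      exact ⟨i y, ⟨y, hy, rfl⟩, by rw [LinearMap.mulRight_apply, ← map_mul, mul_comm]⟩
    · rintro ⟨_, ⟨y, hy, rfl⟩, rfl⟩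
      refine ⟨k * y, FractionalIdeal.mem_singleton_mul.2 ⟨y, hy, rfl⟩, ?_⟩
      rw [mul_comm, map_mul]; rfl
  rw [h1]
  apply le_antisymm
  · rw [rmul, Submodule.map_le_iff_le_comap, Submodule.mul_le]
    intro m hm n hn
    rw [Submodule.mem_comap, LinearMap.mulRight_apply, mul_assoc]
    exact Submodule.mul_mem_mul hm ⟨n, hn, rfl⟩
  · rw [Submodule.mul_le]
    rintro m hm _ ⟨n, hn, rfl⟩
    rw [LinearMap.mulRight_apply, ← mul_assoc]
    exact ⟨m * n, Submodule.mul_mem_mul hm hn, rfl⟩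

end EmbIdeal

/-! ### Special points and the action of fractional ideals. -/

namespace EmbeddedField

variable {p : ℕ} [Fact p.Prime] {B : Type*} [Ring B] [Algebra ℚ B] {Ot : Subalgebra ℤ B}
  {κ : Type*} [Field κ] [Fintype κ] {K : Type*} [Field K] [NumberField K]
  (E : EmbeddedField p Ot κ K)

theorem i_eq (z : 𝓞 K) : ∃ a b : ℤ, E.i (z : K) = a • 1 + b • E.w := by
  obtain ⟨a, b, h⟩ := E.exists_eq z
  refine ⟨a, b, ?_⟩
  rw [h, map_add, map_mul, map_intCast, map_intCast, zsmul_eq_mul, zsmul_eq_mul, mul_one]; rfl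

theorem mul_i_mem {L : Submodule ℤ B} (h : ∀ l ∈ L, l * E.w ∈ L) (z : 𝓞 K) {l : B} (hl : l ∈ L) :
    l * E.i (z : K) ∈ L := by
  obtain ⟨a, b, hz⟩ := E.i_eq z
  rw [hz, mul_add, mul_smul_comm, mul_smul_comm, mul_one]
  exact add_mem (zsmul_mem hl _) (zsmul_mem (h l hl) _)

theorem mul_toLoc_i_mem {ℓ : ℕ} [Fact ℓ.Prime] {M : Submodule ℤ_[ℓ] (Bloc B ℓ)}
    (h : ∀ l ∈ M, l * toLoc ℓ E.w ∈ M) (z : 𝓞 K) {l : Bloc B ℓ} (hl : l ∈ M) :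
    l * toLoc ℓ (E.i (z : K)) ∈ M := by
  obtain ⟨a, b, hz⟩ := E.i_eq z
  rw [hz, map_add, map_zsmul, map_zsmul, map_one, mul_add, mul_smul_comm, mul_smul_comm, mul_one]
  exact add_mem (zsmul_mem hl _) (zsmul_mem (h l hl) _)

/-- The families `x` such that `Ot x` is a special point. -/
def IsSp (x : ∀ ℓ : Nat.Primes, (Bloc B (ℓ : ℕ))ˣ) : Prop :=
  ∀ ℓ : Nat.Primes, (x ℓ : Bloc B (ℓ : ℕ)) * toLoc (ℓ : ℕ) E.w * (↑(x ℓ)⁻¹ : Bloc B (ℓ : ℕ)) ∈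
    locLat (ℓ : ℕ) (ordLat Ot)

variable {x x' : ∀ ℓ : Nat.Primes, (Bloc B (ℓ : ℕ))ˣ}

theorem isSp_iff (hx : AEUnit Ot x) : E.IsSp x ↔ E.w ∈ rightOrder (idl Ot x) :=
  (mem_rightOrder_idl E.S.lat hx).symm

/-- At every prime k is conjugate into the local order, so its trace and norm are integral
everywhere. -/
theorem exists_integer_of_mem_rightOrder (hx : AEUnit Ot x) {k : K}
    (hk : E.i k ∈ rightOrder (idl Ot x)) : ∃ z : 𝓞 K, (z : K) = k := by
  have hk' := (mem_rightOrder_idl E.S.lat hx).1 hk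
  obtain ⟨T, hT⟩ := rat_eq_int_of_padic_norm (q := trd (E.i k)) fun ℓ _ => by
    have := E.S.norm_trd_le (hk' ⟨ℓ, Fact.out⟩)
    rwa [trdF_conj_units, trdF_toLoc E.S.quat] at this
  obtain ⟨N, hN⟩ := rat_eq_int_of_padic_norm (q := nrd (E.i k)) fun ℓ _ => by
    have := E.S.norm_nrd_le (hk' ⟨ℓ, Fact.out⟩)
    rwa [(E.S.quatLoc _).nrd_conj_units, nrdF_toLoc E.S.quat] at this
  have h1 : E.i k * E.i k = trd (E.i k) • E.i k - algebraMap ℚ B (nrd (E.i k)) :=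
    E.S.quat.mul_self _
  have hint : IsIntegral ℤ k := by
    refine isIntegral_of_quadratic (T := T) (N := N) ?_
    have := E.S.quat.nontrivial
    apply E.i.toRingHom.injective
    change E.i (k * k) = E.i (T * k - N)
    rw [map_mul, h1, map_sub, map_mul, map_intCast, map_intCast, ← hT, ← hN, map_intCast,
      Algebra.smul_def, map_intCast]
  exact ⟨⟨k, hint⟩, rfl⟩

/-- Only ω needs checking: it generates the integers of K, and no larger part of K can stabilize a
lattice. -/
theorem isSpecialPoint_idl_iff (hx : AEUnit Ot x) :
    IsSpecialPoint Ot (idl Ot x) E.i ↔ E.IsSp x := by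
  rw [E.isSp_iff hx]
  constructor
  · rintro ⟨-, h⟩
    have h1 : E.w ∈ Set.range (fun z : 𝓞 K => E.i (z : K)) := ⟨E.ω, rfl⟩
    rw [← h] at h1
    exact h1.1
  · intro h
    refine ⟨isLeftIdeal_idl E.S.lat hx, Set.Subset.antisymm ?_ ?_⟩
    · rintro _ ⟨hk, k, rfl⟩
      obtain ⟨z, hz⟩ := E.exists_integer_of_mem_rightOrder hx hk
      exact ⟨z, by rw [← hz]⟩
    · rintro _ ⟨z, rfl⟩
      exact ⟨fun l hl => E.mul_i_mem h z hl, _, rfl⟩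

/-- The family is 1 wherever w is already in the local order, hence at p and at almost all primes.
Elsewhere w is conjugated to a companion matrix. -/
theorem exists_isSp : ∃ x, AEUnit Ot x ∧ E.IsSp x := by
  have h : ∀ ℓ : Nat.Primes, ∃ x : (Bloc B (ℓ : ℕ))ˣ,
      (x : Bloc B (ℓ : ℕ)) * toLoc (ℓ : ℕ) E.w * (↑x⁻¹ : Bloc B (ℓ : ℕ)) ∈
        locLat (ℓ : ℕ) (ordLat Ot) ∧ (toLoc (ℓ : ℕ) E.w ∈ locLat (ℓ : ℕ) (ordLat Ot) → x = 1) := by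
    intro ℓ
    by_cases hw : toLoc (ℓ : ℕ) E.w ∈ locLat (ℓ : ℕ) (ordLat Ot)
    · exact ⟨1, by simpa using hw, fun _ => rfl⟩
    · have hℓ : (ℓ : ℕ) ≠ p := by
        revert ℓ
        rintro ⟨ℓ, hℓ⟩ hw rfl
        exact hw E.toLoc_w_mem
      obtain ⟨x, hx⟩ := (E.S.split _ hℓ).exists_conj_mem (E.toLoc_w_ne _)
        (by rw [trd_toLoc_w]; exact Padic.norm_int_le_one _)
        (by rw [nrd_toLoc_w]; exact Padic.norm_int_le_one _)
      exact ⟨x, hx, fun h => absurd h hw⟩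
  choose x hx hx1 using h
  refine ⟨x, (finite_toLoc_notMem E.S.lat E.w).subset fun ℓ hℓ hw => hℓ ?_, hx⟩
  rw [hx1 ℓ hw]; exact one_mem _

/-- A fractional ideal is principal at ℓ, so locally it acts as right multiplication by one element
of K. -/
theorem exists_mul_locLat_embIdeal {ℓ : ℕ} [Fact ℓ.Prime] {M : Submodule ℤ_[ℓ] (Bloc B ℓ)}
    (h : ∀ l ∈ M, l * toLoc ℓ E.w ∈ M) {J : FractionalIdeal (𝓞 K)⁰ K} (hJ : J ≠ 0) :
    ∃ k : Kˣ, M * locLat ℓ (embIdeal E.i J) = locRmul M (E.loc ℓ k : Bloc B ℓ) := by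
  obtain ⟨j, hj, hj0, s, hs, hJs⟩ := exists_local_generator_fractional ℓ hJ
  refine ⟨Units.mk0 j hj0, le_antisymm ?_ ?_⟩
  · rw [Submodule.mul_le]
    intro m hm n hn
    refine toLoc_mul_mem (L := embIdeal E.i J) ?_ hn
    rintro _ ⟨k, hk, rfl⟩
    change m * toLoc ℓ (E.i k) ∈ _
    obtain ⟨z, hz⟩ := hJs k hk
    refine mem_of_nsmul_mem hs ?_
    rw [← mul_smul_comm, ← map_nsmul, ← map_nsmul, nsmul_eq_mul, hz, mul_comm, map_mul, map_mul,
      ← mul_assoc]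
    exact ⟨_, E.mul_toLoc_i_mem h z hm, rfl⟩
  · rintro _ ⟨m, hm, rfl⟩
    exact Submodule.mul_mem_mul hm (toLoc_mem_locLat ⟨j, hj, rfl⟩)

/-- Twisting the family `x` by a family of elements of the quadratic field. -/
noncomputable def twist (x : ∀ ℓ : Nat.Primes, (Bloc B (ℓ : ℕ))ˣ) (k : Nat.Primes → Kˣ) :
    ∀ ℓ : Nat.Primes, (Bloc B (ℓ : ℕ))ˣ := fun ℓ => x ℓ * E.loc (ℓ : ℕ) (k ℓ)

theorem conj_loc {ℓ : ℕ} [Fact ℓ.Prime] (x : (Bloc B ℓ)ˣ) (k : Kˣ) :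
    ((x * E.loc ℓ k : (Bloc B ℓ)ˣ) : Bloc B ℓ) * toLoc ℓ E.w *
      (↑(x * E.loc ℓ k)⁻¹ : Bloc B ℓ) = (x : Bloc B ℓ) * toLoc ℓ E.w * (↑x⁻¹ : Bloc B ℓ) := by
  have h1 : x * E.loc ℓ k * E.loc ℓ E.ωu * (x * E.loc ℓ k)⁻¹ = x * E.loc ℓ E.ωu * x⁻¹ := by
    rw [mul_assoc x, E.loc_comm, mul_inv_rev]; group
  have := congrArg (Units.val) h1
  simpa only [Units.val_mul, coe_loc_ωu] using this

theorem isSp_twist (hx : E.IsSp x) (k : Nat.Primes → Kˣ) : E.IsSp (E.twist x k) := by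
  intro ℓ
  rw [twist, conj_loc]; exact hx ℓ

theorem mul_w_mem (hx : E.IsSp x) (ℓ : Nat.Primes) :
    ∀ l ∈ locRmul (locLat (ℓ : ℕ) (ordLat Ot)) (x ℓ : Bloc B (ℓ : ℕ)),
      l * toLoc (ℓ : ℕ) E.w ∈ locRmul (locLat (ℓ : ℕ) (ordLat Ot)) (x ℓ : Bloc B (ℓ : ℕ)) := by
  intro l hl
  rw [mem_locRmul] at hl ⊢
  have := mul_mem_locLat hl (hx ℓ)
  simpa only [mul_assoc, Units.inv_mul_cancel_left] using this

theorem idl_mul_embIdeal (hx : AEUnit Ot x) (hsp : E.IsSp x) {J : FractionalIdeal (𝓞 K)⁰ K}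
    (hJ : J ≠ 0) : ∃ k : Nat.Primes → Kˣ, AEUnit Ot (E.twist x k) ∧
      idl Ot x * embIdeal E.i J = idl Ot (E.twist x k) := by
  choose k hk using fun ℓ : Nat.Primes => E.exists_mul_locLat_embIdeal (E.mul_w_mem hsp ℓ) hJ
  have hlat := isLatticeIn_mul_embIdeal E.i (isLatticeIn_idl E.S.lat hx) hJ
  have hloc : ∀ ℓ : Nat.Primes, locLat (ℓ : ℕ) (idl Ot x * embIdeal E.i J) =
      locRmul (locLat (ℓ : ℕ) (ordLat Ot)) (E.twist x k ℓ : Bloc B (ℓ : ℕ)) := by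
    intro ℓ
    rw [locLat_mul, locLat_idl E.S.lat hx, hk ℓ]
    ext z
    rw [mem_locRmul, mem_locRmul, mem_locRmul, twist, mul_inv_rev, Units.val_mul, mul_assoc]
  exact ⟨k, aeUnit_of_locLat E.S.lat hlat hloc, eq_idl_of_locLat hlat hloc⟩

theorem idl_mul_embIdeal_one (hx : AEUnit Ot x) (hsp : E.IsSp x) :
    idl Ot x * embIdeal E.i 1 = idl Ot x := by
  apply le_antisymm
  · rw [Submodule.mul_le]
    rintro l hl _ ⟨k, hk, rfl⟩
    obtain ⟨z, rfl⟩ := (FractionalIdeal.mem_one_iff (𝓞 K)⁰).1 hk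
    exact E.mul_i_mem ((E.isSp_iff hx).1 hsp) z hl
  · intro l hl
    rw [← mul_one l]
    exact Submodule.mul_mem_mul hl ⟨1, FractionalIdeal.one_mem_one (𝓞 K)⁰, map_one E.i⟩

/-- Both J and J⁻¹ preserve the lattice, so both lie in the intersection of K with the right order,
the ring of integers. -/
theorem eq_one_of_idl_mul_embIdeal (hx : AEUnit Ot x) (hsp : E.IsSp x)
    (J : (FractionalIdeal (𝓞 K)⁰ K)ˣ)
    (h : idl Ot x * embIdeal E.i (J : FractionalIdeal (𝓞 K)⁰ K) = idl Ot x) : J = 1 := by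
  have key : ∀ J : FractionalIdeal (𝓞 K)⁰ K, idl Ot x * embIdeal E.i J = idl Ot x → J ≤ 1 := by
    intro J h k hk
    have h1 : E.i k ∈ rightOrder (idl Ot x) := fun l hl => by
      have h2 := Submodule.mul_mem_mul (M := idl Ot x) hl ((mem_embIdeal E.i).2 ⟨k, hk, rfl⟩)
      rwa [h] at h2
    obtain ⟨z, hz⟩ := E.exists_integer_of_mem_rightOrder hx h1
    exact (FractionalIdeal.mem_one_iff (𝓞 K)⁰).2 ⟨z, hz⟩
  have h' : idl Ot x * embIdeal E.i ((J⁻¹ : (FractionalIdeal (𝓞 K)⁰ K)ˣ) :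
      FractionalIdeal (𝓞 K)⁰ K) = idl Ot x := by
    conv_lhs => rw [← h]
    rw [mul_assoc, ← embIdeal_mul, Units.mul_inv, E.idl_mul_embIdeal_one hx hsp]
  have h1 := key _ h
  have h2 := key _ h'
  refine Units.ext (le_antisymm h1 ?_)
  calc (1 : FractionalIdeal (𝓞 K)⁰ K) = J * (J⁻¹ : (FractionalIdeal (𝓞 K)⁰ K)ˣ) :=
        (Units.mul_inv J).symm
    _ ≤ J * 1 := mul_le_mul_right h2 _
    _ = J := mul_one _

theorem embIdeal_injective (hx : AEUnit Ot x) (hsp : E.IsSp x)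
    {J J' : (FractionalIdeal (𝓞 K)⁰ K)ˣ}
    (h : idl Ot x * embIdeal E.i (J : FractionalIdeal (𝓞 K)⁰ K) =
      idl Ot x * embIdeal E.i (J' : FractionalIdeal (𝓞 K)⁰ K)) : J = J' := by
  rw [← mul_inv_eq_one]
  refine E.eq_one_of_idl_mul_embIdeal hx hsp _ ?_
  rw [Units.val_mul, embIdeal_mul, ← mul_assoc, h, mul_assoc, ← embIdeal_mul, ← Units.val_mul,
    mul_inv_cancel, Units.val_one, E.idl_mul_embIdeal_one hx hsp]

end EmbeddedField

/-! ### Comparing special points prime by prime. -/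

namespace EmbeddedField

variable {p : ℕ} [Fact p.Prime] {B : Type*} [Ring B] [Algebra ℚ B] {Ot : Subalgebra ℤ B}
  {κ : Type*} [Field κ] [Fintype κ] {K : Type*} [Field K] [NumberField K]
  (E : EmbeddedField p Ot κ K) {x x' : ∀ ℓ : Nat.Primes, (Bloc B (ℓ : ℕ))ˣ}

/-- If `x' ∈ Ot_ℓ x k` at `ℓ`, then a multiple of `k` prime to `ℓ` maps `Ot x` into `Ot x'`. -/
theorem exists_coprime_mul_mem (hx : AEUnit Ot x) (hx' : AEUnit Ot x') {ℓ : Nat.Primes} {k : K}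
    (hk : ∀ l ∈ locLat (ℓ : ℕ) (idl Ot x),
      l * toLoc (ℓ : ℕ) (E.i k) ∈ locLat (ℓ : ℕ) (idl Ot x')) :
    ∃ s : ℕ, s.Coprime ℓ ∧ ∀ l ∈ idl Ot x, l * E.i (s * k) ∈ idl Ot x' := by
  have hL := isLatticeIn_idl E.S.lat hx
  have hL' := isLatticeIn_idl E.S.lat hx'
  obtain ⟨N, hN0, hN⟩ := IsLatticeIn.exists_nsmul_le
    (L := rmul (idl Ot x) (E.i k)) (hL.1.map _) hL'
  obtain ⟨a, s, hs, rfl⟩ := Nat.exists_eq_pow_mul_and_not_dvd hN0.ne' (ℓ : ℕ) ℓ.2.ne_one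
  refine ⟨s, ((Nat.Prime.coprime_iff_not_dvd ℓ.2).2 hs).symm, fun l hl => ?_⟩
  have hs' : l * E.i (s * k) = s • (l * E.i k) := by
    rw [← nsmul_eq_mul, map_nsmul, mul_smul_comm]
  rw [hs']
  suffices h : ∀ q : Nat.Primes, toLoc (q : ℕ) (s • (l * E.i k)) ∈ locLat (q : ℕ) (idl Ot x') from
    hL'.mem_of_forall_loc fun q _ => h ⟨q, Fact.out⟩
  intro q
  by_cases hq : q = ℓ
  · rw [hq, map_nsmul, map_mul]
    exact nsmul_mem (hk _ (toLoc_mem_locLat hl)) s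
  · have hcop : ((ℓ : ℕ) ^ a).Coprime q :=
      Nat.Coprime.pow_left a ((Nat.coprime_primes ℓ.2 q.2).2 fun h => hq (Subtype.ext h.symm))
    refine mem_of_nsmul_mem hcop ?_
    rw [← map_nsmul, smul_smul]
    exact toLoc_mem_locLat (hN _ ⟨l, hl, rfl⟩)

/-- Special points that differ locally by elements of the quadratic field differ globally by a
fractional ideal. -/
theorem exists_idl_eq_mul_embIdeal (hx : AEUnit Ot x) (hx' : AEUnit Ot x')
    (hsp' : E.IsSp x')
    (h : ∀ ℓ : Nat.Primes, ∃ k : Kˣ, x' ℓ * (x ℓ * E.loc (ℓ : ℕ) k)⁻¹ ∈ locUnits Ot (ℓ : ℕ)) :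
    ∃ J : (FractionalIdeal (𝓞 K)⁰ K)ˣ,
      idl Ot x' = idl Ot x * embIdeal E.i (J : FractionalIdeal (𝓞 K)⁰ K) := by
  have hL := isLatticeIn_idl E.S.lat hx
  have hL' := isLatticeIn_idl E.S.lat hx'
  have hnontriv := E.S.quat.nontrivial
  have hloc : ∀ ℓ : Nat.Primes, ∃ k : Kˣ, ∀ z, z ∈ locLat (ℓ : ℕ) (idl Ot x') ↔
      z * (↑(E.loc (ℓ : ℕ) k)⁻¹ : Bloc B (ℓ : ℕ)) ∈ locLat (ℓ : ℕ) (idl Ot x) := by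
    intro ℓ
    obtain ⟨k, hk⟩ := h ℓ
    refine ⟨k, fun z => ?_⟩
    rw [locLat_idl E.S.lat hx', locLat_idl E.S.lat hx, locRmul_eq_iff.2 hk, mem_locRmul,
      mem_locRmul, mul_inv_rev, Units.val_mul, mul_assoc]
  have hex : ∀ ℓ : Nat.Primes, ∃ k : Kˣ, (∀ z ∈ locLat (ℓ : ℕ) (idl Ot x'),
      z * (↑(E.loc (ℓ : ℕ) k)⁻¹ : Bloc B (ℓ : ℕ)) ∈ locLat (ℓ : ℕ) (idl Ot x)) ∧
      ∃ s : ℕ, s.Coprime ℓ ∧ ∀ l ∈ idl Ot x, l * E.i (s * (k : K)) ∈ idl Ot x' := by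
    intro ℓ
    obtain ⟨k, hk⟩ := hloc ℓ
    refine ⟨k, fun z hz => (hk z).1 hz, E.exists_coprime_mul_mem hx hx' fun l hl => ?_⟩
    rw [hk, ← coe_loc, mul_assoc, Units.mul_inv, mul_one]; exact hl
  -- The required ideal consists of the elements of K that carry the first lattice into the second.
  let J₀ : Submodule (𝓞 K) K :=
    { carrier := {k | ∀ l ∈ idl Ot x, l * E.i k ∈ idl Ot x'}
      add_mem' := fun {a b} ha hb l hl => by
        rw [map_add, mul_add]; exact add_mem (ha l hl) (hb l hl)
      zero_mem' := fun l _ => by rw [map_zero, mul_zero]; exact zero_mem _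
      smul_mem' := fun z k hk l hl => by
        rw [Algebra.smul_def, mul_comm, map_mul, ← mul_assoc]
        exact E.mul_i_mem ((E.isSp_iff hx').1 hsp') z (hk l hl) }
  -- Some N > 0 maps the second lattice into the first, so N k stabilizes the first lattice for
  -- every k in J₀ and is integral.
  have hfrac : IsFractional (𝓞 K)⁰ J₀ := by
    obtain ⟨N, hN0, hN⟩ := IsLatticeIn.exists_nsmul_le hL'.1 hL
    refine ⟨(N : 𝓞 K), mem_nonZeroDivisors_of_ne_zero (by exact_mod_cast hN0.ne'), fun k hk => ?_⟩
    have h1 : E.i ((N : K) * k) ∈ rightOrder (idl Ot x) := fun l hl => by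
      rw [← nsmul_eq_mul, map_nsmul, mul_smul_comm]
      exact hN _ (hk l hl)
    obtain ⟨z, hz⟩ := E.exists_integer_of_mem_rightOrder hx h1
    refine ⟨z, ?_⟩
    rw [Algebra.smul_def, map_natCast]; exact hz
  let J : FractionalIdeal (𝓞 K)⁰ K := ⟨J₀, hfrac⟩
  have hJmem : ∀ k, k ∈ J ↔ ∀ l ∈ idl Ot x, l * E.i k ∈ idl Ot x' := fun k => Iff.rfl
  have hJ0 : J ≠ 0 := by
    obtain ⟨k, -, s, hs, hk⟩ := hex ⟨p, Fact.out⟩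
    intro h0
    have h1 : (s : K) * k ∈ J := (hJmem _).2 hk
    rw [h0, FractionalIdeal.mem_zero_iff, mul_eq_zero, Nat.cast_eq_zero] at h1
    refine h1.elim (fun hs0 => ?_) k.ne_zero
    rw [hs0, Nat.coprime_zero_left] at hs
    exact (Fact.out : p.Prime).one_lt.ne' hs
  refine ⟨Units.mk0 J hJ0, ?_⟩
  rw [Units.val_mk0]
  apply le_antisymm
  · refine (isLatticeIn_mul_embIdeal E.i hL hJ0).le_of_forall_loc fun ℓ _ z hz => ?_
    obtain ⟨k, hk, s, hs, hsk⟩ := hex ⟨ℓ, Fact.out⟩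
    have hz' := hk z hz
    refine mem_of_nsmul_mem hs ?_
    rw [locLat_mul]
    have h1 : s • z = z * (↑(E.loc ℓ k)⁻¹ : Bloc B ℓ) * toLoc ℓ (E.i ((s : K) * k)) := by
      rw [← nsmul_eq_mul, map_nsmul, map_nsmul, mul_smul_comm, ← coe_loc,
          Units.inv_mul_cancel_right]
    rw [h1]
    exact Submodule.mul_mem_mul hz' (toLoc_mem_locLat ⟨_, (hJmem _).2 hsk, rfl⟩)
  · rw [Submodule.mul_le]
    rintro l hl _ ⟨k, hk, rfl⟩
    exact (hJmem k).1 hk l hl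

/-- Away from `p`, special points are locally unique up to the quadratic field. -/
theorem exists_loc_of_ne {ℓ : ℕ} [Fact ℓ.Prime] (hℓ : ℓ ≠ p) {x x' : (Bloc B ℓ)ˣ}
    (hx : (x : Bloc B ℓ) * toLoc ℓ E.w * (↑x⁻¹ : Bloc B ℓ) ∈ locLat ℓ (ordLat Ot))
    (hx' : (x' : Bloc B ℓ) * toLoc ℓ E.w * (↑x'⁻¹ : Bloc B ℓ) ∈ locLat ℓ (ordLat Ot)) :
    ∃ k : Kˣ, x' * (x * E.loc ℓ k)⁻¹ ∈ locUnits Ot ℓ := by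
  have hℓ0 : (0 : ℝ) < ℓ := by exact_mod_cast (Fact.out : ℓ.Prime).pos
  have hℓQ : (ℓ : ℚ_[ℓ]) ≠ 0 := by exact_mod_cast (Fact.out : ℓ.Prime).ne_zero
  have hq := E.S.quatLoc ℓ
  have hnontriv := hq.nontrivial
  obtain ⟨u, z, hu, hu', rfl, a, b, hz⟩ := (E.S.split ℓ hℓ).exists_factor hx hx'
    (fun n y hy => E.conj_w_sub_ne x n hy) (fun n y hy => E.conj_w_sub_ne x' n hy)
    (E.toLoc_w_ne ℓ)
  have huU : u ∈ locUnits Ot ℓ := ⟨hu, hu'⟩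
  -- The exponent m clears the denominator of x z⁻¹ x⁻¹. Approximating the coordinates of z to
  -- precision ℓ^(m+1) by rationals then gives k in K with x z⁻¹ k x⁻¹ = 1 + ℓ c and c integral, so
  -- this element is a local unit.
  obtain ⟨m, hm⟩ := exists_pow_nsmul_mem (E.S.lat.isLattice_locLat ℓ).span_eq_top
    ((x : Bloc B ℓ) * (↑z⁻¹ : Bloc B ℓ) * (↑x⁻¹ : Bloc B ℓ))
  have happrox : ∀ c : ℚ_[ℓ], ∃ q : ℚ, ∃ e : ℚ_[ℓ], ‖e‖ ≤ 1 ∧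
      (q : ℚ_[ℓ]) = c + ℓ ^ (m + 1) * e := by
    intro c
    obtain ⟨q, hq⟩ := Padic.rat_dense ℓ c (ε := ((ℓ : ℝ)⁻¹) ^ (m + 1)) (by positivity)
    refine ⟨q, (q - c) / ℓ ^ (m + 1), ?_, by field_simp; ring⟩
    rw [norm_div, norm_pow, Padic.norm_p, norm_sub_rev]
    exact div_le_one_of_le₀ hq.le (by positivity)
  obtain ⟨qa, ea, hea, hqa⟩ := happrox a
  obtain ⟨qb, eb, heb, hqb⟩ := happrox b
  set k : K := qa + qb * (E.ω : K) with hk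
  have hik : toLoc ℓ (E.i k) = (z : Bloc B ℓ) + (ℓ : ℚ_[ℓ]) ^ (m + 1) •
      (algebraMap ℚ_[ℓ] (Bloc B ℓ) ea + eb • toLoc ℓ E.w) := by
    have hrat : ∀ q : ℚ, toLoc ℓ (E.i (q : K)) = algebraMap ℚ_[ℓ] (Bloc B ℓ) (q : ℚ_[ℓ]) := by
      intro q
      rw [← eq_ratCast (algebraMap ℚ K), AlgHom.commutes, AlgHom.commutes,
        IsScalarTower.algebraMap_apply ℚ ℚ_[ℓ] (Bloc B ℓ), eq_ratCast]
    rw [hk, map_add, map_mul, map_add, map_mul, hrat, hrat, hqa, hqb, hz]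
    change _ + _ * toLoc ℓ E.w = _
    rw [← Algebra.smul_def, map_add, add_smul, smul_add, mul_smul, map_mul, ← Algebra.smul_def]
    abel
  set c : Bloc B ℓ := (ℓ ^ m • ((x : Bloc B ℓ) * (↑z⁻¹ : Bloc B ℓ) * (↑x⁻¹ : Bloc B ℓ))) *
    (algebraMap ℚ_[ℓ] (Bloc B ℓ) ea + eb • ((x : Bloc B ℓ) * toLoc ℓ E.w * (↑x⁻¹ : Bloc B ℓ)))
    with hc
  have hcO : c ∈ locLat ℓ (ordLat Ot) := mul_mem_locLat hm (add_mem (algebraMap_mem_locLat hea)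
    ((locLat ℓ (ordLat Ot)).smul_mem (Padic.toInt eb heb) hx))
  have hxk : (x : Bloc B ℓ) * (↑z⁻¹ : Bloc B ℓ) * toLoc ℓ (E.i k) * (↑x⁻¹ : Bloc B ℓ) =
      1 + ℓ • c := by
    have h1 : (algebraMap ℚ_[ℓ] (Bloc B ℓ) ea +
        eb • ((x : Bloc B ℓ) * toLoc ℓ E.w * (↑x⁻¹ : Bloc B ℓ))) =
        (x : Bloc B ℓ) * (algebraMap ℚ_[ℓ] (Bloc B ℓ) ea + eb • toLoc ℓ E.w) *
          (↑x⁻¹ : Bloc B ℓ) := by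
      rw [mul_add, add_mul, ← Algebra.commutes, mul_assoc (algebraMap _ _ _), Units.mul_inv,
        mul_one, mul_smul_comm, smul_mul_assoc]
    rw [hc, h1, hik, smul_mul_assoc, smul_smul, ← pow_succ', ← Nat.cast_smul_eq_nsmul ℚ_[ℓ],
      Nat.cast_pow]
    simp only [mul_add, add_mul, mul_smul_comm, smul_mul_assoc, mul_assoc,
      Units.inv_mul_cancel_left, Units.mul_inv]
  have hnorm : ‖nrdF ℚ_[ℓ] (1 + ℓ • c)‖ = 1 := E.S.norm_nrd_one_add hcO
  have hk0 : k ≠ 0 := by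
    intro h0
    rw [← hxk, h0, map_zero, map_zero, mul_zero, zero_mul, hq.nrd_zero, norm_zero] at hnorm
    exact zero_ne_one hnorm
  refine ⟨Units.mk0 k hk0, ?_⟩
  have hv : x * z⁻¹ * E.loc ℓ (Units.mk0 k hk0) * x⁻¹ ∈ locUnits Ot ℓ := by
    have h1 : ((x * z⁻¹ * E.loc ℓ (Units.mk0 k hk0) * x⁻¹ : (Bloc B ℓ)ˣ) : Bloc B ℓ) =
        1 + ℓ • c := by
      rw [← hxk]; rfl
    rw [E.S.mem_locUnits_iff, h1]
    exact ⟨add_mem one_mem_locLat (nsmul_mem hcO _), hnorm⟩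
  have := mul_mem huU (inv_mem hv)
  have hcomm : Commute (E.loc ℓ (Units.mk0 k hk0)) z := by
    have h1 : toLoc ℓ (E.i k) * toLoc ℓ E.w = toLoc ℓ E.w * toLoc ℓ (E.i k) := by
      rw [w, ← map_mul, ← map_mul, mul_comm k, map_mul, map_mul]
    refine Units.ext ?_
    rw [Units.val_mul, Units.val_mul, coe_loc, Units.val_mk0, hz, mul_add, add_mul, mul_smul_comm,
      smul_mul_assoc, h1, Algebra.commutes]
  convert this using 1
  simp only [mul_inv_rev, inv_inv, mul_assoc]
  rw [← mul_assoc z, ← hcomm.inv_left.eq, mul_assoc]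

end EmbeddedField

theorem LocalStructure.mem_locUnits_conj {p : ℕ} [Fact p.Prime] {B : Type*} [Ring B] [Algebra ℚ B]
    {Ot : Subalgebra ℤ B} {κ : Type*} [Field κ] [Fintype κ] (S : LocalStructure p Ot κ)
    (y : (Bloc B p)ˣ) {u : (Bloc B p)ˣ} (hu : u ∈ locUnits Ot p) :
    y * u * y⁻¹ ∈ locUnits Ot p := by
  refine ⟨S.mem_conj y hu.1, ?_⟩
  have h1 : (y * u * y⁻¹)⁻¹ = y * u⁻¹ * y⁻¹ := by group
  rw [h1]
  exact S.mem_conj y hu.2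

theorem exists_norm_eq_zpow {p : ℕ} [Fact p.Prime] {c : ℚ_[p]} (hc : c ≠ 0) :
    ∃ k : ℤ, ‖c‖ = ((p : ℝ)⁻¹) ^ k :=
  ⟨c.valuation, by rw [Padic.norm_eq_zpow_neg_valuation hc, inv_zpow, zpow_neg]⟩

/-! ### The orbit of a special point under bilateral ideals and fractional ideals. -/

namespace EmbeddedField

variable {p : ℕ} [Fact p.Prime] {B : Type*} [Ring B] [Algebra ℚ B] {Ot : Subalgebra ℤ B}
  {κ : Type*} [Field κ] [Fintype κ] {K : Type*} [Field K] [NumberField K]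
  (E : EmbeddedField p Ot κ K) {x x' : ∀ ℓ : Nat.Primes, (Bloc B (ℓ : ℕ))ˣ}

theorem conj_w_mem (y : (Bloc B p)ˣ) :
    (y : Bloc B p) * toLoc p E.w * (↑y⁻¹ : Bloc B p) ∈ locLat p (ordLat Ot) :=
  E.S.mem_conj y E.toLoc_w_mem

/-- The component at `p` of a family. -/
def compP (p : ℕ) [Fact p.Prime] (x : ∀ ℓ : Nat.Primes, (Bloc B (ℓ : ℕ))ˣ) : (Bloc B p)ˣ :=
  x ⟨p, Fact.out⟩

theorem compP_atP (u : (Bloc B p)ˣ) : compP p (atP u) = u := atP_self u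

theorem isSp_atP_mul (hsp : E.IsSp x) (y : (Bloc B p)ˣ) : E.IsSp (atP y * x) := by
  refine (forall_primes_iff p).2 ⟨?_, fun ℓ hℓ => ?_⟩
  · exact E.conj_w_mem _
  · rw [Pi.mul_apply, atP_of_ne y hℓ, one_mul]; exact hsp ℓ

theorem norm_nrd_zpow (k : ℤ) :
    ‖nrdF ℚ_[p] (E.loc p (E.ωu ^ k) : Bloc B p)‖ = ((p : ℝ)⁻¹) ^ k := by
  let f : (Bloc B p)ˣ →* ℝ :=
    { toFun := fun u => ‖nrdF ℚ_[p] (u : Bloc B p)‖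
      map_one' := by rw [Units.val_one, E.S.div.quat.nrd_one, norm_one]
      map_mul' := fun u v => E.S.norm_nrd_mul u v }
  change f (E.loc p (E.ωu ^ k)) = _
  rw [map_zpow, map_zpow' f (fun u => E.S.norm_nrd_inv u)]
  congr 1
  exact E.norm_nrd_ωu

theorem compP_twist_atP_mul (u : (Bloc B p)ˣ) (k : Nat.Primes → Kˣ) :
    compP p (E.twist (atP u * x) k) = u * compP p x * E.loc p (k ⟨p, Fact.out⟩) :=
  congrArg (fun v : (Bloc B p)ˣ => v * compP p x * E.loc p (k ⟨p, Fact.out⟩)) (atP_self u)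

theorem bil_mul_idl_mul_embIdeal (hx : AEUnit Ot x) (hsp : E.IsSp x) (u : (Bloc B p)ˣ)
    (J : (FractionalIdeal (𝓞 K)⁰ K)ˣ) : ∃ k : Nat.Primes → Kˣ,
      AEUnit Ot (E.twist (atP u * x) k) ∧
      bil Ot u * idl Ot x * embIdeal E.i (J : FractionalIdeal (𝓞 K)⁰ K) =
        idl Ot (E.twist (atP u * x) k) := by
  rw [E.S.bil_mul_idl u hx]
  exact E.idl_mul_embIdeal ((aeUnit_atP u).mul hx) (E.isSp_atP_mul hsp u) J.ne_zero

/-- Every special point is obtained from a given one by a bilateral ideal of norm one and a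
fractional ideal. -/
theorem exists_eq_bil_mul (hx : AEUnit Ot x) (hsp : E.IsSp x) (hx' : AEUnit Ot x')
    (hsp' : E.IsSp x') : ∃ (u : (Bloc B p)ˣ) (J : (FractionalIdeal (𝓞 K)⁰ K)ˣ),
      ‖nrdF ℚ_[p] (u : Bloc B p)‖ = 1 ∧
      idl Ot x' = bil Ot u * idl Ot x * embIdeal E.i (J : FractionalIdeal (𝓞 K)⁰ K) := by
  obtain ⟨y, hy⟩ : ∃ y : (Bloc B p)ˣ, compP p x = y := ⟨_, rfl⟩
  obtain ⟨y', hy'⟩ : ∃ y' : (Bloc B p)ˣ, compP p x' = y' := ⟨_, rfl⟩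
  have hp0 : (p : ℝ)⁻¹ ≠ 0 := inv_ne_zero (by exact_mod_cast (Fact.out : p.Prime).ne_zero)
  obtain ⟨a, ha⟩ := exists_norm_eq_zpow (E.S.div.quat.nrd_ne_zero_of_isUnit y.isUnit)
  obtain ⟨a', ha'⟩ := exists_norm_eq_zpow (E.S.div.quat.nrd_ne_zero_of_isUnit y'.isUnit)
  -- A power of the uniformizer ω absorbs the difference of valuations at p, so the remaining factor
  -- u has norm 1.
  set c := E.loc p (E.ωu ^ (a' - a)) with hc
  have hu : ‖nrdF ℚ_[p] ((y' * (y * c)⁻¹ : (Bloc B p)ˣ) : Bloc B p)‖ = 1 := by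
    rw [E.S.norm_nrd_mul, E.S.norm_nrd_inv, E.S.norm_nrd_mul, ha, ha', hc, E.norm_nrd_zpow,
      ← zpow_add₀ hp0, add_sub_cancel, mul_inv_cancel₀ (zpow_ne_zero _ hp0)]
  have hloc : ∀ ℓ : Nat.Primes, ∃ k : Kˣ,
      x' ℓ * ((atP (y' * (y * c)⁻¹) * x) ℓ * E.loc (ℓ : ℕ) k)⁻¹ ∈ locUnits Ot (ℓ : ℕ) := by
    refine (forall_primes_iff p).2 ⟨⟨E.ωu ^ (a' - a), ?_⟩, fun ℓ hℓ => ?_⟩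
    · change compP p x' * (compP p (atP (y' * (y * c)⁻¹)) * compP p x * c)⁻¹ ∈ locUnits Ot p
      rw [compP_atP, hy, hy']
      have : y' * (y' * (y * c)⁻¹ * y * c)⁻¹ = 1 := by group
      rw [this]; exact one_mem _
    · rw [Pi.mul_apply, atP_of_ne _ hℓ, one_mul]
      exact E.exists_loc_of_ne hℓ (hsp ℓ) (hsp' ℓ)
  obtain ⟨J, hJ⟩ := E.exists_idl_eq_mul_embIdeal ((aeUnit_atP _).mul hx) hx' hsp' hloc
  refine ⟨_, J, hu, ?_⟩
  rw [hJ, E.S.bil_mul_idl _ hx]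

/-- An element of K of unit norm commutes with the uniformizer ω, so its residue is fixed by
Frobenius. Conjugation by y keeps it in the unit group. -/
theorem conj_loc_mem_locUnits (y : (Bloc B p)ˣ) (k : Kˣ)
    (hk : ‖nrdF ℚ_[p] (E.loc p k : Bloc B p)‖ = 1) : y * E.loc p k * y⁻¹ ∈ locUnits Ot p := by
  refine E.S.mem_locUnits_conj y (E.S.mem_locUnits_self_iff.2 ⟨hk, ?_⟩)
  exact ResidueMap.fixed_of_commute E.S.R E.S.div E.S.card E.norm_nrd_ωu hk.le
    (by rw [← Units.val_mul, E.loc_comm, Units.val_mul])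

/-- At p the generators differ by u u'⁻¹ and a conjugate of an element of K of unit norm. The latter
is a local unit, so the bilateral ideals agree; they can then be cancelled. -/
theorem bil_mul_idl_mul_embIdeal_injective (hx : AEUnit Ot x) (hsp : E.IsSp x)
    {u u' : (Bloc B p)ˣ} (hu : ‖nrdF ℚ_[p] (u : Bloc B p)‖ = 1)
    (hu' : ‖nrdF ℚ_[p] (u' : Bloc B p)‖ = 1) {J J' : (FractionalIdeal (𝓞 K)⁰ K)ˣ}
    (h : bil Ot u * idl Ot x * embIdeal E.i (J : FractionalIdeal (𝓞 K)⁰ K) =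
      bil Ot u' * idl Ot x * embIdeal E.i (J' : FractionalIdeal (𝓞 K)⁰ K)) :
    bil Ot u = bil Ot u' ∧ J = J' := by
  have hbil : bil Ot u = bil Ot u' := by
    obtain ⟨k, hk, hk'⟩ := E.bil_mul_idl_mul_embIdeal hx hsp u J
    obtain ⟨l, hl, hl'⟩ := E.bil_mul_idl_mul_embIdeal hx hsp u' J'
    rw [hk', hl', idl_eq_iff E.S.lat hk hl] at h
    have h1 : compP p (E.twist (atP u * x) k) * (compP p (E.twist (atP u' * x) l))⁻¹ ∈
      locUnits Ot p := h ⟨p, Fact.out⟩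
    rw [compP_twist_atP_mul, compP_twist_atP_mul] at h1
    generalize compP p x = y at h1
    generalize k ⟨p, Fact.out⟩ = a at h1
    generalize l ⟨p, Fact.out⟩ = b at h1
    have h2 : u * y * E.loc p a * (u' * y * E.loc p b)⁻¹ =
        (u * y) * E.loc p (a * b⁻¹) * (u * y)⁻¹ * (u * u'⁻¹) := by
      rw [map_mul, map_inv]; group
    rw [h2] at h1
    have hnorm : ‖nrdF ℚ_[p] (E.loc p (a * b⁻¹) : Bloc B p)‖ = 1 := by
      have h3 := (E.S.mem_locUnits_iff.1 h1).2
      have hpos := (E.S.norm_nrd_pos y).ne'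
      simp only [E.S.norm_nrd_mul, E.S.norm_nrd_inv, hu, hu'] at h3
      field_simp at h3
      exact h3
    rw [bil_eq_iff E.S.lat]
    exact (Subgroup.mul_mem_cancel_left _ (E.conj_loc_mem_locUnits _ _ hnorm)).1 h1
  refine ⟨hbil, ?_⟩
  rw [hbil, E.S.bil_mul_idl u' hx] at h
  exact E.embIdeal_injective ((aeUnit_atP u').mul hx) (E.isSp_atP_mul hsp u') h

/-- Right multiplication by k only changes J by the principal ideal of k. -/
theorem mk_eq_mk_iff (hx : AEUnit Ot x) (hsp : E.IsSp x)
    {u u' : (Bloc B p)ˣ} (hu : ‖nrdF ℚ_[p] (u : Bloc B p)‖ = 1)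
    (hu' : ‖nrdF ℚ_[p] (u' : Bloc B p)‖ = 1) {J J' : (FractionalIdeal (𝓞 K)⁰ K)ˣ} :
    (Quotient.mk (kSetoid E.i)
        (bil Ot u * idl Ot x * embIdeal E.i (J : FractionalIdeal (𝓞 K)⁰ K)) =
      Quotient.mk (kSetoid E.i)
        (bil Ot u' * idl Ot x * embIdeal E.i (J' : FractionalIdeal (𝓞 K)⁰ K))) ↔
    bil Ot u = bil Ot u' ∧ J⁻¹ * J' ∈ (toPrincipalIdeal (𝓞 K) K).range := by
  have hcoe : ∀ k : Kˣ, rmul (bil Ot u * idl Ot x * embIdeal E.i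
      (J : FractionalIdeal (𝓞 K)⁰ K)) (E.i (k : K)) = bil Ot u * idl Ot x * embIdeal E.i
        ((J * toPrincipalIdeal (𝓞 K) K k : (FractionalIdeal (𝓞 K)⁰ K)ˣ) :
          FractionalIdeal (𝓞 K)⁰ K) := by
    intro k
    rw [rmul_mul_embIdeal, Units.val_mul, coe_toPrincipalIdeal]
  rw [Quotient.eq]
  constructor
  · rintro ⟨k, hk0, h⟩
    have h1 := hcoe (Units.mk0 k hk0)
    rw [Units.val_mk0, ← h] at h1
    obtain ⟨h2, h3⟩ := E.bil_mul_idl_mul_embIdeal_injective hx hsp hu' hu h1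
    exact ⟨h2.symm, Units.mk0 k hk0, by rw [h3, inv_mul_cancel_left]⟩
  · rintro ⟨h, k, hk⟩
    refine ⟨k, k.ne_zero, ?_⟩
    rw [hcoe k, hk, mul_inv_cancel_left, h]

/-- Counting the points in the orbits of a given point under a set of bilateral ideals. -/
theorem ncard_modK (hx : AEUnit Ot x) (hsp : E.IsSp x) {T : Set (Submodule ℤ B)}
    (hT : T ⊆ bilateralOfNorm Ot 1) :
    (modK E.i {L | ∃ M ∈ T, ∃ J : (FractionalIdeal (𝓞 K)⁰ K)ˣ,
      L = M * idl Ot x * embIdeal E.i (J : FractionalIdeal (𝓞 K)⁰ K)}).ncard =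
      T.ncard * NumberField.classNumber K := by
  have hTu : ∀ M : T, ∃ u : (Bloc B p)ˣ, ‖nrdF ℚ_[p] (u : Bloc B p)‖ = 1 ∧ (M : Submodule ℤ B) =
    bil Ot u := fun M => E.S.mem_bilateralOfNorm_one_iff.1 (hT M.2)
  choose u hu hMu using hTu
  let g : T × ((FractionalIdeal (𝓞 K)⁰ K)ˣ ⧸ (toPrincipalIdeal (𝓞 K) K).range) →
      Quotient (kSetoid E.i) := fun a => Quotient.mk (kSetoid E.i)
        (bil Ot (u a.1) * idl Ot x * embIdeal E.i
          ((a.2.out : (FractionalIdeal (𝓞 K)⁰ K)ˣ) : FractionalIdeal (𝓞 K)⁰ K))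
  have hg : Function.Injective g := by
    rintro ⟨M, a⟩ ⟨M', a'⟩ h
    obtain ⟨h1, h2⟩ := (E.mk_eq_mk_iff hx hsp (hu M) (hu M')).1 h
    refine Prod.ext (Subtype.ext (by rw [hMu, hMu, h1])) ?_
    rw [← Quotient.out_eq a, ← Quotient.out_eq a']
    exact Quotient.sound (QuotientGroup.leftRel_apply.2 h2)
  have hrange : modK E.i {L | ∃ M ∈ T, ∃ J : (FractionalIdeal (𝓞 K)⁰ K)ˣ,
      L = M * idl Ot x * embIdeal E.i (J : FractionalIdeal (𝓞 K)⁰ K)} = Set.range g := by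
    ext q
    constructor
    · rintro ⟨_, ⟨M, hM, J, rfl⟩, rfl⟩
      refine ⟨(⟨M, hM⟩, QuotientGroup.mk J), ?_⟩
      have hM' : M = bil Ot (u ⟨M, hM⟩) := hMu ⟨M, hM⟩
      conv_rhs => rw [hM']
      refine (E.mk_eq_mk_iff hx hsp (hu _) (hu _)).2 ⟨rfl, ?_⟩
      exact QuotientGroup.eq.1 (Quotient.out_eq _)
    · rintro ⟨⟨M, a⟩, rfl⟩
      exact ⟨_, ⟨M, M.2, a.out, by rw [hMu M]⟩, rfl⟩
  rw [hrange, ← Nat.card_coe_set_eq, Nat.card_range_of_injective hg, Nat.card_prod,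
    Nat.card_coe_set_eq, ← Nat.card_congr (ClassGroup.equiv (R := 𝓞 K) K).toEquiv,
    Nat.card_eq_fintype_card]
  rfl

end EmbeddedField

/-! ### The pieces attached to bilateral ideals of norm p. -/

namespace EmbeddedField

variable {p : ℕ} [Fact p.Prime] {B : Type*} [Ring B] [Algebra ℚ B] {Ot : Subalgebra ℤ B}
  {κ : Type*} [Field κ] [Fintype κ] {K : Type*} [Field K] [NumberField K]
  (E : EmbeddedField p Ot κ K) {x x' : ∀ ℓ : Nat.Primes, (Bloc B (ℓ : ℕ))ˣ}

/-- The uniformizer `x_p ω x_p⁻¹`. -/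
noncomputable def unif (x : ∀ ℓ : Nat.Primes, (Bloc B (ℓ : ℕ))ˣ) : (Bloc B p)ˣ :=
  compP p x * E.loc p E.ωu * (compP p x)⁻¹

theorem coe_unif : (E.unif x : Bloc B p) =
    (compP p x : Bloc B p) * toLoc p E.w * (↑(compP p x)⁻¹ : Bloc B p) := rfl

theorem nrd_unif : nrdF ℚ_[p] (E.unif x : Bloc B p) = (E.n : ℚ_[p]) := by
  rw [coe_unif, E.S.div.quat.nrd_conj_units, nrd_toLoc_w]

theorem norm_unif : ‖nrdF ℚ_[p] (E.unif x : Bloc B p)‖ = (p : ℝ)⁻¹ := by rw [nrd_unif, norm_n]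

/-- Elements of K commute with ω, so only u affects the uniformizer. -/
theorem unif_twist_atP_mul (u : (Bloc B p)ˣ) (k : Nat.Primes → Kˣ) :
    E.unif (E.twist (atP u * x) k) = u * E.unif x * u⁻¹ := by
  rw [unif, unif, compP_twist_atP_mul]
  generalize k ⟨p, Fact.out⟩ = a
  have h : E.loc p a * E.loc p E.ωu * (E.loc p a)⁻¹ = E.loc p E.ωu := by
    rw [E.loc_comm, mul_inv_cancel_right]
  calc u * compP p x * E.loc p a * E.loc p E.ωu * (u * compP p x * E.loc p a)⁻¹
      = u * (compP p x * (E.loc p a * E.loc p E.ωu * (E.loc p a)⁻¹) * (compP p x)⁻¹) * u⁻¹ := by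
        group
    _ = _ := by rw [h]

/-- Away from p the membership only repeats that the point is special. At p the uniformizer lies in
the local ideal generated by y and has a norm of the same size, so it generates the same ideal. -/
theorem idl_mem_CSet_iff (hx : AEUnit Ot x) {y : (Bloc B p)ˣ}
    (hy : ‖nrdF ℚ_[p] (y : Bloc B p)‖ = (p : ℝ)⁻¹) :
    idl Ot x ∈ CSet Ot E.i E.ω (bil Ot y) ↔ E.IsSp x ∧ bil Ot (E.unif x) = bil Ot y := by
  have hp0 : (p : ℝ)⁻¹ ≠ 0 := inv_ne_zero (by exact_mod_cast (Fact.out : p.Prime).ne_zero)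
  have hmem := mem_latInv_mul_mul E.S.lat hx (aeUnit_atP y) (E.S.normalizes_atP y) (b := E.w)
  change IsSpecialPoint Ot (idl Ot x) E.i ∧
    E.w ∈ latInv (idl Ot x) * idl Ot (atP y) * idl Ot x ↔ _
  rw [E.isSpecialPoint_idl_iff hx, hmem]
  refine and_congr_right fun hsp => ?_
  rw [bil_eq_iff E.S.lat, E.S.mem_locUnits_iff, E.S.norm_nrd_mul, E.S.norm_nrd_inv, hy, norm_unif,
    mul_inv_cancel₀ hp0, forall_primes_iff p, atP_self]
  constructor
  · rintro ⟨h, -⟩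
    exact ⟨mem_locRmul.1 h, rfl⟩
  · rintro ⟨h, -⟩
    refine ⟨mem_locRmul.2 h, fun ℓ hℓ => ?_⟩
    rw [atP_of_ne y hℓ, locRmul_one]
    exact hsp ℓ

theorem mem_CSet_iff {y : (Bloc B p)ˣ} (hy : ‖nrdF ℚ_[p] (y : Bloc B p)‖ = (p : ℝ)⁻¹)
    {L : Submodule ℤ B} : L ∈ CSet Ot E.i E.ω (bil Ot y) ↔
      ∃ x, AEUnit Ot x ∧ E.IsSp x ∧ bil Ot (E.unif x) = bil Ot y ∧ L = idl Ot x := by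
  constructor
  · intro h
    obtain ⟨x, hx, rfl⟩ := (isLeftIdeal_iff E.S.lat).1 h.1.1
    obtain ⟨h1, h2⟩ := (E.idl_mem_CSet_iff hx hy).1 h
    exact ⟨x, hx, h1, h2, rfl⟩
  · rintro ⟨x, hx, h1, h2, rfl⟩
    exact (E.idl_mem_CSet_iff hx hy).2 ⟨h1, h2⟩

/-- Conjugation by a unit `u` of norm one fixes the bilateral ideal of a uniformizer iff the
square of the residue of `u` lies in the prime field. -/
theorem bil_conj_eq_iff {ϖ u : (Bloc B p)ˣ} (hϖ : ‖nrdF ℚ_[p] (ϖ : Bloc B p)‖ = (p : ℝ)⁻¹)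
    (hu : ‖nrdF ℚ_[p] (u : Bloc B p)‖ = 1) :
    bil Ot (u * ϖ * u⁻¹) = bil Ot ϖ ↔
      E.S.R.res u ^ p = E.S.R.res u ∨ E.S.R.res u ^ p = -E.S.R.res u := by
  rw [bil_eq_iff E.S.lat, E.S.mem_locUnits_self_iff,
    E.S.R.commutator_fixed_iff E.S.div E.S.card hϖ hu, E.S.norm_nrd_mul, E.S.norm_nrd_mul,
    E.S.norm_nrd_mul, E.S.norm_nrd_inv, E.S.norm_nrd_inv, hu, one_mul, inv_one, mul_one,
    mul_inv_cancel₀ (E.S.norm_nrd_pos ϖ).ne']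
  constructor
  · rintro ⟨-, h⟩; exact fixed_or_neg_of_sq_fixed h
  · rintro (h | h)
    · exact ⟨rfl, by rw [← pow_mul, mul_comm, pow_mul, h]⟩
    · exact ⟨rfl, by rw [← pow_mul, mul_comm, pow_mul, h, neg_sq]⟩

/-- Every special point is the given one moved by some u and a fractional ideal, and its uniformizer
is conjugated by u. The ideal of the uniformizer is preserved exactly when the residue of u is fixed
or negated by Frobenius, that is, for the two listed ideals. -/
theorem CSet_eq (hx : AEUnit Ot x) (hsp : E.IsSp x) {y : (Bloc B p)ˣ}
    (hy : ‖nrdF ℚ_[p] (y : Bloc B p)‖ = (p : ℝ)⁻¹) (hxy : bil Ot (E.unif x) = bil Ot y)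
    {W : Submodule ℤ B} (hW : IsInvolutiveNormOne Ot W) :
    CSet Ot E.i E.ω (bil Ot y) = {L | ∃ M ∈ ({ordLat Ot, W} : Set (Submodule ℤ B)),
      ∃ J : (FractionalIdeal (𝓞 K)⁰ K)ˣ,
        L = M * idl Ot x * embIdeal E.i (J : FractionalIdeal (𝓞 K)⁰ K)} := by
  ext L
  rw [Set.mem_ofPred_eq]
  constructor
  · intro hL
    obtain ⟨x', hx', hsp', hxy', rfl⟩ := (E.mem_CSet_iff hy).1 hL
    obtain ⟨u, J, hu, h⟩ := E.exists_eq_bil_mul hx hsp hx' hsp'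
    refine ⟨bil Ot u, ?_, J, h⟩
    obtain ⟨k, hk, hk'⟩ := E.bil_mul_idl_mul_embIdeal hx hsp u J
    rw [h, hk', E.idl_mem_CSet_iff hk hy, unif_twist_atP_mul, ← hxy,
      E.bil_conj_eq_iff E.norm_unif hu] at hL
    rcases hL.2 with h1 | h1
    · left
      rw [← bil_one (p := p) E.S.lat, bil_eq_iff E.S.lat, inv_one, mul_one,
        E.S.mem_locUnits_self_iff]
      exact ⟨hu, h1⟩
    · right
      exact E.S.existsUnique_isInvolutiveNormOne.unique
        (E.S.isInvolutiveNormOne_iff.2 ⟨u, hu, h1, rfl⟩) hW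
  · rintro ⟨M, hM, J, rfl⟩
    obtain ⟨u, hu, hres, rfl⟩ : ∃ u : (Bloc B p)ˣ, ‖nrdF ℚ_[p] (u : Bloc B p)‖ = 1 ∧
        (E.S.R.res u ^ p = E.S.R.res u ∨ E.S.R.res u ^ p = -E.S.R.res u) ∧ M = bil Ot u := by
      rcases hM with rfl | rfl
      · exact ⟨1, by rw [Units.val_one, E.S.div.quat.nrd_one, norm_one],
          Or.inl (by rw [Units.val_one, E.S.R.map_one, one_pow]), (bil_one E.S.lat).symm⟩
      · obtain ⟨u, hu, h1, h2⟩ := E.S.isInvolutiveNormOne_iff.1 hW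
        exact ⟨u, hu, Or.inr h1, h2⟩
    obtain ⟨k, hk, hk'⟩ := E.bil_mul_idl_mul_embIdeal hx hsp u J
    rw [hk', E.idl_mem_CSet_iff hk hy, unif_twist_atP_mul, ← hxy,
      E.bil_conj_eq_iff E.norm_unif hu]
    exact ⟨E.isSp_twist (E.isSp_atP_mul hsp u) k, hres⟩

theorem ordLat_mem_bilateralOfNorm (E : EmbeddedField p Ot κ K) :
    ordLat Ot ∈ bilateralOfNorm Ot 1 :=
  E.S.mem_bilateralOfNorm_one_iff.2
    ⟨1, by rw [Units.val_one, E.S.div.quat.nrd_one, norm_one], (bil_one E.S.lat).symm⟩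

theorem ncard_modK_CSet {y : (Bloc B p)ˣ} (hy : ‖nrdF ℚ_[p] (y : Bloc B p)‖ = (p : ℝ)⁻¹)
    (hne : (CSet Ot E.i E.ω (bil Ot y)).Nonempty) :
    (modK E.i (CSet Ot E.i E.ω (bil Ot y))).ncard = 2 * NumberField.classNumber K := by
  obtain ⟨L, hL⟩ := hne
  obtain ⟨x, hx, hsp, hxy, rfl⟩ := (E.mem_CSet_iff hy).1 hL
  obtain ⟨W, hW⟩ := E.S.existsUnique_isInvolutiveNormOne.exists
  rw [E.CSet_eq hx hsp hy hxy hW, E.ncard_modK hx hsp, Set.ncard_pair]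
  · rintro rfl
    refine hW.2.1 ⟨1, one_ne_zero, ?_⟩
    ext z
    simp [rmul]
  · rintro M (rfl | rfl)
    · exact E.ordLat_mem_bilateralOfNorm
    · exact hW.1

theorem setOf_isSpecialPoint_eq (hx : AEUnit Ot x) (hsp : E.IsSp x) :
    {L | IsSpecialPoint Ot L E.i} = {L | ∃ M ∈ bilateralOfNorm Ot 1,
      ∃ J : (FractionalIdeal (𝓞 K)⁰ K)ˣ,
        L = M * idl Ot x * embIdeal E.i (J : FractionalIdeal (𝓞 K)⁰ K)} := by
  ext L
  rw [Set.mem_ofPred_eq, Set.mem_ofPred_eq]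
  constructor
  · intro hL
    obtain ⟨x', hx', rfl⟩ := (isLeftIdeal_iff E.S.lat).1 hL.1
    obtain ⟨u, J, hu, h⟩ := E.exists_eq_bil_mul hx hsp hx' ((E.isSpecialPoint_idl_iff hx').1 hL)
    exact ⟨bil Ot u, E.S.mem_bilateralOfNorm_one_iff.2 ⟨u, hu, rfl⟩, J, h⟩
  · rintro ⟨M, hM, J, rfl⟩
    obtain ⟨u, hu, rfl⟩ := E.S.mem_bilateralOfNorm_one_iff.1 hM
    obtain ⟨k, hk, hk'⟩ := E.bil_mul_idl_mul_embIdeal hx hsp u J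
    rw [hk', E.isSpecialPoint_idl_iff hk]
    exact E.isSp_twist (E.isSp_atP_mul hsp u) k

theorem ncard_OKPoints :
    (OKPoints Ot E.i).ncard = (p + 1) * NumberField.classNumber K := by
  obtain ⟨x, hx, hsp⟩ := E.exists_isSp
  rw [OKPoints, E.setOf_isSpecialPoint_eq hx hsp, E.ncard_modK hx hsp subset_rfl,
    E.S.ncard_bilateralOfNorm_one]

theorem bil_unif_mem : bil Ot (E.unif x) ∈ bilateralOfNorm Ot p :=
  E.S.mem_bilateralOfNorm_prime_iff.2 ⟨_, E.norm_unif, rfl⟩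

theorem OKPoints_eq_iUnion :
    OKPoints Ot E.i = ⋃ P ∈ bilateralOfNorm Ot p, modK E.i (CSet Ot E.i E.ω P) := by
  ext q
  simp only [Set.mem_iUnion, exists_prop]
  constructor
  · rintro ⟨L, hL, rfl⟩
    obtain ⟨x, hx, rfl⟩ := (isLeftIdeal_iff E.S.lat).1 hL.1
    exact ⟨_, E.bil_unif_mem, idl Ot x, (E.idl_mem_CSet_iff hx E.norm_unif).2
      ⟨(E.isSpecialPoint_idl_iff hx).1 hL, rfl⟩, rfl⟩
  · rintro ⟨P, -, L, hL, rfl⟩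
    exact ⟨L, hL.1, rfl⟩

/-- The ideal P is recovered from the class of the point as the ideal of its uniformizer, which
right multiplication by Kˣ does not change. -/
theorem pairwiseDisjoint_CSet :
    (bilateralOfNorm Ot p).PairwiseDisjoint fun P => modK E.i (CSet Ot E.i E.ω P) := by
  intro P hP P' hP' hne
  obtain ⟨y, hy, rfl⟩ := E.S.mem_bilateralOfNorm_prime_iff.1 hP
  obtain ⟨y', hy', rfl⟩ := E.S.mem_bilateralOfNorm_prime_iff.1 hP'
  refine Set.disjoint_left.2 ?_
  rintro _ ⟨L, hL, rfl⟩ ⟨L', hL', hLL'⟩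
  obtain ⟨k, hk0, hk⟩ := Quotient.exact hLL'
  obtain ⟨x, hx, hsp, hxy, rfl⟩ := (E.mem_CSet_iff hy').1 hL'
  have hunit : E.i k = ((Units.map (E.i : K →* B) (Units.mk0 k hk0) : Bˣ) : B) := rfl
  -- Multiplication by k is the twist by a constant family with u = 1.
  have htw : (x * fun ℓ : Nat.Primes => unitLoc (ℓ : ℕ)
      (Units.map (E.i : K →* B) (Units.mk0 k hk0))) =
      E.twist (atP (1 : (Bloc B p)ˣ) * x) fun _ => Units.mk0 k hk0 := by
    have h : atP (1 : (Bloc B p)ˣ) = 1 := Pi.mulSingle_one _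
    rw [h, one_mul]; rfl
  have hae : AEUnit Ot (x * fun ℓ : Nat.Primes => unitLoc (ℓ : ℕ)
      (Units.map (E.i : K →* B) (Units.mk0 k hk0))) := hx.mul (aeUnit_unitLoc E.S.lat _)
  rw [hunit, rmul_idl, htw] at hk
  rw [htw] at hae
  rw [hk, E.idl_mem_CSet_iff hae hy, unif_twist_atP_mul, one_mul, inv_one, mul_one] at hL
  exact hne (hL.2.symm.trans hxy)

theorem chi_bil_unif : chi p (bil Ot (E.unif x)) = legendreSym p E.d := by
  obtain ⟨m, hm, hd⟩ := E.exists_n_eq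
  have h := E.S.chi_bil_eq_iff_isSquare (ϖ := E.unif x) (c := 1) (d := E.d) (m := m)
    (by rw [nrd_unif, hm]; push_cast; rfl) E.not_dvd_int hd
    (by rw [Units.val_one, E.S.div.quat.nrd_one, norm_one])
  rw [one_mul] at h
  rw [h, Units.val_one, E.S.R.map_one]
  exact IsSquare.one

/-- A bilateral ideal of norm `p` with the right character is conjugate to the one of `ω`. -/
theorem exists_bil_conj_eq {y : (Bloc B p)ˣ} (hy : ‖nrdF ℚ_[p] (y : Bloc B p)‖ = (p : ℝ)⁻¹)
    (hchi : chi p (bil Ot y) = legendreSym p E.d) :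
    ∃ u : (Bloc B p)ˣ, bil Ot (u * E.loc p E.ωu * u⁻¹) = bil Ot y := by
  have hp0 : (p : ℝ)⁻¹ ≠ 0 := inv_ne_zero (by exact_mod_cast (Fact.out : p.Prime).ne_zero)
  obtain ⟨m, hm, hd⟩ := E.exists_n_eq
  have hc : ‖nrdF ℚ_[p] ((y * (E.loc p E.ωu)⁻¹ : (Bloc B p)ˣ) : Bloc B p)‖ = 1 := by
    rw [E.S.norm_nrd_mul, E.S.norm_nrd_inv, hy, norm_nrd_ωu, mul_inv_cancel₀ hp0]
  have h := E.S.chi_bil_eq_iff_isSquare (ϖ := E.loc p E.ωu) (c := y * (E.loc p E.ωu)⁻¹)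
    (d := E.d) (m := m) (by rw [nrd_ωu, hm]; push_cast; rfl) E.not_dvd_int hd hc
  rw [inv_mul_cancel_right] at h
  obtain ⟨u, v, -, hv, hv', huv⟩ := E.S.R.exists_conj_of_isSquare E.S.div E.S.card E.norm_nrd_ωu
    hc (h.1 hchi)
  refine ⟨u, ?_⟩
  rw [bil_eq_iff E.S.lat, huv, inv_mul_cancel_right, mul_inv_cancel_right,
    E.S.mem_locUnits_self_iff]
  exact ⟨hv, hv'⟩

/-- The character of a uniformizer ideal is always (d/p). Conversely, P comes from a conjugate u ω
u⁻¹, and the component at p of any special family may be replaced by u. -/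
theorem CSet_nonempty_iff {P : Submodule ℤ B} (hP : P ∈ bilateralOfNorm Ot p) :
    (CSet Ot E.i E.ω P).Nonempty ↔ chi p P = legendreSym p E.d := by
  obtain ⟨y, hy, rfl⟩ := E.S.mem_bilateralOfNorm_prime_iff.1 hP
  constructor
  · rintro ⟨L, hL⟩
    obtain ⟨x, hx, hsp, hxy, rfl⟩ := (E.mem_CSet_iff hy).1 hL
    rw [← hxy]; exact E.chi_bil_unif
  · intro h
    obtain ⟨u, hu⟩ := E.exists_bil_conj_eq hy h
    obtain ⟨x, hx, hsp⟩ := E.exists_isSp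
    refine ⟨_, (E.mem_CSet_iff hy).2 ⟨atP (u * (compP p x)⁻¹) * x, (aeUnit_atP _).mul hx,
      E.isSp_atP_mul hsp _, ?_, rfl⟩⟩
    rw [← hu]
    congr 1
    have h1 : compP p (atP (u * (compP p x)⁻¹) * x) = u := by
      change compP p (atP (u * (compP p x)⁻¹)) * compP p x = u
      rw [compP_atP, inv_mul_cancel_right]
    rw [unif, h1]

theorem finite_bilateralOfNorm (E : EmbeddedField p Ot κ K) : (bilateralOfNorm Ot p).Finite :=
  Set.finite_of_ncard_pos (by rw [E.S.ncard_bilateralOfNorm_prime E.norm_nrd_ωu]; omega)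

/-- The disjoint union of the non-empty pieces, each of size 2h, has (p + 1) h elements. -/
theorem two_mul_ncard_nonempty :
    2 * {P ∈ bilateralOfNorm Ot p | (CSet Ot E.i E.ω P).Nonempty}.ncard = p + 1 := by
  set N := {P ∈ bilateralOfNorm Ot p | (CSet Ot E.i E.ω P).Nonempty} with hN
  have hNsub : N ⊆ bilateralOfNorm Ot p := fun P hP => hP.1
  have hfin : N.Finite := E.finite_bilateralOfNorm.subset hNsub
  have hh : NumberField.classNumber K ≠ 0 := NumberField.classNumber_ne_zero K
  have hcard : ∀ P ∈ N, (modK E.i (CSet Ot E.i E.ω P)).ncard = 2 * NumberField.classNumber K := by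
    rintro P ⟨hP, hne⟩
    obtain ⟨y, hy, rfl⟩ := E.S.mem_bilateralOfNorm_prime_iff.1 hP
    exact E.ncard_modK_CSet hy hne
  have hunion : OKPoints Ot E.i = ⋃ P ∈ N, modK E.i (CSet Ot E.i E.ω P) := by
    rw [OKPoints_eq_iUnion]
    refine Set.Subset.antisymm ?_ (Set.biUnion_subset_biUnion_left hNsub)
    intro q hq
    simp only [Set.mem_iUnion, exists_prop] at hq ⊢
    obtain ⟨P, hP, hq⟩ := hq
    obtain ⟨L, hL, hLq⟩ := id hq
    exact ⟨P, ⟨hP, L, hL⟩, hq⟩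
  have h1 := E.ncard_OKPoints
  rw [hunion, hfin.ncard_biUnion (fun P hP => Set.finite_of_ncard_ne_zero (by
      rw [hcard P hP]; exact mul_ne_zero two_ne_zero hh)) (E.pairwiseDisjoint_CSet.subset hNsub),
    finsum_mem_congr rfl hcard, finsum_mem_eq_finite_toFinset_sum _ hfin, Finset.sum_const,
    smul_eq_mul, ← Set.ncard_eq_toFinset_card _ hfin] at h1
  refine Nat.eq_of_mul_eq_mul_right (Nat.pos_of_ne_zero hh) ?_
  rw [← h1]; ring

theorem two_mul_ncard_empty :
    2 * {P ∈ bilateralOfNorm Ot p | CSet Ot E.i E.ω P = ∅}.ncard = p + 1 := by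
  have h1 := E.two_mul_ncard_nonempty
  have h2 : {P ∈ bilateralOfNorm Ot p | CSet Ot E.i E.ω P = ∅} =
      bilateralOfNorm Ot p \ {P ∈ bilateralOfNorm Ot p | (CSet Ot E.i E.ω P).Nonempty} := by
    ext P
    simp only [Set.mem_ofPred_eq, Set.mem_sdiff, not_and, Set.not_nonempty_iff_eq_empty]
    exact and_congr_right fun hP => ⟨fun h _ => h, fun h => h hP⟩
  rw [h2, Set.ncard_sdiff (fun P hP => hP.1) (E.finite_bilateralOfNorm.subset fun P hP => hP.1),
    E.S.ncard_bilateralOfNorm_prime E.norm_nrd_ωu]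
  omega

end EmbeddedField

/-! ### Conjugating orders and lattices by ideles. -/

section Conjugation

variable {B : Type*} [Ring B] [Algebra ℚ B]

section
variable {ℓ : ℕ} [Fact ℓ.Prime] {M M' : Submodule ℤ_[ℓ] (Bloc B ℓ)} {x y : (Bloc B ℓ)ˣ}

/-- `x⁻¹ M x`, locally. -/
noncomputable abbrev locConj (x : (Bloc B ℓ)ˣ) (M : Submodule ℤ_[ℓ] (Bloc B ℓ)) :
    Submodule ℤ_[ℓ] (Bloc B ℓ) :=
  locLmul (↑x⁻¹ : Bloc B ℓ) (locRmul M (x : Bloc B ℓ))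

theorem mem_locConj {z : Bloc B ℓ} :
    z ∈ locConj x M ↔ (x : Bloc B ℓ) * z * (↑x⁻¹ : Bloc B ℓ) ∈ M := by
  rw [mem_locLmul, mem_locRmul, inv_inv]

theorem locConj_injective (x : (Bloc B ℓ)ˣ) :
    Function.Injective (locConj x : Submodule ℤ_[ℓ] (Bloc B ℓ) → _) := by
  intro M M' h
  ext z
  have hz : (x : Bloc B ℓ) * ((↑x⁻¹ : Bloc B ℓ) * z * x) * (↑x⁻¹ : Bloc B ℓ) = z := by
    rw [mul_assoc (↑x⁻¹ : Bloc B ℓ), Units.mul_inv_cancel_left, mul_assoc, Units.mul_inv, mul_one]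
  have h1 : (↑x⁻¹ : Bloc B ℓ) * z * x ∈ locConj x M ↔ (↑x⁻¹ : Bloc B ℓ) * z * x ∈ locConj x M' := by
    rw [h]
  rwa [mem_locConj, mem_locConj, hz] at h1

theorem locConj_one (M : Submodule ℤ_[ℓ] (Bloc B ℓ)) : locConj 1 M = M := by
  ext z; rw [mem_locConj]; simp

theorem locRmul_locConj : locRmul (locConj x M) (y : Bloc B ℓ) =
    locConj x (locRmul M ((x * y * x⁻¹ : (Bloc B ℓ)ˣ) : Bloc B ℓ)) := by
  ext z
  rw [mem_locRmul, mem_locConj, mem_locConj, mem_locRmul]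
  have : (x : Bloc B ℓ) * z * (↑x⁻¹ : Bloc B ℓ) * (↑(x * y * x⁻¹)⁻¹ : Bloc B ℓ) =
      (x : Bloc B ℓ) * (z * (↑y⁻¹ : Bloc B ℓ)) * (↑x⁻¹ : Bloc B ℓ) := by
    simp [mul_inv_rev, mul_assoc]
  rw [this]

theorem locLmul_locConj : locLmul (x : Bloc B ℓ) (locConj x M) = locRmul M (x : Bloc B ℓ) := by
  ext z
  rw [mem_locLmul, mem_locConj, mem_locRmul, Units.mul_inv_cancel_left]

theorem locLmul_mul (b : Bloc B ℓ) : locLmul b (M * M') = locLmul b M * M' := by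
  apply le_antisymm
  · rw [locLmul, Submodule.map_le_iff_le_comap, Submodule.mul_le]
    intro m hm n hn
    rw [Submodule.mem_comap, LinearMap.mulLeft_apply, ← mul_assoc]
    exact Submodule.mul_mem_mul ⟨m, hm, rfl⟩ hn
  · rw [Submodule.mul_le]
    rintro _ ⟨m, hm, rfl⟩ n hn
    rw [LinearMap.mulLeft_apply, mul_assoc]
    exact ⟨m * n, Submodule.mul_mem_mul hm hn, rfl⟩

end

/-- The lattice `x⁻¹ L x`. -/
noncomputable def conjLat (x : ∀ ℓ : Nat.Primes, (Bloc B (ℓ : ℕ))ˣ) (L : Submodule ℤ B) :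
    Submodule ℤ B :=
  globalLat fun ℓ => locConj (x ℓ) (locLat (ℓ : ℕ) L)

variable {O : Subalgebra ℤ B} {x : ∀ ℓ : Nat.Primes, (Bloc B (ℓ : ℕ))ˣ} {L L' : Submodule ℤ B}

theorem finite_locConj_ne (hO : IsLatticeIn (ordLat O)) (hx : AEUnit O x) (hL : IsLatticeIn L) :
    {ℓ : Nat.Primes | locConj (x ℓ) (locLat (ℓ : ℕ) L) ≠ locLat (ℓ : ℕ) (ordLat O)}.Finite := by
  refine (Set.Finite.union hx (hL.finite_locLat_ne hO)).subset fun ℓ hℓ => ?_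
  by_contra hcon
  rw [Set.mem_union, not_or] at hcon
  have h1 : x ℓ ∈ locUnits O (ℓ : ℕ) := not_not.1 hcon.1
  have h2 : locLat (ℓ : ℕ) L = locLat (ℓ : ℕ) (ordLat O) := not_not.1 hcon.2
  refine hℓ ?_
  ext z
  rw [h2, mem_locConj]
  constructor
  · intro h
    have := mul_mem_locLat (mul_mem_locLat h1.2 h) h1.1
    simpa only [mul_assoc, Units.inv_mul_cancel_left, Units.inv_mul, mul_one] using this
  · exact fun h => mul_mem_locLat (mul_mem_locLat h1.1 h) h1.2

theorem isLattice_locConj (hL : IsLatticeIn L) (ℓ : Nat.Primes) :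
    Submodule.IsLattice ℚ_[(ℓ : ℕ)] (locConj (x ℓ) (locLat (ℓ : ℕ) L)) :=
  isLattice_locLmul (isLattice_locRmul (hL.isLattice_locLat _) (x ℓ)) (x ℓ)⁻¹

theorem isLatticeIn_conjLat (hO : IsLatticeIn (ordLat O)) (hx : AEUnit O x) (hL : IsLatticeIn L) :
    IsLatticeIn (conjLat x L) :=
  isLatticeIn_globalLat hO (isLattice_locConj hL) (finite_locConj_ne hO hx hL)

theorem locLat_conjLat (hO : IsLatticeIn (ordLat O)) (hx : AEUnit O x) (hL : IsLatticeIn L)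
    (ℓ : Nat.Primes) :
    locLat (ℓ : ℕ) (conjLat x L) = locConj (x ℓ) (locLat (ℓ : ℕ) L) :=
  locLat_globalLat hO (M := fun ℓ : Nat.Primes => locConj (x ℓ) (locLat (ℓ : ℕ) L))
    (isLattice_locConj hL) (finite_locConj_ne hO hx hL) ℓ

theorem conjLat_eq_iff (hO : IsLatticeIn (ordLat O)) (hx : AEUnit O x) (hL : IsLatticeIn L)
    (hL' : IsLatticeIn L') : conjLat x L = L' ↔
      ∀ ℓ : Nat.Primes, locLat (ℓ : ℕ) L' = locConj (x ℓ) (locLat (ℓ : ℕ) L) := by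
  constructor
  · rintro rfl ℓ
    exact locLat_conjLat hO hx hL ℓ
  · intro h
    rw [← globalLat_locLat hL', conjLat]
    congr 1
    ext1 ℓ
    exact (h ℓ).symm

theorem sameGenus_iff (hO : IsOrderIn O) {R : Subalgebra ℤ B} (hR : IsOrderIn R) :
    SameGenus O R ↔ ∃ x, AEUnit O x ∧ conjLat x (ordLat O) = ordLat R := by
  constructor
  · intro h
    -- Taking 1 wherever the two orders already agree makes the family of conjugators an idele.
    have h' : ∀ ℓ : Nat.Primes, ∃ x : (Bloc B (ℓ : ℕ))ˣ,
        locLat (ℓ : ℕ) (ordLat R) = locConj x (locLat (ℓ : ℕ) (ordLat O)) ∧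
          (locLat (ℓ : ℕ) (ordLat R) = locLat (ℓ : ℕ) (ordLat O) → x = 1) := by
      intro ℓ
      by_cases h1 : locLat (ℓ : ℕ) (ordLat R) = locLat (ℓ : ℕ) (ordLat O)
      · exact ⟨1, by rw [locConj_one, h1], fun _ => rfl⟩
      · obtain ⟨x, hx⟩ := h (ℓ : ℕ)
        exact ⟨x, hx, fun h2 => absurd h2 h1⟩
    choose x hx hx1 using h'
    have hae : AEUnit O x := (hR.finite_locLat_ne hO).subset fun ℓ hℓ h2 => hℓ (by
      rw [hx1 ℓ h2]; exact one_mem _)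
    exact ⟨x, hae, (conjLat_eq_iff hO hae hO hR).2 hx⟩
  · rintro ⟨x, hx, h⟩ ℓ _
    exact ⟨x ⟨ℓ, Fact.out⟩, (conjLat_eq_iff hO hx hO hR).1 h ⟨ℓ, Fact.out⟩⟩

/-- The order `x⁻¹ O x`. -/
noncomputable def conjOrder (O : Subalgebra ℤ B) (x : ∀ ℓ : Nat.Primes, (Bloc B (ℓ : ℕ))ˣ) :
    Subalgebra ℤ B :=
  Submodule.toSubalgebra (conjLat x (ordLat O))
    (fun ℓ => by
      change toLoc (ℓ : ℕ) 1 ∈ _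
      rw [mem_locConj, map_one, mul_one, Units.mul_inv]; exact one_mem_locLat)
    (fun a b ha hb ℓ => by
      have h1 : (x ℓ : Bloc B (ℓ : ℕ)) * toLoc (ℓ : ℕ) a * (↑(x ℓ)⁻¹ : Bloc B (ℓ : ℕ)) ∈ _ :=
        mem_locConj.1 (ha ℓ)
      have h2 : (x ℓ : Bloc B (ℓ : ℕ)) * toLoc (ℓ : ℕ) b * (↑(x ℓ)⁻¹ : Bloc B (ℓ : ℕ)) ∈ _ :=
        mem_locConj.1 (hb ℓ)
      change toLoc (ℓ : ℕ) (a * b) ∈ _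
      rw [mem_locConj, map_mul]
      have := mul_mem_locLat h1 h2
      simpa only [mul_assoc, Units.inv_mul_cancel_left] using this)

theorem mem_conjOrder {b : B} : b ∈ conjOrder O x ↔ ∀ ℓ : Nat.Primes,
    (x ℓ : Bloc B (ℓ : ℕ)) * toLoc (ℓ : ℕ) b * (↑(x ℓ)⁻¹ : Bloc B (ℓ : ℕ)) ∈
      locLat (ℓ : ℕ) (ordLat O) :=
  forall_congr' fun _ => mem_locConj

/-- Since R = α⁻¹ O α, the lattice α R is O α. -/
theorem ideleMul_mul {R : Subalgebra ℤ B} (hO : IsOrderIn O) (hR : IsOrderIn R) (α : BIdeles O)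
    (h : conjLat α (ordLat O) = ordLat R) (hL : IsLatticeIn (idl O α * L)) :
    ideleMul α (ordLat R * L) = idl O α * L := by
  have hα : AEUnit O α := α.2
  rw [← globalLat_locLat hL, ideleMul]
  congr 1
  ext1 ℓ
  rw [locLat_mul, locLat_mul, (conjLat_eq_iff hO hα hO hR).1 h ℓ, locLmul_mul, locLmul_locConj,
    locLat_idl hO hα]

end Conjugation

/-! ### The prime of K above p and the transporting ideles. -/

section PrimeIdeal

variable {K : Type*} [Field K] [NumberField K] {p : ℕ} [Fact p.Prime] {I : Ideal (𝓞 K)}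

theorem dvd_of_intCast_mem (hI : Ideal.absNorm I = p) {a : ℤ} (ha : (a : 𝓞 K) ∈ I) :
    (p : ℤ) ∣ a := by
  by_contra hcon
  obtain ⟨u, v, huv⟩ := (Nat.prime_iff_prime_int.1 (Fact.out : p.Prime)).coprime_iff_not_dvd.2 hcon
  have hp : (p : 𝓞 K) ∈ I := by
    have := Ideal.absNorm_mem I
    rwa [hI] at this
  have h1 : (1 : 𝓞 K) ∈ I := by
    have h2 := I.add_mem (I.mul_mem_left (u : 𝓞 K) hp) (I.mul_mem_left (v : 𝓞 K) ha)
    have h3 : (u : 𝓞 K) * (p : 𝓞 K) + (v : 𝓞 K) * (a : 𝓞 K) = 1 := by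
      exact_mod_cast congrArg (Int.cast : ℤ → 𝓞 K) huv
    rwa [h3] at h2
  rw [(Ideal.eq_top_iff_one I).2 h1, Ideal.absNorm_top] at hI
  exact (Fact.out : p.Prime).one_lt.ne hI

end PrimeIdeal

namespace EmbeddedField

variable {p : ℕ} [Fact p.Prime] {B : Type*} [Ring B] [Algebra ℚ B] {Ot : Subalgebra ℤ B}
  {κ : Type*} [Field κ] [Fintype κ] {K : Type*} [Field K] [NumberField K]
  (E : EmbeddedField p Ot κ K) {x x' : ∀ ℓ : Nat.Primes, (Bloc B (ℓ : ℕ))ˣ}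
  {I : Ideal (𝓞 K)}

/-- The trace and norm of ω are divisible by p, so ω² lies in I, which is prime because its norm is.
-/
theorem ω_mem (hI : Ideal.absNorm I = p) : E.ω ∈ I := by
  have hp : (p : 𝓞 K) ∈ I := by
    have := Ideal.absNorm_mem I
    rwa [hI] at this
  have hprime : I.IsPrime := Ideal.isPrime_of_irreducible_absNorm (by
    rw [hI]; exact (Fact.out : p.Prime))
  refine hprime.mem_of_pow_mem 2 ?_
  obtain ⟨m, hm, -⟩ := E.exists_n_eq
  obtain ⟨s, hs⟩ := E.dvd_trace
  rw [sq, mul_self_ringOfIntegers E.finrank, hs]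
  change _ - ((E.n : ℤ) : 𝓞 K) ∈ I
  rw [hm]
  push_cast
  exact sub_mem (I.mul_mem_right _ (I.mul_mem_right _ hp)) (I.mul_mem_right _ hp)

theorem mul_locLat_embIdeal_of_ne {ℓ : ℕ} [Fact ℓ.Prime] (hℓ : ℓ ≠ p)
    {M : Submodule ℤ_[ℓ] (Bloc B ℓ)} (h : ∀ l ∈ M, l * toLoc ℓ E.w ∈ M)
    (hI : Ideal.absNorm I = p) :
    M * locLat ℓ (embIdeal E.i (I : FractionalIdeal (𝓞 K)⁰ K)) = M := by
  apply le_antisymm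
  · rw [Submodule.mul_le]
    intro m hm n hn
    refine toLoc_mul_mem (L := embIdeal E.i (I : FractionalIdeal (𝓞 K)⁰ K)) ?_ hn
    rintro _ ⟨k, hk, rfl⟩
    obtain ⟨z, hz, rfl⟩ := (FractionalIdeal.mem_coeIdeal (𝓞 K)⁰).1 hk
    exact E.mul_toLoc_i_mem h z hm
  · intro m hm
    refine mem_of_nsmul_mem (N := p) ((Nat.coprime_primes Fact.out Fact.out).2 hℓ.symm) ?_
    have hp : E.i (p : K) ∈ embIdeal E.i (I : FractionalIdeal (𝓞 K)⁰ K) := by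
      refine ⟨(p : K), (FractionalIdeal.mem_coeIdeal (𝓞 K)⁰).2
        ⟨(p : 𝓞 K), ?_, map_natCast (algebraMap (𝓞 K) K) p⟩, rfl⟩
      have := Ideal.absNorm_mem I
      rwa [hI] at this
    have := Submodule.mul_mem_mul hm (toLoc_mem_locLat (ℓ := ℓ) hp)
    rwa [map_natCast, map_natCast, ← nsmul_eq_mul'] at this

/-- Locally at p the prime above p is generated by the uniformizer ω. -/
theorem mul_locLat_embIdeal_self {M : Submodule ℤ_[p] (Bloc B p)}
    (h : ∀ l ∈ M, l * toLoc p E.w ∈ M) (hI : Ideal.absNorm I = p) :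
    M * locLat p (embIdeal E.i (I : FractionalIdeal (𝓞 K)⁰ K)) =
      locRmul M (E.loc p E.ωu : Bloc B p) := by
  apply le_antisymm
  · rw [Submodule.mul_le]
    intro m hm n hn
    refine toLoc_mul_mem (L := embIdeal E.i (I : FractionalIdeal (𝓞 K)⁰ K)) ?_ hn
    rintro _ ⟨k, hk, rfl⟩
    obtain ⟨z, hz, rfl⟩ := (FractionalIdeal.mem_coeIdeal (𝓞 K)⁰).1 hk
    obtain ⟨a, b, hab⟩ := exists_eq_add_mul E.finrank E.disc z
    have ha : (a : 𝓞 K) ∈ I := by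
      have := sub_mem hz (I.mul_mem_left (b : 𝓞 K) (E.ω_mem hI))
      rwa [hab, add_sub_cancel_right] at this
    obtain ⟨c, rfl⟩ := dvd_of_intCast_mem hI ha
    obtain ⟨q, hq, hd⟩ := E.exists_n_eq
    have hq' : q.natAbs.Coprime p := by
      refine Nat.Coprime.symm ((Nat.Prime.coprime_iff_not_dvd Fact.out).2 fun h0 => ?_)
      have := dvd_sub ((Int.natCast_dvd.2 h0).mul_left 4) hd
      rw [sub_sub_cancel] at this
      exact E.not_dvd_int this
    -- Here z = p c + b ω and the norm p q of ω equals ω(t - ω), so q z is a multiple of ω, while q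
    -- is prime to p.
    have hzq : (q : 𝓞 K) * z = ((c : 𝓞 K) * (E.t - E.ω) + q * b) * E.ω := by
      have h1 := mul_self_ringOfIntegers E.finrank E.ω
      change E.ω * E.ω = ((E.t : ℤ) : 𝓞 K) * E.ω - ((E.n : ℤ) : 𝓞 K) at h1
      rw [hq] at h1
      rw [hab]
      push_cast at h1 ⊢
      linear_combination (c : 𝓞 K) * h1
    have hmem : m * toLoc p (q • E.i (z : K)) ∈ locRmul M (E.loc p E.ωu : Bloc B p) := by
      refine ⟨_, E.mul_toLoc_i_mem h ((c : 𝓞 K) * (E.t - E.ω) + q * b) hm, ?_⟩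
      have h2 : q • E.i (z : K) =
          E.i (((c : 𝓞 K) * (E.t - E.ω) + q * b : 𝓞 K) : K) * E.w := by
        have hmul : ∀ a b : 𝓞 K, E.i ((a * b : 𝓞 K) : K) = E.i (a : K) * E.i (b : K) :=
          fun a b => map_mul (E.i.toRingHom.comp (algebraMap (𝓞 K) K)) a b
        have hcast : E.i (((q : ℤ) : 𝓞 K) : K) = (q : B) :=
          map_intCast (E.i.toRingHom.comp (algebraMap (𝓞 K) K)) q
        rw [zsmul_eq_mul, ← hcast, ← hmul, hzq, hmul]; rfl
      rw [LinearMap.mulRight_apply, coe_loc_ωu, h2, map_mul, mul_assoc]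
    change m * toLoc p (E.i (z : K)) ∈ _
    refine mem_of_nsmul_mem hq' ?_
    rw [map_zsmul, mul_smul_comm] at hmem
    rcases Int.natAbs_eq q with h0 | h0
    · rwa [h0, natCast_zsmul] at hmem
    · rw [h0, neg_smul, natCast_zsmul] at hmem
      exact neg_mem_iff.1 hmem
  · rintro _ ⟨m, hm, rfl⟩
    exact Submodule.mul_mem_mul hm (toLoc_mem_locLat
      ⟨(E.ω : K), (FractionalIdeal.mem_coeIdeal (𝓞 K)⁰).2 ⟨E.ω, E.ω_mem hI, rfl⟩, rfl⟩)

theorem mem_rightOrder_idl_i (hx : AEUnit Ot x) (hsp : E.IsSp x) (z : 𝓞 K) :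
    E.i (z : K) ∈ rightOrder (idl Ot x) :=
  fun _ hl => E.mul_i_mem ((E.isSp_iff hx).1 hsp) z hl

theorem exists_order : ∃ R : Subalgebra ℤ B, IsOrderIn R ∧ SameGenus Ot R ∧
    ∀ z : 𝓞 K, E.i (z : K) ∈ R := by
  obtain ⟨x, hx, hsp⟩ := E.exists_isSp
  have hR : IsOrderIn (conjOrder Ot x) := isLatticeIn_conjLat E.S.lat hx E.S.lat
  refine ⟨conjOrder Ot x, hR, (sameGenus_iff E.S.lat hR).2 ⟨x, hx, rfl⟩, fun z => ?_⟩
  rw [mem_conjOrder, ← mem_rightOrder_idl E.S.lat hx]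
  exact E.mem_rightOrder_idl_i hx hsp z

theorem isSp_of_conjLat_eq {R : Subalgebra ℤ B}
    (h : conjLat x (ordLat Ot) = ordLat R) (hw : E.w ∈ R) : E.IsSp x := by
  have hw' : E.w ∈ conjLat x (ordLat Ot) := by rw [h]; exact hw
  exact fun ℓ => mem_locConj.1 (hw' ℓ)

theorem locConj_locLat (E : EmbeddedField p Ot κ K) (u : (Bloc B p)ˣ) :
    locConj u (locLat p (ordLat Ot)) = locLat p (ordLat Ot) := by
  ext z
  rw [mem_locConj]
  refine ⟨fun h => ?_, fun h => E.S.mem_conj u h⟩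
  have := E.S.mem_conj u⁻¹ h
  rw [inv_inv] at this
  simpa only [mul_assoc, Units.inv_mul_cancel_left, Units.inv_mul, mul_one] using this

/-- Every element of B_pˣ normalizes the local order, so the component at p may be altered freely.
-/
theorem conjLat_atP_mul (E : EmbeddedField p Ot κ K) (u : (Bloc B p)ˣ) :
    conjLat (atP u * x) (ordLat Ot) = conjLat x (ordLat Ot) := by
  rw [conjLat, conjLat]
  congr 1
  ext1 ℓ
  revert ℓ
  refine (forall_primes_iff p).2 ⟨?_, fun ℓ hℓ => ?_⟩
  · exact (E.locConj_locLat _).trans (E.locConj_locLat _).symm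
  · rw [Pi.mul_apply, atP_of_ne u hℓ, one_mul]

/-- Away from p both lattices are the completions of R. At p the right side is R_p ω, which
conjugation by x_p turns into the ideal of the uniformizer x_p ω x_p⁻¹. -/
theorem conjLat_bil_eq_iff {R : Subalgebra ℤ B} (hR : IsOrderIn R) (hx : AEUnit Ot x)
    (h : conjLat x (ordLat Ot) = ordLat R) (hw : E.w ∈ R) (hI : Ideal.absNorm I = p)
    (y : (Bloc B p)ˣ) :
    conjLat x (bil Ot y) = ordLat R * embIdeal E.i (I : FractionalIdeal (𝓞 K)⁰ K) ↔
      bil Ot (E.unif x) = bil Ot y := by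
  have hI0 : (I : FractionalIdeal (𝓞 K)⁰ K) ≠ 0 := by
    rw [Ne, FractionalIdeal.coeIdeal_eq_zero]
    rintro rfl
    rw [Ideal.absNorm_bot] at hI
    exact (Fact.out : p.Prime).ne_zero hI.symm
  have hloc := (conjLat_eq_iff E.S.lat hx E.S.lat hR).1 h
  have hM : ∀ ℓ : Nat.Primes, ∀ l ∈ locLat (ℓ : ℕ) (ordLat R),
      l * toLoc (ℓ : ℕ) E.w ∈ locLat (ℓ : ℕ) (ordLat R) :=
    fun ℓ l hl => mul_mem_locLat hl (toLoc_mem_locLat hw)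
  refine (conjLat_eq_iff E.S.lat hx (L := bil Ot y) (isLatticeIn_idl E.S.lat (aeUnit_atP y))
    (isLatticeIn_mul_embIdeal E.i hR hI0)).trans ((forall_primes_iff p).trans ?_)
  have hp : locLat p (ordLat R * embIdeal E.i (I : FractionalIdeal (𝓞 K)⁰ K)) =
      locConj (compP p x) (locLat p (bil Ot y)) ↔ bil Ot (E.unif x) = bil Ot y := by
    have h1 : locLat p (bil Ot y) = locRmul (locLat p (ordLat Ot)) (y : Bloc B p) :=
      (locLat_idl E.S.lat (aeUnit_atP y) ⟨p, Fact.out⟩).trans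
        (congrArg (fun u : (Bloc B p)ˣ => locRmul (locLat p (ordLat Ot)) (u : Bloc B p))
          (atP_self y))
    have h2 : locLat p (ordLat R) = locConj (compP p x) (locLat p (ordLat Ot)) :=
      hloc ⟨p, Fact.out⟩
    rw [locLat_mul, E.mul_locLat_embIdeal_self (hM ⟨p, Fact.out⟩) hI, h1, h2, locRmul_locConj,
      (locConj_injective _).eq_iff, locRmul_eq_iff, bil_eq_iff E.S.lat]
    rfl
  refine (and_iff_left fun ℓ hℓ => ?_).trans hp
  rw [locLat_mul, E.mul_locLat_embIdeal_of_ne hℓ (hM ℓ) hI, hloc, bil,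
    locLat_idl E.S.lat (aeUnit_atP y), atP_of_ne y hℓ, locRmul_one]

theorem isTransporter_iff {R : Subalgebra ℤ B} (hR : IsOrderIn R) (hw : E.w ∈ R)
    (hI : Ideal.absNorm I = p) (y : (Bloc B p)ˣ) (α : BIdeles Ot) :
    IsTransporter Ot R E.i (bil Ot y) I α ↔
      conjLat α (ordLat Ot) = ordLat R ∧ bil Ot (E.unif α) = bil Ot y :=
  and_congr_right fun h => E.conjLat_bil_eq_iff hR α.2 h hw hI y

/-- An idele conjugating Ot to R exists because the genera agree. Its component at p is replaced by
one that conjugates ω into a generator of the given ideal. -/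
theorem exists_isTransporter {R : Subalgebra ℤ B} (hR : IsOrderIn R) (hg : SameGenus Ot R)
    (hw : E.w ∈ R) (hI : Ideal.absNorm I = p) {y : (Bloc B p)ˣ}
    (hy : ‖nrdF ℚ_[p] (y : Bloc B p)‖ = (p : ℝ)⁻¹)
    (hchi : chi p (bil Ot y) = legendreSym p E.d) :
    ∃ α : BIdeles Ot, IsTransporter Ot R E.i (bil Ot y) I α := by
  obtain ⟨x, hx, h⟩ := (sameGenus_iff E.S.lat hR).1 hg
  obtain ⟨u, hu⟩ := E.exists_bil_conj_eq hy hchi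
  have hae : AEUnit Ot (atP (u * (compP p x)⁻¹) * x) := (aeUnit_atP _).mul hx
  refine ⟨⟨_, hae⟩, (E.isTransporter_iff hR hw hI y _).2 ⟨(E.conjLat_atP_mul _).trans h, ?_⟩⟩
  rw [← hu]
  congr 1
  have h1 : compP p (atP (u * (compP p x)⁻¹) * x) = u := by
    change compP p (atP (u * (compP p x)⁻¹)) * compP p x = u
    rw [compP_atP, inv_mul_cancel_right]
  change E.unif (atP (u * (compP p x)⁻¹) * x) = _
  rw [unif, h1]

theorem ordLat_mul_idl (E : EmbeddedField p Ot κ K) (hx : AEUnit Ot x) :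
    ordLat Ot * idl Ot x = idl Ot x := by
  have h : atP (1 : (Bloc B p)ˣ) = 1 := Pi.mulSingle_one _
  rw [← bil_one (p := p) E.S.lat, E.S.bil_mul_idl 1 hx, h, one_mul]

theorem CDSet_eq {R : Subalgebra ℤ B} (hR : IsOrderIn R) (hw : E.w ∈ R)
    (hI : Ideal.absNorm I = p) {y : (Bloc B p)ˣ} (hy : ‖nrdF ℚ_[p] (y : Bloc B p)‖ = (p : ℝ)⁻¹)
    {α : BIdeles Ot} (hα : IsTransporter Ot R E.i (bil Ot y) I α) {W : Submodule ℤ B}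
    (hW : IsInvolutiveNormOne Ot W) :
    CDSet Ot R E.i W α = modK E.i (CSet Ot E.i E.ω (bil Ot y)) := by
  obtain ⟨h, hu⟩ := (E.isTransporter_iff hR hw hI y α).1 hα
  have hae : AEUnit Ot α := α.2
  have hsp : E.IsSp α := E.isSp_of_conjLat_eq h hw
  have hmul : ∀ J : (FractionalIdeal (𝓞 K)⁰ K)ˣ,
      ideleMul α (ordLat R * embIdeal E.i (J : FractionalIdeal (𝓞 K)⁰ K)) =
        idl Ot α * embIdeal E.i (J : FractionalIdeal (𝓞 K)⁰ K) := fun J =>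
    ideleMul_mul E.S.lat hR α h
      (isLatticeIn_mul_embIdeal E.i (isLatticeIn_idl E.S.lat hae) J.ne_zero)
  have hone := E.ordLat_mul_idl hae
  rw [CDSet, E.CSet_eq hae hsp hy hu hW]
  congr 1
  ext L
  rw [Set.mem_union, Set.mem_range, Set.mem_range, Set.mem_ofPred_eq]
  constructor
  · rintro (⟨J, rfl⟩ | ⟨J, rfl⟩)
    · exact ⟨_, Or.inl rfl, J, by rw [hone, hmul]⟩
    · exact ⟨_, Or.inr rfl, J, by rw [hmul, mul_assoc]⟩
  · rintro ⟨M, rfl | rfl, J, rfl⟩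
    · exact Or.inl ⟨J, by rw [hone]; exact hmul J⟩
    · exact Or.inr ⟨J, by rw [mul_assoc]; exact congrArg _ (hmul J)⟩

end EmbeddedField

/-- The square root of the discriminant is a uniformizer of `B_p`. -/
theorem exists_norm_nrd_eq {p : ℕ} [Fact p.Prime] {B : Type*} [Ring B] [Algebra ℚ B]
    (hB : QuatLike ℚ B) {K : Type*} [Field K] [NumberField K] (hK : Module.finrank ℚ K = 2)
    {d : ℕ} (hpd : ¬ p ∣ d) (hD : NumberField.discr K = -((p : ℤ) * d)) {ω : 𝓞 K}
    (hω : (Algebra.trace ℤ (𝓞 K) ω) ^ 2 - 4 * Algebra.norm ℤ ω = NumberField.discr K)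
    (i : K →ₐ[ℚ] B) : ∃ ϖ : Bloc B p, ‖nrdF ℚ_[p] ϖ‖ = (p : ℝ)⁻¹ := by
  set t := Algebra.trace ℤ (𝓞 K) ω
  set δ : 𝓞 K := 2 * ω - t
  let f : 𝓞 K →+* B := i.toRingHom.comp (algebraMap (𝓞 K) K)
  have h1 : δ * δ = ((-((p : ℤ) * d) : ℤ) : 𝓞 K) := by
    rw [← hD, ← hω]
    push_cast
    linear_combination 4 * mul_self_ringOfIntegers hK ω
  have h2 : f δ * f δ = algebraMap ℚ B (-((p : ℤ) * d) : ℤ) := by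
    rw [← map_mul, h1, map_intCast, map_intCast]
  have h3 : nrdF ℚ (f δ) ^ 2 = ((p : ℚ) * d) ^ 2 := by
    rw [sq, ← hB.nrd_mul, h2, hB.nrd_algebraMap]
    push_cast; ring
  refine ⟨toLoc p (f δ), ?_⟩
  have hd : ‖(d : ℚ_[p])‖ = 1 := le_antisymm (Padic.norm_int_le_one (d : ℤ))
    (not_lt.1 fun h => hpd (by
      have := (Padic.norm_intCast_lt_one_iff (p := p) (k := d)).1 (by exact_mod_cast h)
      exact_mod_cast this))
  have h4 : ‖((p : ℚ_[p]) * d)‖ = (p : ℝ)⁻¹ := by rw [norm_mul, hd, mul_one, Padic.norm_p]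
  rw [nrdF_toLoc hB]
  change ‖((nrdF ℚ (f δ) : ℚ) : ℚ_[p])‖ = _
  -- Multiplicativity determines the norm of δ only up to sign, which does not affect its p-adic
  -- absolute value.
  rcases sq_eq_sq_iff_eq_or_eq_neg.1 h3 with h | h
  · rw [h]; push_cast; exact h4
  · rw [h]; push_cast; rw [norm_neg]; exact h4

theorem mainTheorem5
    (p : ℕ) [Fact p.Prime] (hp : 2 < p)
    {B : Type*} [Ring B] [Algebra ℚ B] (hB : IsQuaternionRamifiedExactly B p)
    (O Ot : Subalgebra ℤ B) (hO : IsMaximalOrderIn O) (hOt : IsSuborderOfIndex Ot O p)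
    {K : Type*} [Field K] [NumberField K] (hK : Module.finrank ℚ K = 2)
    (d : ℕ) (hpd : ¬ p ∣ d) (hD : NumberField.discr K = -((p : ℤ) * d))
    (pK : Ideal (𝓞 K)) (hpK : Ideal.absNorm pK = p)
    (ω : 𝓞 K)
    (hω : (Algebra.trace ℤ (𝓞 K) ω) ^ 2 - 4 * Algebra.norm ℤ ω = NumberField.discr K)
    (hωp : (p : ℤ) ∣ Algebra.trace ℤ (𝓞 K) ω)
    (i : K →ₐ[ℚ] B) :
    -- the ideal defining `W̃` and the order `R` exist
    (∃! W : Submodule ℤ B, IsInvolutiveNormOne Ot W) ∧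
    (∃ R : Subalgebra ℤ B, IsOrderIn R ∧ SameGenus Ot R ∧ ∀ z : 𝓞 K, i (z : K) ∈ R) ∧
    -- the case `χ(𝔭) = (d/p)`
    (∀ P ∈ bilateralOfNorm Ot p, chi p P = legendreSym p d →
      (∀ R : Subalgebra ℤ B, IsOrderIn R → SameGenus Ot R → (∀ z : 𝓞 K, i (z : K) ∈ R) →
        (∃ α : BIdeles Ot, IsTransporter Ot R i P pK α) ∧
        (∀ α : BIdeles Ot, IsTransporter Ot R i P pK α →
          ∀ W : Submodule ℤ B, IsInvolutiveNormOne Ot W →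
            CDSet Ot R i W α = modK i (CSet Ot i ω P))) ∧
      (modK i (CSet Ot i ω P)).ncard = 2 * NumberField.classNumber K) ∧
    -- the number of special points, and their decomposition
    (OKPoints Ot i).ncard = (p + 1) * NumberField.classNumber K ∧
    OKPoints Ot i = ⋃ P ∈ bilateralOfNorm Ot p, modK i (CSet Ot i ω P) ∧
    (bilateralOfNorm Ot p).PairwiseDisjoint (fun P => modK i (CSet Ot i ω P)) ∧
    -- the empty pieces, and the proportion of empty and non-empty pieces
    (∀ P ∈ bilateralOfNorm Ot p, CSet Ot i ω P = ∅ ↔ chi p P ≠ legendreSym p d) ∧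
    (bilateralOfNorm Ot p).ncard = p + 1 ∧
    2 * {P ∈ bilateralOfNorm Ot p | CSet Ot i ω P = ∅}.ncard = p + 1 ∧
    2 * {P ∈ bilateralOfNorm Ot p | (CSet Ot i ω P).Nonempty}.ncard = p + 1 := by
  -- A uniformizer is needed before the local structure exists: it forces the residue field to have
  -- p² elements.
  obtain ⟨ϖ, hϖ⟩ := exists_norm_nrd_eq (p := p) (hB.quatLike hp) hK hpd hD hω i
  obtain ⟨κ, _, _, ⟨S⟩⟩ := exists_localStructure p hp hB O Ot hO hOt hϖ
  let E : EmbeddedField p Ot κ K := ⟨S, i, ω, d, hK, hpd, hD, hω, hωp⟩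
  refine ⟨S.existsUnique_isInvolutiveNormOne, E.exists_order, fun P hP hchi => ?_,
    E.ncard_OKPoints, E.OKPoints_eq_iUnion, E.pairwiseDisjoint_CSet, fun P hP => ?_,
    S.ncard_bilateralOfNorm_prime E.norm_nrd_ωu, E.two_mul_ncard_empty, E.two_mul_ncard_nonempty⟩
  · have hne := (E.CSet_nonempty_iff hP).2 hchi
    obtain ⟨y, hy, rfl⟩ := S.mem_bilateralOfNorm_prime_iff.1 hP
    refine ⟨fun R hR hg hi => ⟨?_, fun α hα W hW => ?_⟩, E.ncard_modK_CSet hy hne⟩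
    · exact E.exists_isTransporter hR hg (hi ω) hpK hy hchi
    · exact E.CDSet_eq hR (hi ω) hpK hy hα hW
  · rw [← Set.not_nonempty_iff_eq_empty]
    exact not_congr (E.CSet_nonempty_iff hP)
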